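/- \textbf{Definitions.} A \emph{mosaic floorplan} is a dissection of a rectangle into finitely many rectangles (rooms) without cross junctions (no four rooms meet in a point). For $k\ge 1$, an $\mathrm{HFO}_k$ floorplan (hierarchical floorplan of order $k$) is a mosaic floorplan that can be obtained from a single rectangle by repeatedly embedding, in a room, a mosaic floorplan with at most $k$ rooms. The top-left deletion of a mosaic floorplan with more than one room removes the top left room $b$: if the bottom right corner of $b$ is a $\dashv$ junction, the bottom edge of $b$ is shifted upwards to the bounding rectangle (the rooms below $b$ grow), and if it is a $\perp$ junction, the right edge of $b$ is shifted leftwards to the bounding rectangle. Bottom-left deletion is the mirror image. The \emph{Abe-label} of a mosaic floorplan with $n$ rooms is the permutation of $\{1,\dots,n\}$ obtained by labelling the rooms $1,\dots,n$ in top-left deletion order and listing the labels in bottom-left deletion order. A permutation $\pi$ \emph{corresponds to an $\mathrm{HFO}_k$ floorplan} (is $\mathrm{HFO}_k$) if it is the Abe-label of an $\mathrm{HFO}_k$ floorplan. A permutation is \emph{Baxter} if there are no positions $a<b<c<d$ with $\pi(c)<\pi(a)<\pi(a)+1=\pi(d)<\pi(b)$ or $\pi(b)<\pi(d)<\pi(d)+1=\pi(a)<\pi(c)$.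 \textbf{Algorithm} $\mathrm{Recognise}_k$ (for a fixed $k$; input: a permutation $\pi$ of $\{1,\dots,n\}$). Keep a stack of ranges (sets of consecutive integers), initially empty. For $i=1,\dots,n$: push the range $\{\pi(i)\}$; then, as long as there is a $j$ with $2\le j\le k$ such that the union of the top $j$ stack entries is a range and, for the least such $j$, the relative order of these entries is a Baxter permutation, replace these $j$ entries by their union. Accept if in the end the stack has exactly one entry, otherwise reject. \textbf{Algorithm} $\mathrm{FindOrder}$ (input: $\pi$). Reject if $\pi$ is not a Baxter permutation. Otherwise proceed as in $\mathrm{Recognise}_k$, but with all $j\ge 2$ up to the size of the stack allowed (and without the test for Baxter permutations at the merges). If in the end the stack has exactly one entry, accept and return the greatest $j$ for which $j$ entries were merged ($1$ if there was no merge); otherwise reject. Both algorithms are implemented as explicit programs for a random access machine with finitely many registers and arrays of natural numbers, on which each elementary operation (reading, writing, addition, subtraction, comparison, branching) costs one step. \textbf{Theorem.} (1) For every $k\ge 1$ there is a constant $C_k$ such that for all $n\ge 1$ and all permutations $\pi$ of $\{1,\dots,n\}$, $\mathrm{Recognise}_k$ halts on $\pi$ after at most $C_k n$ steps, having accessed at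 most $C_k n$ array cells, and it accepts $\pi$ if $\pi$ corresponds to an $\mathrm{HFO}_k$ floorplan and rejects $\pi$ otherwise. (2) There is a constant $C$ such that for all $n\ge 1$ and all permutations $\pi$ of $\{1,\dots,n\}$, $\mathrm{FindOrder}$ halts on $\pi$, after at most $C n^2\log_2 n$ steps if $n\ge 2$; if $\pi$ corresponds to an $\mathrm{HFO}_k$ floorplan for some $k\ge 1$, it accepts and returns the least such $k$, and otherwise it rejects. -/

import Mathlib

namespace HFO

/-! ## Mosaic floorplans -/

/-- An axis-parallel rectangle `[left, right] × [bottom, top]` in the plane. -/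
@[ext] structure Rect where
  left : ℝ
  right : ℝ
  bottom : ℝ
  top : ℝ

namespace Rect

/-- The rectangle has positive width and positive height. -/
def Proper (P : Rect) : Prop := P.left < P.right ∧ P.bottom < P.top

/-- The closed region of a rectangle. -/
def region (P : Rect) : Set (ℝ × ℝ) := Set.Icc P.left P.right ×ˢ Set.Icc P.bottom P.top

/-- The open region of a rectangle. -/
def inner (P : Rect) : Set (ℝ × ℝ) := Set.Ioo P.left P.right ×ˢ Set.Ioo P.bottom P.top

/-- Reflection in the horizontal axis. -/
def flip (P : Rect) : Rect := ⟨P.left, P.right, -P.top, -P.bottom⟩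

end Rect

/-- Four rooms of `F` meet in one point, i.e. `F` has a cross junction. -/
def HasCross (F : Set Rect) : Prop :=
  ∃ x y : ℝ, ∃ P₁ ∈ F, ∃ P₂ ∈ F, ∃ P₃ ∈ F, ∃ P₄ ∈ F,
    (P₁.right = x ∧ P₁.bottom = y) ∧ (P₂.left = x ∧ P₂.bottom = y) ∧
    (P₃.right = x ∧ P₃.top = y) ∧ (P₄.left = x ∧ P₄.top = y)

/-- `F` is the set of rooms of a mosaic floorplan with bounding rectangle `B`: a dissection of `B`
into finitely many rectangles without cross junctions. -/
structure IsMosaic (B : Rect) (F : Set Rect) : Prop where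
  proper_box : B.Proper
  finite : F.Finite
  proper : ∀ P ∈ F, P.Proper
  disjoint : F.PairwiseDisjoint Rect.inner
  cover : ⋃ P ∈ F, P.region = B.region
  no_cross : ¬ HasCross F

/-- Hierarchical floorplans of order `k` with bounding rectangle `B`: the mosaic floorplans obtained
from the rectangle `B` by repeatedly embedding, in a room `Q`, a mosaic floorplan `G` with at most
`k` rooms. -/
inductive IsHFO (k : ℕ) (B : Rect) : Set Rect → Prop
  | box : IsMosaic B {B} → IsHFO k B {B}
  | embed (F : Set Rect) (Q : Rect) (G : Set Rect) :
      IsHFO k B F → Q ∈ F → IsMosaic Q G → G.ncard ≤ k →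
      IsMosaic B ((F \ {Q}) ∪ G) → IsHFO k B ((F \ {Q}) ∪ G)

/-! ## The Abe-label of a mosaic floorplan

Rooms are indexed by `Fin n`, so that they keep their identity while the deletion operation
changes their shape; `s` is the set of rooms that are still present. -/

/-- For the top left room `b`: its bottom right corner is a `⊣` junction, i.e. the wall on the
right of `b` continues below `b` (otherwise the corner is a `⊥` junction). -/
def CornerTee {n : ℕ} (s : Finset (Fin n)) (R : Fin n → Rect) (b : Fin n) : Prop :=
  ∃ r ∈ s, (R r).top = (R b).bottom ∧ (R r).right = (R b).right

open Classical in
/-- The rooms after deletion of the top left room `b`. For a `⊣` junction the bottom edge of `b` is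
shifted upwards to the bounding rectangle `B`, so that the rooms below `b` grow upwards; for a `⊥`
junction the right edge of `b` is shifted leftwards to the bounding rectangle. -/
noncomputable def deleteTopLeft {n : ℕ} (B : Rect) (s : Finset (Fin n)) (R : Fin n → Rect)
    (b : Fin n) : Fin n → Rect := fun r =>
  if CornerTee s R b then
    if (R r).top = (R b).bottom ∧ (R r).right ≤ (R b).right then
      { R r with top := B.top } else R r
  else
    if (R r).left = (R b).right ∧ (R b).bottom ≤ (R r).bottom then
      { R r with left := B.left } else R r

/-- `TopLeftOrder B s R l`: the list `l` is the top-left deletion order of the floorplan with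
bounding rectangle `B` and rooms `R r`, `r ∈ s`. -/
inductive TopLeftOrder {n : ℕ} (B : Rect) :
    Finset (Fin n) → (Fin n → Rect) → List (Fin n) → Prop
  | single (b : Fin n) (R : Fin n → Rect) : TopLeftOrder B {b} R [b]
  | delete (s : Finset (Fin n)) (R : Fin n → Rect) (b : Fin n) (l : List (Fin n)) :
      b ∈ s → 1 < s.card → (R b).left = B.left → (R b).top = B.top →
      TopLeftOrder B (s.erase b) (deleteTopLeft B s R b) l →
      TopLeftOrder B s R (b :: l)

/-- The bottom-left deletion order is the top-left deletion order of the floorplan reflected in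
the horizontal axis. -/
def BottomLeftOrder {n : ℕ} (B : Rect) (s : Finset (Fin n)) (R : Fin n → Rect)
    (l : List (Fin n)) : Prop :=
  TopLeftOrder B.flip s (fun r => (R r).flip) l

/-- `π` is the Abe-label of the floorplan with bounding rectangle `B` and rooms `R 0, …, R (n-1)`:
label the rooms in their top-left deletion order `tl`, and arrange the labels in the bottom-left
deletion order `bl`; the `i`-th room in `bl` then has label `π i`, i.e. it is the `π i`-th in
`tl`. -/
def IsAbeLabel {n : ℕ} (B : Rect) (R : Fin n → Rect) (π : Equiv.Perm (Fin n)) : Prop :=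
  ∃ tl bl : List (Fin n), TopLeftOrder B Finset.univ R tl ∧ BottomLeftOrder B Finset.univ R bl ∧
    ∀ i : Fin n, bl[(i : ℕ)]? = tl[(π i : ℕ)]?

/-- The permutation `π` of length `n` corresponds to a hierarchical floorplan of order `k` (with
`n` rooms). -/
def IsHFOPerm (k : ℕ) {n : ℕ} (π : Equiv.Perm (Fin n)) : Prop :=
  ∃ (B : Rect) (R : Fin n → Rect), Function.Injective R ∧ IsMosaic B (Set.range R) ∧
    IsHFO k B (Set.range R) ∧ IsAbeLabel B R π

/-! ## A random access machine

An imperative language with finitely many registers and arrays of natural numbers. Every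
elementary operation (reading a register, a constant or an array cell, adding, subtracting,
comparing, branching, writing) costs one step. The semantics also records the set of array cells
that a run has accessed. -/

/-- The registers. -/
inductive Reg
  | n | i | top | j | mn | mx | len | found | go | ok | a | b | c | d | v | p | q | seen | out | kmin
  deriving DecidableEq

/-- The arrays: the input, the lower and upper ends of the ranges on the stack, and an auxiliary
array. -/
inductive Arr
  | input | lo | hi | pos
  deriving DecidableEq

/-- A memory state. -/
structure State where
  reg : Reg → ℕ
  arr : Arr → ℕ → ℕ

/-- Arithmetic expressions (subtraction is truncated). -/
inductive Expr
  | const (m : ℕ)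
  | reg (x : Reg)
  | get (A : Arr) (e : Expr)
  | add (e f : Expr)
  | sub (e f : Expr)

/-- Boolean expressions. -/
inductive Test
  | lt (e f : Expr)
  | eq (e f : Expr)
  | and (s t : Test)
  | or (s t : Test)

/-- Programs. -/
inductive Cmd
  | skip
  | assign (x : Reg) (e : Expr)
  | store (A : Arr) (e f : Expr)
  | seq (C D : Cmd)
  | ite (t : Test) (C D : Cmd)
  | while (t : Test) (C : Cmd)

namespace Expr

/-- The value of an expression. -/
def eval (σ : State) : Expr → ℕ
  | const m => m
  | reg x => σ.reg x
  | get A e => σ.arr A (e.eval σ)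
  | add e f => e.eval σ + f.eval σ
  | sub e f => e.eval σ - f.eval σ

/-- The number of elementary operations in the evaluation of an expression. -/
def cost : Expr → ℕ
  | const _ => 1
  | reg _ => 1
  | get _ e => e.cost + 1
  | add e f => e.cost + f.cost + 1
  | sub e f => e.cost + f.cost + 1

/-- The array cells that are read in the evaluation of an expression. -/
def cells (σ : State) : Expr → Finset (Arr × ℕ)
  | const _ => ∅
  | reg _ => ∅
  | get A e => insert (A, e.eval σ) (e.cells σ)
  | add e f => e.cells σ ∪ f.cells σ
  | sub e f => e.cells σ ∪ f.cells σ

end Expr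

namespace Test

/-- The truth value of a Boolean expression. -/
def eval (σ : State) : Test → Bool
  | lt e f => decide (e.eval σ < f.eval σ)
  | eq e f => decide (e.eval σ = f.eval σ)
  | and s t => s.eval σ && t.eval σ
  | or s t => s.eval σ || t.eval σ

/-- The number of elementary operations in the evaluation of a Boolean expression. -/
def cost : Test → ℕ
  | lt e f => e.cost + f.cost + 1
  | eq e f => e.cost + f.cost + 1
  | and s t => s.cost + t.cost + 1
  | or s t => s.cost + t.cost + 1

/-- The array cells that are read in the evaluation of a Boolean expression. -/
def cells (σ : State) : Test → Finset (Arr × ℕ)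
  | lt e f => e.cells σ ∪ f.cells σ
  | eq e f => e.cells σ ∪ f.cells σ
  | and s t => s.cells σ ∪ t.cells σ
  | or s t => s.cells σ ∪ t.cells σ

end Test

/-- Write a register. -/
def State.setReg (σ : State) (x : Reg) (m : ℕ) : State :=
  { σ with reg := Function.update σ.reg x m }

/-- Write an array cell. -/
def State.setArr (σ : State) (A : Arr) (i m : ℕ) : State :=
  { σ with arr := Function.update σ.arr A (Function.update (σ.arr A) i m) }

/-- `Run C σ t S τ`: the program `C`, started in state `σ`, halts in state `τ` after exactly `t`
steps, and `S` is the set of array cells that it has accessed. -/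
inductive Run : Cmd → State → ℕ → Finset (Arr × ℕ) → State → Prop
  | skip (σ : State) : Run .skip σ 1 ∅ σ
  | assign (σ : State) (x : Reg) (e : Expr) :
      Run (.assign x e) σ (e.cost + 1) (e.cells σ) (σ.setReg x (e.eval σ))
  | store (σ : State) (A : Arr) (e f : Expr) :
      Run (.store A e f) σ (e.cost + f.cost + 1)
        (insert (A, e.eval σ) (e.cells σ ∪ f.cells σ)) (σ.setArr A (e.eval σ) (f.eval σ))
  | seq (σ ρ τ : State) (C D : Cmd) (t u : ℕ) (S T : Finset (Arr × ℕ)) :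
      Run C σ t S ρ → Run D ρ u T τ → Run (.seq C D) σ (t + u) (S ∪ T) τ
  | ite_true (σ τ : State) (b : Test) (C D : Cmd) (t : ℕ) (S : Finset (Arr × ℕ)) :
      b.eval σ = true → Run C σ t S τ → Run (.ite b C D) σ (b.cost + 1 + t) (b.cells σ ∪ S) τ
  | ite_false (σ τ : State) (b : Test) (C D : Cmd) (t : ℕ) (S : Finset (Arr × ℕ)) :
      b.eval σ = false → Run D σ t S τ → Run (.ite b C D) σ (b.cost + 1 + t) (b.cells σ ∪ S) τ
  | while_true (σ ρ τ : State) (b : Test) (C : Cmd) (t u : ℕ) (S T : Finset (Arr × ℕ)) :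
      b.eval σ = true → Run C σ t S ρ → Run (.while b C) ρ u T τ →
      Run (.while b C) σ (b.cost + 1 + t + u) (b.cells σ ∪ S ∪ T) τ
  | while_false (σ : State) (b : Test) (C : Cmd) :
      b.eval σ = false → Run (.while b C) σ (b.cost + 1) (b.cells σ) σ

/-- The initial memory: register `n` holds the length `n`, the cells `0, …, n - 1` of the input
array hold the one-line notation (with values `1, …, n`) of `π`, and everything else is `0`. -/
def inputState {n : ℕ} (π : Equiv.Perm (Fin n)) : State where
  reg := Function.update (fun _ => 0) Reg.n n
  arr := Function.update (fun _ _ => 0) Arr.input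
    (fun m => if h : m < n then (π ⟨m, h⟩ : ℕ) + 1 else 0)

/-! ## The algorithms -/

infixr:30 ";;" => Cmd.seq
infix:40 "≔" => Cmd.assign
infixl:65 "⊹" => Expr.add
infixl:65 "∸" => Expr.sub
infix:50 "≺" => Test.lt
infix:50 "≐" => Test.eq

/-- The stack entry (its lower or upper end) at depth `e`, where the top entry has depth `1`. -/
def atDepth (A : Arr) (e : Expr) : Expr := .get A (.reg .top ∸ e)

/-- Push the one-element range of the next entry of the input. -/
def pushNext : Cmd :=
  .store .lo (.reg .top) (.get .input (.reg .i)) ;;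
  .store .hi (.reg .top) (.get .input (.reg .i)) ;;
  .top ≔ .reg .top ⊹ .const 1 ;;
  .i ≔ .reg .i ⊹ .const 1

/-- Search for the least `j ≥ 2` such that the top `j` stack entries form a range, increasing `j`
as long as `more` holds. The registers `mn`, `mx`, `len` hold the least element, the greatest
element and the total size of the top `j` entries; these form a range when `mx - mn + 1 = len`. -/
def findRange (more : Test) : Cmd :=
  .j ≔ .const 1 ;;
  .mn ≔ atDepth .lo (.const 1) ;;
  .mx ≔ atDepth .hi (.const 1) ;;
  .len ≔ .reg .mx ⊹ .const 1 ∸ .reg .mn ;;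
  .found ≔ .const 0 ;;
  .while (.and (.reg .found ≐ .const 0) more)
    (.j ≔ .reg .j ⊹ .const 1 ;;
     .ite (atDepth .lo (.reg .j) ≺ .reg .mn) (.mn ≔ atDepth .lo (.reg .j)) .skip ;;
     .ite (.reg .mx ≺ atDepth .hi (.reg .j)) (.mx ≔ atDepth .hi (.reg .j)) .skip ;;
     .len ≔ .reg .len ⊹ (atDepth .hi (.reg .j) ⊹ .const 1 ∸ atDepth .lo (.reg .j)) ;;
     .ite (.reg .mx ⊹ .const 1 ∸ .reg .mn ≐ .reg .len) (.found ≔ .const 1) .skip)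

/-- Replace the top `j` stack entries by their union, the range from `mn` to `mx`. -/
def merge : Cmd :=
  .top ≔ .reg .top ∸ .reg .j ;;
  .store .lo (.reg .top) (.reg .mn) ;;
  .store .hi (.reg .top) (.reg .mx) ;;
  .top ≔ .reg .top ⊹ .const 1

/-- The stack entries at the positions `a < b < c < d` violate the Baxter condition: they follow
the pattern `2413` or the pattern `3142`, and the values of the first and of the last are
adjacent. -/
def badQuadruple : Test :=
  .or
    (.and (.get .hi (.reg .a) ⊹ .const 1 ≐ .get .lo (.reg .d))
      (.and (.get .lo (.reg .c) ≺ .get .lo (.reg .a)) (.get .lo (.reg .d) ≺ .get .lo (.reg .b))))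
    (.and (.get .hi (.reg .d) ⊹ .const 1 ≐ .get .lo (.reg .a))
      (.and (.get .lo (.reg .b) ≺ .get .lo (.reg .d)) (.get .lo (.reg .a) ≺ .get .lo (.reg .c))))

/-- For the top `j` stack entries, which form a range: set `ok` to `1` if they form a Baxter
permutation, and to `0` otherwise. -/
def baxterTop : Cmd :=
  .ok ≔ .const 1 ;;
  .a ≔ .reg .top ∸ .reg .j ;;
  .while (.reg .a ≺ .reg .top)
    (.b ≔ .reg .a ⊹ .const 1 ;;
     .while (.reg .b ≺ .reg .top)
      (.c ≔ .reg .b ⊹ .const 1 ;;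
       .while (.reg .c ≺ .reg .top)
        (.d ≔ .reg .c ⊹ .const 1 ;;
         .while (.reg .d ≺ .reg .top)
          (.ite badQuadruple (.ok ≔ .const 0) .skip ;;
           .d ≔ .reg .d ⊹ .const 1) ;;
         .c ≔ .reg .c ⊹ .const 1) ;;
       .b ≔ .reg .b ⊹ .const 1) ;;
     .a ≔ .reg .a ⊹ .const 1)

/-- Accept (`out = 1`) if the stack holds exactly one entry, otherwise reject (`out = 0`). -/
def verdict : Cmd :=
  .ite (.reg .top ≐ .const 1) (.out ≔ .const 1) (.out ≔ .const 0)

/-- The recognition algorithm for a fixed `k`: push the entries of the permutation one by one; after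
each push, as long as there is a `j ≤ k` for which the top `j` stack entries form a range, and the
entries for the least such `j` form a Baxter permutation, merge these. -/
def recognise (k : ℕ) : Cmd :=
  .top ≔ .const 0 ;;
  .i ≔ .const 0 ;;
  .while (.reg .i ≺ .reg .n)
    (pushNext ;;
     .go ≔ .const 1 ;;
     .while (.reg .go ≐ .const 1)
      (.go ≔ .const 0 ;;
       findRange (.and (.reg .j ≺ .const k) (.reg .j ≺ .reg .top)) ;;
       .ite (.reg .found ≐ .const 1)
        (baxterTop ;;
         .ite (.reg .ok ≐ .const 1) (merge ;; .go ≔ .const 1) .skip)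
        .skip)) ;;
  verdict

/-- Set `ok` to `1` if the input is a Baxter permutation, and to `0` otherwise: invert the
permutation, and for each pair of adjacent values `v`, `v + 1` at the positions `p`, `q`, scan the
entries between these positions for a larger one followed by a smaller one (if `p < q`), or for
a smaller one followed by a larger one (if `q < p`). -/
def baxterInput : Cmd :=
  .ok ≔ .const 1 ;;
  .i ≔ .const 0 ;;
  .while (.reg .i ≺ .reg .n)
    (.store .pos (.get .input (.reg .i)) (.reg .i) ;;
     .i ≔ .reg .i ⊹ .const 1) ;;
  .v ≔ .const 1 ;;
  .while (.reg .v ≺ .reg .n)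
    (.p ≔ .get .pos (.reg .v) ;;
     .q ≔ .get .pos (.reg .v ⊹ .const 1) ;;
     .seen ≔ .const 0 ;;
     .ite (.reg .p ≺ .reg .q)
      (.c ≔ .reg .p ⊹ .const 1 ;;
       .while (.reg .c ≺ .reg .q)
        (.ite (.reg .v ≺ .get .input (.reg .c)) (.seen ≔ .const 1)
          (.ite (.reg .seen ≐ .const 1) (.ok ≔ .const 0) .skip) ;;
         .c ≔ .reg .c ⊹ .const 1))
      (.c ≔ .reg .q ⊹ .const 1 ;;
       .while (.reg .c ≺ .reg .p)
        (.ite (.get .input (.reg .c) ≺ .reg .v) (.seen ≔ .const 1)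
          (.ite (.reg .seen ≐ .const 1) (.ok ≔ .const 0) .skip) ;;
         .c ≔ .reg .c ⊹ .const 1)) ;;
     .v ≔ .reg .v ⊹ .const 1)

/-- The modified algorithm, for unknown `k`: reject if the input is not a Baxter permutation;
otherwise proceed as in `recognise`, but without a bound on the number `j` of merged entries, and
record in `kmin` the greatest `j` that occurs. -/
def findOrder : Cmd :=
  baxterInput ;;
  .ite (.reg .ok ≐ .const 0) (.out ≔ .const 0)
    (.kmin ≔ .const 1 ;;
     .top ≔ .const 0 ;;
     .i ≔ .const 0 ;;
     .while (.reg .i ≺ .reg .n)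
      (pushNext ;;
       .go ≔ .const 1 ;;
       .while (.reg .go ≐ .const 1)
        (.go ≔ .const 0 ;;
         findRange (.reg .j ≺ .reg .top) ;;
         .ite (.reg .found ≐ .const 1)
          (.ite (.reg .kmin ≺ .reg .j) (.kmin ≔ .reg .j) .skip ;;
           merge ;;
           .go ≔ .const 1)
          .skip)) ;;
     verdict)

end HFO

/-! The proof replaces floorplans by patterns. A permutation is regarded as the set of its values,
with the position as horizontal and the value as vertical coordinate. An interval is a subset that
no outside point separates in either direction, and it may be contracted to one of its points. `Dec
k` says that Baxter intervals with at most `k` points can be contracted until a single point is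
left. The two forbidden patterns are mirror images, so `Baxter` is `HalfBaxter` for the horizontal
coordinate and for its reverse. Everything rests on `isHFOPerm_iff`: being the label of a
hierarchical floorplan of order `k` is the same as `Dec k`.

Geometry. The top left room has the least label. If its corner is a `⊣`, then in the bottom-left
order it comes immediately after the last room below it (`BLO.insert_tee`); if it is a `⊥`, it comes
immediately before the lowest room on its right (`BLO.insert_perp`). At the same time the rooms on
the upper boundary are the right-to-left minima of the label, and those on the left boundary are its
left-to-right minima (`Mos.label`). This matches the way in which Baxter patterns grow by a new
minimum, which must stand right after a right-to-left minimum or right before a left-to-right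
minimum (`Baxter.insert_min`, `Baxter.afterMin`). Hence labels are Baxter, and every Baxter pattern
is a label (`Baxter.exists_mos`). Embedding a floorplan in a room replaces this room by a block in
both orders (`Mos.inflate`), which inflates a point to an interval (`IsHFO.dec`). Conversely, a
contraction is undone by embedding a floorplan, in general position so that no cross junction arises
(`Dec.exists_isHFO`).

Combinatorics. Greedy contraction can do no harm: contracting any interval preserves `Dec k`
(`Dec.contract`), and a minimal nontrivial interval of a `Dec k` pattern has at most `k` points
(`Dec.card_le_of_minimal`).

Algorithms. The unread values together with one representative for each stack entry (`remaining`)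
form a contraction of the input pattern. Consecutive entries form a range exactly when their
representatives form an interval, so that a merge is a contraction. In `recognise`, a non-Baxter
range refutes `Dec k`, and so does a final stack with at least two entries and no range of at most
`k` of them (`IsStack.not_dec_of_noRange`). In `findOrder`, each merged range is a minimal interval,
so the order is the greatest length of a merge (`IsStack.dec_merge_iff`).

Running time. Every round of the inner loop shortens the stack or ends the loop, so `n` pushes allow
at most `2n` rounds (`wp_mainLoop`). A round costs `O(k ^ 4)` in `recognise` and `O(n)` in
`findOrder`; the Baxter test of the input is quadratic. The number of accessed cells is bounded by
the number of steps (`Run.card_le`). -/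

namespace HFO

/-! ## Intervals and Baxter patterns of point sets

A permutation pattern is a finite set `S` of points with a horizontal coordinate `u` and a vertical
coordinate `v`. -/

section Pattern

set_option linter.unusedSectionVars false

variable {ι κ α β α' β' : Type*} [LinearOrder α] [LinearOrder β]
  [LinearOrder α'] [LinearOrder β']

/-- All elements of `I` lie on the same side of `p`. -/
def Apart (u : ι → α) (p : ι) (I : Finset ι) : Prop :=
  (∀ q ∈ I, u p < u q) ∨ (∀ q ∈ I, u q < u p)

/-- `I` is a nonempty interval of the point set `S`. -/
structure IsInterval (u : ι → α) (v : ι → β) (S I : Finset ι) : Prop where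
  sub : I ⊆ S
  nonempty : I.Nonempty
  apart_fst : ∀ p ∈ S, p ∉ I → Apart u p I
  apart_snd : ∀ p ∈ S, p ∉ I → Apart v p I

/-- The point set `S` avoids the pattern `2413` with adjacent values `2`, `3`. -/
def HalfBaxter (u : ι → α) (v : ι → β) (S : Finset ι) : Prop :=
  ∀ a ∈ S, ∀ b ∈ S, ∀ c ∈ S, ∀ d ∈ S, u a < u b → u b < u c → u c < u d →
    v c < v a → v a < v d → v d < v b → ∃ e ∈ S, v a < v e ∧ v e < v d

/-- Baxter point sets. -/
def Baxter (u : ι → α) (v : ι → β) (S : Finset ι) : Prop :=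
  HalfBaxter u v S ∧ HalfBaxter (OrderDual.toDual ∘ u) v S

variable [DecidableEq ι] [DecidableEq κ]

/-- The point sets that can be reduced to a point by contracting intervals that have at most `k`
elements and are Baxter. -/
inductive Dec (k : ℕ) (u : ι → α) (v : ι → β) : Finset ι → Prop
  | single (p : ι) : Dec k u v {p}
  | step (S I : Finset ι) (x : ι) : IsInterval u v S I → x ∈ I → I.card ≤ k → Baxter u v I →
      Dec k u v (S \ I.erase x) → Dec k u v S

theorem Apart.dual {u : ι → α} {p : ι} {I : Finset ι} (h : Apart u p I) :
    Apart (OrderDual.toDual ∘ u) p I := h.symm.imp (fun h => h) (fun h => h)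

theorem Apart.mono {u : ι → α} {p : ι} {I J : Finset ι} (h : Apart u p I) (hJ : J ⊆ I) :
    Apart u p J := h.imp (fun h q hq => h q (hJ hq)) (fun h q hq => h q (hJ hq))

/-- Comparisons with a point that does not separate `I` can be transferred between the elements of
`I`; this is why the representative chosen in a contraction is immaterial. -/
theorem Apart.lt_iff {u : ι → α} {p x y : ι} {I : Finset ι} (h : Apart u p I) (hx : x ∈ I)
    (hy : y ∈ I) : u p < u x ↔ u p < u y := by
  rcases h with h | h
  · exact ⟨fun _ => h y hy, fun _ => h x hx⟩
  · exact ⟨fun g => absurd g (h x hx).not_gt, fun g => absurd g (h y hy).not_gt⟩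

theorem Apart.gt_iff {u : ι → α} {p x y : ι} {I : Finset ι} (h : Apart u p I) (hx : x ∈ I)
    (hy : y ∈ I) : u x < u p ↔ u y < u p := h.dual.lt_iff hx hy

/-- `p` is apart from `I` if it is apart from `{x}` and `I` is on one side of `p`. -/
theorem Apart.of_pivot {u : ι → α} {p x : ι} {I : Finset ι} (hx : u p < u x ∨ u x < u p)
    (h1 : ∀ q ∈ I, u p < u x → u p < u q) (h2 : ∀ q ∈ I, u x < u p → u q < u p) :
    Apart u p I :=
  hx.imp (fun h q hq => h1 q hq h) (fun h q hq => h2 q hq h)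

theorem Apart.union {u : ι → α} {p x : ι} {I J : Finset ι} (hI : Apart u p I) (hJ : Apart u p J)
    (hxI : x ∈ I) (hxJ : x ∈ J) : Apart u p (I ∪ J) := by
  refine Apart.of_pivot (x := x) (hI.imp (fun h => h x hxI) (fun h => h x hxI)) ?_ ?_
  · intro q hq h
    rcases Finset.mem_union.1 hq with hq | hq
    · exact (hI.lt_iff hxI hq).1 h
    · exact (hJ.lt_iff hxJ hq).1 h
  · intro q hq h
    rcases Finset.mem_union.1 hq with hq | hq
    · exact (hI.gt_iff hxI hq).1 h
    · exact (hJ.gt_iff hxJ hq).1 h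

/-! ### Set operations on intervals -/

namespace IsInterval

variable {u : ι → α} {v : ι → β} {S I J : Finset ι}

theorem dual (h : IsInterval u v S I) : IsInterval (OrderDual.toDual ∘ u) v S I :=
  ⟨h.sub, h.nonempty, fun p hp hpI => (h.apart_fst p hp hpI).dual, h.apart_snd⟩

theorem restrict (h : IsInterval u v S I) {T : Finset ι} (hT : T ⊆ S) (hI : I ⊆ T) :
    IsInterval u v T I :=
  ⟨hI, h.nonempty, fun p hp hpI => h.apart_fst p (hT hp) hpI,
    fun p hp hpI => h.apart_snd p (hT hp) hpI⟩

theorem inter (hI : IsInterval u v S I) (hJ : IsInterval u v S J) (h : (I ∩ J).Nonempty) :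
    IsInterval u v S (I ∩ J) := by
  refine ⟨fun x hx => hI.sub (Finset.mem_inter.1 hx).1, h, fun p hp hpI => ?_, fun p hp hpI => ?_⟩
  · by_cases h1 : p ∈ I
    · exact (hJ.apart_fst p hp fun h2 => hpI (Finset.mem_inter.2 ⟨h1, h2⟩)).mono
        Finset.inter_subset_right
    · exact (hI.apart_fst p hp h1).mono Finset.inter_subset_left
  · by_cases h1 : p ∈ I
    · exact (hJ.apart_snd p hp fun h2 => hpI (Finset.mem_inter.2 ⟨h1, h2⟩)).mono
        Finset.inter_subset_right
    · exact (hI.apart_snd p hp h1).mono Finset.inter_subset_left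

theorem union (hI : IsInterval u v S I) (hJ : IsInterval u v S J) {x : ι} (hxI : x ∈ I)
    (hxJ : x ∈ J) : IsInterval u v S (I ∪ J) := by
  refine ⟨Finset.union_subset hI.sub hJ.sub, ⟨x, Finset.mem_union_left _ hxI⟩,
    fun p hp hpI => ?_, fun p hp hpI => ?_⟩ <;> rw [Finset.mem_union, not_or] at hpI
  · exact (hI.apart_fst p hp hpI.1).union (hJ.apart_fst p hp hpI.2) hxI hxJ
  · exact (hI.apart_snd p hp hpI.1).union (hJ.apart_snd p hp hpI.2) hxI hxJ

/-- A point `p` of `I ∩ J` is compared with `q ∈ I \ J` through `z ∈ J \ I`: as `q` does not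
separate `J`, the points `p` and `z` lie on the same side of `q`, and `z` has all of `I` on one
side. -/
theorem apart_diff {u : ι → α} (hI : ∀ p ∈ S, p ∉ I → Apart u p I)
    (hJ : ∀ p ∈ S, p ∉ J → Apart u p J) (hIS : I ⊆ S) (hJS : J ⊆ S) {z : ι} (hz : z ∈ J)
    (hzI : z ∉ I) : ∀ p ∈ S, p ∉ I \ J → Apart u p (I \ J) := by
  intro p hp hpIJ
  by_cases h : p ∈ I
  · have hpJ : p ∈ J := by
      by_contra h'
      exact hpIJ (Finset.mem_sdiff.2 ⟨h, h'⟩)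
    have hzz := hI z (hJS hz) hzI
    rcases hzz with h1 | h1
    · left
      intro q hq
      obtain ⟨hq, hqJ⟩ := Finset.mem_sdiff.1 hq
      exact ((hJ q (hIS hq) hqJ).gt_iff hz hpJ).1 (h1 q hq)
    · right
      intro q hq
      obtain ⟨hq, hqJ⟩ := Finset.mem_sdiff.1 hq
      exact ((hJ q (hIS hq) hqJ).lt_iff hz hpJ).1 (h1 q hq)
  · exact (hI p hp h).mono Finset.sdiff_subset

theorem sdiff (hI : IsInterval u v S I) (hJ : IsInterval u v S J) (h : (I \ J).Nonempty)
    (h' : (J \ I).Nonempty) : IsInterval u v S (I \ J) := by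
  obtain ⟨z, hz⟩ := h'
  obtain ⟨hz, hzI⟩ := Finset.mem_sdiff.1 hz
  exact ⟨fun x hx => hI.sub (Finset.mem_sdiff.1 hx).1, h,
    apart_diff hI.apart_fst hJ.apart_fst hI.sub hJ.sub hz hzI,
    apart_diff hI.apart_snd hJ.apart_snd hI.sub hJ.sub hz hzI⟩

/-- Intervals of a contraction that avoid the contracted interval. -/
theorem of_contract (hJ : IsInterval u v S J) {x : ι} (hx : x ∈ J)
    (hI : IsInterval u v (S \ J.erase x) I) (hd : Disjoint I J) : IsInterval u v S I := by
  have key : ∀ p ∈ S, p ∉ I → p ∈ J ∨ p ∈ S \ J.erase x := by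
    intro p hp _
    by_cases h : p ∈ J
    · exact Or.inl h
    · exact Or.inr (Finset.mem_sdiff.2 ⟨hp, fun h' => h (Finset.mem_of_mem_erase h')⟩)
  have hxT : x ∈ S \ J.erase x := Finset.mem_sdiff.2 ⟨hJ.sub hx, Finset.notMem_erase x J⟩
  have hxI : x ∉ I := fun h => Finset.disjoint_left.1 hd h hx
  have hIJ : ∀ q ∈ I, q ∉ J := fun q hq => Finset.disjoint_left.1 hd hq
  have hIS : I ⊆ S := fun q hq => (Finset.mem_sdiff.1 (hI.sub hq)).1
  refine ⟨hIS, hI.nonempty, fun p hp hpI => ?_, fun p hp hpI => ?_⟩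
  -- A point `p` of `J` lost in the contraction lies on the same side of each `q ∈ I` as the
  -- representative `x`, because `q ∉ J`.
  · rcases key p hp hpI with h | h
    · refine (hI.apart_fst x hxT hxI).imp (fun g q hq => ?_) (fun g q hq => ?_)
      · exact ((hJ.apart_fst q (hIS hq) (hIJ q hq)).gt_iff hx h).1 (g q hq)
      · exact ((hJ.apart_fst q (hIS hq) (hIJ q hq)).lt_iff hx h).1 (g q hq)
    · exact hI.apart_fst p h hpI
  · rcases key p hp hpI with h | h
    · refine (hI.apart_snd x hxT hxI).imp (fun g q hq => ?_) (fun g q hq => ?_)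
      · exact ((hJ.apart_snd q (hIS hq) (hIJ q hq)).gt_iff hx h).1 (g q hq)
      · exact ((hJ.apart_snd q (hIS hq) (hIJ q hq)).lt_iff hx h).1 (g q hq)
    · exact hI.apart_snd p h hpI

theorem image (hI : IsInterval u v S I) {u' : κ → α'} {v' : κ → β'} {g : ι → κ}
    (hu : ∀ x ∈ S, ∀ y ∈ S, u x < u y ↔ u' (g x) < u' (g y))
    (hv : ∀ x ∈ S, ∀ y ∈ S, v x < v y ↔ v' (g x) < v' (g y)) :
    IsInterval u' v' (S.image g) (I.image g) := by
  refine ⟨Finset.image_subset_image hI.sub, hI.nonempty.image g, fun p hp hpI => ?_,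
    fun p hp hpI => ?_⟩ <;> obtain ⟨p, hpS, rfl⟩ := Finset.mem_image.1 hp
  · have := hI.apart_fst p hpS fun h => hpI (Finset.mem_image_of_mem g h)
    refine this.imp (fun h q hq => ?_) (fun h q hq => ?_) <;>
      obtain ⟨q, hqI, rfl⟩ := Finset.mem_image.1 hq
    · exact (hu p hpS q (hI.sub hqI)).1 (h q hqI)
    · exact (hu q (hI.sub hqI) p hpS).1 (h q hqI)
  · have := hI.apart_snd p hpS fun h => hpI (Finset.mem_image_of_mem g h)
    refine this.imp (fun h q hq => ?_) (fun h q hq => ?_) <;>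
      obtain ⟨q, hqI, rfl⟩ := Finset.mem_image.1 hq
    · exact (hv p hpS q (hI.sub hqI)).1 (h q hqI)
    · exact (hv q (hI.sub hqI) p hpS).1 (h q hqI)

end IsInterval

/-! ### Baxter patterns under relabelling, restriction and contraction -/

theorem HalfBaxter.image {u : ι → α} {v : ι → β} {S : Finset ι} (h : HalfBaxter u v S)
    {u' : κ → α'} {v' : κ → β'} {g : ι → κ}
    (hu : ∀ x ∈ S, ∀ y ∈ S, u x < u y ↔ u' (g x) < u' (g y))
    (hv : ∀ x ∈ S, ∀ y ∈ S, v x < v y ↔ v' (g x) < v' (g y)) :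
    HalfBaxter u' v' (S.image g) := by
  simp only [HalfBaxter, Finset.forall_mem_image, Finset.exists_mem_image]
  intro a ha b hb c hc d hd
  rw [← hu a ha b hb, ← hu b hb c hc, ← hu c hc d hd, ← hv c hc a ha, ← hv a ha d hd,
    ← hv d hd b hb]
  intro h1 h2 h3 h4 h5 h6
  obtain ⟨e, he, h7, h8⟩ := h a ha b hb c hc d hd h1 h2 h3 h4 h5 h6
  exact ⟨e, he, (hv a ha e he).1 h7, (hv e he d hd).1 h8⟩

theorem Baxter.image {u : ι → α} {v : ι → β} {S : Finset ι} (h : Baxter u v S)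
    {u' : κ → α'} {v' : κ → β'} {g : ι → κ}
    (hu : ∀ x ∈ S, ∀ y ∈ S, u x < u y ↔ u' (g x) < u' (g y))
    (hv : ∀ x ∈ S, ∀ y ∈ S, v x < v y ↔ v' (g x) < v' (g y)) :
    Baxter u' v' (S.image g) :=
  ⟨h.1.image hu hv, h.2.image (fun x hx y hy => hu y hy x hx) hv⟩

/-- The witness lies between two values of `I`, and no point outside the interval does. -/
theorem HalfBaxter.interval {u : ι → α} {v : ι → β} {S I : Finset ι} (h : HalfBaxter u v S)
    (hI : IsInterval u v S I) : HalfBaxter u v I := by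
  intro a ha b hb c hc d hd h1 h2 h3 h4 h5 h6
  obtain ⟨e, he, h7, h8⟩ := h a (hI.sub ha) b (hI.sub hb) c (hI.sub hc) d (hI.sub hd) h1 h2 h3 h4
    h5 h6
  refine ⟨e, ?_, h7, h8⟩
  by_contra heI
  rcases hI.apart_snd e he heI with g | g
  · exact (g a ha).not_gt h7
  · exact (g d hd).not_gt h8

theorem Baxter.interval {u : ι → α} {v : ι → β} {S I : Finset ι} (h : Baxter u v S)
    (hI : IsInterval u v S I) : Baxter u v I :=
  ⟨h.1.interval hI, h.2.interval hI.dual⟩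

/-- The danger is a witness inside `I`, which the contraction deletes. If the representative plays
the `2` of the pattern, it is replaced by the highest point of `I`, and if it plays the `3`, by the
lowest; the witness then falls outside `I`. In the remaining cases a witness in `I` can be traded
for `x`. -/
theorem HalfBaxter.contract {u : ι → α} {v : ι → β} {S I : Finset ι} (h : HalfBaxter u v S)
    (hI : IsInterval u v S I) {x : ι} (hx : x ∈ I) : HalfBaxter u v (S \ I.erase x) := by
  have hmem : ∀ p, p ∈ S \ I.erase x → p ∈ S ∧ (p ≠ x → p ∉ I) := by
    intro p hp
    rw [Finset.mem_sdiff, Finset.mem_erase] at hp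
    exact ⟨hp.1, fun h1 h2 => hp.2 ⟨h1, h2⟩⟩
  have hmem' : ∀ p ∈ S, p ∉ I → p ∈ S \ I.erase x := by
    intro p hp hpI
    exact Finset.mem_sdiff.2 ⟨hp, fun h => hpI (Finset.mem_of_mem_erase h)⟩
  intro a ha b hb c hc d hd h1 h2 h3 h4 h5 h6
  obtain ⟨haS, ha'⟩ := hmem a ha
  obtain ⟨hbS, hb'⟩ := hmem b hb
  obtain ⟨hcS, hc'⟩ := hmem c hc
  obtain ⟨hdS, hd'⟩ := hmem d hd
  by_cases hax : a = x
  · subst hax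
    have hbI := hb' (by rintro rfl; exact h1.false)
    have hcI := hc' (by rintro rfl; exact h4.false)
    have hdI := hd' (by rintro rfl; exact h5.false)
    obtain ⟨m, hm, hmax⟩ := I.exists_max_image v ⟨a, hx⟩
    obtain ⟨e, he, h7, h8⟩ := h m (hI.sub hm) b hbS c hcS d hdS
      (((hI.apart_fst b hbS hbI).gt_iff hx hm).1 h1) h2 h3
      (((hI.apart_snd c hcS hcI).lt_iff hx hm).1 h4)
      (((hI.apart_snd d hdS hdI).gt_iff hx hm).1 h5) h6
    exact ⟨e, hmem' e he fun heI => (hmax e heI).not_gt h7, (hmax a hx).trans_lt h7, h8⟩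
  by_cases hdx : d = x
  · subst hdx
    have haI := ha' hax
    have hbI := hb' (by rintro rfl; exact h6.false)
    have hcI := hc' (by rintro rfl; exact h3.false)
    obtain ⟨m, hm, hmin⟩ := I.exists_min_image v ⟨d, hx⟩
    obtain ⟨e, he, h7, h8⟩ := h a haS b hbS c hcS m (hI.sub hm) h1 h2
      (((hI.apart_fst c hcS hcI).lt_iff hx hm).1 h3) h4
      (((hI.apart_snd a haS haI).lt_iff hx hm).1 h5)
      (((hI.apart_snd b hbS hbI).gt_iff hx hm).1 h6)
    exact ⟨e, hmem' e he fun heI => (hmin e heI).not_gt h8, h7, h8.trans_le (hmin d hx)⟩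
  obtain ⟨e, he, h7, h8⟩ := h a haS b hbS c hcS d hdS h1 h2 h3 h4 h5 h6
  by_cases heI : e ∈ I
  · exact ⟨x, Finset.mem_sdiff.2 ⟨hI.sub hx, Finset.notMem_erase x I⟩,
      ((hI.apart_snd a haS (ha' hax)).lt_iff heI hx).1 h7,
      ((hI.apart_snd d hdS (hd' hdx)).gt_iff heI hx).1 h8⟩
  · exact ⟨e, hmem' e he heI, h7, h8⟩

theorem Baxter.contract {u : ι → α} {v : ι → β} {S I : Finset ι} (h : Baxter u v S)
    (hI : IsInterval u v S I) {x : ι} (hx : x ∈ I) : Baxter u v (S \ I.erase x) :=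
  ⟨h.1.contract hI hx, h.2.contract hI.dual hx⟩

/-- The pattern `2413` is simple: an occurrence lies inside `I` or meets it in at most one point. In
the second case the map `f`, which collapses `I` to `x`, turns it into an occurrence in the
contraction, and the witness found there serves for the original quadruple. -/
theorem HalfBaxter.of_contract {u : ι → α} {v : ι → β} {S I : Finset ι}
    (hI : IsInterval u v S I) (hB : HalfBaxter u v I) {x : ι} (hx : x ∈ I)
    (h : HalfBaxter u v (S \ I.erase x)) : HalfBaxter u v S := by
  intro a ha b hb c hc d hd h1 h2 h3 h4 h5 h6
  -- an element between two elements of the interval belongs to the interval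
  have hu : ∀ p ∈ I, ∀ r ∈ I, ∀ q ∈ S, u p < u q → u q < u r → q ∈ I := by
    intro p hp r hr q hq g1 g2
    by_contra hqI
    exact g1.not_gt (((hI.apart_fst q hq hqI).lt_iff hr hp).1 g2)
  have hv : ∀ p ∈ I, ∀ r ∈ I, ∀ q ∈ S, v p < v q → v q < v r → q ∈ I := by
    intro p hp r hr q hq g1 g2
    by_contra hqI
    exact g1.not_gt (((hI.apart_snd q hq hqI).lt_iff hr hp).1 g2)
  by_cases hall : a ∈ I ∧ b ∈ I ∧ c ∈ I ∧ d ∈ I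
  · obtain ⟨e, he, h7⟩ := hB a hall.1 b hall.2.1 c hall.2.2.1 d hall.2.2.2 h1 h2 h3 h4 h5 h6
    exact ⟨e, hI.sub he, h7⟩
  have had : ¬ (a ∈ I ∧ d ∈ I) := fun g =>
    hall ⟨g.1, hu a g.1 d g.2 b hb h1 (h2.trans h3), hu a g.1 d g.2 c hc (h1.trans h2) h3, g.2⟩
  have hab : ¬ (a ∈ I ∧ b ∈ I) := fun g => had ⟨g.1, hv a g.1 b g.2 d hd h5 h6⟩
  have hac : ¬ (a ∈ I ∧ c ∈ I) := fun g => hab ⟨g.1, hu a g.1 c g.2 b hb h1 h2⟩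
  have hbc : ¬ (b ∈ I ∧ c ∈ I) := fun g =>
    hab ⟨hv c g.2 b g.1 a ha h4 (h5.trans h6), g.1⟩
  have hbd : ¬ (b ∈ I ∧ d ∈ I) := fun g => hbc ⟨g.1, hu b g.1 d g.2 c hc h2 h3⟩
  have hcd : ¬ (c ∈ I ∧ d ∈ I) := fun g => had ⟨hv c g.1 d g.2 a ha h4 h5, g.2⟩
  let f : ι → ι := fun p => if p ∈ I then x else p
  have hfT : ∀ p ∈ S, f p ∈ S \ I.erase x := by
    intro p hp
    by_cases hpI : p ∈ I
    · simp [f, hpI, hI.sub hx]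
    · simp [f, hpI, hp]
  have fu : ∀ p ∈ S, ∀ q ∈ S, ¬ (p ∈ I ∧ q ∈ I) → u p < u q → u (f p) < u (f q) := by
    intro p hp q hq hpq hlt
    by_cases hpI : p ∈ I
    · have hqI : q ∉ I := fun g => hpq ⟨hpI, g⟩
      simpa [f, hpI, hqI] using ((hI.apart_fst q hq hqI).gt_iff hpI hx).1 hlt
    · by_cases hqI : q ∈ I
      · simpa [f, hpI, hqI] using ((hI.apart_fst p hp hpI).lt_iff hqI hx).1 hlt
      · simpa [f, hpI, hqI] using hlt
  have fv : ∀ p ∈ S, ∀ q ∈ S, ¬ (p ∈ I ∧ q ∈ I) → v p < v q → v (f p) < v (f q) := by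
    intro p hp q hq hpq hlt
    by_cases hpI : p ∈ I
    · have hqI : q ∉ I := fun g => hpq ⟨hpI, g⟩
      simpa [f, hpI, hqI] using ((hI.apart_snd q hq hqI).gt_iff hpI hx).1 hlt
    · by_cases hqI : q ∈ I
      · simpa [f, hpI, hqI] using ((hI.apart_snd p hp hpI).lt_iff hqI hx).1 hlt
      · simpa [f, hpI, hqI] using hlt
  obtain ⟨e, he, h7, h8⟩ := h _ (hfT a ha) _ (hfT b hb) _ (hfT c hc) _ (hfT d hd)
    (fu a ha b hb hab h1) (fu b hb c hc hbc h2) (fu c hc d hd hcd h3)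
    (fv c hc a ha (fun g => hac g.symm) h4) (fv a ha d hd had h5)
    (fv d hd b hb (fun g => hbd g.symm) h6)
  have heS := (Finset.mem_sdiff.1 he).1
  have heI : e ≠ x → e ∉ I := fun g1 g2 =>
    (Finset.mem_sdiff.1 he).2 (Finset.mem_erase.2 ⟨g1, g2⟩)
  refine ⟨e, heS, ?_, ?_⟩
  · by_cases haI : a ∈ I
    · simp only [f, haI, if_true] at h7
      exact ((hI.apart_snd e heS (heI (by rintro rfl; exact h7.false))).gt_iff hx haI).1 h7
    · simpa [f, haI] using h7
  · by_cases hdI : d ∈ I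
    · simp only [f, hdI, if_true] at h8
      exact ((hI.apart_snd e heS (heI (by rintro rfl; exact h8.false))).lt_iff hx hdI).1 h8
    · simpa [f, hdI] using h8

/-! ### Decomposable patterns -/

namespace Dec

variable {k : ℕ} {u : ι → α} {v : ι → β} {S I : Finset ι}

theorem baxter (h : Dec k u v S) : Baxter u v S := by
  induction h with
  | single p =>
    constructor <;> intro a ha b hb <;> rw [Finset.mem_singleton] at ha hb <;> subst ha <;>
      subst hb <;> exact fun _ _ _ _ h => absurd h (lt_irrefl _)
  | step S I x hI hx _ hB _ ih =>
    exact ⟨.of_contract hI hB.1 hx ih.1, .of_contract hI.dual hB.2 hx ih.2⟩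

theorem image (h : Dec k u v S) {u' : κ → α'} {v' : κ → β'} {g : ι → κ} (hg : Set.InjOn g S)
    (hu : ∀ x ∈ S, ∀ y ∈ S, u x < u y ↔ u' (g x) < u' (g y))
    (hv : ∀ x ∈ S, ∀ y ∈ S, v x < v y ↔ v' (g x) < v' (g y)) : Dec k u' v' (S.image g) := by
  induction h with
  | single p => rw [Finset.image_singleton]; exact .single _
  | step S I x hI hx hk hB _ ih =>
    have hsub : S \ I.erase x ⊆ S := Finset.sdiff_subset
    refine .step _ (I.image g) (g x) (hI.image hu hv) (Finset.mem_image_of_mem g hx)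
      (Finset.card_image_le.trans hk)
      (hB.image (fun p hp q hq => hu p (hI.sub hp) q (hI.sub hq))
        (fun p hp q hq => hv p (hI.sub hp) q (hI.sub hq))) ?_
    have : S.image g \ (I.image g).erase (g x) = (S \ I.erase x).image g := by
      ext y
      simp only [Finset.mem_sdiff, Finset.mem_image, Finset.mem_erase, not_and, not_exists]
      constructor
      · rintro ⟨⟨p, hp, rfl⟩, h2⟩
        refine ⟨p, ⟨hp, fun hpx hpI => h2 (fun h3 => hpx ?_) p hpI rfl⟩, rfl⟩
        exact hg hp (hI.sub hx) h3
      · rintro ⟨p, ⟨hp, h2⟩, rfl⟩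
        refine ⟨⟨p, hp, rfl⟩, fun h3 q hq h4 => ?_⟩
        have : q = p := hg (hI.sub hq) hp h4
        subst this
        exact h2 (fun h5 => h3 (by rw [h5])) hq
    rw [this]
    exact ih (hg.mono (by exact_mod_cast hsub)) (fun p hp q hq => hu p (hsub hp) q (hsub hq))
      (fun p hp q hq => hv p (hsub hp) q (hsub hq))

/-- The representative of a contracted interval does not matter. -/
theorem change (hI : IsInterval u v S I) {x y : ι} (hx : x ∈ I) (hy : y ∈ I)
    (h : Dec k u v (S \ I.erase x)) : Dec k u v (S \ I.erase y) := by
  have hmem : ∀ z p, p ∈ S \ I.erase z ↔ p ∈ S ∧ (p ≠ z → p ∉ I) := by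
    intro z p
    simp [Finset.mem_sdiff, Finset.mem_erase]
  -- Exchanging the representative is an isomorphism of the two contractions, since points outside
  -- `I` do not distinguish `x` from `y`.
  let g : ι → ι := fun p => if p = x then y else p
  have hgx : g x = y := by simp [g]
  have hgp : ∀ p, p ≠ x → g p = p := fun p hp => by simp [g, hp]
  have himg : (S \ I.erase x).image g = S \ I.erase y := by
    ext p
    simp only [Finset.mem_image, hmem]
    constructor
    · rintro ⟨q, ⟨hq, hqI⟩, rfl⟩
      by_cases hqx : q = x
      · subst hqx; rw [hgx]; exact ⟨hI.sub hy, fun h => absurd rfl h⟩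
      · rw [hgp q hqx]; exact ⟨hq, fun _ => hqI hqx⟩
    · rintro ⟨hp, hpI⟩
      by_cases hpy : p = y
      · subst hpy; exact ⟨x, ⟨hI.sub hx, fun h => absurd rfl h⟩, hgx⟩
      · have := hpI hpy
        exact ⟨p, ⟨hp, fun _ => this⟩, hgp p fun h => this (h ▸ hx)⟩
  have ap : ∀ p ∈ S \ I.erase x, p ≠ x → p ∈ S ∧ p ∉ I := fun p hp hpx =>
    ⟨((hmem x p).1 hp).1, ((hmem x p).1 hp).2 hpx⟩
  rw [← himg]
  refine h.image ?_ ?_ ?_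
  · intro p hp q hq hpq
    by_cases hpx : p = x <;> by_cases hqx : q = x
    · rw [hpx, hqx]
    · subst hpx; rw [hgx, hgp q hqx] at hpq; exact absurd (hpq ▸ hy) (ap q hq hqx).2
    · subst hqx; rw [hgx, hgp p hpx] at hpq; exact absurd (hpq ▸ hy) (ap p hp hpx).2
    · rwa [hgp p hpx, hgp q hqx] at hpq
  · intro p hp q hq
    by_cases hpx : p = x <;> by_cases hqx : q = x
    · subst hpx; subst hqx; simp
    · subst hpx; rw [hgx, hgp q hqx]
      exact (hI.apart_fst q (ap q hq hqx).1 (ap q hq hqx).2).gt_iff hx hy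
    · subst hqx; rw [hgx, hgp p hpx]
      exact (hI.apart_fst p (ap p hp hpx).1 (ap p hp hpx).2).lt_iff hx hy
    · rw [hgp p hpx, hgp q hqx]
  · intro p hp q hq
    by_cases hpx : p = x <;> by_cases hqx : q = x
    · subst hpx; subst hqx; simp
    · subst hpx; rw [hgx, hgp q hqx]
      exact (hI.apart_snd q (ap q hq hqx).1 (ap q hq hqx).2).gt_iff hx hy
    · subst hqx; rw [hgx, hgp p hpx]
      exact (hI.apart_snd p (ap p hp hpx).1 (ap p hp hpx).2).lt_iff hx hy
    · rw [hgp p hpx, hgp q hqx]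

/-- Contracting any interval preserves decomposability. -/
theorem contract (h : Dec k u v S) (hI : IsInterval u v S I) {y : ι} (hy : y ∈ I) :
    Dec k u v (S \ I.erase y) := by
  induction h generalizing I y with
  | single p =>
    have h1 := Finset.mem_singleton.1 (hI.sub hy)
    subst h1
    have : ({y} : Finset ι) \ I.erase y = {y} := by ext z; simp +contextual
    rw [this]; exact .single _
  | step S J x hJ hx hk hB hD ih =>
    -- Let `J` be the interval contracted in the given first step. If it is disjoint from `I`, the
    -- two contractions commute. Otherwise they share a point `z`, and `I ∪ J` is an interval.
    -- Contracting first `J` and then what is left of `I` shows, by induction, that the contraction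
    -- of `I ∪ J` is decomposable. The contraction of `I` to `z` leads to the same set by
    -- contracting the remainder of `J`, which is Baxter as a contraction of `J` and has at most `k`
    -- elements.
    by_cases hd : Disjoint I J
    · have hIT : I ⊆ S \ J.erase x := fun p hp => Finset.mem_sdiff.2
        ⟨hI.sub hp, fun h => Finset.disjoint_left.1 hd hp (Finset.mem_of_mem_erase h)⟩
      have h1 := ih (hI.restrict Finset.sdiff_subset hIT) hy
      rw [sdiff_right_comm] at h1
      refine .step _ J x (hJ.restrict Finset.sdiff_subset fun p hp => Finset.mem_sdiff.2
        ⟨hJ.sub hp, fun h => Finset.disjoint_left.1 hd (Finset.mem_of_mem_erase h) hp⟩) hx hk hB h1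
    · obtain ⟨z, hzI, hzJ⟩ := Finset.not_disjoint_iff.1 hd
      refine change hI hzI hy ?_
      have hU := hI.union hJ hzI hzJ
      have hxU : x ∈ I ∪ J := Finset.mem_union_right _ hx
      have hzU : z ∈ I ∪ J := Finset.mem_union_right _ hzJ
      have h1 : IsInterval u v (S \ J.erase x) ((I ∪ J) \ J.erase x) := by
        refine ⟨Finset.sdiff_subset_sdiff hU.sub subset_rfl, ⟨x, by simp [hx]⟩,
          fun p hp hpI => ?_, fun p hp hpI => ?_⟩
        · refine (hU.apart_fst p (Finset.mem_sdiff.1 hp).1 fun h => hpI ?_).mono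
            Finset.sdiff_subset
          exact Finset.mem_sdiff.2 ⟨h, (Finset.mem_sdiff.1 hp).2⟩
        · refine (hU.apart_snd p (Finset.mem_sdiff.1 hp).1 fun h => hpI ?_).mono
            Finset.sdiff_subset
          exact Finset.mem_sdiff.2 ⟨h, (Finset.mem_sdiff.1 hp).2⟩
      have h2 := ih h1 (y := x) (by simp [hx])
      have h3 : (S \ J.erase x) \ ((I ∪ J) \ J.erase x).erase x = S \ (I ∪ J).erase x := by
        ext p; simp; tauto
      rw [h3] at h2
      have h4 := change hU hxU hzU h2
      have hIJ := hI.inter hJ ⟨z, Finset.mem_inter.2 ⟨hzI, hzJ⟩⟩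
      have hz2 : z ∈ I ∩ J := Finset.mem_inter.2 ⟨hzI, hzJ⟩
      refine .step _ (J \ (I ∩ J).erase z) z ?_ (by simp [hzJ])
        ((Finset.card_le_card Finset.sdiff_subset).trans hk)
        (hB.contract (hIJ.restrict hJ.sub Finset.inter_subset_right) hz2) ?_
      · refine ⟨?_, ⟨z, by simp [hzJ]⟩, fun p hp hpI => ?_, fun p hp hpI => ?_⟩
        · intro p hp
          have := @hJ.sub p
          simp at hp ⊢
          tauto
        · refine (hJ.apart_fst p (Finset.mem_sdiff.1 hp).1 fun h => hpI ?_).mono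
            Finset.sdiff_subset
          simp at hp ⊢
          tauto
        · refine (hJ.apart_snd p (Finset.mem_sdiff.1 hp).1 fun h => hpI ?_).mono
            Finset.sdiff_subset
          simp at hp ⊢
          tauto
      · have h5 : (S \ I.erase z) \ (J \ (I ∩ J).erase z).erase z = S \ (I ∪ J).erase z := by
          ext p; simp; tauto
        rwa [h5]

/-- A step may contract a one-element interval and change nothing, so the first nontrivial step has
to be taken. -/
theorem exists_interval (h : Dec k u v S) (hS : 2 ≤ S.card) :
    ∃ I, IsInterval u v S I ∧ 2 ≤ I.card ∧ I.card ≤ k := by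
  induction h with
  | single p => simp at hS
  | step S I x hI hx hk hB _ ih =>
    by_cases h2 : 2 ≤ I.card
    · exact ⟨I, hI, h2, hk⟩
    · have h1 : I.erase x = ∅ := by
        rw [← Finset.card_eq_zero, Finset.card_erase_of_mem hx]; omega
      rw [h1, Finset.sdiff_empty] at ih
      exact ih hS

/-- A minimal nontrivial interval of a decomposable set has at most `k` elements. -/
theorem card_le_of_minimal (h : Dec k u v S) (hI : IsInterval u v S I) (h2 : 2 ≤ I.card)
    (hmin : ∀ J, IsInterval u v S J → J ⊆ I → 2 ≤ J.card → J = I) : I.card ≤ k := by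
  induction h with
  | single p =>
    have := Finset.card_le_card hI.sub
    simp at this
    omega
  | step S J x hJ hx hk hB hD ih =>
    -- If the first contracted interval `J` is disjoint from `I`, then `I` stays minimal after the
    -- contraction. If `I ∩ J` is nontrivial, it equals `I` by minimality, so `I ⊆ J`. If `J` is
    -- nontrivial and meets `I` in one point, then `I \ J` is an interval, which by minimality has
    -- only one element; thus `I` has two elements, no more than `J`.
    by_cases hd : Disjoint I J
    · have hIT : I ⊆ S \ J.erase x := fun p hp => Finset.mem_sdiff.2
        ⟨hI.sub hp, fun h => Finset.disjoint_left.1 hd hp (Finset.mem_of_mem_erase h)⟩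
      exact ih (hI.restrict Finset.sdiff_subset hIT) fun L hL hLI =>
        hmin L (hJ.of_contract hx hL (Finset.disjoint_of_subset_left hLI hd)) hLI
    · obtain ⟨z, hzI, hzJ⟩ := Finset.not_disjoint_iff.1 hd
      have hz : z ∈ I ∩ J := Finset.mem_inter.2 ⟨hzI, hzJ⟩
      have hIJ := hI.inter hJ ⟨z, hz⟩
      by_cases hc : 2 ≤ (I ∩ J).card
      · rw [← hmin _ hIJ Finset.inter_subset_left hc]
        exact (Finset.card_le_card Finset.inter_subset_right).trans hk
      by_cases hJ1 : J.card ≤ 1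
      · have h1 : J.erase x = ∅ := by
          rw [← Finset.card_eq_zero, Finset.card_erase_of_mem hx]; omega
        rw [h1, Finset.sdiff_empty] at ih
        exact ih hI hmin
      have e1 := Finset.card_sdiff_add_card_inter I J
      have e2 := Finset.card_sdiff_add_card_inter J I
      rw [Finset.inter_comm J I] at e2
      have hne : (I \ J).Nonempty := Finset.card_pos.1 (by omega)
      have hne' : (J \ I).Nonempty := Finset.card_pos.1 (by omega)
      have h3 := hI.sdiff hJ hne hne'
      by_cases h4 : 2 ≤ (I \ J).card
      · have h5 := hmin _ h3 Finset.sdiff_subset h4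
        rw [← h5] at hzI
        exact absurd hzJ (Finset.mem_sdiff.1 hzI).2
      · omega

end Dec

/-! ### Insertion of a minimum -/

/-- `b` is the immediate successor of `p`, and `p` is a right-to-left minimum of `S \ {b}`. -/
def AfterMin (u : ι → α) (v : ι → β) (S : Finset ι) (b p : ι) : Prop :=
  p ∈ S ∧ u p < u b ∧ (∀ e ∈ S, u e < u b → e = p ∨ u e < u p) ∧
    ∀ e ∈ S, e ≠ b → u p < u e → v p < v e

/-- Being the minimum, `b` can only play the `1` of a pattern `2413`, and its neighbour `p` takes
over: either `p` lies below the `2` and is itself a `1`, or its value lies between the `2` and the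
`3`, so that `p` is the required witness. If `p` follows `b` as a left-to-right minimum, only the
first case occurs. -/
theorem HalfBaxter.insert_min {u : ι → α} {v : ι → β} {S : Finset ι} {b : ι}
    (hv : Set.InjOn v S) (hmin : ∀ e ∈ S, e ≠ b → v b < v e)
    (h : HalfBaxter u v (S.erase b))
    (hp : (∃ p, AfterMin u v S b p) ∨ ∃ p, AfterMin (OrderDual.toDual ∘ u) v S b p) :
    HalfBaxter u v S := by
  intro x hx y hy c hc z hz h1 h2 h3 h4 h5 h6
  have hxb : x ≠ b := by
    rintro rfl
    exact (hmin c hc (by rintro rfl; exact h4.false)).not_gt h4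
  have hzb : z ≠ b := by
    rintro rfl
    exact (hmin x hx hxb).not_gt h5
  have hyb : y ≠ b := by
    rintro rfl
    exact (hmin z hz hzb).not_gt h6
  have hxT := Finset.mem_erase.2 ⟨hxb, hx⟩
  have hyT := Finset.mem_erase.2 ⟨hyb, hy⟩
  have hzT := Finset.mem_erase.2 ⟨hzb, hz⟩
  by_cases hcb : c = b
  · subst hcb
    rcases hp with ⟨p, hpS, hp1, hp2, hp3⟩ | ⟨p, hpS, hp1, hp2, hp3⟩
    · have hpT := Finset.mem_erase.2 ⟨(by rintro rfl; exact hp1.false : p ≠ c), hpS⟩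
      have hpz := hp3 z hz hzb (hp1.trans h3)
      have hyp : u y < u p := by
        rcases hp2 y hy h2 with rfl | g
        · exact absurd hpz h6.not_gt
        · exact g
      rcases lt_trichotomy (v p) (v x) with g | g | g
      · obtain ⟨e, he, h7⟩ := h x hxT y hyT p hpT z hzT h1 hyp (hp1.trans h3) g h5 h6
        exact ⟨e, Finset.mem_of_mem_erase he, h7⟩
      · have := hv hpS hx g
        subst this
        exact absurd h1 hyp.not_gt
      · exact ⟨p, hpS, g, hpz⟩
    · have hp1' : u c < u p := hp1
      have hpT := Finset.mem_erase.2 ⟨(by rintro rfl; exact hp1'.false : p ≠ c), hpS⟩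
      have hxp := hp3 x hx hxb (show u x < u p from (h1.trans h2).trans hp1')
      have hzp : u p < u z := by
        rcases hp2 z hz h3 with rfl | g
        · exact absurd hxp h5.not_gt
        · exact g
      obtain ⟨e, he, h7⟩ := h x hxT y hyT p hpT z hzT h1 (h2.trans hp1') hzp hxp h5 h6
      exact ⟨e, Finset.mem_of_mem_erase he, h7⟩
  · obtain ⟨e, he, h7⟩ := h x hxT y hyT c (Finset.mem_erase.2 ⟨hcb, hc⟩) z hzT h1 h2 h3 h4 h5 h6
    exact ⟨e, Finset.mem_of_mem_erase he, h7⟩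

theorem Baxter.insert_min {u : ι → α} {v : ι → β} {S : Finset ι} {b : ι}
    (hv : Set.InjOn v S) (hmin : ∀ e ∈ S, e ≠ b → v b < v e)
    (h : Baxter u v (S.erase b))
    (hp : (∃ p, AfterMin u v S b p) ∨ ∃ p, AfterMin (OrderDual.toDual ∘ u) v S b p) :
    Baxter u v S :=
  ⟨h.1.insert_min hv hmin hp, h.2.insert_min hv hmin hp.symm⟩

theorem HalfBaxter.erase_min {u : ι → α} {v : ι → β} {S : Finset ι} {b : ι}
    (hmin : ∀ e ∈ S, e ≠ b → v b < v e) (h : HalfBaxter u v S) : HalfBaxter u v (S.erase b) := by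
  intro x hx y hy c hc z hz h1 h2 h3 h4 h5 h6
  obtain ⟨hxb, hxS⟩ := Finset.mem_erase.1 hx
  obtain ⟨e, he, h7, h8⟩ := h x hxS y (Finset.mem_of_mem_erase hy) c (Finset.mem_of_mem_erase hc) z
    (Finset.mem_of_mem_erase hz) h1 h2 h3 h4 h5 h6
  refine ⟨e, Finset.mem_erase.2 ⟨?_, he⟩, h7, h8⟩
  rintro rfl
  exact (hmin x hxS hxb).not_gt h7

theorem Baxter.erase_min {u : ι → α} {v : ι → β} {S : Finset ι} {b : ι}
    (hmin : ∀ e ∈ S, e ≠ b → v b < v e) (h : Baxter u v S) : Baxter u v (S.erase b) :=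
  ⟨h.1.erase_min hmin, h.2.erase_min hmin⟩

/-- If some `z` to the right of `p` were below `p`, let `x` be the lowest point to the left of `b`
that is not below `z`, and `y` the highest point to the right of `b` that is below `x`. No value
lies between `y` and `x`, so `x`, `b`, `q`, `y` form a forbidden `3142`. -/
theorem HalfBaxter.afterMin {u : ι → α} {v : ι → β} {S : Finset ι} {b p q : ι}
    (hu : Set.InjOn u S) (hv : Set.InjOn v S) (hb : b ∈ S)
    (hmin : ∀ e ∈ S, e ≠ b → v b < v e) (h : HalfBaxter (OrderDual.toDual ∘ u) v S)
    (hp : p ∈ S) (hpb : u p < u b) (hpmax : ∀ e ∈ S, u e < u b → u e ≤ u p)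
    (hqmin : ∀ e ∈ S, u b < u e → u q ≤ u e) (hbq : u b < u q) (hq : q ∈ S) (hpq : v p < v q) :
    AfterMin u v S b p := by
  refine ⟨hp, hpb, fun e he heb => ?_, fun z hz hzb hpz => ?_⟩
  · rcases (hpmax e he heb).lt_or_eq with g | g
    · exact Or.inr g
    · exact Or.inl (hu he hp g)
  by_contra hlt
  have hzu : u b < u z := by
    rcases lt_trichotomy (u z) (u b) with g | g | g
    · exact absurd hpz (hpmax z hz g).not_gt
    · exact absurd (hu hz hb g) hzb
    · exact g
  obtain ⟨x, hx, hxmin⟩ := (S.filter fun w => u w < u b ∧ v z ≤ v w).exists_min_image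
    v ⟨p, by simp [hp, hpb, not_lt.1 hlt]⟩
  obtain ⟨hxS, hxb, hzx⟩ := Finset.mem_filter.1 hx
  have hxp : v x ≤ v p := hxmin p (by simp [hp, hpb, not_lt.1 hlt])
  have hzx' : v z < v x := by
    rcases hzx.lt_or_eq with g | g
    · exact g
    · have := hv hz hxS g
      subst this
      exact absurd hzu hxb.not_gt
  obtain ⟨y, hy, hymax⟩ := (S.filter fun w => u b < u w ∧ v w < v x).exists_max_image
    v ⟨z, by simp [hz, hzu, hzx']⟩
  obtain ⟨hyS, hby, hyx⟩ := Finset.mem_filter.1 hy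
  have hzy : v z ≤ v y := hymax z (by simp [hz, hzu, hzx'])
  have hqy : u q < u y := by
    rcases (hqmin y hyS hby).lt_or_eq with g | g
    · exact g
    · have := hu hq hyS g
      subst this
      exact absurd (hyx.trans_le hxp) hpq.not_gt
  have hne : ∀ e, v y < v e → e ≠ b := by
    rintro e he rfl
    exact (hmin y hyS (by rintro rfl; exact hby.false)).not_gt he
  obtain ⟨e, he, h1, h2⟩ := h y hyS q hq b hb x hxS hqy hbq hxb
    (hmin y hyS (by rintro rfl; exact hby.false)) hyx (hxp.trans_lt hpq)
  rcases lt_trichotomy (u e) (u b) with g | g | g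
  · exact (hxmin e (by simp [he, g, hzy.trans h1.le])).not_gt h2
  · exact hne e h1 (hu he hb g)
  · exact (hymax e (by simp [he, g, h2])).not_gt h1

/-- The minimum of a Baxter set immediately follows a right-to-left minimum or immediately precedes
a left-to-right minimum of the other elements. -/
theorem Baxter.afterMin {u : ι → α} {v : ι → β} {S : Finset ι} {b : ι}
    (hu : Set.InjOn u S) (hv : Set.InjOn v S) (hb : b ∈ S) (hS : 2 ≤ S.card)
    (hmin : ∀ e ∈ S, e ≠ b → v b < v e) (h : Baxter u v S) :
    (∃ p, AfterMin u v S b p) ∨ ∃ p, AfterMin (OrderDual.toDual ∘ u) v S b p := by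
  by_cases hl : (S.filter fun e => u e < u b).Nonempty
  · obtain ⟨p, hp, hpmax⟩ := Finset.exists_max_image _ u hl
    obtain ⟨hpS, hpb⟩ := Finset.mem_filter.1 hp
    have hpmax : ∀ e ∈ S, u e < u b → u e ≤ u p := fun e he h => hpmax e (by simp [he, h])
    by_cases hr : (S.filter fun e => u b < u e).Nonempty
    · obtain ⟨q, hq, hqmin⟩ := Finset.exists_min_image _ u hr
      obtain ⟨hqS, hbq⟩ := Finset.mem_filter.1 hq
      have hqmin : ∀ e ∈ S, u b < u e → u q ≤ u e := fun e he h => hqmin e (by simp [he, h])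
      -- The lower of the two neighbours of `b` is the required one; the two cases are mirror
      -- images.
      rcases lt_trichotomy (v p) (v q) with g | g | g
      · exact Or.inl ⟨p, h.2.afterMin hu hv hb hmin hpS hpb hpmax hqmin hbq hqS g⟩
      · have := hv hpS hqS g
        subst this
        exact absurd hpb hbq.not_gt
      · exact Or.inr ⟨q, HalfBaxter.afterMin (u := OrderDual.toDual ∘ u) hu hv hb hmin h.1 hqS hbq
          hqmin hpmax hpb hpS g⟩
    · have hr' : ∀ e ∈ S, ¬ u b < u e := fun e he h => hr ⟨e, by simp [he, h]⟩
      refine Or.inl ⟨p, hpS, hpb, fun e he heb => ?_, fun e he heb hpe => ?_⟩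
      · rcases (hpmax e he heb).lt_or_eq with g | g
        · exact Or.inr g
        · exact Or.inl (hu he hpS g)
      · rcases (not_lt.1 (hr' e he)).lt_or_eq with g | g
        · exact absurd hpe (hpmax e he g).not_gt
        · exact absurd (hu he hb g) heb
  · have hl' : ∀ e ∈ S, ¬ u e < u b := fun e he h => hl ⟨e, by simp [he, h]⟩
    have hbe : ∀ e ∈ S, e ≠ b → u b < u e := by
      intro e he heb
      rcases (not_lt.1 (hl' e he)).lt_or_eq with g | g
      · exact g
      · exact absurd (hu hb he g).symm heb
    obtain ⟨q, hq, hqmin⟩ := (S.erase b).exists_min_image u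
      (Finset.card_pos.1 (by rw [Finset.card_erase_of_mem hb]; omega))
    obtain ⟨hqb, hqS⟩ := Finset.mem_erase.1 hq
    refine Or.inr ⟨q, hqS, hbe q hqS hqb, fun e he heb => ?_, fun e he heb hpe => ?_⟩
    · have heb' : e ≠ b := by rintro rfl; exact lt_irrefl _ heb
      rcases (hqmin e (Finset.mem_erase.2 ⟨heb', he⟩)).lt_or_eq with g | g
      · exact Or.inr g
      · exact Or.inl (hu hqS he g).symm
    · exact absurd (show u e < u q from hpe) (hqmin e (Finset.mem_erase.2 ⟨heb, he⟩)).not_gt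

end Pattern
end HFO

namespace HFO

/-! ## Indexed mosaics -/

namespace Rect

/-- Reflection in the diagonal through the top left corner: `(x, y) ↦ (-y, -x)`. -/
def diag (P : Rect) : Rect := ⟨-P.top, -P.bottom, -P.right, -P.left⟩

@[simp] theorem diag_diag (P : Rect) : P.diag.diag = P := by simp [diag]
@[simp] theorem flip_flip (P : Rect) : P.flip.flip = P := by simp [flip]
@[simp] theorem diag_left (P : Rect) : P.diag.left = -P.top := rfl
@[simp] theorem diag_right (P : Rect) : P.diag.right = -P.bottom := rfl
@[simp] theorem diag_bottom (P : Rect) : P.diag.bottom = -P.right := rfl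
@[simp] theorem diag_top (P : Rect) : P.diag.top = -P.left := rfl
@[simp] theorem flip_left (P : Rect) : P.flip.left = P.left := rfl
@[simp] theorem flip_right (P : Rect) : P.flip.right = P.right := rfl
@[simp] theorem flip_bottom (P : Rect) : P.flip.bottom = -P.top := rfl
@[simp] theorem flip_top (P : Rect) : P.flip.top = -P.bottom := rfl

end Rect

section Mosaic

set_option linter.unusedSectionVars false

variable {ι κ : Type*}

/-- The rooms `R i`, `i ∈ s`, form a mosaic floorplan with bounding rectangle `B`. -/
structure Mos (B : Rect) (s : Finset ι) (R : ι → Rect) : Prop where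
  box_x : B.left < B.right
  box_y : B.bottom < B.top
  proper_x : ∀ i ∈ s, (R i).left < (R i).right
  proper_y : ∀ i ∈ s, (R i).bottom < (R i).top
  left_le : ∀ i ∈ s, B.left ≤ (R i).left
  right_le : ∀ i ∈ s, (R i).right ≤ B.right
  bottom_le : ∀ i ∈ s, B.bottom ≤ (R i).bottom
  top_le : ∀ i ∈ s, (R i).top ≤ B.top
  disj : ∀ i ∈ s, ∀ j ∈ s, i ≠ j → (R i).right ≤ (R j).left ∨ (R j).right ≤ (R i).left ∨
    (R i).top ≤ (R j).bottom ∨ (R j).top ≤ (R i).bottom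
  cover : ∀ x y, B.left < x → x < B.right → B.bottom < y → y < B.top →
    ∃ i ∈ s, (R i).left ≤ x ∧ x ≤ (R i).right ∧ (R i).bottom ≤ y ∧ y ≤ (R i).top
  no_cross : ∀ x y, ∀ i ∈ s, ∀ j ∈ s, ∀ k ∈ s, ∀ l ∈ s,
    (R i).right = x ∧ (R i).bottom = y → (R j).left = x ∧ (R j).bottom = y →
    (R k).right = x ∧ (R k).top = y → (R l).left = x ∧ (R l).top = y → False

theorem eventually_gap (s : Finset ι) (f : ι → ℝ) (x : ℝ) :
    ∀ᶠ ε in nhdsWithin (0 : ℝ) (Set.Ioi 0), ∀ i ∈ s, f i < x - ε ∨ f i = x ∨ x + ε < f i := by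
  rw [Filter.eventually_all_finset]
  intro i _
  rcases lt_trichotomy (f i) x with h | h | h
  · filter_upwards [Ioo_mem_nhdsGT (sub_pos.2 h)] with ε hε
    left; linarith [hε.2]
  · simp [h]
  · filter_upwards [Ioo_mem_nhdsGT (sub_pos.2 h)] with ε hε
    right; right; linarith [hε.2]

/-! ### Reflections and local structure of mosaics -/

namespace Mos

variable {B : Rect} {s : Finset ι} {R : ι → Rect}

theorem flip (h : Mos B s R) : Mos B.flip s (fun i => (R i).flip) where
  box_x := h.box_x
  box_y := neg_lt_neg h.box_y
  proper_x := h.proper_x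
  proper_y i hi := neg_lt_neg (h.proper_y i hi)
  left_le := h.left_le
  right_le := h.right_le
  bottom_le i hi := neg_le_neg (h.top_le i hi)
  top_le i hi := neg_le_neg (h.bottom_le i hi)
  disj i hi j hj hij := by
    simp only [Rect.flip_left, Rect.flip_right, Rect.flip_bottom, Rect.flip_top, neg_le_neg_iff]
    have := h.disj i hi j hj hij
    tauto
  cover x y h1 h2 h3 h4 := by
    simp only [Rect.flip_left, Rect.flip_right, Rect.flip_bottom, Rect.flip_top] at *
    obtain ⟨i, hi, h5, h6, h7, h8⟩ := h.cover x (-y) h1 h2 (by linarith) (by linarith)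
    exact ⟨i, hi, h5, h6, by linarith, by linarith⟩
  no_cross x y i hi j hj k hk l hl := by
    simp only [Rect.flip_left, Rect.flip_right, Rect.flip_bottom, Rect.flip_top]
    intro h1 h2 h3 h4
    exact h.no_cross x (-y) k hk l hl i hi j hj ⟨h3.1, by linarith⟩ ⟨h4.1, by linarith⟩
      ⟨h1.1, by linarith⟩ ⟨h2.1, by linarith⟩

theorem diag (h : Mos B s R) : Mos B.diag s (fun i => (R i).diag) where
  box_x := neg_lt_neg h.box_y
  box_y := neg_lt_neg h.box_x
  proper_x i hi := neg_lt_neg (h.proper_y i hi)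
  proper_y i hi := neg_lt_neg (h.proper_x i hi)
  left_le i hi := neg_le_neg (h.top_le i hi)
  right_le i hi := neg_le_neg (h.bottom_le i hi)
  bottom_le i hi := neg_le_neg (h.right_le i hi)
  top_le i hi := neg_le_neg (h.left_le i hi)
  disj i hi j hj hij := by
    simp only [Rect.diag_left, Rect.diag_right, Rect.diag_bottom, Rect.diag_top, neg_le_neg_iff]
    have := h.disj i hi j hj hij
    tauto
  cover x y h1 h2 h3 h4 := by
    simp only [Rect.diag_left, Rect.diag_right, Rect.diag_bottom, Rect.diag_top] at *
    obtain ⟨i, hi, h5, h6, h7, h8⟩ :=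
      h.cover (-y) (-x) (by linarith) (by linarith) (by linarith) (by linarith)
    exact ⟨i, hi, by linarith, by linarith, by linarith, by linarith⟩
  no_cross x y i hi j hj k hk l hl := by
    simp only [Rect.diag_left, Rect.diag_right, Rect.diag_bottom, Rect.diag_top]
    intro h1 h2 h3 h4
    exact h.no_cross (-y) (-x) i hi k hk j hj l hl ⟨by linarith, by linarith⟩
      ⟨by linarith, by linarith⟩ ⟨by linarith, by linarith⟩ ⟨by linarith, by linarith⟩

/-- Allows a point to be examined from a small distance: within `ε` of `x` and `y` there are no edge
coordinates of rooms other than `x` and `y` themselves. -/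
theorem exists_gap (B : Rect) (s : Finset ι) (R : ι → Rect) (x y : ℝ) : ∃ ε : ℝ, 0 < ε ∧
    (∀ i ∈ s, ((R i).left < x - ε ∨ (R i).left = x ∨ x + ε < (R i).left) ∧
      ((R i).right < x - ε ∨ (R i).right = x ∨ x + ε < (R i).right) ∧
      ((R i).bottom < y - ε ∨ (R i).bottom = y ∨ y + ε < (R i).bottom) ∧
      ((R i).top < y - ε ∨ (R i).top = y ∨ y + ε < (R i).top)) ∧
    (B.left < x → B.left < x - ε) ∧ (x < B.right → x + ε < B.right) ∧
    (B.bottom < y → B.bottom < y - ε) ∧ (y < B.top → y + ε < B.top) := by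
  have e1 := eventually_gap s (fun i => (R i).left) x
  have e2 := eventually_gap s (fun i => (R i).right) x
  have e3 := eventually_gap s (fun i => (R i).bottom) y
  have e4 := eventually_gap s (fun i => (R i).top) y
  have e5 := eventually_gap (Finset.univ : Finset (Fin 2)) ![B.left, B.right] x
  have e6 := eventually_gap (Finset.univ : Finset (Fin 2)) ![B.bottom, B.top] y
  obtain ⟨ε, hε, h1, h2, h3, h4, h5, h6⟩ :=
    ((self_mem_nhdsWithin : Set.Ioi (0 : ℝ) ∈ nhdsWithin (0 : ℝ) (Set.Ioi 0)) |>
      fun e0 => ((Filter.eventually_of_mem e0 fun _ h => h).and (e1.and (e2.and (e3.and (e4.and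
        (e5.and e6)))))).exists)
  have hε : 0 < ε := hε
  simp only [Fin.forall_fin_two, Finset.mem_univ, forall_const, Matrix.cons_val_zero,
    Matrix.cons_val_one] at h5 h6
  refine ⟨ε, hε, fun i hi => ⟨h1 i hi, h2 i hi, h3 i hi, h4 i hi⟩, fun g => ?_, fun g => ?_,
    fun g => ?_, fun g => ?_⟩
  · rcases h5.1 with g' | g' | g' <;> linarith
  · rcases h5.2 with g' | g' | g' <;> linarith
  · rcases h6.1 with g' | g' | g' <;> linarith
  · rcases h6.2 with g' | g' | g' <;> linarith

/-- A room that contains `(x + ε, y + ε)` reaches back to `(x, y)`, because none of its edges lies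
within the gap. The other three directions follow by reflection. -/
theorem north_east (h : Mos B s R) {x y : ℝ} (h1 : B.left ≤ x) (h2 : x < B.right)
    (h3 : B.bottom ≤ y) (h4 : y < B.top) :
    ∃ i ∈ s, (R i).left ≤ x ∧ x < (R i).right ∧ (R i).bottom ≤ y ∧ y < (R i).top := by
  obtain ⟨ε, hε, g, b1, b2, b3, b4⟩ := exists_gap B s R x y
  obtain ⟨i, hi, h5, h6, h7, h8⟩ := h.cover (x + ε) (y + ε) (by linarith) (b2 h2) (by linarith)
    (b4 h4)
  obtain ⟨g1, g2, g3, g4⟩ := g i hi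
  refine ⟨i, hi, ?_, by linarith, ?_, by linarith⟩
  · rcases g1 with g1 | g1 | g1 <;> linarith
  · rcases g3 with g1 | g1 | g1 <;> linarith

theorem south_east (h : Mos B s R) {x y : ℝ} (h1 : B.left ≤ x) (h2 : x < B.right)
    (h3 : B.bottom < y) (h4 : y ≤ B.top) :
    ∃ i ∈ s, (R i).left ≤ x ∧ x < (R i).right ∧ (R i).bottom < y ∧ y ≤ (R i).top := by
  obtain ⟨i, hi, h5, h6, h7, h8⟩ := h.flip.north_east (x := x) (y := -y) h1 h2
    (neg_le_neg h4) (neg_lt_neg h3)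
  exact ⟨i, hi, h5, h6, neg_lt_neg_iff.1 h8, neg_le_neg_iff.1 h7⟩

theorem south_west (h : Mos B s R) {x y : ℝ} (h1 : B.left < x) (h2 : x ≤ B.right)
    (h3 : B.bottom < y) (h4 : y ≤ B.top) :
    ∃ i ∈ s, (R i).left < x ∧ x ≤ (R i).right ∧ (R i).bottom < y ∧ y ≤ (R i).top := by
  obtain ⟨i, hi, h5, h6, h7, h8⟩ := h.diag.north_east (x := -y) (y := -x) (neg_le_neg h4)
    (neg_lt_neg h3) (neg_le_neg h2) (neg_lt_neg h1)
  exact ⟨i, hi, neg_lt_neg_iff.1 h8, neg_le_neg_iff.1 h7, neg_lt_neg_iff.1 h6,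
    neg_le_neg_iff.1 h5⟩

theorem north_west (h : Mos B s R) {x y : ℝ} (h1 : B.left < x) (h2 : x ≤ B.right)
    (h3 : B.bottom ≤ y) (h4 : y < B.top) :
    ∃ i ∈ s, (R i).left < x ∧ x ≤ (R i).right ∧ (R i).bottom ≤ y ∧ y < (R i).top := by
  obtain ⟨i, hi, h5, h6, h7, h8⟩ := h.flip.south_west (x := x) (y := -y) h1 h2
    (neg_lt_neg h4) (neg_le_neg h3)
  exact ⟨i, hi, h5, h6, neg_le_neg_iff.1 h8, neg_lt_neg_iff.1 h7⟩

/-- Rooms that share an interior point coincide. -/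
theorem eq_of_overlap (h : Mos B s R) {i j : ι} (hi : i ∈ s) (hj : j ∈ s)
    (h1 : (R i).left < (R j).right) (h2 : (R j).left < (R i).right)
    (h3 : (R i).bottom < (R j).top) (h4 : (R j).bottom < (R i).top) : i = j := by
  by_contra hij
  rcases h.disj i hi j hj hij with g | g | g | g <;> linarith

theorem nonempty (h : Mos B s R) : s.Nonempty := by
  obtain ⟨i, hi, _⟩ := h.north_east le_rfl h.box_x le_rfl h.box_y
  exact ⟨i, hi⟩

theorem congr (h : Mos B s R) {R' : ι → Rect} (hR : ∀ i ∈ s, R' i = R i) : Mos B s R' where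
  box_x := h.box_x
  box_y := h.box_y
  proper_x i hi := by rw [hR i hi]; exact h.proper_x i hi
  proper_y i hi := by rw [hR i hi]; exact h.proper_y i hi
  left_le i hi := by rw [hR i hi]; exact h.left_le i hi
  right_le i hi := by rw [hR i hi]; exact h.right_le i hi
  bottom_le i hi := by rw [hR i hi]; exact h.bottom_le i hi
  top_le i hi := by rw [hR i hi]; exact h.top_le i hi
  disj i hi j hj := by rw [hR i hi, hR j hj]; exact h.disj i hi j hj
  cover x y h1 h2 h3 h4 := by
    obtain ⟨i, hi, h5⟩ := h.cover x y h1 h2 h3 h4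
    exact ⟨i, hi, by rwa [hR i hi]⟩
  no_cross x y i hi j hj k hk l hl := by
    rw [hR i hi, hR j hj, hR k hk, hR l hl]; exact h.no_cross x y i hi j hj k hk l hl

end Mos

/-! ### Deletion of the top left room -/

/-- The wall on the right of `b` continues below `b`. -/
def Tee (s : Finset ι) (R : ι → Rect) (b : ι) : Prop :=
  ∃ r ∈ s, (R r).top = (R b).bottom ∧ (R r).right = (R b).right

/-- The wall below `b` continues on the right of `b`. -/
def Perp (s : Finset ι) (R : ι → Rect) (b : ι) : Prop :=
  ∃ r ∈ s, (R r).left = (R b).right ∧ (R r).bottom = (R b).bottom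

open Classical in
/-- The rooms below `b` grow upwards. -/
noncomputable def growUp (B : Rect) (R : ι → Rect) (b : ι) : ι → Rect := fun r =>
  if (R r).top = (R b).bottom ∧ (R r).right ≤ (R b).right then { R r with top := B.top } else R r

open Classical in
/-- The rooms on the right of `b` grow leftwards. -/
noncomputable def growLeft (B : Rect) (R : ι → Rect) (b : ι) : ι → Rect := fun r =>
  if (R r).left = (R b).right ∧ (R b).bottom ≤ (R r).bottom then { R r with left := B.left }
  else R r

open Classical in
/-- The rooms after deletion of the top left room `b`. -/
noncomputable def delTL (B : Rect) (s : Finset ι) (R : ι → Rect) (b : ι) : ι → Rect :=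
  if Tee s R b then growUp B R b else growLeft B R b

/-- `b` is the top left room. -/
structure IsTL (B : Rect) (s : Finset ι) (R : ι → Rect) (b : ι) : Prop where
  mem : b ∈ s
  left : (R b).left = B.left
  top : (R b).top = B.top

theorem IsTL.diag {B : Rect} {s : Finset ι} {R : ι → Rect} {b : ι} (h : IsTL B s R b) :
    IsTL B.diag s (fun i => (R i).diag) b :=
  ⟨h.mem, congrArg Neg.neg h.top, congrArg Neg.neg h.left⟩

/-- The reflection in the diagonal through the top left corner exchanges the two kinds of deletion,
so statements about `⊥` follow from those about `⊣`. -/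
theorem growUp_diag (B : Rect) (R : ι → Rect) (b : ι) :
    growUp B.diag (fun i => (R i).diag) b = fun i => (growLeft B R b i).diag := by
  funext i
  simp only [growUp, growLeft, Rect.diag_left, Rect.diag_right, Rect.diag_bottom, Rect.diag_top,
    neg_inj, neg_le_neg_iff]
  split_ifs <;> rfl

theorem growLeft_diag (B : Rect) (R : ι → Rect) (b : ι) :
    growLeft B.diag (fun i => (R i).diag) b = fun i => (growUp B R b i).diag := by
  funext i
  simp only [growUp, growLeft, Rect.diag_left, Rect.diag_right, Rect.diag_bottom, Rect.diag_top,
    neg_inj, neg_le_neg_iff]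
  split_ifs <;> rfl

theorem tee_diag {s : Finset ι} {R : ι → Rect} {b : ι} :
    Tee s (fun i => (R i).diag) b ↔ Perp s R b := by
  simp [Tee, Perp]

@[simp] theorem growUp_left (B : Rect) (R : ι → Rect) (b i : ι) :
    (growUp B R b i).left = (R i).left := by unfold growUp; split_ifs <;> rfl
@[simp] theorem growUp_right (B : Rect) (R : ι → Rect) (b i : ι) :
    (growUp B R b i).right = (R i).right := by unfold growUp; split_ifs <;> rfl
@[simp] theorem growUp_bottom (B : Rect) (R : ι → Rect) (b i : ι) :
    (growUp B R b i).bottom = (R i).bottom := by unfold growUp; split_ifs <;> rfl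
@[simp] theorem growLeft_top (B : Rect) (R : ι → Rect) (b i : ι) :
    (growLeft B R b i).top = (R i).top := by unfold growLeft; split_ifs <;> rfl
@[simp] theorem growLeft_right (B : Rect) (R : ι → Rect) (b i : ι) :
    (growLeft B R b i).right = (R i).right := by unfold growLeft; split_ifs <;> rfl
@[simp] theorem growLeft_bottom (B : Rect) (R : ι → Rect) (b i : ι) :
    (growLeft B R b i).bottom = (R i).bottom := by unfold growLeft; split_ifs <;> rfl

open Classical in
theorem growUp_top (B : Rect) (R : ι → Rect) (b i : ι) : (growUp B R b i).top =
    if (R i).top = (R b).bottom ∧ (R i).right ≤ (R b).right then B.top else (R i).top := by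
  unfold growUp; split_ifs <;> rfl

open Classical in
theorem growLeft_left (B : Rect) (R : ι → Rect) (b i : ι) : (growLeft B R b i).left =
    if (R i).left = (R b).right ∧ (R b).bottom ≤ (R i).bottom then B.left else (R i).left := by
  unfold growLeft; split_ifs <;> rfl

namespace Mos

variable {B : Rect} {s : Finset ι} {R : ι → Rect} {b : ι}

theorem exists_isTL (h : Mos B s R) : ∃ b, IsTL B s R b := by
  obtain ⟨i, hi, h1, h2, h3, h4⟩ := h.south_east le_rfl h.box_x h.box_y le_rfl
  exact ⟨i, hi, h1.antisymm (h.left_le i hi), (h.top_le i hi).antisymm h4⟩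

theorem isTL_unique (h : Mos B s R) {c : ι} (hb : IsTL B s R b) (hc : IsTL B s R c) : b = c := by
  have := h.proper_x b hb.mem
  have := h.proper_x c hc.mem
  have := h.proper_y b hb.mem
  have := h.proper_y c hc.mem
  apply h.eq_of_overlap hb.mem hc.mem <;> linarith [hb.left, hc.left, hb.top, hc.top]

/-- A wall that continues both below and on the right would give a cross junction. -/
theorem not_tee_perp (h : Mos B s R) (hb : b ∈ s) (h1 : Tee s R b) (h2 : Perp s R b) : False := by
  obtain ⟨p, hp, p1, p2⟩ := h1
  obtain ⟨q, hq, q1, q2⟩ := h2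
  have := h.proper_y p hp
  have := h.bottom_le p hp
  have := h.proper_x q hq
  have := h.right_le q hq
  have := h.left_le b hb
  have := h.top_le b hb
  have := h.proper_x b hb
  have := h.proper_y b hb
  have := h.proper_x p hp
  have := h.proper_y q hq
  obtain ⟨i, hi, h3, h4, h5, h6⟩ := h.south_east (x := (R b).right) (y := (R b).bottom)
    (by linarith) (by linarith) (by linarith) (by linarith)
  have hip : (R b).right ≤ (R i).left := by
    by_contra g
    have := h.eq_of_overlap hi hp (by linarith) (by linarith) (by linarith) (by linarith)
    subst this
    linarith
  have hiq : (R i).top ≤ (R b).bottom := by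
    by_contra g
    have := h.eq_of_overlap hi hq (by linarith) (by linarith) (by linarith) (by linarith)
    subst this
    linarith
  exact h.no_cross _ _ b hb q hq p hp i hi ⟨rfl, rfl⟩ ⟨q1, q2⟩ ⟨p2, p1⟩ ⟨by linarith, by linarith⟩

/-- If the room south-west of the bottom right corner of `b` ends at this corner, the corner is a
`⊣`. If it extends further, the room north-east of the corner has to stand on its top edge, which
makes a `⊥`. If `b` reaches the lower boundary, the north-east room reaches it too, unless `b` fills
the box. -/
theorem tee_or_perp (h : Mos B s R) (hb : IsTL B s R b) (hs : 1 < s.card) :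
    Tee s R b ∨ Perp s R b := by
  have hxb := h.proper_x b hb.mem
  have hyb := h.proper_y b hb.mem
  have hlb := h.left_le b hb.mem
  have htb := h.top_le b hb.mem
  have hrb := h.right_le b hb.mem
  have hbb := h.bottom_le b hb.mem
  -- the rooms around the bottom right corner of `b`
  have hne : (R b).right < B.right → ∃ r ∈ s, (R r).left = (R b).right ∧
      (R r).bottom ≤ (R b).bottom ∧ (R b).right < (R r).right ∧ (R b).bottom < (R r).top := by
    intro g
    obtain ⟨i, hi, h1, h2, h3, h4⟩ := h.north_east (x := (R b).right) (y := (R b).bottom)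
      (by linarith) g hbb (by linarith)
    refine ⟨i, hi, h1.antisymm ?_, h3, h2, h4⟩
    by_contra g'
    have := h.eq_of_overlap hi hb.mem (by linarith) (by linarith) (by linarith) (by linarith)
    subst this
    linarith
  have hsw : B.bottom < (R b).bottom → ∃ r ∈ s, (R r).top = (R b).bottom ∧
      (R b).right ≤ (R r).right ∧ (R r).left < (R b).right ∧ (R r).bottom < (R b).bottom := by
    intro g
    obtain ⟨i, hi, h1, h2, h3, h4⟩ := h.south_west (x := (R b).right) (y := (R b).bottom)
      (by linarith) hrb g (by linarith)
    refine ⟨i, hi, le_antisymm ?_ h4, h2, h1, h3⟩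
    by_contra g'
    have := h.eq_of_overlap hi hb.mem (by linarith) (by linarith) (by linarith) (by linarith)
    subst this
    linarith
  rcases hbb.lt_or_eq with g1 | g1
  · obtain ⟨p, hp, p1, p2, p3, p4⟩ := hsw g1
    rcases p2.lt_or_eq with p2 | p2
    · right
      have := h.right_le p hp
      obtain ⟨q, hq, q1, q2, q3, q4⟩ := hne (by linarith)
      refine ⟨q, hq, q1, q2.antisymm ?_⟩
      by_contra g'
      have := h.eq_of_overlap hp hq (by linarith) (by linarith) (by linarith) (by linarith)
      subst this
      linarith
    · exact Or.inl ⟨p, hp, p1, p2.symm⟩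
  · rcases hrb.lt_or_eq with g2 | g2
    · obtain ⟨q, hq, q1, q2, q3, q4⟩ := hne g2
      exact Or.inr ⟨q, hq, q1, q2.antisymm (by linarith [h.bottom_le q hq])⟩
    · exfalso
      obtain ⟨i, hi, j, hj, hij⟩ := Finset.one_lt_card.1 hs
      have key : ∀ i ∈ s, i = b := by
        intro i hi
        have := h.proper_x i hi
        have := h.proper_y i hi
        have := h.left_le i hi
        have := h.right_le i hi
        have := h.top_le i hi
        have := h.bottom_le i hi
        apply h.eq_of_overlap hi hb.mem <;> linarith [hb.left, hb.top]
      exact hij ((key i hi).trans (key j hj).symm)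

theorem perp_iff_not_tee (h : Mos B s R) (hb : IsTL B s R b) (hs : 1 < s.card) :
    Perp s R b ↔ ¬ Tee s R b :=
  ⟨fun h1 h2 => h.not_tee_perp hb.mem h2 h1, fun h1 => (h.tee_or_perp hb hs).resolve_left h1⟩

/-- The rooms below `b` cover the bottom edge of `b`. -/
theorem exists_below (h : Mos B s R) (hb : b ∈ s) (ht : Tee s R b) {x : ℝ}
    (h1 : (R b).left ≤ x) (h2 : x ≤ (R b).right) :
    ∃ r ∈ s, (R r).top = (R b).bottom ∧ (R r).right ≤ (R b).right ∧ (R r).left ≤ x ∧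
      x ≤ (R r).right := by
  obtain ⟨p, hp, p1, p2⟩ := ht
  have := h.proper_x p hp
  have := h.proper_y p hp
  have := h.proper_x b hb
  have := h.proper_y b hb
  have := h.bottom_le p hp
  have := h.top_le b hb
  have := h.left_le b hb
  have := h.right_le b hb
  rcases h2.lt_or_eq with h2 | rfl
  · obtain ⟨i, hi, i1, i2, i3, i4⟩ := h.south_east (x := x) (y := (R b).bottom) (by linarith)
      (by linarith) (by linarith) (by linarith)
    have hib : (R i).top = (R b).bottom := by
      refine le_antisymm ?_ i4
      by_contra g
      have := h.eq_of_overlap hi hb (by linarith) (by linarith) (by linarith) (by linarith)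
      subst this
      linarith
    refine ⟨i, hi, hib, ?_, i1, i2.le⟩
    by_contra g
    have := h.eq_of_overlap hi hp (by linarith) (by linarith) (by linarith) (by linarith)
    subst this
    linarith
  · exact ⟨p, hp, p1, p2.le, by linarith, p2.ge⟩

variable [DecidableEq ι]

/-- Since the wall on the right of `b` continues downwards, the rooms below `b` tile its bottom edge
exactly and, stretched to the top, cover `b`. Nothing else lies above them, and no cross arises,
because the moved edges are now on the boundary of the box. -/
theorem growUp (h : Mos B s R) (hb : IsTL B s R b) (ht : Tee s R b) :
    Mos B (s.erase b) (growUp B R b) := by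
  have hE : ∀ {i}, i ∈ s.erase b → i ∈ s := fun hi => Finset.mem_of_mem_erase hi
  have hN : ∀ {i}, i ∈ s.erase b → i ≠ b := fun hi => Finset.ne_of_mem_erase hi
  have hyb := h.proper_y b hb.mem
  have htop : ∀ i ∈ s, (R i).top ≤ (HFO.growUp B R b i).top := by
    intro i hi
    rw [growUp_top]
    split_ifs
    · exact h.top_le i hi
    · exact le_rfl
  refine ⟨h.box_x, h.box_y, fun i hi => ?_, fun i hi => ?_, fun i hi => ?_, fun i hi => ?_,
    fun i hi => ?_, fun i hi => ?_, fun i hi j hj hij => ?_, fun x y h1 h2 h3 h4 => ?_, ?_⟩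
  · simpa using h.proper_x i (hE hi)
  · rw [growUp_bottom]; exact (h.proper_y i (hE hi)).trans_le (htop i (hE hi))
  · simpa using h.left_le i (hE hi)
  · simpa using h.right_le i (hE hi)
  · simpa using h.bottom_le i (hE hi)
  · rw [growUp_top]
    split_ifs
    · exact le_rfl
    · exact h.top_le i (hE hi)
  · have key : ∀ i ∈ s, ∀ j ∈ s, i ≠ b → j ≠ b → i ≠ j →
        ((R i).top = (R b).bottom ∧ (R i).right ≤ (R b).right) → (R i).right ≤ (R j).left ∨
          (R j).right ≤ (R i).left ∨ (R j).top ≤ (R i).bottom := by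
      intro i hi j hj hib hjb hij ⟨g1, g2⟩
      have e1 := h.disj i hi j hj hij
      have e2 := h.disj j hj b hb.mem hjb
      have e3 := h.proper_y j hj
      have e4 := h.proper_x j hj
      have e5 := h.left_le i hi
      have e6 := h.left_le j hj
      have e7 := h.top_le j hj
      have e8 := h.proper_y i hi
      rcases e1 with e1 | e1 | e1 | e1
      · exact Or.inl e1
      · exact Or.inr (Or.inl e1)
      · rcases e2 with e2 | e2 | e2 | e2
        · linarith [hb.left]
        · left; linarith
        · linarith
        · linarith [hb.top]
      · exact Or.inr (Or.inr e1)
    simp only [growUp_left, growUp_right, growUp_bottom]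
    by_cases gi : (R i).top = (R b).bottom ∧ (R i).right ≤ (R b).right
    · have := key i (hE hi) j (hE hj) (hN hi) (hN hj) hij gi
      by_cases gj : (R j).top = (R b).bottom ∧ (R j).right ≤ (R b).right
      · have h5 := key j (hE hj) i (hE hi) (hN hj) (hN hi) hij.symm gj
        have := h.proper_y i (hE hi)
        have := h.proper_y j (hE hj)
        have := h.proper_x i (hE hi)
        have := h.proper_x j (hE hj)
        rcases h5 with h5 | h5 | h5
        · tauto
        · tauto
        · linarith [gi.1, gj.1]
      · rw [growUp_top, growUp_top, if_pos gi, if_neg gj]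
        tauto
    · by_cases gj : (R j).top = (R b).bottom ∧ (R j).right ≤ (R b).right
      · have := key j (hE hj) i (hE hi) (hN hj) (hN hi) hij.symm gj
        rw [growUp_top, growUp_top, if_neg gi, if_pos gj]
        tauto
      · rw [growUp_top, growUp_top, if_neg gi, if_neg gj]
        exact h.disj i (hE hi) j (hE hj) hij
  · simp only [growUp_left, growUp_right, growUp_bottom]
    obtain ⟨i, hi, i1, i2, i3, i4⟩ := h.cover x y h1 h2 h3 h4
    by_cases hib : i = b
    · subst hib
      obtain ⟨r, hr, r1, r2, r3, r4⟩ := h.exists_below hi ht i1 i2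
      refine ⟨r, Finset.mem_erase.2 ⟨?_, hr⟩, r3, r4, ?_, ?_⟩
      · rintro rfl; linarith
      · linarith [h.proper_y r hr]
      · rw [growUp_top, if_pos ⟨r1, r2⟩]; exact h4.le
    · exact ⟨i, Finset.mem_erase.2 ⟨hib, hi⟩, i1, i2, i3, i4.trans (htop i hi)⟩
  · intro x y i hi j hj k hk l hl
    simp only [growUp_left, growUp_right, growUp_bottom]
    intro c1 c2 c3 c4
    have htop' : ∀ m ∈ s, (HFO.growUp B R b m).top = y → (R m).top = y := by
      intro m hm hmy
      rw [growUp_top] at hmy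
      split_ifs at hmy
      · linarith [h.proper_y i (hE hi), h.top_le i (hE hi)]
      · exact hmy
    exact h.no_cross x y i (hE hi) j (hE hj) k (hE hk) l (hE hl) c1 c2
      ⟨c3.1, htop' k (hE hk) c3.2⟩ ⟨c4.1, htop' l (hE hl) c4.2⟩

theorem growLeft (h : Mos B s R) (hb : IsTL B s R b) (ht : Perp s R b) :
    Mos B (s.erase b) (growLeft B R b) := by
  have := (h.diag.growUp hb.diag (tee_diag.2 ht)).diag
  rw [growUp_diag] at this
  simpa using this

theorem delTL (h : Mos B s R) (hb : IsTL B s R b) (hs : 1 < s.card) :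
    Mos B (s.erase b) (delTL B s R b) := by
  unfold HFO.delTL
  split_ifs with ht
  · exact h.growUp hb ht
  · exact h.growLeft hb ((h.perp_iff_not_tee hb hs).2 ht)

end Mos

/-! ### Deletion orders -/

variable [DecidableEq ι] [DecidableEq κ]

/-- The list `l` is the top-left deletion order of the rooms `R r`, `r ∈ s`. -/
inductive TLO (B : Rect) : Finset ι → (ι → Rect) → List ι → Prop
  | single (b : ι) (R : ι → Rect) : TLO B {b} R [b]
  | delete (s : Finset ι) (R : ι → Rect) (b : ι) (l : List ι) :
      IsTL B s R b → 1 < s.card → TLO B (s.erase b) (delTL B s R b) l → TLO B s R (b :: l)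

/-! ### Existence, uniqueness and invariance of the deletion order -/

namespace TLO

variable {B : Rect} {s : Finset ι} {R : ι → Rect} {l : List ι}

theorem toFinset (h : TLO B s R l) : l.toFinset = s := by
  induction h with
  | single b R => simp
  | delete s R b l hb _ _ ih => rw [List.toFinset_cons, ih, Finset.insert_erase hb.mem]

theorem nodup (h : TLO B s R l) : l.Nodup := by
  induction h with
  | single b R => simp
  | delete s R b l hb _ h ih =>
    refine List.nodup_cons.2 ⟨fun hbl => ?_, ih⟩
    rw [← List.mem_toFinset, h.toFinset] at hbl
    exact Finset.notMem_erase b s hbl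

theorem mem_iff (h : TLO B s R l) {i : ι} : i ∈ l ↔ i ∈ s := by
  rw [← h.toFinset, List.mem_toFinset]

theorem exists_of_mos (h : Mos B s R) : ∃ l, TLO B s R l := by
  induction hn : s.card generalizing s R with
  | zero =>
    have := h.nonempty.card_pos
    omega
  | succ n ih =>
    obtain ⟨b, hb⟩ := h.exists_isTL
    by_cases hs : 1 < s.card
    · obtain ⟨l, hl⟩ := ih (h.delTL hb hs) (by rw [Finset.card_erase_of_mem hb.mem]; omega)
      exact ⟨b :: l, .delete s R b l hb hs hl⟩
    · obtain ⟨c, rfl⟩ := Finset.card_eq_one.1 (show s.card = 1 by omega)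
      exact ⟨[c], .single c R⟩

theorem unique (hm : Mos B s R) (h : TLO B s R l) {l' : List ι} (h' : TLO B s R l') : l = l' := by
  induction h generalizing l' with
  | single b R =>
    generalize hs : ({b} : Finset ι) = s at h'
    cases h' with
    | single c R => rw [Finset.singleton_injective hs]
    | delete s R c l _ h1 _ => rw [← hs] at h1; simp at h1
  | delete s R b l hb h1 _ ih =>
    cases h' with
    | single c R => simp at h1
    | delete s R c l hc _ h2 =>
      have := hm.isTL_unique hb hc
      subst this
      rw [ih (hm.delTL hb h1) h2]

theorem map (h : TLO B s R l) {f : ι → κ} (hf : Set.InjOn f s) {R' : κ → Rect}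
    (hR : ∀ i ∈ s, R' (f i) = R i) : TLO B (s.image f) R' (l.map f) := by
  induction h generalizing R' with
  | single b R => simpa using TLO.single (B := B) (f b) R'
  | delete s R b l hb h1 _ ih =>
    have htee : Tee (s.image f) R' (f b) ↔ Tee s R b := by
      simp only [Tee, Finset.exists_mem_image]
      constructor <;> rintro ⟨r, hr, h⟩ <;> refine ⟨r, hr, ?_⟩
      · rwa [hR r hr, hR b hb.mem] at h
      · rwa [hR r hr, hR b hb.mem]
    rw [List.map_cons]
    refine .delete _ _ _ _ ⟨Finset.mem_image_of_mem f hb.mem, ?_, ?_⟩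
      (by rwa [Finset.card_image_of_injOn hf]) ?_
    · rw [hR b hb.mem, hb.left]
    · rw [hR b hb.mem, hb.top]
    · have he : (s.image f).erase (f b) = (s.erase b).image f := by
        ext y
        simp only [Finset.mem_erase, Finset.mem_image]
        constructor
        · rintro ⟨h2, i, hi, rfl⟩
          exact ⟨i, ⟨fun h3 => h2 (by rw [h3]), hi⟩, rfl⟩
        · rintro ⟨i, ⟨h2, hi⟩, rfl⟩
          exact ⟨fun h3 => h2 (hf hi hb.mem h3), i, hi, rfl⟩
      rw [he]
      refine ih (hf.mono (by exact_mod_cast Finset.erase_subset b s)) fun i hi => ?_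
      have hi := Finset.mem_of_mem_erase hi
      unfold delTL
      by_cases ht : Tee s R b
      · rw [if_pos ht, if_pos (htee.2 ht)]
        simp only [growUp, hR i hi, hR b hb.mem]
      · rw [if_neg ht, if_neg (mt htee.1 ht)]
        simp only [growLeft, hR i hi, hR b hb.mem]

theorem congr (h : TLO B s R l) {R' : ι → Rect} (hR : ∀ i ∈ s, R' i = R i) : TLO B s R' l := by
  simpa using h.map (f := id) Function.injective_id.injOn hR

/-- The diagonal reflection keeps the top left corner in place and exchanges `⊣` with `⊥`, so the
same rooms are deleted in the same order. -/
theorem diag (hm : Mos B s R) (h : TLO B s R l) : TLO B.diag s (fun i => (R i).diag) l := by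
  induction h with
  | single b R => exact .single b _
  | delete s R b l hb h1 _ ih =>
    refine .delete _ _ _ _ hb.diag h1 ?_
    have := ih (hm.delTL hb h1)
    convert this using 1
    have h2 := hm.perp_iff_not_tee hb h1
    by_cases ht : Tee s R b
    · unfold delTL
      rw [if_pos ht, if_neg fun h3 => h2.1 (tee_diag.1 h3) ht, growLeft_diag]
    · unfold delTL
      rw [if_neg ht, if_pos (tee_diag.2 (h2.2 ht)), growUp_diag]

end TLO
end Mosaic
end HFO

namespace HFO

section BottomLeft

set_option linter.unusedSectionVars false

variable {ι κ : Type*}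

/-! ### Bottom left deletion -/

/-- The wall on the right of `c` continues above `c`. -/
def BTee (s : Finset ι) (R : ι → Rect) (c : ι) : Prop :=
  ∃ r ∈ s, (R r).bottom = (R c).top ∧ (R r).right = (R c).right

open Classical in
/-- The rooms above `c` grow downwards. -/
noncomputable def growDown (B : Rect) (R : ι → Rect) (c : ι) : ι → Rect := fun r =>
  if (R r).bottom = (R c).top ∧ (R r).right ≤ (R c).right then { R r with bottom := B.bottom }
  else R r

open Classical in
/-- The rooms on the right of the bottom left room `c` grow leftwards. -/
noncomputable def shiftLeft (B : Rect) (R : ι → Rect) (c : ι) : ι → Rect := fun r =>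
  if (R r).left = (R c).right ∧ (R r).top ≤ (R c).top then { R r with left := B.left }
  else R r

open Classical in
/-- The rooms after deletion of the bottom left room `c`. -/
noncomputable def delBL (B : Rect) (s : Finset ι) (R : ι → Rect) (c : ι) : ι → Rect :=
  if BTee s R c then growDown B R c else shiftLeft B R c

/-- `c` is the bottom left room. -/
structure IsBL (B : Rect) (s : Finset ι) (R : ι → Rect) (c : ι) : Prop where
  mem : c ∈ s
  left : (R c).left = B.left
  bottom : (R c).bottom = B.bottom

theorem IsBL.flip {B : Rect} {s : Finset ι} {R : ι → Rect} {c : ι} (h : IsBL B s R c) :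
    IsTL B.flip s (fun i => (R i).flip) c := ⟨h.mem, h.left, congrArg Neg.neg h.bottom⟩

theorem IsBL.of_flip {B : Rect} {s : Finset ι} {R : ι → Rect} {c : ι}
    (h : IsTL B.flip s (fun i => (R i).flip) c) : IsBL B s R c :=
  ⟨h.mem, h.left, neg_injective h.top⟩

theorem growUp_flip (B : Rect) (R : ι → Rect) (c : ι) :
    growUp B.flip (fun i => (R i).flip) c = fun i => (growDown B R c i).flip := by
  funext i
  simp only [growUp, growDown, Rect.flip_right, Rect.flip_bottom, Rect.flip_top, neg_inj]
  split_ifs <;> rfl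

theorem growLeft_flip (B : Rect) (R : ι → Rect) (c : ι) :
    growLeft B.flip (fun i => (R i).flip) c = fun i => (shiftLeft B R c i).flip := by
  funext i
  simp only [growLeft, shiftLeft, Rect.flip_left, Rect.flip_right, Rect.flip_bottom,
    Rect.flip_top, neg_le_neg_iff]
  split_ifs <;> rfl

theorem tee_flip {s : Finset ι} {R : ι → Rect} {c : ι} :
    Tee s (fun i => (R i).flip) c ↔ BTee s R c := by
  simp [Tee, BTee]

theorem delTL_flip (B : Rect) (s : Finset ι) (R : ι → Rect) (c : ι) :
    delTL B.flip s (fun i => (R i).flip) c = fun i => (delBL B s R c i).flip := by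
  unfold delTL delBL
  by_cases h : BTee s R c
  · rw [if_pos h, if_pos (tee_flip.2 h), growUp_flip]
  · rw [if_neg h, if_neg (mt tee_flip.1 h), growLeft_flip]

section coordinates

variable (B : Rect) (R : ι → Rect) (b i : ι)

@[simp] theorem growDown_left : (growDown B R b i).left = (R i).left := by
  unfold growDown; split_ifs <;> rfl
@[simp] theorem growDown_right : (growDown B R b i).right = (R i).right := by
  unfold growDown; split_ifs <;> rfl
@[simp] theorem growDown_top : (growDown B R b i).top = (R i).top := by
  unfold growDown; split_ifs <;> rfl
@[simp] theorem shiftLeft_top : (shiftLeft B R b i).top = (R i).top := by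
  unfold shiftLeft; split_ifs <;> rfl
@[simp] theorem shiftLeft_right : (shiftLeft B R b i).right = (R i).right := by
  unfold shiftLeft; split_ifs <;> rfl
@[simp] theorem shiftLeft_bottom : (shiftLeft B R b i).bottom = (R i).bottom := by
  unfold shiftLeft; split_ifs <;> rfl

open Classical in
theorem growDown_bottom : (growDown B R b i).bottom =
    if (R i).bottom = (R b).top ∧ (R i).right ≤ (R b).right then B.bottom else (R i).bottom := by
  unfold growDown; split_ifs <;> rfl

open Classical in
theorem shiftLeft_left : (shiftLeft B R b i).left =
    if (R i).left = (R b).right ∧ (R i).top ≤ (R b).top then B.left else (R i).left := by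
  unfold shiftLeft; split_ifs <;> rfl

variable {B R b i}

theorem growUp_eq (h : ¬ ((R i).top = (R b).bottom ∧ (R i).right ≤ (R b).right)) :
    growUp B R b i = R i := if_neg h

theorem growLeft_eq (h : ¬ ((R i).left = (R b).right ∧ (R b).bottom ≤ (R i).bottom)) :
    growLeft B R b i = R i := if_neg h

theorem growDown_eq (h : ¬ ((R i).bottom = (R b).top ∧ (R i).right ≤ (R b).right)) :
    growDown B R b i = R i := if_neg h

theorem shiftLeft_eq (h : ¬ ((R i).left = (R b).right ∧ (R i).top ≤ (R b).top)) :
    shiftLeft B R b i = R i := if_neg h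

end coordinates

theorem delBL_of_tee {B : Rect} {s : Finset ι} {R : ι → Rect} {c : ι} (h : BTee s R c) :
    delBL B s R c = growDown B R c := if_pos h

theorem delBL_of_not_tee {B : Rect} {s : Finset ι} {R : ι → Rect} {c : ι} (h : ¬ BTee s R c) :
    delBL B s R c = shiftLeft B R c := if_neg h

theorem delTL_of_tee {B : Rect} {s : Finset ι} {R : ι → Rect} {c : ι} (h : Tee s R c) :
    delTL B s R c = growUp B R c := if_pos h

theorem delTL_of_not_tee {B : Rect} {s : Finset ι} {R : ι → Rect} {c : ι} (h : ¬ Tee s R c) :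
    delTL B s R c = growLeft B R c := if_neg h

variable [DecidableEq ι] [DecidableEq κ]

theorem Mos.delBL {B : Rect} {s : Finset ι} {R : ι → Rect} {c : ι} (h : Mos B s R)
    (hc : IsBL B s R c) (hs : 1 < s.card) : Mos B (s.erase c) (delBL B s R c) := by
  have := (h.flip.delTL hc.flip hs).flip
  rw [delTL_flip] at this
  simpa using this

/-- The list `l` is the bottom-left deletion order of the rooms `R r`, `r ∈ s`. -/
def BLO (B : Rect) (s : Finset ι) (R : ι → Rect) (l : List ι) : Prop :=
  TLO B.flip s (fun i => (R i).flip) l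

namespace BLO

variable {B : Rect} {s : Finset ι} {R : ι → Rect} {l : List ι}

theorem single (B : Rect) (c : ι) (R : ι → Rect) : BLO B {c} R [c] := TLO.single c _

theorem delete {c : ι} (hc : IsBL B s R c) (hs : 1 < s.card)
    (h : BLO B (s.erase c) (delBL B s R c) l) : BLO B s R (c :: l) := by
  refine TLO.delete _ _ _ _ hc.flip hs ?_
  rw [delTL_flip]
  exact h

theorem cases (h : BLO B s R l) : (∃ c, s = {c} ∧ l = [c]) ∨ ∃ c l', l = c :: l' ∧
    IsBL B s R c ∧ 1 < s.card ∧ BLO B (s.erase c) (delBL B s R c) l' := by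
  unfold BLO at h
  generalize hR : (fun i => (R i).flip) = R' at h
  cases h with
  | single c R => exact Or.inl ⟨c, rfl, rfl⟩
  | delete s R' c l' hc hs h =>
    subst hR
    rw [delTL_flip] at h
    exact Or.inr ⟨c, l', rfl, .of_flip hc, hs, h⟩

theorem congr (h : BLO B s R l) {R' : ι → Rect} (hR : ∀ i ∈ s, R' i = R i) : BLO B s R' l :=
  TLO.congr h fun i hi => by rw [hR i hi]

end BLO

/-- The top left room `b` of type `⊣` comes immediately after the last room below it in the
bottom-left deletion order. -/
theorem BLO.insert_tee {B : Rect} {b m : ι} {l' : List ι} : ∀ {s : Finset ι} {R : ι → Rect},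
    Mos B s R → IsTL B s R b → m ∈ s → (R m).top = (R b).bottom → (R m).right = (R b).right →
    BLO B (s.erase b) (growUp B R b) l' →
    ∃ l₁ l₂, l' = l₁ ++ m :: l₂ ∧ BLO B s R (l₁ ++ m :: b :: l₂) := by
  -- The bottom-left deletions of the floorplan with `b` and of the one without `b` are run in
  -- parallel. As long as `m` has not come up, both delete the same room `c`, and this commutes with
  -- the deletion of `b`.
  induction l' with
  | nil =>
    intro s R _ _ _ _ _ h
    rcases h.cases with ⟨c, _, h⟩ | ⟨c, l', h, _⟩ <;> simp at h
  | cons c l'' ih =>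
    intro s R hM hb hm hmt hmr h
    have hpm := hM.proper_y m hm
    have hxm := hM.proper_x m hm
    have hbm := hM.bottom_le m hm
    have hlm := hM.left_le m hm
    have hpb := hM.proper_y b hb.mem
    have hxb := hM.proper_x b hb.mem
    have hbl := hb.left
    have hbt := hb.top
    have hmb : m ≠ b := by rintro rfl; linarith
    have hmb' : m ∈ s.erase b := Finset.mem_erase.2 ⟨hmb, hm⟩
    have hbc : c ∈ s.erase b := by
      have := TLO.mem_iff h (i := c)
      simpa using this
    have hcb : c ≠ b := Finset.ne_of_mem_erase hbc
    have hcs : c ∈ s := Finset.mem_of_mem_erase hbc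
    have hcBL : ∀ {R' : ι → Rect}, IsBL B (s.erase b) (growUp B R b) c → IsBL B s R c :=
      fun g => ⟨hcs, by simpa using g.left, by simpa using g.bottom⟩
    rcases h.cases with ⟨d, hd, h1⟩ | ⟨d, l, h1, hd, hs, h2⟩
    · obtain ⟨rfl, rfl⟩ := List.cons.inj h1
      have : m = c := by rw [hd] at hmb'; exact Finset.mem_singleton.1 hmb'
      subst this
      have hs : s = {b, m} := by rw [← Finset.insert_erase hb.mem, hd]
      have hcard : 1 < s.card := by rw [hs, Finset.card_pair hmb.symm]; norm_num
      have hBL : IsBL B s R m := by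
        obtain ⟨i, hi, i1, i2, i3, i4⟩ := hM.north_east le_rfl hM.box_x le_rfl hM.box_y
        have hi' : i = m := by
          rw [hs] at hi
          rcases Finset.mem_insert.1 hi with rfl | hi
          · linarith
          · exact Finset.mem_singleton.1 hi
        subst hi'
        exact ⟨hm, i1.antisymm hlm, i3.antisymm hbm⟩
      refine ⟨[], [], rfl, .delete hBL hcard ?_⟩
      have : s.erase m = {b} := by
        rw [hs]; ext i; simp only [Finset.mem_erase, Finset.mem_insert, Finset.mem_singleton]
        constructor
        · tauto
        · rintro rfl; exact ⟨hmb.symm, Or.inl rfl⟩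
      rw [this]
      exact .single B b _
    obtain ⟨rfl, rfl⟩ := List.cons.inj h1
    have hc : IsBL B s R c := ⟨hcs, by simpa using hd.left, by simpa using hd.bottom⟩
    have hcl := hc.left
    have hcbot := hc.bottom
    have hpc := hM.proper_y c hcs
    have hxc := hM.proper_x c hcs
    have hcard : 1 < (s.erase c).card := by
      rw [Finset.card_erase_of_mem hb.mem] at hs
      rw [Finset.card_erase_of_mem hcs]
      exact hs
    have hcard' : 1 < s.card := hcard.trans_le (Finset.card_erase_le)
    have hbsc : b ∈ s.erase c := Finset.mem_erase.2 ⟨hcb.symm, hb.mem⟩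
    have hctop : (R c).top ≤ (R b).bottom := by
      rcases hM.disj c hcs b hb.mem hcb with g | g | g | g
      · linarith
      · linarith
      · exact g
      · linarith
    have hMc := hM.delBL hc hcard'
    have hswap : (s.erase c).erase b = (s.erase b).erase c := Finset.erase_right_comm
    -- When `m` is deleted from `s`, the room `b` above it grows down to the lower boundary and is
    -- the next room, to be deleted leftwards. Without `b`, the room `m` has itself grown to full
    -- height and is deleted leftwards. Both lead to the same floorplan.
    by_cases hcm : c = m
    · subst hcm
      refine ⟨[], l'', rfl, .delete hc hcard' (.delete ⟨hbsc, ?_, ?_⟩ hcard ?_)⟩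
      · rw [delBL_of_tee ⟨b, hb.mem, hmt.symm, hmr.symm⟩]; simpa using hbl
      · rw [delBL_of_tee ⟨b, hb.mem, hmt.symm, hmr.symm⟩, growDown_bottom,
          if_pos ⟨hmt.symm, hmr.symm.le⟩]
      · rw [delBL_of_tee ⟨b, hb.mem, hmt.symm, hmr.symm⟩] at hMc ⊢
        have n1 : ¬ BTee (s.erase c) (growDown B R c) b := by
          rintro ⟨r, hr, h3, h4⟩
          have := hMc.proper_y r hr
          have := hMc.top_le r hr
          rw [growDown_top] at h3
          linarith
        have hgc : (growUp B R b c).top = B.top := by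
          rw [growUp_top, if_pos ⟨hmt, hmr.le⟩]
        have n2 : ¬ BTee (s.erase b) (growUp B R b) c := by
          rintro ⟨r, hr, h3, h4⟩
          have := hM.proper_y r (Finset.mem_of_mem_erase hr)
          have := hM.top_le r (Finset.mem_of_mem_erase hr)
          rw [hgc, growUp_bottom] at h3
          linarith
        rw [delBL_of_not_tee n1, hswap]
        rw [delBL_of_not_tee n2] at h2
        refine h2.congr fun r hr => ?_
        simp only [Finset.mem_erase] at hr
        obtain ⟨hrc, hrb, hrs⟩ := hr
        have := hM.proper_y r hrs
        have := hM.proper_x r hrs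
        have := hM.left_le r hrs
        have := hM.top_le r hrs
        have e1 : growDown B R c r = R r := growDown_eq fun ⟨g1, g2⟩ => hrb
          (hM.eq_of_overlap hrs hb.mem (by linarith) (by linarith) (by linarith) (by linarith))
        have e2 : growUp B R b r = R r := growUp_eq fun ⟨g1, g2⟩ => hrc
          (hM.eq_of_overlap hrs hcs (by linarith) (by linarith) (by linarith) (by linarith))
        unfold shiftLeft
        simp only [e1, e2, growDown_right, growDown_top, growUp_right, hgc, hmr, hbt]
    -- `c` is neither `b` nor `m`
    have hcm1 : (R c).top = (R b).bottom → (R c).right < (R b).right := by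
      intro g
      by_contra g'
      exact hcm (hM.eq_of_overlap hcs hm (by linarith) (by linarith) (by linarith) (by linarith))
    -- The deletions of `b` and `c` commute. If `c` touches `b` from below, it ends to the left of
    -- the right edge of `b`, so `b` does not grow when `c` is deleted.
    have key : ∃ Rc, delBL B s R c = Rc ∧ Rc b = R b ∧
        (∀ r ∈ s, (Rc r).top = (R r).top ∧ (Rc r).right = (R r).right) ∧
        ∀ r ∈ (s.erase b).erase c, growUp B Rc b r = delBL B (s.erase b) (growUp B R b) c r := by
      refine ⟨_, rfl, ?_⟩
      by_cases ht : BTee s R c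
      · have hcg : growUp B R b c = R c := growUp_eq fun ⟨g1, g2⟩ => by
          obtain ⟨w, hw, w1, w2⟩ := ht
          have := hM.proper_x w hw
          have := hM.proper_y w hw
          have := hM.left_le w hw
          have := hM.top_le w hw
          have := hcm1 g1
          have := hM.eq_of_overlap hw hb.mem (by linarith) (by linarith) (by linarith)
            (by linarith)
          subst this
          linarith
        have ht' : BTee (s.erase b) (growUp B R b) c := by
          obtain ⟨w, hw, w1, w2⟩ := ht
          refine ⟨w, Finset.mem_erase.2 ⟨?_, hw⟩, ?_⟩
          · rintro rfl
            linarith [hcm1 w1.symm]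
          · rw [hcg, growUp_bottom, growUp_right]
            exact ⟨w1, w2⟩
        have hbg : growDown B R c b = R b := growDown_eq fun ⟨g1, g2⟩ => by
          linarith [hcm1 g1.symm]
        rw [delBL_of_tee ht, delBL_of_tee ht']
        refine ⟨hbg, fun r _ => by simp, fun r hr => ?_⟩
        ext <;> simp [growUp_top, growDown_bottom, hbg, hcg]
      · have ht' : ¬ BTee (s.erase b) (growUp B R b) c := by
          rintro ⟨w, hw, w1, w2⟩
          have hws := Finset.mem_of_mem_erase hw
          rw [growUp_bottom, growUp_top] at w1
          split_ifs at w1 with g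
          · linarith [hM.proper_y w hws, hM.top_le w hws]
          · exact ht ⟨w, hws, w1, by simpa using w2⟩
        have hbg : shiftLeft B R c b = R b := shiftLeft_eq fun ⟨g1, g2⟩ => by linarith
        rw [delBL_of_not_tee ht, delBL_of_not_tee ht']
        refine ⟨hbg, fun r _ => by simp, fun r hr => ?_⟩
        simp only [Finset.mem_erase] at hr
        obtain ⟨hrc, hrb, hrs⟩ := hr
        have r1 := hM.proper_y r hrs
        have r2 := hM.proper_x r hrs
        have r3 := hM.left_le r hrs
        have r4 := hM.top_le r hrs
        have hiff : (R r).left = (R c).right →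
            ((R r).top ≤ (R c).top ↔ (growUp B R b r).top ≤ (growUp B R b c).top) := by
          intro g
          rw [growUp_top, growUp_top]
          by_cases gc : (R c).top = (R b).bottom ∧ (R c).right ≤ (R b).right
          · have := hcm1 gc.1
            rw [if_pos gc]
            have e1 : (R r).top ≤ (R c).top := by
              by_contra g'
              exact hrb (hM.eq_of_overlap hrs hb.mem (by linarith) (by linarith) (by linarith)
                (by linarith))
            refine ⟨fun _ => ?_, fun _ => e1⟩
            split_ifs
            · exact le_rfl
            · exact r4
          · rw [if_neg gc]
            split_ifs with gr
            · constructor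
              · intro g'
                exact absurd ⟨by linarith, by linarith⟩ gc
              · intro g'
                linarith
            · exact Iff.rfl
        ext
        · simp only [growUp_left, shiftLeft_left, growUp_right]
          by_cases g : (R r).left = (R c).right
          · simp only [g, true_and, hiff g]
          · simp only [g, false_and, if_false]
        · simp
        · simp
        · simp [growUp_top, hbg]
    obtain ⟨Rc, e, e1, e2, e3⟩ := key
    rw [e] at hMc
    have hTL : IsTL B (s.erase c) Rc b := ⟨hbsc, by rw [e1, hbl], by rw [e1, hbt]⟩
    have h3 : BLO B ((s.erase c).erase b) (growUp B Rc b) l'' := by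
      rw [hswap]
      exact h2.congr e3
    obtain ⟨l₁, l₂, h4, h5⟩ := ih hMc hTL (Finset.mem_erase.2 ⟨Ne.symm hcm, hm⟩)
      (by rw [e1, (e2 m hm).1, hmt]) (by rw [e1, (e2 m hm).2, hmr]) h3
    refine ⟨c :: l₁, l₂, by rw [h4, List.cons_append], .delete hc hcard' ?_⟩
    rw [e]
    exact h5

/-- The top left room `b` of type `⊥` comes immediately before the lowest room on its right in the
bottom-left deletion order. -/
theorem BLO.insert_perp {B : Rect} {b m : ι} {l' : List ι} : ∀ {s : Finset ι} {R : ι → Rect},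
    Mos B s R → IsTL B s R b → m ∈ s → (R m).left = (R b).right → (R m).bottom = (R b).bottom →
    BLO B (s.erase b) (growLeft B R b) l' →
    ∃ l₁ l₂, l' = l₁ ++ m :: l₂ ∧ BLO B s R (l₁ ++ b :: m :: l₂) := by
  -- Again the deletions with and without `b` run in parallel until `m` comes up.
  induction l' with
  | nil =>
    intro s R _ _ _ _ _ h
    rcases h.cases with ⟨c, _, h⟩ | ⟨c, l', h, _⟩ <;> simp at h
  | cons c l'' ih =>
    intro s R hM hb hm hml hmbot h
    have hpm := hM.proper_y m hm
    have hxm := hM.proper_x m hm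
    have hbm := hM.bottom_le m hm
    have htm := hM.top_le m hm
    have hpb := hM.proper_y b hb.mem
    have hxb := hM.proper_x b hb.mem
    have hbl := hb.left
    have hbt := hb.top
    have hnt : ¬ Tee s R b := fun g => hM.not_tee_perp hb.mem g ⟨m, hm, hml, hmbot⟩
    have hmb : m ≠ b := by rintro rfl; linarith
    have hmb' : m ∈ s.erase b := Finset.mem_erase.2 ⟨hmb, hm⟩
    have hbc : c ∈ s.erase b := by
      have := TLO.mem_iff h (i := c)
      simpa using this
    have hcb : c ≠ b := Finset.ne_of_mem_erase hbc
    have hcs : c ∈ s := Finset.mem_of_mem_erase hbc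
    have hcard' : 1 < s.card := Finset.one_lt_card.2 ⟨m, hm, b, hb.mem, hmb⟩
    have hpc := hM.proper_y c hcs
    have hxc := hM.proper_x c hcs
    have hcbl : IsBL B (s.erase b) (growLeft B R b) c := by
      rcases h.cases with ⟨d, hd, h1⟩ | ⟨d, l, h1, hd, hs, h2⟩
      · obtain ⟨rfl, rfl⟩ := List.cons.inj h1
        have hM' := hM.growLeft hb ⟨m, hm, hml, hmbot⟩
        obtain ⟨i, hi, i1, i2, i3, i4⟩ := hM'.north_east le_rfl hM.box_x le_rfl hM.box_y
        have := hM'.left_le i hi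
        have := hM'.bottom_le i hi
        have hic : i = c := by rw [hd] at hi; exact Finset.mem_singleton.1 hi
        subst hic
        exact ⟨hi, by linarith, by linarith⟩
      · obtain ⟨rfl, rfl⟩ := List.cons.inj h1
        exact hd
    have hcbot : (R c).bottom = B.bottom := by simpa using hcbl.bottom
    -- Now `m` stands on the lower boundary, hence so does `b`, which is therefore a column of full
    -- height at the left. Its bottom-left deletion moves the same rooms as its top-left deletion.
    by_cases hcm : c = m
    · subst hcm
      refine ⟨[], l'', rfl, .delete ⟨hb.mem, hbl, by linarith⟩ hcard' ?_⟩
      have n1 : ¬ BTee s R b := by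
        rintro ⟨r, hr, h3, h4⟩
        have := hM.proper_y r hr
        have := hM.top_le r hr
        linarith
      rw [delBL_of_not_tee n1]
      refine h.congr fun r hr => ?_
      have := hM.top_le r (Finset.mem_of_mem_erase hr)
      have := hM.bottom_le r (Finset.mem_of_mem_erase hr)
      simp only [shiftLeft, growLeft]
      congr 1
      simp only [eq_iff_iff, and_congr_right_iff]
      intro _
      constructor <;> intro _ <;> linarith
    have hcl : (R c).left = B.left := by
      have := hcbl.left
      rw [growLeft_left] at this
      split_ifs at this with g
      · exact absurd (hM.eq_of_overlap hcs hm (by linarith) (by linarith) (by linarith)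
          (by linarith)) hcm
      · exact this
    have hcg : growLeft B R b c = R c := growLeft_eq fun g => by linarith
    rcases h.cases with ⟨d, hd, h1⟩ | ⟨d, l, h1, hd, hs, h2⟩
    · obtain ⟨rfl, rfl⟩ := List.cons.inj h1
      rw [hd] at hmb'
      exact absurd (Finset.mem_singleton.1 hmb').symm hcm
    obtain ⟨rfl, rfl⟩ := List.cons.inj h1
    have hc : IsBL B s R c := ⟨hcs, hcl, hcbot⟩
    have hbsc : b ∈ s.erase c := Finset.mem_erase.2 ⟨hcb.symm, hb.mem⟩
    have hctop : (R c).top ≤ (R b).bottom := by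
      rcases hM.disj c hcs b hb.mem hcb with g | g | g | g <;> linarith
    have hMc := hM.delBL hc hcard'
    have hswap : (s.erase c).erase b = (s.erase b).erase c := Finset.erase_right_comm
    have hcr : (R c).top = (R b).bottom → (R c).right ≠ (R b).right := fun g1 g2 =>
      hnt ⟨c, hcs, g1, g2⟩
    -- Deleting `c` may let `b` grow downwards, but then `m` grows along with it, so `m` still
    -- starts at the bottom right corner of `b`.
    have key : ∃ Rc, delBL B s R c = Rc ∧ (Rc b).left = B.left ∧ (Rc b).top = B.top ∧
        (Rc m).left = (Rc b).right ∧ (Rc m).bottom = (Rc b).bottom ∧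
        ∀ r ∈ (s.erase b).erase c, growLeft B Rc b r = delBL B (s.erase b) (growLeft B R b) c r := by
      refine ⟨_, rfl, ?_⟩
      by_cases ht : BTee s R c
      · have ht' : BTee (s.erase b) (growLeft B R b) c := by
          obtain ⟨w, hw, w1, w2⟩ := ht
          refine ⟨w, Finset.mem_erase.2 ⟨?_, hw⟩, ?_⟩
          · rintro rfl
            exact hcr w1.symm w2.symm
          · rw [hcg, growLeft_bottom, growLeft_right]
            exact ⟨w1, w2⟩
        rw [delBL_of_tee ht, delBL_of_tee ht']
        have hmr : (R m).bottom = (R c).top → (R b).right ≤ (R c).right →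
            (R m).right ≤ (R c).right := by
          intro g1 g2
          obtain ⟨w, hw, w1, w2⟩ := ht
          by_contra g3
          have := hM.proper_x w hw
          have := hM.proper_y w hw
          have h5 := lt_of_le_of_ne g2 (hcr (by linarith)).symm
          have := hM.eq_of_overlap hw hm (by linarith) (by linarith) (by linarith) (by linarith)
          subst this
          linarith
        refine ⟨by simpa using hbl, by simpa using hbt, by simpa using hml, ?_, fun r hr => ?_⟩
        · rw [growDown_bottom, growDown_bottom]
          have : ((R m).bottom = (R c).top ∧ (R m).right ≤ (R c).right) ↔
              ((R b).bottom = (R c).top ∧ (R b).right ≤ (R c).right) := by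
            constructor
            · rintro ⟨g1, g2⟩; exact ⟨by linarith, by linarith⟩
            · rintro ⟨g1, g2⟩; exact ⟨by linarith, hmr (by linarith) g2⟩
          simp only [this]
          rw [hmbot]
        · simp only [Finset.mem_erase] at hr
          obtain ⟨hrc, hrb, hrs⟩ := hr
          have r1 := hM.proper_y r hrs
          have r2 := hM.proper_x r hrs
          have r3 := hM.bottom_le r hrs
          have hiff : (R r).left = (R b).right → ((growDown B R c b).bottom ≤
              (growDown B R c r).bottom ↔ (R b).bottom ≤ (R r).bottom) := by
            intro g
            rw [growDown_bottom, growDown_bottom]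
            by_cases gb : (R b).bottom = (R c).top ∧ (R b).right ≤ (R c).right
            · rw [if_pos gb]
              have h5 := lt_of_le_of_ne gb.2 (hcr gb.1.symm).symm
              have : (R b).bottom ≤ (R r).bottom := by
                rcases hM.disj r hrs c hcs hrc with g | g | g | g <;> linarith
              simp only [this, iff_true]
              split_ifs <;> linarith
            · rw [if_neg gb]
              split_ifs with gr
              · constructor
                · intro _; linarith
                · intro _
                  exact absurd ⟨by linarith, by linarith⟩ gb
              · exact Iff.rfl
          ext
          · simp only [growLeft_left, growDown_left, growDown_right]
            by_cases g : (R r).left = (R b).right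
            · simp only [g, true_and, hiff g]
            · simp only [g, false_and, if_false]
          · simp
          · simp [growDown_bottom, hcg]
          · simp
      · have ht' : ¬ BTee (s.erase b) (growLeft B R b) c := by
          rintro ⟨w, hw, w1, w2⟩
          rw [growLeft_bottom, hcg] at w1
          rw [growLeft_right, hcg] at w2
          exact ht ⟨w, Finset.mem_of_mem_erase hw, w1, w2⟩
        rw [delBL_of_not_tee ht, delBL_of_not_tee ht']
        have hbg : shiftLeft B R c b = R b := shiftLeft_eq fun g => by linarith
        have hmg : shiftLeft B R c m = R m := shiftLeft_eq fun g => by linarith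
        rw [hbg, hmg]
        refine ⟨hbl, hbt, hml, hmbot, fun r hr => ?_⟩
        simp only [Finset.mem_erase] at hr
        obtain ⟨hrc, hrb, hrs⟩ := hr
        ext
        · simp only [growLeft_left, shiftLeft_left, shiftLeft_bottom, growLeft_top, hbg, hcg]
          split_ifs <;> rfl
        · simp
        · simp
        · simp
    obtain ⟨Rc, e, e1, e1', e2, e2', e3⟩ := key
    rw [e] at hMc
    have h3 : BLO B ((s.erase c).erase b) (growLeft B Rc b) l'' := by
      rw [hswap]
      exact h2.congr e3
    obtain ⟨l₁, l₂, h4, h5⟩ := ih hMc ⟨hbsc, e1, e1'⟩ (Finset.mem_erase.2 ⟨Ne.symm hcm, hm⟩)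
      e2 e2' h3
    refine ⟨c :: l₁, l₂, by rw [h4, List.cons_append], .delete hc hcard' ?_⟩
    rw [e]
    exact h5

end BottomLeft
end HFO

namespace HFO

section Label

set_option linter.unusedSectionVars false

variable {ι κ : Type*} [DecidableEq ι] [DecidableEq κ]

/-! ### The label of a mosaic -/

theorem idxOf_insert_self {A C : List ι} {b : ι} (h : b ∉ A) :
    (A ++ b :: C).idxOf b = A.length := by
  rw [List.idxOf_append_of_notMem h, List.idxOf_cons_self, add_zero]

theorem idxOf_insert {A C : List ι} {b x : ι} (h : x ≠ b) : (A ++ b :: C).idxOf x =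
    if (A ++ C).idxOf x < A.length then (A ++ C).idxOf x else (A ++ C).idxOf x + 1 := by
  by_cases hx : x ∈ A
  · rw [List.idxOf_append_of_mem hx, List.idxOf_append_of_mem hx, if_pos (List.idxOf_lt_length_iff.2 hx)]
  · rw [List.idxOf_append_of_notMem hx, List.idxOf_append_of_notMem hx,
      List.idxOf_cons_ne _ h.symm, if_neg (by omega)]
    omega

theorem idxOf_injOn {l : List ι} {s : Finset ι} (h : ∀ i ∈ s, i ∈ l) : Set.InjOn l.idxOf s := by
  intro x hx y _ hxy
  exact (List.idxOf_inj (h x hx)).1 hxy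

namespace BLO

/-- Rooms on the left boundary occur in the bottom-left deletion order from bottom to top. -/
theorem idxOf_lt_of_left {B : Rect} {r r' : ι} {l : List ι} :
    ∀ {s : Finset ι} {R : ι → Rect}, Mos B s R → BLO B s R l → r ∈ s → r' ∈ s →
    (R r).left = B.left → (R r').left = B.left → (R r).top ≤ (R r').bottom →
    l.idxOf r < l.idxOf r' := by
  induction l with
  | nil => intro s R _ h; rcases h.cases with ⟨c, _, h⟩ | ⟨c, l', h, _⟩ <;> simp at h
  | cons c l ih =>
    intro s R hM h hr hr' h1 h2 h3
    have p1 := hM.proper_y r hr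
    have p2 := hM.proper_y r' hr'
    have p3 := hM.proper_x r hr
    have p4 := hM.bottom_le r hr
    have hne : r ≠ r' := by rintro rfl; linarith
    rcases h.cases with ⟨d, hd, _⟩ | ⟨d, l', h4, hd, hs, h5⟩
    · rw [hd, Finset.mem_singleton] at hr hr'
      exact absurd (hr.trans hr'.symm) hne
    obtain ⟨rfl, rfl⟩ := List.cons.inj h4
    by_cases hcr : c = r
    · subst hcr
      rw [List.idxOf_cons_self, List.idxOf_cons_ne _ hne]
      omega
    have hcr' : c ≠ r' := by
      rintro rfl
      linarith [hd.bottom]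
    rw [List.idxOf_cons_ne _ hcr, List.idxOf_cons_ne _ hcr']
    have hl : ∀ i, (R i).left = B.left → (delBL B s R c i).left = B.left := by
      intro i hi
      unfold delBL
      split_ifs
      · rw [growDown_left, hi]
      · rw [shiftLeft_left]; split_ifs <;> [rfl; exact hi]
    have ht : (delBL B s R c r).top = (R r).top := by unfold delBL; split_ifs <;> simp
    have hb : (delBL B s R c r').bottom = (R r').bottom := by
      unfold delBL
      split_ifs
      · rw [growDown_bottom, if_neg]
        rintro ⟨g1, g2⟩
        have := hM.proper_x c hd.mem
        exact hcr (hM.eq_of_overlap hd.mem hr (by linarith [hd.left]) (by linarith [hd.left])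
          (by linarith [hd.bottom]) (by linarith))
      · simp
    exact Nat.succ_lt_succ (ih (hM.delBL hd hs) h5 (Finset.mem_erase.2 ⟨Ne.symm hcr, hr⟩)
      (Finset.mem_erase.2 ⟨hcr'.symm, hr'⟩) (hl r h1) (hl r' h2) (by rw [ht, hb]; exact h3))

/-- Rooms on the upper boundary occur in the bottom-left deletion order from left to right. -/
theorem idxOf_lt_of_top {B : Rect} {r r' : ι} {l : List ι} :
    ∀ {s : Finset ι} {R : ι → Rect}, Mos B s R → BLO B s R l → r ∈ s → r' ∈ s →
    (R r).top = B.top → (R r').top = B.top → (R r).right ≤ (R r').left →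
    l.idxOf r < l.idxOf r' := by
  induction l with
  | nil => intro s R _ h; rcases h.cases with ⟨c, _, h⟩ | ⟨c, l', h, _⟩ <;> simp at h
  | cons c l ih =>
    intro s R hM h hr hr' h1 h2 h3
    have p1 := hM.proper_x r hr
    have p2 := hM.proper_x r' hr'
    have p3 := hM.proper_y r hr
    have p4 := hM.left_le r hr
    have p5 := hM.bottom_le r hr
    have hne : r ≠ r' := by rintro rfl; linarith
    rcases h.cases with ⟨d, hd, _⟩ | ⟨d, l', h4, hd, hs, h5⟩
    · rw [hd, Finset.mem_singleton] at hr hr'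
      exact absurd (hr.trans hr'.symm) hne
    obtain ⟨rfl, rfl⟩ := List.cons.inj h4
    by_cases hcr : c = r
    · subst hcr
      rw [List.idxOf_cons_self, List.idxOf_cons_ne _ hne]
      omega
    have hcr' : c ≠ r' := by
      rintro rfl
      linarith [hd.left]
    rw [List.idxOf_cons_ne _ hcr, List.idxOf_cons_ne _ hcr']
    have ht : ∀ i, (delBL B s R c i).top = (R i).top := by
      intro i; unfold delBL; split_ifs <;> simp
    have hrt : (delBL B s R c r).right = (R r).right := by unfold delBL; split_ifs <;> simp
    have hb : (delBL B s R c r').left = (R r').left := by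
      unfold delBL
      split_ifs
      · simp
      · rw [shiftLeft_left, if_neg]
        rintro ⟨g1, g2⟩
        have := hM.proper_y c hd.mem
        exact hcr (hM.eq_of_overlap hd.mem hr (by linarith [hd.left]) (by linarith [hd.left])
          (by linarith [hd.bottom]) (by linarith))
    exact Nat.succ_lt_succ (ih (hM.delBL hd hs) h5 (Finset.mem_erase.2 ⟨Ne.symm hcr, hr⟩)
      (Finset.mem_erase.2 ⟨hcr'.symm, hr'⟩) (by rw [ht, h1]) (by rw [ht, h2])
      (by rw [hrt, hb]; exact h3))

theorem exists_of_mos {B : Rect} {s : Finset ι} {R : ι → Rect} (h : Mos B s R) :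
    ∃ l, BLO B s R l := TLO.exists_of_mos h.flip

theorem unique {B : Rect} {s : Finset ι} {R : ι → Rect} {l l' : List ι} (hm : Mos B s R)
    (h : BLO B s R l) (h' : BLO B s R l') : l = l' := TLO.unique hm.flip h h'

end BLO

theorem Mos.eq_box {B : Rect} {b : ι} {R : ι → Rect} (h : Mos B {b} R) : R b = B := by
  obtain ⟨i, hi, i1, i2, i3, i4⟩ := h.north_east le_rfl h.box_x le_rfl h.box_y
  obtain ⟨j, hj, j1, j2, j3, j4⟩ := h.south_west h.box_x le_rfl h.box_y le_rfl
  rw [Finset.mem_singleton] at hi hj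
  subst hi
  subst hj
  have hb := Finset.mem_singleton_self j
  ext
  · exact i1.antisymm (h.left_le j hb)
  · exact (h.right_le j hb).antisymm j2
  · exact i3.antisymm (h.bottom_le j hb)
  · exact (h.top_le j hb).antisymm j4

/-- The label of a mosaic is Baxter, its right-to-left minima correspond to the rooms on the upper
boundary, and its left-to-right minima to the rooms on the left boundary. -/
theorem Mos.label {B : Rect} {s : Finset ι} {R : ι → Rect} {tl bl : List ι} (hM : Mos B s R)
    (ht : TLO B s R tl) (hb : BLO B s R bl) : Baxter bl.idxOf tl.idxOf s ∧
      (∀ r ∈ s, (R r).top = B.top ↔ ∀ r' ∈ s, bl.idxOf r < bl.idxOf r' →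
        tl.idxOf r < tl.idxOf r') ∧
      (∀ r ∈ s, (R r).left = B.left ↔ ∀ r' ∈ s, bl.idxOf r' < bl.idxOf r →
        tl.idxOf r < tl.idxOf r') := by
  induction ht generalizing bl with
  | single b R =>
    refine ⟨(Dec.single (k := 0) b).baxter, fun r hr => ?_, fun r hr => ?_⟩ <;>
    · rw [Finset.mem_singleton] at hr
      subst hr
      simp [hM.eq_box]
  | delete s R b tl hTL hs ht ih =>
    have hM' := hM.delTL hTL hs
    obtain ⟨bl', hb'⟩ := BLO.exists_of_mos hM'
    obtain ⟨ihB, ihT, ihL⟩ := ih hM' hb'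
    have hnd : bl.Nodup := TLO.nodup hb
    have hmem' : ∀ i ∈ s.erase b, i ∈ bl' := fun i hi => (TLO.mem_iff hb').2 hi
    have hinj' := idxOf_injOn hmem'
    have hinj : Set.InjOn bl.idxOf s := idxOf_injOn fun i hi => (TLO.mem_iff hb).2 hi
    have htb : (b :: tl).idxOf b = 0 := List.idxOf_cons_self
    have htx : ∀ x, x ≠ b → (b :: tl).idxOf x = tl.idxOf x + 1 := fun x hx =>
      List.idxOf_cons_ne _ hx.symm
    have tinj : Set.InjOn (b :: tl).idxOf s :=
      idxOf_injOn fun i hi => (TLO.mem_iff (.delete s R b tl hTL hs ht)).2 hi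
    have hmin : ∀ e ∈ s, e ≠ b → (b :: tl).idxOf b < (b :: tl).idxOf e := by
      intro e _ heb
      rw [htb, htx e heb]
      omega
    -- it suffices to describe the insertion of `b`
    suffices key : ∃ A C, bl' = A ++ C ∧ bl = A ++ b :: C ∧ ((∃ p, AfterMin bl.idxOf
        (b :: tl).idxOf s b p) ∨ ∃ p, AfterMin (OrderDual.toDual ∘ bl.idxOf) (b :: tl).idxOf s b p) ∧
        (∀ r ∈ s.erase b, (HFO.delTL B s R b r).top = B.top → (R r).top ≠ B.top →
          bl'.idxOf r < A.length) ∧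
        (∀ r ∈ s.erase b, (HFO.delTL B s R b r).left = B.left → (R r).left ≠ B.left →
          A.length ≤ bl'.idxOf r) by
      obtain ⟨A, C, rfl, rfl, hA, kT, kL⟩ := key
      have hbA : b ∉ A := by
        intro g
        rw [List.nodup_append] at hnd
        exact hnd.2.2 b g b List.mem_cons_self rfl
      have ub : (A ++ b :: C).idxOf b = A.length := idxOf_insert_self hbA
      have ux : ∀ x, x ≠ b → (A ++ b :: C).idxOf x =
        if (A ++ C).idxOf x < A.length then (A ++ C).idxOf x else (A ++ C).idxOf x + 1 :=
        fun x hx => idxOf_insert hx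
      have uiff : ∀ x y, x ≠ b → y ≠ b → ((A ++ C).idxOf x < (A ++ C).idxOf y ↔
          (A ++ b :: C).idxOf x < (A ++ b :: C).idxOf y) := by
        intro x y hx hy
        rw [ux x hx, ux y hy]
        split_ifs <;> omega
      have viff : ∀ x y, x ≠ b → y ≠ b → (tl.idxOf x < tl.idxOf y ↔
          (b :: tl).idxOf x < (b :: tl).idxOf y) := by
        intro x y hx hy
        rw [htx x hx, htx y hy]
        omega
      have hpb := hM.proper_x b hTL.mem
      have hpb' := hM.proper_y b hTL.mem
      have hpl := hTL.left
      have hpt := hTL.top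
      refine ⟨?_, fun r hr => ?_, fun r hr => ?_⟩
      · refine Baxter.insert_min tinj hmin ?_ hA
        have := ihB.image (g := id) (u' := (A ++ b :: C).idxOf) (v' := (b :: tl).idxOf)
          (fun x hx y hy => uiff x y (Finset.ne_of_mem_erase hx) (Finset.ne_of_mem_erase hy))
          (fun x hx y hy => viff x y (Finset.ne_of_mem_erase hx) (Finset.ne_of_mem_erase hy))
        simpa using this
      · by_cases hrb : r = b
        · subst hrb
          refine ⟨fun _ r' hr' hlt => hmin r' hr' ?_, fun _ => hTL.top⟩
          rintro rfl
          exact hlt.false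
        have hr' := Finset.mem_erase.2 ⟨hrb, hr⟩
        have h1 := hM.proper_x r hr
        have h2 := hM.proper_y r hr
        have h3 := hM.left_le r hr
        -- A new minimum inserted at position `A.length` leaves, besides itself, exactly those
        -- right-to-left minima that come after it. The geometric counterpart is that the rooms
        -- raised to the upper boundary by the deletion come before `b`, which is `kT`.
        have e1 : (R r).top = B.top ↔ (HFO.delTL B s R b r).top = B.top ∧ ¬ (A ++ C).idxOf r < A.length := by
          constructor
          · intro g
            constructor
            · unfold HFO.delTL
              split_ifs
              · rw [growUp_top]; split_ifs <;> [rfl; exact g]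
              · rw [growLeft_top, g]
            · have g1 : (R b).right ≤ (R r).left := by
                rcases hM.disj b hTL.mem r hr (Ne.symm hrb) with g' | g' | g' | g' <;> linarith
              have := hb.idxOf_lt_of_top hM hTL.mem hr hTL.top g g1
              rw [ub, ux r hrb] at this
              split_ifs at this with g2
              · omega
              · exact g2
          · rintro ⟨g1, g2⟩
            by_contra g3
            exact g2 (kT r hr' g1 g3)
        rw [e1, ihT r hr']
        constructor
        · rintro ⟨g1, g2⟩ r' hr'' hlt
          have : r' ≠ b := by
            rintro rfl
            rw [ub, ux r hrb, if_neg g2] at hlt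
            omega
          exact (viff r r' hrb this).1 (g1 r' (Finset.mem_erase.2 ⟨this, hr''⟩)
            ((uiff r r' hrb this).2 hlt))
        · intro g
          constructor
          · intro r' hr'' hlt
            have := Finset.ne_of_mem_erase hr''
            exact (viff r r' hrb this).2 (g r' (Finset.mem_of_mem_erase hr'')
              ((uiff r r' hrb this).1 hlt))
          · intro g1
            have := g b hTL.mem (by rw [ub, ux r hrb, if_pos g1]; exact g1)
            rw [htb] at this
            omega
      · by_cases hrb : r = b
        · subst hrb
          refine ⟨fun _ r' hr' hlt => hmin r' hr' ?_, fun _ => hTL.left⟩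
          rintro rfl
          exact hlt.false
        have hr' := Finset.mem_erase.2 ⟨hrb, hr⟩
        have h1 := hM.proper_x r hr
        have h2 := hM.proper_y r hr
        have h3 := hM.top_le r hr
        have e1 : (R r).left = B.left ↔ (HFO.delTL B s R b r).left = B.left ∧ (A ++ C).idxOf r < A.length := by
          constructor
          · intro g
            constructor
            · unfold HFO.delTL
              split_ifs
              · rw [growUp_left, g]
              · rw [growLeft_left]; split_ifs <;> [rfl; exact g]
            · have g1 : (R r).top ≤ (R b).bottom := by
                rcases hM.disj b hTL.mem r hr (Ne.symm hrb) with g' | g' | g' | g' <;> linarith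
              have := hb.idxOf_lt_of_left hM hr hTL.mem g hTL.left g1
              rw [ub, ux r hrb] at this
              split_ifs at this with g2
              · exact g2
              · omega
          · rintro ⟨g1, g2⟩
            by_contra g3
            exact g2.not_ge (kL r hr' g1 g3)
        rw [e1, ihL r hr']
        constructor
        · rintro ⟨g1, g2⟩ r' hr'' hlt
          have : r' ≠ b := by
            rintro rfl
            rw [ub, ux r hrb, if_pos g2] at hlt
            omega
          exact (viff r r' hrb this).1 (g1 r' (Finset.mem_erase.2 ⟨this, hr''⟩)
            ((uiff r' r this hrb).2 hlt))
        · intro g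
          constructor
          · intro r' hr'' hlt
            have := Finset.ne_of_mem_erase hr''
            exact (viff r r' hrb this).2 (g r' (Finset.mem_of_mem_erase hr'')
              ((uiff r' r this hrb).1 hlt))
          · by_contra g1
            have := g b hTL.mem (by rw [ub, ux r hrb, if_neg g1]; omega)
            rw [htb] at this
            omega
    have hpb := hM.proper_x b hTL.mem
    have hpb' := hM.proper_y b hTL.mem
    have hpl := hTL.left
    have hpt := hTL.top
    have huniq : ∀ {m}, m ∈ s.erase b → ∀ e ∈ s, e ≠ b → bl'.idxOf e = bl'.idxOf m → e = m :=
      fun hm e he heb h => hinj' (Finset.mem_erase.2 ⟨heb, he⟩) hm h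
    -- For a `⊣`, the room `m` below the right end of `b` touches the upper boundary once `b` is
    -- deleted, so by induction it is a right-to-left minimum, and `b` is inserted right after it.
    -- The other raised rooms lie to the left of `m` on the upper boundary and thus come earlier.
    rcases hM.tee_or_perp hTL hs with hT | hP
    · obtain ⟨m, hm, m1, m2⟩ := id hT
      rw [delTL_of_tee hT] at *
      have mp := hM.proper_y m hm
      have mx := hM.proper_x m hm
      have hmb : m ≠ b := by rintro rfl; linarith
      have hm' := Finset.mem_erase.2 ⟨hmb, hm⟩
      obtain ⟨l₁, l₂, e1, e2⟩ := BLO.insert_tee hM hTL hm m1 m2 hb'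
      have e3 := BLO.unique hM hb e2
      have e1' : bl' = (l₁ ++ [m]) ++ l₂ := by simp [e1]
      have e3' : bl = (l₁ ++ [m]) ++ b :: l₂ := by simp [e3]
      have hnd' := TLO.nodup hb'
      have um : bl'.idxOf m = l₁.length := by
        rw [e1]
        refine idxOf_insert_self fun g => ?_
        rw [e1, List.nodup_append] at hnd'
        exact hnd'.2.2 m g m List.mem_cons_self rfl
      have hbA : b ∉ l₁ ++ [m] := by
        intro g
        rw [e3', List.nodup_append] at hnd
        exact hnd.2.2 b g b List.mem_cons_self rfl
      have ub : bl.idxOf b = l₁.length + 1 := by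
        rw [e3', idxOf_insert_self hbA]; simp
      have ux : ∀ x, x ≠ b → bl.idxOf x =
          if bl'.idxOf x < l₁.length + 1 then bl'.idxOf x else bl'.idxOf x + 1 := by
        intro x hx
        rw [e3', idxOf_insert hx, ← e1']; simp
      have hmtop : (HFO.growUp B R b m).top = B.top := by rw [growUp_top, if_pos ⟨m1, m2.le⟩]
      refine ⟨l₁ ++ [m], l₂, e1', e3', Or.inl ⟨m, hm, ?_, fun e he hlt => ?_, fun e he heb hlt => ?_⟩,
        fun r hr h1 h2 => ?_, fun r hr h1 h2 => ?_⟩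
      · change bl.idxOf m < bl.idxOf b
        rw [ub, ux m hmb, um]; split_ifs <;> omega
      · change bl.idxOf e < bl.idxOf b at hlt
        change _ ∨ bl.idxOf e < bl.idxOf m
        have heb : e ≠ b := by rintro rfl; exact hlt.false
        by_cases h : bl'.idxOf e = bl'.idxOf m
        · exact Or.inl (huniq hm' e he heb h)
        · right
          rw [ub, ux e heb] at hlt
          rw [ux e heb, ux m hmb]
          split_ifs at hlt ⊢ <;> omega
      · change bl.idxOf m < bl.idxOf e at hlt
        change (b :: tl).idxOf m < (b :: tl).idxOf e
        have := (ihT m hm').1 hmtop e (Finset.mem_erase.2 ⟨heb, he⟩) (by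
          rw [ux e heb, ux m hmb] at hlt
          split_ifs at hlt <;> omega)
        rw [htx m hmb, htx e heb]
        omega
      · rw [List.length_append, List.length_singleton]
        rw [growUp_top] at h1
        split_ifs at h1 with g
        · have hrs := Finset.mem_of_mem_erase hr
          by_cases hrm : r = m
          · rw [hrm, um]; omega
          · have h3 : (R r).right ≤ (R m).left := by
              have := hM.proper_y r hrs
              have := hM.proper_x r hrs
              rcases hM.disj r hrs m hm hrm with g' | g' | g' | g' <;> linarith [g.1, g.2]
            have := hb'.idxOf_lt_of_top hM' hr hm' (by rw [growUp_top, if_pos g]) hmtop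
              (by simpa using h3)
            omega
        · exact absurd h1 h2
      · rw [growUp_left] at h1
        exact absurd h1 h2
    -- For a `⊥`, the roles of the upper and the left boundary are exchanged: `m` is the lowest of
    -- the rooms pulled to the left boundary, and `b` is inserted right before it.
    · obtain ⟨m, hm, m1, m2⟩ := id hP
      rw [delTL_of_not_tee ((hM.perp_iff_not_tee hTL hs).1 hP)] at *
      have mp := hM.proper_y m hm
      have mx := hM.proper_x m hm
      have hmb : m ≠ b := by rintro rfl; linarith
      have hm' := Finset.mem_erase.2 ⟨hmb, hm⟩
      obtain ⟨l₁, l₂, e1, e2⟩ := BLO.insert_perp hM hTL hm m1 m2 hb'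
      have e3 := BLO.unique hM hb e2
      have hnd' := TLO.nodup hb'
      have um : bl'.idxOf m = l₁.length := by
        rw [e1]
        refine idxOf_insert_self fun g => ?_
        rw [e1, List.nodup_append] at hnd'
        exact hnd'.2.2 m g m List.mem_cons_self rfl
      have hbA : b ∉ l₁ := by
        intro g
        rw [e3, List.nodup_append] at hnd
        exact hnd.2.2 b g b List.mem_cons_self rfl
      have ub : bl.idxOf b = l₁.length := by
        rw [e3, idxOf_insert_self hbA]
      have ux : ∀ x, x ≠ b → bl.idxOf x =
          if bl'.idxOf x < l₁.length then bl'.idxOf x else bl'.idxOf x + 1 := by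
        intro x hx
        rw [e3, idxOf_insert hx, ← e1]
      have hmleft : (HFO.growLeft B R b m).left = B.left := by
        rw [growLeft_left, if_pos ⟨m1, m2.ge⟩]
      refine ⟨l₁, m :: l₂, e1, e3, Or.inr ⟨m, hm, ?_, fun e he hlt => ?_, fun e he heb hlt => ?_⟩,
        fun r hr h1 h2 => ?_, fun r hr h1 h2 => ?_⟩
      · change bl.idxOf b < bl.idxOf m
        rw [ub, ux m hmb, um]; split_ifs <;> omega
      · change bl.idxOf b < bl.idxOf e at hlt
        change _ ∨ bl.idxOf m < bl.idxOf e
        have heb : e ≠ b := by rintro rfl; exact hlt.false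
        by_cases h : bl'.idxOf e = bl'.idxOf m
        · exact Or.inl (huniq hm' e he heb h)
        · right
          rw [ub, ux e heb] at hlt
          rw [ux e heb, ux m hmb]
          split_ifs at hlt ⊢ <;> omega
      · change bl.idxOf e < bl.idxOf m at hlt
        change (b :: tl).idxOf m < (b :: tl).idxOf e
        have := (ihL m hm').1 hmleft e (Finset.mem_erase.2 ⟨heb, he⟩) (by
          rw [ux e heb, ux m hmb] at hlt
          split_ifs at hlt <;> omega)
        rw [htx m hmb, htx e heb]
        omega
      · rw [growLeft_top] at h1
        exact absurd h1 h2
      · rw [growLeft_left] at h1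
        split_ifs at h1 with g
        · have hrs := Finset.mem_of_mem_erase hr
          by_cases hrm : r = m
          · rw [hrm, um]
          · have h3 : (R m).top ≤ (R r).bottom := by
              have := hM.proper_y r hrs
              have := hM.proper_x r hrs
              rcases hM.disj r hrs m hm hrm with g' | g' | g' | g' <;> linarith [g.1, g.2]
            have := hb'.idxOf_lt_of_left hM' hm' hr hmleft (by rw [growLeft_left, if_pos g])
              (by simpa using h3)
            omega
        · exact absurd h1 h2

end Label
end HFO

namespace HFO

/-! ### Change of coordinates -/

/-- The image of a rectangle under a change of coordinates. -/
def Rect.map (f g : ℝ → ℝ) (P : Rect) : Rect := ⟨f P.left, f P.right, g P.bottom, g P.top⟩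

section Inflate

set_option linter.unusedSectionVars false

variable {ι κ : Type*} [DecidableEq ι] [DecidableEq κ]

theorem Mos.mem_x {B : Rect} {s : Finset ι} {R : ι → Rect} (h : Mos B s R) {i : ι} (hi : i ∈ s) :
    (R i).left ∈ Set.Icc B.left B.right ∧ (R i).right ∈ Set.Icc B.left B.right := by
  have := h.left_le i hi
  have := h.right_le i hi
  have := h.proper_x i hi
  refine ⟨⟨?_, ?_⟩, ⟨?_, ?_⟩⟩ <;> linarith

theorem Mos.mem_y {B : Rect} {s : Finset ι} {R : ι → Rect} (h : Mos B s R) {i : ι} (hi : i ∈ s) :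
    (R i).bottom ∈ Set.Icc B.bottom B.top ∧ (R i).top ∈ Set.Icc B.bottom B.top := by
  have := h.bottom_le i hi
  have := h.top_le i hi
  have := h.proper_y i hi
  refine ⟨⟨?_, ?_⟩, ⟨?_, ?_⟩⟩ <;> linarith

/-- The greatest coordinate whose image is at most `x`. -/
theorem exists_greatest_coord (C : Finset ℝ) {f : ℝ → ℝ} {a x : ℝ} (ha : a ∈ C)
    (hx : f a ≤ x) :
    ∃ c ∈ C, a ≤ c ∧ f c ≤ x ∧ ∀ d ∈ C, c < d → x < f d := by
  obtain ⟨c, hc, hmax⟩ := (C.filter fun c => f c ≤ x).exists_max_image id ⟨a, by simp [ha, hx]⟩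
  rw [Finset.mem_filter] at hc
  refine ⟨c, hc.1, hmax a (by simp [ha, hx]), hc.2, fun d hd hcd => ?_⟩
  by_contra h
  exact (hmax d (by simp [hd, not_lt.1 h])).not_gt hcd

/-- Apart from the covering, all conditions compare edge coordinates. The maps need not be onto, so
a point of the new box may have no preimage. It is covered by the room north-east of the point whose
coordinates are the greatest edge coordinates with image at most the given ones. -/
theorem Mos.map {B : Rect} {s : Finset ι} {R : ι → Rect} (h : Mos B s R) {f g : ℝ → ℝ}
    (hf : StrictMonoOn f (Set.Icc B.left B.right)) (hg : StrictMonoOn g (Set.Icc B.bottom B.top)) :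
    Mos (B.map f g) s (fun i => (R i).map f g) := by
  have bl : B.left ∈ Set.Icc B.left B.right := ⟨le_rfl, h.box_x.le⟩
  have br : B.right ∈ Set.Icc B.left B.right := ⟨h.box_x.le, le_rfl⟩
  have bb : B.bottom ∈ Set.Icc B.bottom B.top := ⟨le_rfl, h.box_y.le⟩
  have bt : B.top ∈ Set.Icc B.bottom B.top := ⟨h.box_y.le, le_rfl⟩
  refine ⟨hf bl br h.box_x, hg bb bt h.box_y,
    fun i hi => hf (h.mem_x hi).1 (h.mem_x hi).2 (h.proper_x i hi),
    fun i hi => hg (h.mem_y hi).1 (h.mem_y hi).2 (h.proper_y i hi),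
    fun i hi => hf.monotoneOn bl (h.mem_x hi).1 (h.left_le i hi),
    fun i hi => hf.monotoneOn (h.mem_x hi).2 br (h.right_le i hi),
    fun i hi => hg.monotoneOn bb (h.mem_y hi).1 (h.bottom_le i hi),
    fun i hi => hg.monotoneOn (h.mem_y hi).2 bt (h.top_le i hi),
    fun i hi j hj hij => ?_, fun x y h1 h2 h3 h4 => ?_,
    fun x y i hi j hj k hk l hl c1 c2 c3 c4 => ?_⟩
  · simp only [Rect.map]
    rw [hf.le_iff_le (h.mem_x hi).2 (h.mem_x hj).1, hf.le_iff_le (h.mem_x hj).2 (h.mem_x hi).1,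
      hg.le_iff_le (h.mem_y hi).2 (h.mem_y hj).1, hg.le_iff_le (h.mem_y hj).2 (h.mem_y hi).1]
    exact h.disj i hi j hj hij
  · let X : Finset ℝ := {B.left, B.right} ∪ (s.image fun i => (R i).left) ∪
      s.image fun i => (R i).right
    let Y : Finset ℝ := {B.bottom, B.top} ∪ (s.image fun i => (R i).bottom) ∪
      s.image fun i => (R i).top
    have hX : (X : Set ℝ) ⊆ Set.Icc B.left B.right := by
      intro z hz
      simp only [X, Finset.mem_coe, Finset.mem_union, Finset.mem_insert, Finset.mem_singleton,
        Finset.mem_image] at hz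
      rcases hz with ((rfl | rfl) | ⟨i, hi, rfl⟩) | ⟨i, hi, rfl⟩
      exacts [bl, br, (h.mem_x hi).1, (h.mem_x hi).2]
    have hY : (Y : Set ℝ) ⊆ Set.Icc B.bottom B.top := by
      intro z hz
      simp only [Y, Finset.mem_coe, Finset.mem_union, Finset.mem_insert, Finset.mem_singleton,
        Finset.mem_image] at hz
      rcases hz with ((rfl | rfl) | ⟨i, hi, rfl⟩) | ⟨i, hi, rfl⟩
      exacts [bb, bt, (h.mem_y hi).1, (h.mem_y hi).2]
    obtain ⟨x', hx', x1, x2, x3⟩ := exists_greatest_coord X (a := B.left) (by simp [X]) h1.le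
    obtain ⟨y', hy', y1, y2, y3⟩ := exists_greatest_coord Y (a := B.bottom) (by simp [Y]) h3.le
    have x4 : x' < B.right := by
      refine lt_of_le_of_ne (hX hx').2 ?_
      rintro rfl
      exact x2.not_gt h2
    have y4 : y' < B.top := by
      refine lt_of_le_of_ne (hY hy').2 ?_
      rintro rfl
      exact y2.not_gt h4
    obtain ⟨i, hi, i1, i2, i3, i4⟩ := h.north_east x1 x4 y1 y4
    refine ⟨i, hi, (hf.monotoneOn (h.mem_x hi).1 (hX hx') i1).trans x2, (x3 _ ?_ i2).le,
      (hg.monotoneOn (h.mem_y hi).1 (hY hy') i3).trans y2, (y3 _ ?_ i4).le⟩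
    · exact Finset.mem_union_right _ (Finset.mem_image_of_mem _ hi)
    · exact Finset.mem_union_right _ (Finset.mem_image_of_mem _ hi)
  · simp only [Rect.map] at c1 c2 c3 c4
    have fi := hf.injOn
    have gi := hg.injOn
    refine h.no_cross (R i).right (R i).bottom i hi j hj k hk l hl ⟨rfl, rfl⟩
      ⟨fi (h.mem_x hj).1 (h.mem_x hi).2 (c2.1.trans c1.1.symm),
        gi (h.mem_y hj).1 (h.mem_y hi).1 (c2.2.trans c1.2.symm)⟩
      ⟨fi (h.mem_x hk).2 (h.mem_x hi).2 (c3.1.trans c1.1.symm),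
        gi (h.mem_y hk).2 (h.mem_y hi).1 (c3.2.trans c1.2.symm)⟩
      ⟨fi (h.mem_x hl).1 (h.mem_x hi).2 (c4.1.trans c1.1.symm),
        gi (h.mem_y hl).2 (h.mem_y hi).1 (c4.2.trans c1.2.symm)⟩

theorem TLO.mapRect {B : Rect} {s : Finset ι} {R : ι → Rect} {l : List ι} (hM : Mos B s R)
    (h : TLO B s R l) {f g : ℝ → ℝ} (hf : StrictMonoOn f (Set.Icc B.left B.right))
    (hg : StrictMonoOn g (Set.Icc B.bottom B.top)) :
    TLO (B.map f g) s (fun i => (R i).map f g) l := by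
  induction h with
  | single b R => exact .single b _
  | delete s R b l hb hs _ ih =>
    refine .delete _ _ _ _ ⟨hb.mem, by simp [Rect.map, hb.left], by simp [Rect.map, hb.top]⟩ hs ?_
    refine (ih (hM.delTL hb hs)).congr fun i hi => ?_
    have hi := Finset.mem_of_mem_erase hi
    have hxr : ∀ i ∈ s, (f (R i).right = f (R b).right ↔ (R i).right = (R b).right) :=
      fun i hi => hf.injOn.eq_iff (hM.mem_x hi).2 (hM.mem_x hb.mem).2
    have hxl : ∀ i ∈ s, (f (R i).left = f (R b).right ↔ (R i).left = (R b).right) :=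
      fun i hi => hf.injOn.eq_iff (hM.mem_x hi).1 (hM.mem_x hb.mem).2
    have hyt : ∀ i ∈ s, (g (R i).top = g (R b).bottom ↔ (R i).top = (R b).bottom) :=
      fun i hi => hg.injOn.eq_iff (hM.mem_y hi).2 (hM.mem_y hb.mem).1
    have htee : Tee s (fun i => (R i).map f g) b ↔ Tee s R b := by
      simp only [Tee, Rect.map]
      constructor <;> rintro ⟨r, hr, h⟩ <;> refine ⟨r, hr, ?_⟩
      · rwa [hyt r hr, hxr r hr] at h
      · rwa [hyt r hr, hxr r hr]
    by_cases ht : Tee s R b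
    · rw [delTL_of_tee ht, delTL_of_tee (htee.2 ht)]
      simp only [growUp, Rect.map, hyt i hi, hf.le_iff_le (hM.mem_x hi).2 (hM.mem_x hb.mem).2]
      split_ifs <;> rfl
    · rw [delTL_of_not_tee ht, delTL_of_not_tee (mt htee.1 ht)]
      simp only [growLeft, Rect.map, hxl i hi,
        hg.le_iff_le (hM.mem_y hb.mem).1 (hM.mem_y hi).1]
      split_ifs <;> rfl

/-! ### Embedding a mosaic in a room -/

theorem Mos.exists_top_right {D : Rect} {t : Finset ι} {C : ι → Rect} (h : Mos D t C) :
    ∃ g ∈ t, (C g).top = D.top ∧ (C g).right = D.right := by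
  obtain ⟨g, hg, g1, g2, g3, g4⟩ := h.south_west h.box_x le_rfl h.box_y le_rfl
  exact ⟨g, hg, (h.top_le g hg).antisymm g4, (h.right_le g hg).antisymm g2⟩

theorem Mos.exists_bottom_left {D : Rect} {t : Finset ι} {C : ι → Rect} (h : Mos D t C) :
    ∃ g ∈ t, (C g).left = D.left ∧ (C g).bottom = D.bottom := by
  obtain ⟨g, hg, g1, g2, g3, g4⟩ := h.north_east le_rfl h.box_x le_rfl h.box_y
  exact ⟨g, hg, g1.antisymm (h.left_le g hg), g3.antisymm (h.bottom_le g hg)⟩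

/-- Embedding `t` in the room `Q` of `s`, when `Q` is the top left room. -/
theorem TLO.inflate_head {B D : Rect} {s t : Finset ι} {R C : ι → Rect} {Q : ι} {l l₂ : List ι}
    (h : TLO D t C l) (hD : D = R Q) (hMt : Mos D t C) (hMs : Mos B s R)
    (hdisj : Disjoint (s.erase Q) t) (hC : ∀ i ∈ s.erase Q, C i = R i)
    (hM : Mos B (s.erase Q ∪ t) C) (hQ : IsTL B s R Q) (hs : 1 < s.card)
    (h₂ : TLO B (s.erase Q) (delTL B s R Q) l₂) : TLO B (s.erase Q ∪ t) C (l ++ l₂) := by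
  have hcard : ∀ t : Finset ι, Disjoint (s.erase Q) t → t.Nonempty → 1 < (s.erase Q ∪ t).card := by
    intro t hdisj ht
    have := ht.card_pos
    rw [Finset.card_union_of_disjoint hdisj, Finset.card_erase_of_mem hQ.mem]
    omega
  have hDl : D.left = B.left := by rw [hD, hQ.left]
  have hDt : D.top = B.top := by rw [hD, hQ.top]
  -- `Q` and the box share the left and the upper edge, so the rooms of `t` are top left in turn.
  -- When only one of them is left, it coincides with `Q`, and its deletion is that of `Q`.
  induction h with
  | single g C =>
    have hg := Finset.mem_singleton_self g
    have hCg : C g = R Q := by rw [hMt.eq_box, hD]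
    have hgs : g ∉ s.erase Q := fun h => Finset.disjoint_left.1 hdisj h hg
    have hpQ := hMs.proper_y Q hQ.mem
    refine .delete _ _ _ _ ⟨Finset.mem_union_right _ hg, by rw [hCg, hQ.left], by rw [hCg, hQ.top]⟩
      (hcard _ hdisj ⟨g, hg⟩) ?_
    have he : (s.erase Q ∪ {g}).erase g = s.erase Q := by
      rw [Finset.union_comm, ← Finset.insert_eq, Finset.erase_insert hgs]
    have htee : Tee (s.erase Q ∪ {g}) C g ↔ Tee s R Q := by
      constructor
      · rintro ⟨r, hr, r1, r2⟩
        rcases Finset.mem_union.1 hr with hr | hr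
        · rw [hC r hr, hCg] at r1 r2
          exact ⟨r, Finset.mem_of_mem_erase hr, r1, r2⟩
        · rw [Finset.mem_singleton.1 hr, hCg] at r1
          linarith
      · rintro ⟨r, hr, r1, r2⟩
        have hrQ : r ≠ Q := by rintro rfl; linarith
        have hr := Finset.mem_erase.2 ⟨hrQ, hr⟩
        exact ⟨r, Finset.mem_union_left _ hr, by rw [hC r hr, hCg]; exact ⟨r1, r2⟩⟩
    rw [he]
    refine h₂.congr fun i hi => ?_
    by_cases ht : Tee s R Q
    · rw [delTL_of_tee ht, delTL_of_tee (htee.2 ht)]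
      simp only [growUp, hCg, hC i hi]
    · rw [delTL_of_not_tee ht, delTL_of_not_tee (mt htee.1 ht)]
      simp only [growLeft, hCg, hC i hi]
  | delete t C b l hb ht1 _ ih =>
    have hbc : IsTL B (s.erase Q ∪ t) C b :=
      ⟨Finset.mem_union_right _ hb.mem, hb.left.trans hDl, hb.top.trans hDt⟩
    have hcc := hcard t hdisj ⟨b, hb.mem⟩
    have hbs : b ∉ s.erase Q := fun h => Finset.disjoint_left.1 hdisj h hb.mem
    have htee : Tee t C b → Tee (s.erase Q ∪ t) C b := fun ⟨r, hr, h⟩ =>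
      ⟨r, Finset.mem_union_right _ hr, h⟩
    have hperp : Perp t C b → Perp (s.erase Q ∪ t) C b := fun ⟨r, hr, h⟩ =>
      ⟨r, Finset.mem_union_right _ hr, h⟩
    have hbl := hMt.bottom_le b hb.mem
    have hbr := hMt.right_le b hb.mem
    have hbx := hMt.proper_x b hb.mem
    have hby := hMt.proper_y b hb.mem
    -- the deletion takes place inside `Q`
    have key : delTL D t C b = delTL B (s.erase Q ∪ t) C b ∧
        ∀ i ∈ s.erase Q, delTL B (s.erase Q ∪ t) C b i = C i := by
      have hd : ∀ i ∈ s.erase Q, (C i).left < D.right → D.left < (C i).right →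
          (C i).bottom < D.top → D.bottom < (C i).top → False := by
        intro i hi h1 h2 h3 h4
        have hi' := Finset.mem_erase.1 hi
        rw [hD] at h1 h2 h3 h4
        rw [hC i hi] at h1 h2 h3 h4
        exact hi'.1 (hMs.eq_of_overlap hi'.2 hQ.mem h1 h2 h3 h4)
      by_cases htt : Tee t C b
      · rw [delTL_of_tee htt, delTL_of_tee (htee htt)]
        refine ⟨by funext i; simp only [growUp, hDt], fun i hi => growUp_eq fun ⟨g1, g2⟩ => ?_⟩
        obtain ⟨p, hp, p1, p2⟩ := htt
        have := hMt.proper_y p hp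
        have := hMt.bottom_le p hp
        have hi' := Finset.mem_union_left t hi
        have := hM.proper_x i hi'
        have := hM.proper_y i hi'
        have := hM.left_le i hi'
        have := hM.top_le i hi'
        exact hd i hi (by linarith) (by linarith) (by linarith) (by linarith)
      · have hpp := (hMt.perp_iff_not_tee hb ht1).2 htt
        rw [delTL_of_not_tee htt,
          delTL_of_not_tee ((hM.perp_iff_not_tee hbc hcc).1 (hperp hpp))]
        refine ⟨by funext i; simp only [growLeft, hDl], fun i hi => growLeft_eq fun ⟨g1, g2⟩ => ?_⟩
        obtain ⟨p, hp, p1, p2⟩ := hpp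
        have := hMt.proper_x p hp
        have := hMt.right_le p hp
        have hi' := Finset.mem_union_left t hi
        have := hM.proper_x i hi'
        have := hM.proper_y i hi'
        have := hM.left_le i hi'
        have := hM.top_le i hi'
        exact hd i hi (by linarith) (by linarith) (by linarith) (by linarith)
    rw [List.cons_append]
    refine .delete _ _ _ _ hbc hcc ?_
    have he : (s.erase Q ∪ t).erase b = s.erase Q ∪ t.erase b := by
      rw [Finset.erase_union_distrib, Finset.erase_eq_of_notMem hbs]
    rw [he, ← key.1]
    refine ih (hMt.delTL hb ht1) (Finset.disjoint_of_subset_right (Finset.erase_subset _ _) hdisj)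
      (fun i hi => ?_) ?_
    · rw [key.1, key.2 i hi, hC i hi]
    · rw [key.1, ← he]
      exact hM.delTL hbc hcc

/-- Deleting a room outside `Q` stretches the mosaic embedded in `Q`. -/
theorem stretch_up {B : Rect} {s t : Finset ι} {R C : ι → Rect} {Q b : ι} (hMs : Mos B s R)
    (hQ : Q ∈ s) (hMt : Mos (R Q) t C) (hb : IsTL B s R b) (hbQ : b ≠ Q) (ht : Tee s R b)
    (hCb : C b = R b) :
    Mos (growUp B R b Q) t (growUp B C b) ∧
      ∀ l, TLO (R Q) t C l → TLO (growUp B R b Q) t (growUp B C b) l := by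
  have b1 := hMs.proper_x b hb.mem
  have b2 := hMs.proper_y b hb.mem
  have q1 := hMs.left_le Q hQ
  have q2 := hMs.top_le Q hQ
  have q3 := hMs.proper_y Q hQ
  have q4 := hMs.proper_x Q hQ
  have hbl := hb.left
  have hbt := hb.top
  by_cases hg : (R Q).top = (R b).bottom ∧ (R Q).right ≤ (R b).right
  -- Only the upper edge of `Q` is moved. This discontinuous map is strictly increasing on the
  -- vertical extent of `Q`, which suffices for `Mos.map`.
  · let g : ℝ → ℝ := fun y => if y = (R Q).top then B.top else y
    have hgm : StrictMonoOn g (Set.Icc (R Q).bottom (R Q).top) := by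
      intro y hy z hz hyz
      have hy' : y ≠ (R Q).top := (hyz.trans_le hz.2).ne
      simp only [g, if_neg hy']
      split_ifs <;> linarith
    have e1 : growUp B R b Q = (R Q).map id g := by
      simp only [growUp, if_pos hg, Rect.map, g, id, if_true, if_neg q3.ne]
    have e2 : ∀ i ∈ t, growUp B C b i = (C i).map id g := by
      intro i hi
      have := hMt.proper_y i hi
      have := hMt.top_le i hi
      have := hMt.right_le i hi
      have hne : (C i).bottom ≠ (R Q).top := by intro h; linarith
      have hle : (C i).right ≤ (R b).right := by linarith
      ext
      · simp [Rect.map]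
      · simp [Rect.map]
      · simp [Rect.map, g, hne]
      · rw [growUp_top, hCb]
        simp only [Rect.map, g, hg.1, hle, and_true]
    have hfm : StrictMonoOn id (Set.Icc (R Q).left (R Q).right) := strictMono_id.strictMonoOn _
    rw [e1]
    exact ⟨(hMt.map hfm hgm).congr e2, fun l hl => (hl.mapRect hMt hfm hgm).congr e2⟩
  · have e1 : growUp B R b Q = R Q := growUp_eq hg
    have e2 : ∀ i ∈ t, growUp B C b i = C i := by
      intro i hi
      refine growUp_eq fun ⟨h1, h2⟩ => hg ?_
      rw [hCb] at h1 h2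
      have := hMt.proper_y i hi
      have := hMt.proper_x i hi
      have := hMt.top_le i hi
      have := hMt.left_le i hi
      have := hMt.right_le i hi
      have := hMt.bottom_le i hi
      have e : (R Q).top = (R b).bottom := by
        rcases hMs.disj Q hQ b hb.mem hbQ.symm with g | g | g | g <;> linarith
      refine ⟨e, ?_⟩
      obtain ⟨p, hp, p1, p2⟩ := ht
      have := hMs.proper_y p hp
      have := hMs.proper_x p hp
      by_contra g
      have := hMs.eq_of_overlap hp hQ (by linarith) (by linarith) (by linarith) (by linarith)
      subst this
      linarith
    rw [e1]
    exact ⟨hMt.congr e2, fun l hl => hl.congr e2⟩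

theorem stretch_left {B : Rect} {s t : Finset ι} {R C : ι → Rect} {Q b : ι} (hMs : Mos B s R)
    (hQ : Q ∈ s) (hMt : Mos (R Q) t C) (hb : IsTL B s R b) (hbQ : b ≠ Q) (ht : Perp s R b)
    (hCb : C b = R b) :
    Mos (growLeft B R b Q) t (growLeft B C b) ∧
      ∀ l, TLO (R Q) t C l → TLO (growLeft B R b Q) t (growLeft B C b) l := by
  obtain ⟨h1, h2⟩ := stretch_up hMs.diag hQ hMt.diag hb.diag hbQ (tee_diag.2 ht)
    (congrArg Rect.diag hCb)
  simp only [growUp_diag] at h1 h2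
  refine ⟨by simpa using h1.diag, fun l hl => ?_⟩
  simpa using (h2 l (hl.diag hMt)).diag h1

/-- The top-left deletion order after embedding a mosaic in the room `Q`. -/
theorem TLO.inflate {B : Rect} {Q : ι} {t : Finset ι} {l l₁ l₂ : List ι} :
    ∀ {s : Finset ι} {R C : ι → Rect}, Mos B s R → Mos (R Q) t C → Disjoint (s.erase Q) t →
    (∀ i ∈ s.erase Q, C i = R i) → Mos B (s.erase Q ∪ t) C →
    TLO B s R (l₁ ++ Q :: l₂) → TLO (R Q) t C l → TLO B (s.erase Q ∪ t) C (l₁ ++ l ++ l₂) := by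
  -- The rooms that precede `Q` are deleted in the same way with and without the embedded floorplan,
  -- which is merely stretched together with `Q`. Once `Q` is top left, `TLO.inflate_head` applies.
  induction l₁ with
  | nil =>
    intro s R C hMs hMt hdisj hC hM h hl
    rw [List.nil_append] at h ⊢
    cases h with
    | single _ _ =>
      rw [List.append_nil, Finset.erase_singleton, Finset.empty_union, ← hMs.eq_box]
      exact hl
    | delete s R b l hQ hs h₂ => exact hl.inflate_head rfl hMt hMs hdisj hC hM hQ hs h₂
  | cons b l₁ ih =>
    intro s R C hMs hMt hdisj hC hM h hl
    have hnd := h.nodup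
    have hmem := fun i => (h.mem_iff (i := i)).1
    have hQs : Q ∈ s := hmem Q (by simp)
    have hbQ : b ≠ Q := by
      rintro rfl
      simp at hnd
    rw [List.cons_append] at h
    generalize hL : b :: (l₁ ++ Q :: l₂) = L at h
    cases h with
    | single _ _ => simp at hL
    | delete s R b' L' hb hs h' =>
      obtain ⟨rfl, rfl⟩ := List.cons.inj hL
      have hbs := Finset.mem_erase.2 ⟨hbQ, hb.mem⟩
      have hbt : b ∉ t := Finset.disjoint_left.1 hdisj hbs
      have hCb := hC b hbs
      have hbc : IsTL B (s.erase Q ∪ t) C b :=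
        ⟨Finset.mem_union_left _ hbs, by rw [hCb, hb.left], by rw [hCb, hb.top]⟩
      obtain ⟨g, hg⟩ := hMt.nonempty
      have hcc : 1 < (s.erase Q ∪ t).card := Finset.one_lt_card.2
        ⟨b, hbc.mem, g, Finset.mem_union_right _ hg, by rintro rfl; exact hbt hg⟩
      -- If `Q` itself is the room that makes the junction, the embedded room in the matching corner
      -- of `Q` takes its place.
      have htee : Tee s R b → Tee (s.erase Q ∪ t) C b := by
        rintro ⟨r, hr, h⟩
        by_cases hrQ : r = Q
        · subst hrQ
          obtain ⟨w, hw, w1, w2⟩ := hMt.exists_top_right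
          exact ⟨w, Finset.mem_union_right _ hw, by rw [w1, w2, hCb]; exact h⟩
        · have hr := Finset.mem_erase.2 ⟨hrQ, hr⟩
          exact ⟨r, Finset.mem_union_left _ hr, by rw [hC r hr, hCb]; exact h⟩
      have hperp : Perp s R b → Perp (s.erase Q ∪ t) C b := by
        rintro ⟨r, hr, h⟩
        by_cases hrQ : r = Q
        · subst hrQ
          obtain ⟨w, hw, w1, w2⟩ := hMt.exists_bottom_left
          exact ⟨w, Finset.mem_union_right _ hw, by rw [w1, w2, hCb]; exact h⟩
        · have hr := Finset.mem_erase.2 ⟨hrQ, hr⟩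
          exact ⟨r, Finset.mem_union_left _ hr, by rw [hC r hr, hCb]; exact h⟩
      have he : (s.erase Q ∪ t).erase b = (s.erase b).erase Q ∪ t := by
        rw [Finset.erase_union_distrib, Finset.erase_eq_of_notMem hbt, Finset.erase_right_comm]
      have hdisj' : Disjoint ((s.erase b).erase Q) t :=
        Finset.disjoint_of_subset_left (Finset.erase_subset_erase _ (Finset.erase_subset _ _)) hdisj
      have hM' := hM.delTL hbc hcc
      rw [he] at hM'
      rw [List.cons_append, List.cons_append]
      refine .delete _ _ _ _ hbc hcc ?_
      rw [he]
      have hCi : ∀ i ∈ (s.erase b).erase Q, C i = R i := fun i hi =>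
        hC i (Finset.erase_subset_erase _ (Finset.erase_subset _ _) hi)
      by_cases ht : Tee s R b
      · rw [delTL_of_tee (htee ht)] at hM' ⊢
        rw [delTL_of_tee ht] at h'
        obtain ⟨h1, h2⟩ := stretch_up hMs hQs hMt hb hbQ ht hCb
        exact ih (hMs.growUp hb ht) h1 hdisj' (fun i hi => by simp only [growUp, hCi i hi, hCb]) hM'
          h' (h2 l hl)
      · have hp := (hMs.perp_iff_not_tee hb hs).2 ht
        rw [delTL_of_not_tee ((hM.perp_iff_not_tee hbc hcc).1 (hperp hp))] at hM' ⊢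
        rw [delTL_of_not_tee ht] at h'
        obtain ⟨h1, h2⟩ := stretch_left hMs hQs hMt hb hbQ hp hCb
        exact ih (hMs.growLeft hb hp) h1 hdisj' (fun i hi => by simp only [growLeft, hCi i hi, hCb])
          hM' h' (h2 l hl)

theorem BLO.inflate {B : Rect} {Q : ι} {s t : Finset ι} {l l₁ l₂ : List ι} {R C : ι → Rect}
    (hMs : Mos B s R) (hMt : Mos (R Q) t C) (hdisj : Disjoint (s.erase Q) t)
    (hC : ∀ i ∈ s.erase Q, C i = R i) (hM : Mos B (s.erase Q ∪ t) C)
    (h : BLO B s R (l₁ ++ Q :: l₂)) (hl : BLO (R Q) t C l) :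
    BLO B (s.erase Q ∪ t) C (l₁ ++ l ++ l₂) :=
  TLO.inflate hMs.flip hMt.flip hdisj (fun i hi => by rw [hC i hi]) hM.flip h hl

end Inflate
end HFO

namespace HFO

section Inflation

set_option linter.unusedSectionVars false

variable {ι κ : Type*} [DecidableEq ι] [DecidableEq κ]

/-! ### Inflation of patterns -/

/-- The rank function `w'` is obtained from `w` by replacing `Q` with the elements of `G`. -/
structure RankInflate (w w' : ι → ℕ) (F : Finset ι) (Q : ι) (G : Finset ι) : Prop where
  lt_iff : ∀ x ∈ F.erase Q, ∀ y ∈ F.erase Q, w x < w y ↔ w' x < w' y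
  lt_left : ∀ x ∈ F.erase Q, ∀ g ∈ G, w x < w Q ↔ w' x < w' g
  lt_right : ∀ x ∈ F.erase Q, ∀ g ∈ G, w Q < w x ↔ w' g < w' x

theorem RankInflate.apart {w w' : ι → ℕ} {F G : Finset ι} {Q p : ι}
    (h : RankInflate w w' F Q G) (hw : Set.InjOn w F) (hQ : Q ∈ F) (hp : p ∈ F.erase Q) :
    Apart w' p G := by
  have hp' := Finset.mem_erase.1 hp
  rcases lt_trichotomy (w p) (w Q) with g | g | g
  · exact Or.inl fun q hq => (h.lt_left p hp q hq).1 g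
  · exact absurd (hw hp'.2 hQ g) hp'.1
  · exact Or.inr fun q hq => (h.lt_right p hp q hq).1 g

theorem RankInflate.replace {w w' : ι → ℕ} {F G : Finset ι} {Q x : ι}
    (h : RankInflate w w' F Q G) (hx : x ∈ G) : ∀ y ∈ F, ∀ z ∈ F,
      w y < w z ↔ w' (if y = Q then x else y) < w' (if z = Q then x else z) := by
  intro y hy z hz
  by_cases hyQ : y = Q <;> by_cases hzQ : z = Q
  · simp [hyQ, hzQ]
  · rw [if_pos hyQ, if_neg hzQ, hyQ, h.lt_right z (Finset.mem_erase.2 ⟨hzQ, hz⟩) x hx]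
  · rw [if_neg hyQ, if_pos hzQ, hzQ, h.lt_left y (Finset.mem_erase.2 ⟨hyQ, hy⟩) x hx]
  · rw [if_neg hyQ, if_neg hzQ, h.lt_iff y (Finset.mem_erase.2 ⟨hyQ, hy⟩) z
      (Finset.mem_erase.2 ⟨hzQ, hz⟩)]

/-- The block `G` is an interval of the new pattern, and contracting it to `x` gives the old pattern
with `x` in the place of `Q`. -/
theorem Dec.inflate {k : ℕ} {u v u' v' : ι → ℕ} {F G : Finset ι} {Q : ι} (h : Dec k u v F)
    (hQ : Q ∈ F) (hu : Set.InjOn u F) (hv : Set.InjOn v F) (hd : Disjoint (F.erase Q) G)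
    (hG : G.Nonempty) (hk : G.card ≤ k) (hB : Baxter u' v' G) (h1 : RankInflate u u' F Q G)
    (h2 : RankInflate v v' F Q G) : Dec k u' v' (F.erase Q ∪ G) := by
  obtain ⟨x, hx⟩ := hG
  have hmem : ∀ p ∈ F.erase Q ∪ G, p ∉ G → p ∈ F.erase Q := fun p hp hpG =>
    (Finset.mem_union.1 hp).resolve_right hpG
  refine .step _ G x ⟨Finset.subset_union_right, ⟨x, hx⟩, fun p hp hpG =>
    h1.apart hu hQ (hmem p hp hpG), fun p hp hpG => h2.apart hv hQ (hmem p hp hpG)⟩ hx hk hB ?_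
  have hxF : x ∉ F.erase Q := fun h => Finset.disjoint_left.1 hd h hx
  have himg : (F.erase Q ∪ G) \ G.erase x = F.image fun z => if z = Q then x else z := by
    ext p
    simp only [Finset.mem_sdiff, Finset.mem_union, Finset.mem_erase, Finset.mem_image]
    constructor
    · rintro ⟨h3 | h3, h4⟩
      · exact ⟨p, h3.2, if_neg h3.1⟩
      · have : p = x := by tauto
        exact ⟨Q, hQ, by rw [if_pos rfl, this]⟩
    · rintro ⟨z, hz, rfl⟩
      split_ifs with hzQ
      · exact ⟨Or.inr hx, by simp⟩
      · exact ⟨Or.inl ⟨hzQ, hz⟩, fun h3 => Finset.disjoint_left.1 hd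
          (Finset.mem_erase.2 ⟨hzQ, hz⟩) h3.2⟩
  rw [himg]
  refine h.image ?_ (h1.replace hx) (h2.replace hx)
  intro y hy z hz hyz
  simp only at hyz
  split_ifs at hyz with h3 h4 h4
  · rw [h3, h4]
  · exact absurd (Finset.mem_erase.2 ⟨h4, hz⟩) (hyz ▸ hxF)
  · exact absurd (Finset.mem_erase.2 ⟨h3, hy⟩) (hyz ▸ hxF)
  · exact hyz

theorem idxOf_append_middle {l₁ l l₂ : List ι} (hn : (l₁ ++ l ++ l₂).Nodup) {x : ι} :
    (x ∈ l₁ → (l₁ ++ l ++ l₂).idxOf x = l₁.idxOf x ∧ l₁.idxOf x < l₁.length) ∧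
    (x ∈ l → (l₁ ++ l ++ l₂).idxOf x = l₁.length + l.idxOf x ∧ l.idxOf x < l.length) ∧
    (x ∈ l₂ → (l₁ ++ l ++ l₂).idxOf x = l₁.length + l.length + l₂.idxOf x) := by
  rw [List.append_assoc] at hn ⊢
  have h1 := (List.nodup_append.1 hn).2.2
  have h2 := (List.nodup_append.1 (List.nodup_append.1 hn).2.1).2.2
  refine ⟨fun h => ⟨List.idxOf_append_of_mem h, List.idxOf_lt_length_iff.2 h⟩,
    fun h => ⟨?_, List.idxOf_lt_length_iff.2 h⟩, fun h => ?_⟩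
  · rw [List.idxOf_append_of_notMem fun g => h1 x g x (by simp [h]) rfl, List.idxOf_append_of_mem h]
  · rw [List.idxOf_append_of_notMem fun g => h1 x g x (by simp [h]) rfl,
      List.idxOf_append_of_notMem fun g => h2 x g x h rfl]
    omega

theorem rankInflate_idxOf {l₁ l l₂ : List ι} {Q : ι} {F G : Finset ι}
    (hn : (l₁ ++ l ++ l₂).Nodup) (hn' : (l₁ ++ Q :: l₂).Nodup)
    (hF : ∀ i, i ∈ l₁ ++ Q :: l₂ ↔ i ∈ F) (hG : ∀ i, i ∈ l ↔ i ∈ G) :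
    RankInflate (l₁ ++ Q :: l₂).idxOf (l₁ ++ l ++ l₂).idxOf F Q G ∧
      ∀ g ∈ G, ∀ g' ∈ G, l.idxOf g < l.idxOf g' ↔
        (l₁ ++ l ++ l₂).idxOf g < (l₁ ++ l ++ l₂).idxOf g' := by
  have e : l₁ ++ Q :: l₂ = l₁ ++ [Q] ++ l₂ := by simp
  rw [e] at hn' hF ⊢
  have a := fun x => idxOf_append_middle hn (x := x)
  have b := fun x => idxOf_append_middle hn' (x := x)
  have bQ := ((b Q).2.1 (by simp)).1
  have hQ : [Q].idxOf Q = 0 := List.idxOf_cons_self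
  rw [hQ] at bQ
  have hx : ∀ x ∈ F.erase Q, x ∈ l₁ ∨ x ∈ l₂ := by
    intro x hx
    obtain ⟨h1, h2⟩ := Finset.mem_erase.1 hx
    have := (hF x).2 h2
    simp only [List.mem_append, List.mem_singleton] at this
    tauto
  have hl : [Q].length = 1 := rfl
  have key : ∀ x ∈ F.erase Q, ((l₁ ++ l ++ l₂).idxOf x = (l₁ ++ [Q] ++ l₂).idxOf x ∧
      (l₁ ++ [Q] ++ l₂).idxOf x < l₁.length) ∨
      ((l₁ ++ l ++ l₂).idxOf x + 1 = (l₁ ++ [Q] ++ l₂).idxOf x + l.length ∧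
      l₁.length < (l₁ ++ [Q] ++ l₂).idxOf x) := by
    intro x h
    rcases hx x h with h | h
    · have a1 := (a x).1 h
      have b1 := (b x).1 h
      left; omega
    · have a1 := (a x).2.2 h
      have b1 := (b x).2.2 h
      right; omega
  refine ⟨⟨fun x h y h' => ?_, fun x h g hg => ?_, fun x h g hg => ?_⟩, fun g hg g' hg' => ?_⟩
  · rcases key x h with k1 | k1 <;> rcases key y h' with k2 | k2 <;> omega
  · have := (a g).2.1 ((hG g).2 hg)
    rcases key x h with k1 | k1 <;> omega
  · have := (a g).2.1 ((hG g).2 hg)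
    rcases key x h with k1 | k1 <;> omega
  · have := (a g).2.1 ((hG g).2 hg)
    have := (a g').2.1 ((hG g').2 hg')
    omega

/-- The deletion orders of a mosaic with another mosaic embedded in the room `Q`. -/
theorem Mos.inflate {B : Rect} {Q : ι} {s t : Finset ι} {R C : ι → Rect}
    {tl bl tlt blt : List ι} (hMs : Mos B s R) (hQ : Q ∈ s) (hMt : Mos (R Q) t C)
    (hdisj : Disjoint (s.erase Q) t) (hC : ∀ i ∈ s.erase Q, C i = R i)
    (hM : Mos B (s.erase Q ∪ t) C) (h1 : TLO B s R tl) (h2 : BLO B s R bl)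
    (h3 : TLO (R Q) t C tlt) (h4 : BLO (R Q) t C blt) :
    ∃ tl' bl', TLO B (s.erase Q ∪ t) C tl' ∧ BLO B (s.erase Q ∪ t) C bl' ∧
      RankInflate tl.idxOf tl'.idxOf s Q t ∧ RankInflate bl.idxOf bl'.idxOf s Q t ∧
      (∀ g ∈ t, ∀ g' ∈ t, tlt.idxOf g < tlt.idxOf g' ↔ tl'.idxOf g < tl'.idxOf g') ∧
      ∀ g ∈ t, ∀ g' ∈ t, blt.idxOf g < blt.idxOf g' ↔ bl'.idxOf g < bl'.idxOf g' := by
  obtain ⟨a₁, a₂, rfl⟩ := List.append_of_mem (h1.mem_iff.2 hQ)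
  obtain ⟨b₁, b₂, rfl⟩ := List.append_of_mem ((TLO.mem_iff h2).2 hQ)
  have e1 := TLO.inflate hMs hMt hdisj hC hM h1 h3
  have e2 := BLO.inflate hMs hMt hdisj hC hM h2 h4
  have r1 := rankInflate_idxOf (F := s) (G := t) e1.nodup h1.nodup (fun i => h1.mem_iff)
    fun i => h3.mem_iff
  have r2 := rankInflate_idxOf (F := s) (G := t) (TLO.nodup e2) (TLO.nodup h2)
    (fun i => TLO.mem_iff h2) fun i => TLO.mem_iff h4
  exact ⟨_, _, e1, e2, r1.1, r2.1, r1.2, r2.2⟩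

/-! ### Set mosaics and indexed mosaics -/

theorem IsMosaic.mos {B : Rect} {F : Set Rect} (h : IsMosaic B F) {s : Finset Rect}
    (hs : (s : Set Rect) = F) : Mos B s id := by
  subst hs
  have hsub : ∀ P ∈ s, P.region ⊆ B.region := by
    intro P hP
    rw [← h.cover]
    exact Set.subset_biUnion_of_mem (u := Rect.region) hP
  have hlb : ∀ P ∈ s, B.left ≤ P.left ∧ B.bottom ≤ P.bottom := by
    intro P hP
    obtain ⟨p1, p2⟩ := h.proper P hP
    have : (P.left, P.bottom) ∈ B.region :=
      hsub P hP ⟨⟨le_rfl, p1.le⟩, ⟨le_rfl, p2.le⟩⟩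
    exact ⟨this.1.1, this.2.1⟩
  have hrt : ∀ P ∈ s, P.right ≤ B.right ∧ P.top ≤ B.top := by
    intro P hP
    obtain ⟨p1, p2⟩ := h.proper P hP
    have : (P.right, P.top) ∈ B.region :=
      hsub P hP ⟨⟨p1.le, le_rfl⟩, ⟨p2.le, le_rfl⟩⟩
    exact ⟨this.1.2, this.2.2⟩
  refine ⟨h.proper_box.1, h.proper_box.2, fun P hP => (h.proper P hP).1,
    fun P hP => (h.proper P hP).2, fun P hP => (hlb P hP).1, fun P hP => (hrt P hP).1,
    fun P hP => (hlb P hP).2, fun P hP => (hrt P hP).2, fun P hP Q hQ hPQ => ?_,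
    fun x y h1 h2 h3 h4 => ?_, fun x y i hi j hj k hk l hl c1 c2 c3 c4 => ?_⟩
  · by_contra hc
    simp only [not_or, not_le, id] at hc
    obtain ⟨c1, c2, c3, c4⟩ := hc
    obtain ⟨p1, p2⟩ := h.proper P hP
    obtain ⟨q1, q2⟩ := h.proper Q hQ
    obtain ⟨x, x1, x2⟩ := exists_between (show max P.left Q.left < min P.right Q.right from
      max_lt (lt_min p1 c2) (lt_min c1 q1))
    obtain ⟨y, y1, y2⟩ := exists_between (show max P.bottom Q.bottom < min P.top Q.top from
      max_lt (lt_min p2 c4) (lt_min c3 q2))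
    rw [max_lt_iff] at x1 y1
    rw [lt_min_iff] at x2 y2
    have hd : Disjoint P.inner Q.inner := h.disjoint hP hQ hPQ
    exact Set.disjoint_left.1 hd (show (x, y) ∈ P.inner from ⟨⟨x1.1, x2.1⟩, ⟨y1.1, y2.1⟩⟩)
      ⟨⟨x1.2, x2.2⟩, ⟨y1.2, y2.2⟩⟩
  · have : (x, y) ∈ B.region := ⟨⟨h1.le, h2.le⟩, ⟨h3.le, h4.le⟩⟩
    rw [← h.cover] at this
    simp only [Set.mem_iUnion, Finset.mem_coe] at this
    obtain ⟨P, hP, hxy⟩ := this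
    exact ⟨P, hP, hxy.1.1, hxy.1.2, hxy.2.1, hxy.2.2⟩
  · exact h.no_cross ⟨x, y, i, hi, j, hj, k, hk, l, hl, c1, c2, c3, c4⟩

theorem Mos.injOn {B : Rect} {s : Finset ι} {R : ι → Rect} (h : Mos B s R) : Set.InjOn R s := by
  intro i hi j hj hij
  have h1 := h.proper_x i hi
  have h2 := h.proper_y i hi
  apply h.eq_of_overlap hi hj <;> rw [← hij] <;> assumption

theorem Mos.isMosaic {B : Rect} {s : Finset ι} {R : ι → Rect} (h : Mos B s R) :
    IsMosaic B (R '' s) := by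
  refine ⟨⟨h.box_x, h.box_y⟩, s.finite_toSet.image R, ?_, ?_, ?_, ?_⟩
  · rintro _ ⟨i, hi, rfl⟩
    exact ⟨h.proper_x i hi, h.proper_y i hi⟩
  · rintro _ ⟨i, hi, rfl⟩ _ ⟨j, hj, rfl⟩ hij
    refine Set.disjoint_left.2 fun p hp hq => hij ?_
    rw [h.eq_of_overlap hi hj (hp.1.1.trans hq.1.2) (hq.1.1.trans hp.1.2) (hp.2.1.trans hq.2.2)
      (hq.2.1.trans hp.2.2)]
  · refine Set.Subset.antisymm ?_ ?_
    · intro p hp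
      simp only [Set.mem_iUnion, Set.mem_image, Finset.mem_coe, exists_prop] at hp
      obtain ⟨_, ⟨i, hi, rfl⟩, hp⟩ := hp
      exact ⟨⟨(h.left_le i hi).trans hp.1.1, hp.1.2.trans (h.right_le i hi)⟩,
        ⟨(h.bottom_le i hi).trans hp.2.1, hp.2.2.trans (h.top_le i hi)⟩⟩
    · rintro ⟨x, y⟩ ⟨⟨x1, x2⟩, ⟨y1, y2⟩⟩
      simp only at x1 x2 y1 y2
      have hx := h.box_x
      have hy := h.box_y
      suffices ∃ i ∈ s, (R i).left ≤ x ∧ x ≤ (R i).right ∧ (R i).bottom ≤ y ∧ y ≤ (R i).top by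
        obtain ⟨i, hi, h1, h2, h3, h4⟩ := this
        exact Set.mem_biUnion (Set.mem_image_of_mem R hi) ⟨⟨h1, h2⟩, ⟨h3, h4⟩⟩
      -- For a point on the right or upper edge of the box, the room has to be sought on the other
      -- side of the point.
      rcases x2.lt_or_eq with x2 | rfl <;> rcases y2.lt_or_eq with y2 | rfl
      · obtain ⟨i, hi, h1, h2, h3, h4⟩ := h.north_east x1 x2 y1 y2
        exact ⟨i, hi, h1, h2.le, h3, h4.le⟩
      · obtain ⟨i, hi, h1, h2, h3, h4⟩ := h.south_east x1 x2 hy le_rfl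
        exact ⟨i, hi, h1, h2.le, h3.le, h4⟩
      · obtain ⟨i, hi, h1, h2, h3, h4⟩ := h.north_west hx le_rfl y1 y2
        exact ⟨i, hi, h1.le, h2, h3, h4.le⟩
      · obtain ⟨i, hi, h1, h2, h3, h4⟩ := h.south_west hx le_rfl hy le_rfl
        exact ⟨i, hi, h1.le, h2, h3.le, h4⟩
  · rintro ⟨x, y, _, ⟨i, hi, rfl⟩, _, ⟨j, hj, rfl⟩, _, ⟨k, hk, rfl⟩, _, ⟨l, hl, rfl⟩,
      c1, c2, c3, c4⟩
    exact h.no_cross x y i hi j hj k hk l hl c1 c2 c3 c4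

theorem IsHFO.isMosaic {k : ℕ} {B : Rect} {F : Set Rect} (h : IsHFO k B F) : IsMosaic B F := by
  cases h with
  | box h => exact h
  | embed F Q G _ _ _ _ h => exact h

open Classical in
/-- The label of a hierarchical floorplan of order `k` is decomposable. -/
theorem IsHFO.dec {k : ℕ} {B : Rect} {F : Set Rect} (h : IsHFO k B F) :
    ∀ {s : Finset Rect} {tl bl : List Rect}, (s : Set Rect) = F → TLO B s id tl → BLO B s id bl →
      Dec k bl.idxOf tl.idxOf s := by
  induction h with
  | box _ =>
    intro s tl bl hs _ _
    have : s = {B} := by rw [← Finset.coe_inj, hs, Finset.coe_singleton]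
    rw [this]
    exact .single B
  | embed F Q G hF hQ hG hk hFG ih =>
    intro s tl bl hs htl hbl
    obtain ⟨f, rfl⟩ := hF.isMosaic.finite.exists_finset_coe
    obtain ⟨t, rfl⟩ := hG.finite.exists_finset_coe
    have hMf := hF.isMosaic.mos rfl
    have hMt : Mos (id Q) t id := hG.mos rfl
    have hsf : s = f.erase Q ∪ t := by
      rw [← Finset.coe_inj, hs]
      simp
    subst hsf
    have hM : Mos B (f.erase Q ∪ t) id := hFG.mos hs
    -- Rooms are rectangles here, so a new room might coincide with an old one; this is impossible
    -- since it lies inside `Q`, which the other old rooms do not overlap.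
    have hdisj : Disjoint (f.erase Q) t := by
      refine Finset.disjoint_left.2 fun P hP hPt => ?_
      obtain ⟨h1, h2⟩ := Finset.mem_erase.1 hP
      have := hMt.proper_x P hPt
      have := hMt.proper_y P hPt
      have := hMt.left_le P hPt
      have := hMt.right_le P hPt
      have := hMt.top_le P hPt
      have := hMt.bottom_le P hPt
      simp only [id] at *
      exact h1 (hMf.eq_of_overlap h2 hQ (by simp only [id]; linarith) (by simp only [id]; linarith)
        (by simp only [id]; linarith) (by simp only [id]; linarith))
    obtain ⟨tlf, htlf⟩ := TLO.exists_of_mos hMf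
    obtain ⟨blf, hblf⟩ := BLO.exists_of_mos hMf
    obtain ⟨tlt, htlt⟩ := TLO.exists_of_mos hMt
    obtain ⟨blt, hblt⟩ := BLO.exists_of_mos hMt
    obtain ⟨tl', bl', h1, h2, h3, h4, h5, h6⟩ := hMf.inflate hQ hMt hdisj (fun _ _ => rfl) hM
      htlf hblf htlt hblt
    rw [TLO.unique hM htl h1, BLO.unique hM hbl h2]
    rw [Set.ncard_coe_finset] at hk
    refine (ih rfl htlf hblf).inflate hQ (idxOf_injOn fun i => (TLO.mem_iff hblf).2)
      (idxOf_injOn fun i => htlf.mem_iff.2) hdisj hMt.nonempty hk ?_ h4 h3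
    have := (hMt.label htlt hblt).1.image (u' := bl'.idxOf) (v' := tl'.idxOf) (g := id)
      h6 h5
    simpa using this

/-! ### Realisation of Baxter patterns -/

/-- This reverses the deletion at a `⊣`: a flat room `b` is laid along the upper boundary, from the
left boundary to the right edge of `p`, and the rooms under it are lowered. Its height `ε` is so
small that no bottom edge and no other top edge is reached. -/
theorem Mos.exists_insert_up {B : Rect} {T : Finset ι} {R' : ι → Rect} (h : Mos B T R') {b p : ι}
    (hb : b ∉ T) (hp : p ∈ T) (hpt : (R' p).top = B.top) :
    ∃ R, Mos B (insert b T) R ∧ IsTL B (insert b T) R b ∧ (R p).top = (R b).bottom ∧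
      (R p).right = (R b).right ∧ ∀ i ∈ T, HFO.growUp B R b i = R' i := by
  -- Only the gap below `B.top` is used; the abscissa `0` is arbitrary.
  obtain ⟨ε, hε, hgap, -, -, hBb, -⟩ := exists_gap B T R' 0 B.top
  have hy0 := hBb h.box_y
  set y₀ := B.top - ε with hy₀
  have hyt : y₀ < B.top := by linarith
  have hbot : ∀ i ∈ T, (R' i).bottom < y₀ := by
    intro i hi
    have := h.proper_y i hi
    have := h.top_le i hi
    rcases (hgap i hi).2.2.1 with g | g | g <;> linarith
  have htop : ∀ i ∈ T, (R' i).top = B.top ∨ (R' i).top < y₀ := by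
    intro i hi
    have := h.top_le i hi
    rcases (hgap i hi).2.2.2 with g | g | g
    · exact Or.inr g
    · exact Or.inl g
    · linarith
  classical
  let R : ι → Rect := fun i => if i = b then ⟨B.left, (R' p).right, y₀, B.top⟩ else
    if (R' i).top = B.top ∧ (R' i).right ≤ (R' p).right then { R' i with top := y₀ } else R' i
  have hRb : R b = ⟨B.left, (R' p).right, y₀, B.top⟩ := if_pos rfl
  have hne : ∀ i ∈ T, i ≠ b := by rintro i hi rfl; exact hb hi
  have hRi : ∀ i ∈ T, (R i).left = (R' i).left ∧ (R i).right = (R' i).right ∧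
      (R i).bottom = (R' i).bottom := by
    intro i hi
    simp only [R, if_neg (hne i hi)]
    split_ifs <;> exact ⟨rfl, rfl, rfl⟩
  have hRt : ∀ i ∈ T, (R i).top =
      if (R' i).top = B.top ∧ (R' i).right ≤ (R' p).right then y₀ else (R' i).top := by
    intro i hi
    simp only [R, if_neg (hne i hi)]
    split_ifs <;> rfl
  have hRt' : ∀ i ∈ T, (R i).top ≤ (R' i).top := by
    intro i hi
    rw [hRt i hi]
    split_ifs with g
    · linarith [g.1]
    · exact le_rfl
  have hpl := h.left_le p hp
  have hpx := h.proper_x p hp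
  have hpr := h.right_le p hp
  have hpy := h.proper_y p hp
  have hbi : ∀ i ∈ T, (R' p).right ≤ (R i).left ∨ (R i).top ≤ y₀ := by
    intro i hi
    rw [hRt i hi, (hRi i hi).1]
    split_ifs with g
    · exact Or.inr le_rfl
    · rcases htop i hi with g' | g'
      · left
        by_contra g2
        have := h.proper_x i hi
        have := h.proper_y i hi
        have hlt : (R' p).right < (R' i).right := by
          by_contra g3
          exact g ⟨g', not_lt.1 g3⟩
        have := h.eq_of_overlap hi hp (by linarith) (by linarith) (by linarith) (by linarith)
        subst this
        exact hlt.false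
      · exact Or.inr g'.le
  refine ⟨R, ⟨h.box_x, h.box_y, ?_, ?_, ?_, ?_, ?_, ?_, ?_, ?_, ?_⟩,
    ⟨Finset.mem_insert_self b T, by rw [hRb], by rw [hRb]⟩, ?_, ?_, ?_⟩
  · rw [Finset.forall_mem_insert, hRb]
    refine ⟨by simp only; linarith, fun i hi => ?_⟩
    rw [(hRi i hi).1, (hRi i hi).2.1]
    exact h.proper_x i hi
  · rw [Finset.forall_mem_insert, hRb]
    refine ⟨hyt, fun i hi => ?_⟩
    rw [(hRi i hi).2.2, hRt i hi]
    split_ifs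
    · exact hbot i hi
    · exact h.proper_y i hi
  · rw [Finset.forall_mem_insert, hRb]
    refine ⟨le_rfl, fun i hi => ?_⟩
    rw [(hRi i hi).1]
    exact h.left_le i hi
  · rw [Finset.forall_mem_insert, hRb]
    refine ⟨hpr, fun i hi => ?_⟩
    rw [(hRi i hi).2.1]
    exact h.right_le i hi
  · rw [Finset.forall_mem_insert, hRb]
    refine ⟨hy0.le, fun i hi => ?_⟩
    rw [(hRi i hi).2.2]
    exact h.bottom_le i hi
  · rw [Finset.forall_mem_insert, hRb]
    exact ⟨le_rfl, fun i hi => (hRt' i hi).trans (h.top_le i hi)⟩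
  · intro i hi j hj hij
    rcases Finset.mem_insert.1 hi with rfl | hiT <;> rcases Finset.mem_insert.1 hj with rfl | hjT
    · exact absurd rfl hij
    · rw [hRb]
      have := hbi j hjT
      simp only
      tauto
    · rw [hRb]
      have := hbi i hiT
      simp only
      tauto
    · rw [(hRi i hiT).1, (hRi i hiT).2.1, (hRi i hiT).2.2, (hRi j hjT).1, (hRi j hjT).2.1,
        (hRi j hjT).2.2]
      have h1 := hRt' i hiT
      have h2 := hRt' j hjT
      rcases h.disj i hiT j hjT hij with g | g | g | g
      · exact Or.inl g
      · exact Or.inr (Or.inl g)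
      · exact Or.inr (Or.inr (Or.inl (h1.trans g)))
      · exact Or.inr (Or.inr (Or.inr (h2.trans g)))
  · intro x y h1 h2 h3 h4
    by_cases hxy : x ≤ (R' p).right ∧ y₀ ≤ y
    · exact ⟨b, Finset.mem_insert_self b T, by rw [hRb]; exact ⟨h1.le, hxy.1, hxy.2, h4.le⟩⟩
    · obtain ⟨i, hi, i1, i2, i3, i4⟩ := h.cover x y h1 h2 h3 h4
      refine ⟨i, Finset.mem_insert_of_mem hi, ?_⟩
      rw [(hRi i hi).1, (hRi i hi).2.1, (hRi i hi).2.2, hRt i hi]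
      refine ⟨i1, i2, i3, ?_⟩
      split_ifs with g
      · by_contra g'
        exact hxy ⟨i2.trans g.2, (not_le.1 g').le⟩
      · exact i4
  · intro x y i hi j hj k hk l hl c1 c2 c3 c4
    have hbb : ∀ i ∈ insert b T, (R i).bottom = y → i = b ∨ i ∈ T ∧ y < y₀ := by
      intro i hi hy
      rcases Finset.mem_insert.1 hi with rfl | hi
      · exact Or.inl rfl
      · rw [(hRi i hi).2.2] at hy
        exact Or.inr ⟨hi, hy ▸ hbot i hi⟩
    have hyb : (R b).bottom = y₀ := by rw [hRb]
    rcases hbb i hi c1.2 with rfl | ⟨hiT, hy⟩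
    · rcases hbb j hj c2.2 with rfl | ⟨hjT, hy⟩
      · have := c1.1.trans c2.1.symm
        rw [hRb] at this
        simp only at this
        linarith
      · rw [hyb] at c1
        linarith [c1.2]
    rcases hbb j hj c2.2 with rfl | ⟨hjT, -⟩
    · rw [hyb] at c2
      linarith [c2.2]
    have htt : ∀ k ∈ insert b T, (R k).top = y → k ∈ T ∧ (R' k).top = y := by
      intro k hk hky
      rcases Finset.mem_insert.1 hk with rfl | hk
      · rw [hRb] at hky
        simp only at hky
        linarith
      · refine ⟨hk, ?_⟩
        rw [hRt k hk] at hky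
        split_ifs at hky with g
        · linarith
        · exact hky
    obtain ⟨hkT, k1⟩ := htt k hk c3.2
    obtain ⟨hlT, l1⟩ := htt l hl c4.2
    rw [(hRi i hiT).2.1, (hRi i hiT).2.2] at c1
    rw [(hRi j hjT).1, (hRi j hjT).2.2] at c2
    exact h.no_cross x y i hiT j hjT k hkT l hlT c1 c2 ⟨(hRi k hkT).2.1 ▸ c3.1, k1⟩
      ⟨(hRi l hlT).1 ▸ c4.1, l1⟩
  · rw [hRt p hp, if_pos ⟨hpt, le_rfl⟩, hRb]
  · rw [(hRi p hp).2.1, hRb]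
  · intro i hi
    ext
    · rw [growUp_left, (hRi i hi).1]
    · rw [growUp_right, (hRi i hi).2.1]
    · rw [growUp_bottom, (hRi i hi).2.2]
    · rw [growUp_top, hRt i hi, (hRi i hi).2.1, hRb]
      simp only
      by_cases g : (R' i).top = B.top ∧ (R' i).right ≤ (R' p).right
      · rw [if_pos g, if_pos ⟨rfl, g.2⟩, g.1]
      · rw [if_neg g, if_neg]
        rintro ⟨g1, g2⟩
        rcases htop i hi with g3 | g3
        · exact g ⟨g3, g2⟩
        · linarith

theorem Mos.exists_insert_left {B : Rect} {T : Finset ι} {R' : ι → Rect} (h : Mos B T R') {b p : ι}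
    (hb : b ∉ T) (hp : p ∈ T) (hpl : (R' p).left = B.left) :
    ∃ R, Mos B (insert b T) R ∧ IsTL B (insert b T) R b ∧ (R p).left = (R b).right ∧
      (R p).bottom = (R b).bottom ∧ ∀ i ∈ T, HFO.growLeft B R b i = R' i := by
  obtain ⟨R, h1, h2, h3, h4, h5⟩ := h.diag.exists_insert_up hb hp (congrArg Neg.neg hpl)
  refine ⟨fun i => (R i).diag, by simpa using h1.diag, by simpa using h2.diag,
    congrArg Neg.neg h3, congrArg Neg.neg h4, fun i hi => ?_⟩
  have := growUp_diag B (fun i => (R i).diag) b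
  simp only [Rect.diag_diag] at this
  have h6 := h5 i hi
  rw [this] at h6
  rw [← Rect.diag_diag (R' i), ← h6, Rect.diag_diag]

end Inflation
end HFO

namespace HFO

/-! ### Floorplans with prescribed deletion orders -/

section Realisation

set_option linter.unusedSectionVars false

variable {ι κ : Type*} [DecidableEq ι] [DecidableEq κ]

/-- The deletion orders of the mosaic are given by the rank functions `u` (bottom-left order) and
`v` (top-left order). -/
def HasLabel (B : Rect) (S : Finset ι) (R : ι → Rect) (u v : ι → ℕ) : Prop :=
  ∃ tl bl, TLO B S R tl ∧ BLO B S R bl ∧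
    (∀ x ∈ S, ∀ y ∈ S, u x < u y ↔ bl.idxOf x < bl.idxOf y) ∧
    ∀ x ∈ S, ∀ y ∈ S, v x < v y ↔ tl.idxOf x < tl.idxOf y

theorem Mos.single {B : Rect} (hx : B.left < B.right) (hy : B.bottom < B.top) (b : ι) :
    Mos B {b} fun _ => B where
  box_x := hx
  box_y := hy
  proper_x _ _ := hx
  proper_y _ _ := hy
  left_le _ _ := le_rfl
  right_le _ _ := le_rfl
  bottom_le _ _ := le_rfl
  top_le _ _ := le_rfl
  disj i hi j hj hij := by
    rw [Finset.mem_singleton] at hi hj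
    exact absurd (hi.trans hj.symm) hij
  cover x y h1 h2 h3 h4 := ⟨b, Finset.mem_singleton_self b, h1.le, h2.le, h3.le, h4.le⟩
  no_cross x y i hi j hj k hk l hl c1 c2 c3 c4 := by linarith [c1.1, c2.1]

theorem hasLabel_single (B : Rect) (b : ι) (R : ι → Rect) (u v : ι → ℕ) :
    HasLabel B {b} R u v := by
  refine ⟨[b], [b], .single b R, BLO.single B b R, ?_, ?_⟩ <;>
  · intro x hx y hy
    rw [Finset.mem_singleton] at hx hy
    subst hx
    subst hy
    simp

theorem rank_insert {u : ι → ℕ} {S : Finset ι} {b : ι} {A C : List ι} (hu : Set.InjOn u S)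
    (hb : b ∈ S) (hbA : b ∉ A)
    (hT : ∀ x ∈ S.erase b, ∀ y ∈ S.erase b, u x < u y ↔ (A ++ C).idxOf x < (A ++ C).idxOf y)
    (hlt : ∀ y ∈ S.erase b, u y < u b ↔ (A ++ C).idxOf y < A.length) :
    ∀ x ∈ S, ∀ y ∈ S, u x < u y ↔ (A ++ b :: C).idxOf x < (A ++ b :: C).idxOf y := by
  have ub : (A ++ b :: C).idxOf b = A.length := idxOf_insert_self hbA
  have ux : ∀ x, x ≠ b → (A ++ b :: C).idxOf x =
    if (A ++ C).idxOf x < A.length then (A ++ C).idxOf x else (A ++ C).idxOf x + 1 :=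
    fun x hx => idxOf_insert hx
  intro x hx y hy
  by_cases hxb : x = b <;> by_cases hyb : y = b
  · rw [hxb, hyb]; simp
  · have h1 := hlt y (Finset.mem_erase.2 ⟨hyb, hy⟩)
    have h2 : u y ≠ u b := fun h => hyb (hu hy hb h)
    rw [hxb, ub, ux y hyb]
    split_ifs with g
    · have := h1.2 g; omega
    · have := mt h1.1 g; omega
  · have h1 := hlt x (Finset.mem_erase.2 ⟨hxb, hx⟩)
    rw [hyb, ub, ux x hxb, h1]
    split_ifs <;> omega
  · rw [hT x (Finset.mem_erase.2 ⟨hxb, hx⟩) y (Finset.mem_erase.2 ⟨hyb, hy⟩), ux x hxb, ux y hyb]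
    split_ifs <;> omega

/-- Every Baxter pattern is the label of a mosaic. -/
theorem Baxter.exists_mos {B : Rect} (hx : B.left < B.right) (hy : B.bottom < B.top)
    {u v : ι → ℕ} {S : Finset ι} (hS : S.Nonempty) (hu : Set.InjOn u S) (hv : Set.InjOn v S)
    (h : Baxter u v S) : ∃ R, Mos B S R ∧ HasLabel B S R u v := by
  induction hn : S.card using Nat.strong_induction_on generalizing S with
  | _ n ih =>
    subst hn
    by_cases h1 : S.card = 1
    · obtain ⟨b, rfl⟩ := Finset.card_eq_one.1 h1
      exact ⟨_, .single hx hy b, hasLabel_single _ _ _ _ _⟩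
    have h2 : 2 ≤ S.card := by have := hS.card_pos; omega
    obtain ⟨b, hb, hbmin⟩ := S.exists_min_image v hS
    have hmin : ∀ e ∈ S, e ≠ b → v b < v e := fun e he heb =>
      lt_of_le_of_ne (hbmin e he) fun g => heb (hv hb he g).symm
    have hTS : ∀ x ∈ S.erase b, x ∈ S := fun x hx => Finset.mem_of_mem_erase hx
    have hcard : (S.erase b).card < S.card := Finset.card_erase_lt_of_mem hb
    obtain ⟨R', hM', tl', bl', htl', hbl', ru, rv⟩ := ih _ hcard
      (Finset.card_pos.1 (by rw [Finset.card_erase_of_mem hb]; omega)) (hu.mono hTS) (hv.mono hTS)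
      (h.erase_min hmin) rfl
    obtain ⟨-, hT, hL⟩ := hM'.label htl' hbl'
    have hbT : b ∉ S.erase b := Finset.notMem_erase b S
    have hins : insert b (S.erase b) = S := Finset.insert_erase hb
    have hnd := TLO.nodup hbl'
    have rv' : ∀ x ∈ S, ∀ y ∈ S, v x < v y ↔ ([] ++ b :: tl').idxOf x < ([] ++ b :: tl').idxOf y := by
      refine rank_insert hv hb (by simp) rv fun y hy => ?_
      have := hmin y (hTS y hy) (Finset.ne_of_mem_erase hy)
      simp only [List.length_nil, Nat.not_lt_zero, iff_false]
      omega
    -- The minimum `b` stands next to a right-to-left or left-to-right minimum `p` of the other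
    -- points. By `Mos.label` the room of `p` touches the upper or the left boundary, so a top left
    -- room can be inserted there, and it takes the place next to `p` in the bottom-left order.
    rcases h.afterMin hu hv hb h2 hmin with ⟨p, hp, p1, p2, p3⟩ | ⟨p, hp, p1, p2, p3⟩
    · have hpb : p ≠ b := by rintro rfl; exact p1.false
      have hpT := Finset.mem_erase.2 ⟨hpb, hp⟩
      have hpt : (R' p).top = B.top := by
        rw [hT p hpT]
        intro r hr hlt
        rw [← ru p hpT r hr] at hlt
        rw [← rv p hpT r hr]
        exact p3 r (hTS r hr) (Finset.ne_of_mem_erase hr) hlt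
      obtain ⟨R, hM, hTL, e1, e2, e3⟩ := hM'.exists_insert_up hbT hpT hpt
      rw [hins] at hM hTL
      obtain ⟨l₁, l₂, rfl, hbl⟩ := BLO.insert_tee hM hTL hp e1 e2 (hbl'.congr e3)
      have hpl : p ∉ l₁ := fun g => (List.nodup_append.1 hnd).2.2 p g p List.mem_cons_self rfl
      have ip : (l₁ ++ p :: l₂).idxOf p = l₁.length := idxOf_insert_self hpl
      have htl : TLO B S R (b :: tl') := .delete _ _ _ _ hTL h2 (by
        rw [delTL_of_tee ⟨p, hp, e1, e2⟩]; exact htl'.congr e3)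
      refine ⟨R, hM, b :: tl', _, htl, hbl, ?_, rv'⟩
      have hA : l₁ ++ p :: b :: l₂ = (l₁ ++ [p]) ++ b :: l₂ := by simp
      have hA' : l₁ ++ p :: l₂ = (l₁ ++ [p]) ++ l₂ := by simp
      have hnd2 := TLO.nodup hbl
      rw [hA] at hnd2 ⊢
      rw [hA'] at ru ip
      refine rank_insert hu hb (fun g => (List.nodup_append.1 hnd2).2.2 b g b
        List.mem_cons_self rfl) ru fun y hy => ?_
      have h3 := ru y hy p hpT
      have h4 := p2 y (hTS y hy)
      rw [ip] at h3
      rw [List.length_append, List.length_singleton]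
      constructor
      · intro g
        rcases h4 g with rfl | g'
        · omega
        · have := h3.1 g'; omega
      · intro g
        by_cases hyp : y = p
        · rw [hyp]; exact p1
        · have : (l₁ ++ [p] ++ l₂).idxOf y ≠ (l₁ ++ [p] ++ l₂).idxOf p := by
            intro h5
            rw [← hA'] at h5
            exact hyp ((List.idxOf_inj ((TLO.mem_iff hbl').2 hy)).1 h5)
          exact (h3.2 (by omega)).trans p1
    · have p1' : u b < u p := p1
      have hpb : p ≠ b := by rintro rfl; exact p1'.false
      have hpT := Finset.mem_erase.2 ⟨hpb, hp⟩
      have hpt : (R' p).left = B.left := by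
        rw [hL p hpT]
        intro r hr hlt
        rw [← ru r hr p hpT] at hlt
        rw [← rv p hpT r hr]
        exact p3 r (hTS r hr) (Finset.ne_of_mem_erase hr) hlt
      obtain ⟨R, hM, hTL, e1, e2, e3⟩ := hM'.exists_insert_left hbT hpT hpt
      rw [hins] at hM hTL
      obtain ⟨l₁, l₂, rfl, hbl⟩ := BLO.insert_perp hM hTL hp e1 e2 (hbl'.congr e3)
      have hpl : p ∉ l₁ := fun g => (List.nodup_append.1 hnd).2.2 p g p List.mem_cons_self rfl
      have ip : (l₁ ++ p :: l₂).idxOf p = l₁.length := idxOf_insert_self hpl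
      have hperp : Perp S R b := ⟨p, hp, e1, e2⟩
      have htl : TLO B S R (b :: tl') := .delete _ _ _ _ hTL h2 (by
        rw [delTL_of_not_tee ((hM.perp_iff_not_tee hTL h2).1 hperp)]; exact htl'.congr e3)
      refine ⟨R, hM, b :: tl', _, htl, hbl, ?_, rv'⟩
      have hnd2 := TLO.nodup hbl
      refine rank_insert hu hb (fun g => (List.nodup_append.1 hnd2).2.2 b g b
        List.mem_cons_self rfl) ru fun y hy => ?_
      have h3 := ru y hy p hpT
      rw [ip] at h3
      rw [← h3]
      refine ⟨fun g => g.trans p1', fun g => ?_⟩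
      by_contra g'
      have hne : u y ≠ u b := fun e => Finset.ne_of_mem_erase hy (hu (hTS y hy) hb e)
      rcases p2 y (hTS y hy) (show u b < u y by omega) with rfl | g2
      · exact g.false
      · exact absurd g (not_lt.2 (le_of_lt (show u p < u y from g2)))

/-! ### Embedding in general position -/

/-- A change of coordinates of an interval that avoids finitely many values. -/
theorem exists_generic_map {l r : ℝ} (hlr : l < r) (Z bad : Finset ℝ) :
    ∃ f : ℝ → ℝ, StrictMonoOn f (Set.Icc l r) ∧ f l = l ∧ f r = r ∧
      ∀ z ∈ Z, l < z → z < r → f z ∉ bad := by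
  -- The map is `z + t (z - l) (r - z)`, which fixes `l` and `r` and is increasing between them if
  -- `0 < t < 1 / (r - l)`. For an inner `z` and a bad value, only one `t` sends `z` to this value,
  -- so finitely many parameters are excluded.
  have hinf : (Set.Ioo (0 : ℝ) (1 / (r - l))).Infinite := Set.Ioo_infinite (by
    have := sub_pos.2 hlr; positivity)
  obtain ⟨t, ⟨ht0, ht1⟩, ht⟩ := (hinf.sdiff ((Z ×ˢ bad).image fun p =>
    (p.2 - p.1) / ((p.1 - l) * (r - p.1))).finite_toSet).nonempty
  have hd : 0 < r - l := sub_pos.2 hlr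
  have ht1' : t * (r - l) < 1 := by rwa [lt_div_iff₀ hd] at ht1
  refine ⟨fun z => z + t * ((z - l) * (r - z)), ?_, by simp, by simp, fun z hz h1 h2 hbad => ht ?_⟩
  · intro w hw z hz hwz
    have e : (z + t * ((z - l) * (r - z))) - (w + t * ((w - l) * (r - w))) =
        (z - w) * (1 + t * (l + r - z - w)) := by ring
    have h1 : -(r - l) ≤ l + r - z - w := by linarith [hw.2, hz.2]
    have h2 : t * -(r - l) ≤ t * (l + r - z - w) := mul_le_mul_of_nonneg_left h1 ht0.le
    have h3 : 0 < (z - w) * (1 + t * (l + r - z - w)) :=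
      mul_pos (sub_pos.2 hwz) (by linarith)
    simp only
    linarith
  · rw [Finset.mem_coe, Finset.mem_image]
    refine ⟨(z, _), Finset.mem_product.2 ⟨hz, hbad⟩, ?_⟩
    have h3 : z - l ≠ 0 := by linarith
    have h4 : r - z ≠ 0 := by linarith
    field_simp
    ring

/-- Embedding a mosaic in a room `Q` in general position. -/
theorem Mos.embed {B : Rect} {Q : ι} {s t : Finset ι} {R C : ι → Rect} (hMs : Mos B s R)
    (hQ : Q ∈ s) (hMt : Mos (R Q) t C) (hC : ∀ i ∈ s.erase Q, C i = R i)
    (hl : ∀ i ∈ t, ∀ j ∈ s, (C i).left = (R j).left ∨ (C i).left = (R j).right →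
      (C i).left = (R Q).left)
    (hr : ∀ i ∈ t, ∀ j ∈ s, (C i).right = (R j).left ∨ (C i).right = (R j).right →
      (C i).right = (R Q).right)
    (hb : ∀ i ∈ t, ∀ j ∈ s, (C i).bottom = (R j).bottom ∨ (C i).bottom = (R j).top →
      (C i).bottom = (R Q).bottom)
    (ht : ∀ i ∈ t, ∀ j ∈ s, (C i).top = (R j).bottom ∨ (C i).top = (R j).top →
      (C i).top = (R Q).top) : Mos B (s.erase Q ∪ t) C := by
  have hor : ∀ i ∈ s.erase Q ∪ t, (i ∈ s ∧ i ≠ Q ∧ C i = R i) ∨ i ∈ t := by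
    intro i hi
    rcases Finset.mem_union.1 hi with h | h
    · have := Finset.mem_erase.1 h
      exact Or.inl ⟨this.2, this.1, hC i h⟩
    · exact Or.inr h
  have ql := hMs.left_le Q hQ
  have qr := hMs.right_le Q hQ
  have qb := hMs.bottom_le Q hQ
  have qt := hMs.top_le Q hQ
  have key : ∀ i ∈ s, i ≠ Q → ∀ j ∈ t, (R i).right ≤ (C j).left ∨ (C j).right ≤ (R i).left ∨
      (R i).top ≤ (C j).bottom ∨ (C j).top ≤ (R i).bottom := by
    intro i hi hiQ j hj
    have := hMt.left_le j hj
    have := hMt.right_le j hj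
    have := hMt.bottom_le j hj
    have := hMt.top_le j hj
    rcases hMs.disj i hi Q hQ hiQ with g | g | g | g
    · left; linarith
    · right; left; linarith
    · right; right; left; linarith
    · right; right; right; linarith
  refine ⟨hMs.box_x, hMs.box_y, fun i hi => ?_, fun i hi => ?_, fun i hi => ?_, fun i hi => ?_,
    fun i hi => ?_, fun i hi => ?_, fun i hi j hj hij => ?_, fun x y h1 h2 h3 h4 => ?_,
    fun x y i hi j hj k hk l hl' c1 c2 c3 c4 => ?_⟩
  · rcases hor i hi with ⟨h, -, e⟩ | h
    · rw [e]; exact hMs.proper_x i h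
    · exact hMt.proper_x i h
  · rcases hor i hi with ⟨h, -, e⟩ | h
    · rw [e]; exact hMs.proper_y i h
    · exact hMt.proper_y i h
  · rcases hor i hi with ⟨h, -, e⟩ | h
    · rw [e]; exact hMs.left_le i h
    · exact ql.trans (hMt.left_le i h)
  · rcases hor i hi with ⟨h, -, e⟩ | h
    · rw [e]; exact hMs.right_le i h
    · exact (hMt.right_le i h).trans qr
  · rcases hor i hi with ⟨h, -, e⟩ | h
    · rw [e]; exact hMs.bottom_le i h
    · exact qb.trans (hMt.bottom_le i h)
  · rcases hor i hi with ⟨h, -, e⟩ | h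
    · rw [e]; exact hMs.top_le i h
    · exact (hMt.top_le i h).trans qt
  · rcases hor i hi with ⟨h, h', e⟩ | h <;> rcases hor j hj with ⟨g, g', e'⟩ | g
    · rw [e, e']; exact hMs.disj i h j g hij
    · rw [e]; exact key i h h' j g
    · rw [e']
      have := key j g g' i h
      tauto
    · exact hMt.disj i h j g hij
  · obtain ⟨i, hi, i1, i2, i3, i4⟩ := hMs.north_east h1.le h2 h3.le h4
    by_cases hiQ : i = Q
    · subst hiQ
      obtain ⟨j, hj, j1, j2, j3, j4⟩ := hMt.north_east i1 i2 i3 i4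
      exact ⟨j, Finset.mem_union_right _ hj, j1, j2.le, j3, j4.le⟩
    · have := Finset.mem_erase.2 ⟨hiQ, hi⟩
      exact ⟨i, Finset.mem_union_left _ this, by rw [hC i this]; exact ⟨i1, i2.le, i3, i4.le⟩⟩
  · by_cases hall : i ∈ t ∧ j ∈ t ∧ k ∈ t ∧ l ∈ t
    · exact hMt.no_cross x y i hall.1 j hall.2.1 k hall.2.2.1 l hall.2.2.2 c1 c2 c3 c4
    -- Unless all four rooms of a cross are embedded ones, an old room has a corner there. General
    -- position then forces each embedded room at this point to have its edges there on edges of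
    -- `Q`, so that `Q` can replace it, and the old floorplan would have a cross.
    have hxy : ∃ m ∈ s, ((R m).left = x ∨ (R m).right = x) ∧ ((R m).bottom = y ∨ (R m).top = y) := by
      by_contra hno
      apply hall
      have : ∀ m ∈ s.erase Q ∪ t, ((C m).left = x ∨ (C m).right = x) →
          ((C m).bottom = y ∨ (C m).top = y) → m ∈ t := by
        intro m hm h1 h2
        refine (hor m hm).resolve_left ?_
        rintro ⟨hs, -, e⟩
        rw [e] at h1 h2
        exact hno ⟨m, hs, h1, h2⟩
      exact ⟨this i hi (Or.inr c1.1) (Or.inl c1.2), this j hj (Or.inl c2.1) (Or.inl c2.2),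
        this k hk (Or.inr c3.1) (Or.inr c3.2), this l hl' (Or.inl c4.1) (Or.inr c4.2)⟩
    obtain ⟨m, hm, hmx, hmy⟩ := hxy
    have hrep : ∀ i ∈ s.erase Q ∪ t, ∃ i' ∈ s, ((C i).left = x → (R i').left = x) ∧
        ((C i).right = x → (R i').right = x) ∧ ((C i).bottom = y → (R i').bottom = y) ∧
        ((C i).top = y → (R i').top = y) := by
      intro i hi
      rcases hor i hi with ⟨h, -, e⟩ | h
      · rw [e]; exact ⟨i, h, id, id, id, id⟩
      · refine ⟨Q, hQ, fun e => ?_, fun e => ?_, fun e => ?_, fun e => ?_⟩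
        · rw [← hl i h m hm (by rw [e]; exact hmx.imp Eq.symm Eq.symm), e]
        · rw [← hr i h m hm (by rw [e]; exact hmx.imp Eq.symm Eq.symm), e]
        · rw [← hb i h m hm (by rw [e]; exact hmy.imp Eq.symm Eq.symm), e]
        · rw [← ht i h m hm (by rw [e]; exact hmy.imp Eq.symm Eq.symm), e]
    obtain ⟨i', hi', -, i2, i3, -⟩ := hrep i hi
    obtain ⟨j', hj', j1, -, j3, -⟩ := hrep j hj
    obtain ⟨k', hk', -, k2, -, k4⟩ := hrep k hk
    obtain ⟨l', hl'', l1, -, -, l4⟩ := hrep l hl'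
    exact hMs.no_cross x y i' hi' j' hj' k' hk' l' hl'' ⟨i2 c1.1, i3 c1.2⟩ ⟨j1 c2.1, j3 c2.2⟩
      ⟨k2 c3.1, k4 c3.2⟩ ⟨l1 c4.1, l4 c4.2⟩

theorem BLO.mapRect {B : Rect} {s : Finset ι} {R : ι → Rect} {l : List ι} (hM : Mos B s R)
    (h : BLO B s R l) {f g : ℝ → ℝ} (hf : StrictMonoOn f (Set.Icc B.left B.right))
    (hg : StrictMonoOn g (Set.Icc B.bottom B.top)) :
    BLO (B.map f g) s (fun i => (R i).map f g) l := by
  have hg' : StrictMonoOn (fun y => -g (-y)) (Set.Icc B.flip.bottom B.flip.top) := by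
    intro y hy z hz hyz
    simp only [Rect.flip_bottom, Rect.flip_top, Set.mem_Icc] at hy hz
    exact neg_lt_neg (hg ⟨by linarith [hz.2], by linarith [hz.1]⟩
      ⟨by linarith [hy.2], by linarith [hy.1]⟩ (neg_lt_neg hyz))
  have e : ∀ P : Rect, P.flip.map f (fun y => -g (-y)) = (P.map f g).flip := by
    intro P
    simp [Rect.map, Rect.flip]
  have := TLO.mapRect hM.flip h hf hg'
  simp only [e] at this
  exact this

/-- Moving a mosaic into general position with respect to finitely many coordinates. -/
theorem HasLabel.exists_generic {D : Rect} {t : Finset ι} {C : ι → Rect} {u v : ι → ℕ}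
    (hM : Mos D t C) (h : HasLabel D t C u v) (X Y : Finset ℝ) : ∃ C' : ι → Rect, Mos D t C' ∧
      HasLabel D t C' u v ∧ ∀ i ∈ t, ((C' i).left ∈ X → (C' i).left = D.left) ∧
        ((C' i).right ∈ X → (C' i).right = D.right) ∧
        ((C' i).bottom ∈ Y → (C' i).bottom = D.bottom) ∧
        ((C' i).top ∈ Y → (C' i).top = D.top) := by
  obtain ⟨f, hf, fl, fr, fX⟩ := exists_generic_map hM.box_x
    (t.image (fun i => (C i).left) ∪ t.image fun i => (C i).right) X
  obtain ⟨g, hg, gl, gr, gY⟩ := exists_generic_map hM.box_y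
    (t.image (fun i => (C i).bottom) ∪ t.image fun i => (C i).top) Y
  have hD : D.map f g = D := by simp [Rect.map, fl, fr, gl, gr]
  have hM' := hM.map hf hg
  rw [hD] at hM'
  obtain ⟨tl, bl, h1, h2, h3⟩ := h
  have h1' := h1.mapRect hM hf hg
  have h2' := h2.mapRect hM hf hg
  rw [hD] at h1' h2'
  refine ⟨_, hM', ⟨tl, bl, h1', h2', h3⟩, fun i hi => ⟨fun hX => ?_, fun hX => ?_, fun hY => ?_,
    fun hY => ?_⟩⟩
  · have := hM.proper_x i hi
    have := hM.right_le i hi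
    rcases (hM.left_le i hi).lt_or_eq with g | g
    · exact absurd hX (fX _ (Finset.mem_union_left _ (Finset.mem_image_of_mem _ hi)) g
        (by linarith))
    · simp only [Rect.map, ← g, fl]
  · have := hM.proper_x i hi
    have := hM.left_le i hi
    rcases (hM.right_le i hi).lt_or_eq with g | g
    · exact absurd hX (fX _ (Finset.mem_union_right _ (Finset.mem_image_of_mem _ hi))
        (by linarith) g)
    · simp only [Rect.map, g, fr]
  · have := hM.proper_y i hi
    have := hM.top_le i hi
    rcases (hM.bottom_le i hi).lt_or_eq with g | g
    · exact absurd hY (gY _ (Finset.mem_union_left _ (Finset.mem_image_of_mem _ hi)) g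
        (by linarith))
    · simp only [Rect.map, ← g, gl]
  · have := hM.proper_y i hi
    have := hM.bottom_le i hi
    rcases (hM.top_le i hi).lt_or_eq with g | g
    · exact absurd hY (gY _ (Finset.mem_union_right _ (Finset.mem_image_of_mem _ hi))
        (by linarith) g)
    · simp only [Rect.map, g, gr]

/-- Since no outside point separates `t`, the order on the union is determined by the order on `t`
and the order after contraction to `x`. -/
theorem RankInflate.combine {u w w' : ι → ℕ} {s t : Finset ι} {x : ι}
    (h : RankInflate w w' s x t) (hx : x ∈ s) (hxt : x ∈ t)
    (hs : ∀ y ∈ s, ∀ z ∈ s, u y < u z ↔ w y < w z)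
    (ht : ∀ y ∈ t, ∀ z ∈ t, u y < u z ↔ w' y < w' z)
    (hap : ∀ p ∈ s.erase x, Apart u p t) :
    ∀ y ∈ s.erase x ∪ t, ∀ z ∈ s.erase x ∪ t, u y < u z ↔ w' y < w' z := by
  intro y hy z hz
  rcases Finset.mem_union.1 hy with hy | hy <;> rcases Finset.mem_union.1 hz with hz | hz
  · rw [hs y (Finset.mem_of_mem_erase hy) z (Finset.mem_of_mem_erase hz), h.lt_iff y hy z hz]
  · rw [(hap y hy).lt_iff hz hxt, hs y (Finset.mem_of_mem_erase hy) x hx, h.lt_left y hy z hz]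
  · rw [(hap z hz).gt_iff hy hxt, hs x hx z (Finset.mem_of_mem_erase hz), h.lt_right z hz y hy]
  · exact ht y hy z hz

/-- Every decomposable pattern is the label of a hierarchical floorplan of order `k`. -/
theorem Dec.exists_isHFO {k : ℕ} {u v : ι → ℕ} {S : Finset ι} (h : Dec k u v S)
    (hu : Set.InjOn u S) (hv : Set.InjOn v S) :
    ∃ B R, Mos B S R ∧ IsHFO k B (R '' S) ∧ HasLabel B S R u v := by
  induction h with
  | single p =>
    have hM := Mos.single (B := ⟨0, 1, 0, 1⟩) zero_lt_one zero_lt_one p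
    have := hM.isMosaic
    rw [Finset.coe_singleton, Set.image_singleton] at this
    refine ⟨_, _, hM, ?_, hasLabel_single _ _ _ _ _⟩
    rw [Finset.coe_singleton, Set.image_singleton]
    exact .box this
  | step S I x hI hx hk hB _ ih =>
    have hsub : S \ I.erase x ⊆ S := Finset.sdiff_subset
    obtain ⟨B, R, hM, hF, tl, bl, htl, hbl, ru, rv⟩ := ih
      (hu.mono (by exact_mod_cast hsub)) (hv.mono (by exact_mod_cast hsub))
    set s := S \ I.erase x with hs
    have hxs : x ∈ s := Finset.mem_sdiff.2 ⟨hI.sub hx, Finset.notMem_erase x I⟩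
    have hse : s.erase x = S \ I := by
      ext p
      simp only [hs, Finset.mem_erase, Finset.mem_sdiff]
      constructor
      · tauto
      · rintro ⟨h1, h2⟩
        exact ⟨by rintro rfl; exact h2 hx, h1, fun h3 => h2 h3.2⟩
    have hu' : Set.InjOn u I := hu.mono (by exact_mod_cast hI.sub)
    have hv' : Set.InjOn v I := hv.mono (by exact_mod_cast hI.sub)
    -- The contraction of `I` is undone by embedding, in the room of `x`, a floorplan with label
    -- `I`, which is first moved into general position with respect to all the walls present.
    obtain ⟨C₀, hM₀, hL₀⟩ := hB.exists_mos (hM.proper_x x hxs) (hM.proper_y x hxs) hI.nonempty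
      hu' hv'
    obtain ⟨C', hMt, ⟨tlt, blt, htlt, hblt, ru', rv'⟩, hgen⟩ := hL₀.exists_generic hM₀
      (s.image (fun i => (R i).left) ∪ s.image fun i => (R i).right)
      (s.image (fun i => (R i).bottom) ∪ s.image fun i => (R i).top)
    let C : ι → Rect := fun i => if i ∈ I then C' i else R i
    have hCI : ∀ i ∈ I, C i = C' i := fun i hi => if_pos hi
    have hCs : ∀ i ∈ s.erase x, C i = R i := by
      intro i hi
      rw [hse] at hi
      exact if_neg (Finset.mem_sdiff.1 hi).2
    have hdisj : Disjoint (s.erase x) I := by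
      rw [hse]
      exact Finset.sdiff_disjoint
    have hun : s.erase x ∪ I = S := by rw [hse]; exact Finset.sdiff_union_of_subset hI.sub
    have hMt' := hMt.congr hCI
    have hM2 : Mos B (s.erase x ∪ I) C := by
      have aux : ∀ (a b : ι → ℝ) (z : ℝ), ∀ j ∈ s, z = a j ∨ z = b j → z ∈ s.image a ∪ s.image b := by
        rintro a b z j hj (rfl | rfl)
        · exact Finset.mem_union_left _ (Finset.mem_image_of_mem a hj)
        · exact Finset.mem_union_right _ (Finset.mem_image_of_mem b hj)
      refine hM.embed hxs hMt' hCs ?_ ?_ ?_ ?_ <;> intro i hi j hj h <;> rw [hCI i hi] at h ⊢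
      · exact (hgen i hi).1 (aux _ _ _ j hj h)
      · exact (hgen i hi).2.1 (aux _ _ _ j hj h)
      · exact (hgen i hi).2.2.1 (aux _ _ _ j hj h)
      · exact (hgen i hi).2.2.2 (aux _ _ _ j hj h)
    obtain ⟨tl', bl', h1, h2, h3, h4, h5, h6⟩ := hM.inflate hxs hMt' hdisj hCs hM2 htl hbl
      (htlt.congr hCI) (hblt.congr hCI)
    have hmemS : ∀ p ∈ s.erase x, p ∈ S ∧ p ∉ I := by
      intro p hp
      rw [hse] at hp
      exact Finset.mem_sdiff.1 hp
    have cu := h4.combine hxs hx ru (fun y hy z hz => (ru' y hy z hz).trans (h6 y hy z hz))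
      fun p hp => hI.apart_fst p (hmemS p hp).1 (hmemS p hp).2
    have cv := h3.combine hxs hx rv (fun y hy z hz => (rv' y hy z hz).trans (h5 y hy z hz))
      fun p hp => hI.apart_snd p (hmemS p hp).1 (hmemS p hp).2
    rw [hun] at hM2 h1 h2 cu cv
    refine ⟨B, C, hM2, ?_, tl', bl', h1, h2, cu, cv⟩
    have himg : (R '' s) \ {R x} ∪ C '' I = C '' S := by
      have e : (R '' s) \ {R x} = C '' (s.erase x : Finset ι) := by
        ext P
        simp only [Set.mem_sdiff, Set.mem_image, Finset.mem_coe, Set.mem_singleton_iff]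
        constructor
        · rintro ⟨⟨i, hi, rfl⟩, h⟩
          have : i ∈ s.erase x := Finset.mem_erase.2 ⟨by rintro rfl; exact h rfl, hi⟩
          exact ⟨i, this, hCs i this⟩
        · rintro ⟨i, hi, rfl⟩
          rw [hCs i hi]
          obtain ⟨h1, h2⟩ := Finset.mem_erase.1 hi
          exact ⟨⟨i, h2, rfl⟩, fun h => h1 (hM.injOn h2 hxs h)⟩
      rw [e, ← Set.image_union, ← Finset.coe_union, hun]
    have hm := hM2.isMosaic
    rw [← himg] at hm ⊢
    refine .embed _ (R x) _ hF (Set.mem_image_of_mem R hxs) hMt'.isMosaic ?_ hm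
    exact (Set.ncard_image_le I.finite_toSet).trans (by rwa [Set.ncard_coe_finset])

end Realisation
end HFO

namespace HFO

/-! ### Permutations of hierarchical floorplans -/

theorem deleteTopLeft_eq {n : ℕ} (B : Rect) (s : Finset (Fin n)) (R : Fin n → Rect) (b : Fin n) :
    deleteTopLeft B s R b = delTL B s R b := by
  funext r
  unfold deleteTopLeft delTL
  by_cases h : Tee s R b
  · rw [if_pos h, if_pos (show CornerTee s R b from h)]
    rfl
  · rw [if_neg h, if_neg (show ¬ CornerTee s R b from h)]
    rfl

theorem topLeftOrder_iff {n : ℕ} {B : Rect} {s : Finset (Fin n)} {R : Fin n → Rect}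
    {l : List (Fin n)} : TopLeftOrder B s R l ↔ TLO B s R l := by
  constructor <;> intro h
  · induction h with
    | single b R => exact .single b R
    | delete s R b l h1 h2 h3 h4 _ ih =>
      rw [deleteTopLeft_eq] at ih
      exact .delete s R b l ⟨h1, h3, h4⟩ h2 ih
  · induction h with
    | single b R => exact .single b R
    | delete s R b l h1 h2 _ ih =>
      rw [← deleteTopLeft_eq] at ih
      exact .delete s R b l h1.mem h2 h1.left h1.top ih

theorem BLO.map {ι κ : Type*} [DecidableEq ι] [DecidableEq κ] {B : Rect} {s : Finset ι}
    {R : ι → Rect} {l : List ι} (h : BLO B s R l) {f : ι → κ} (hf : Set.InjOn f s) {R' : κ → Rect}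
    (hR : ∀ i ∈ s, R' (f i) = R i) : BLO B (s.image f) R' (l.map f) :=
  TLO.map h hf fun i hi => by rw [hR i hi]

theorem idxOf_of_getElem? {ι : Type*} [DecidableEq ι] {l : List ι} (hl : l.Nodup) {j : ℕ} {a : ι}
    (h : l[j]? = some a) : l.idxOf a = j := by
  obtain ⟨hj, rfl⟩ := List.getElem?_eq_some_iff.1 h
  exact hl.idxOf_getElem j hj

theorem getElem?_of_idxOf {ι : Type*} [DecidableEq ι] {l : List ι} {j : ℕ} {a : ι} (ha : a ∈ l)
    (h : l.idxOf a = j) : l[j]? = some a := by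
  subst h
  rw [List.getElem?_eq_getElem (List.idxOf_lt_length_iff.2 ha), List.getElem_idxOf]

/-- The position of the value `v` in the one-line notation of `π`. -/
def posOf {n : ℕ} (π : Equiv.Perm (Fin n)) (v : ℕ) : ℕ :=
  if h : 1 ≤ v ∧ v ≤ n then (π.symm ⟨v - 1, by omega⟩ : ℕ) else 0

theorem posOf_apply {n : ℕ} (π : Equiv.Perm (Fin n)) (i : Fin n) : posOf π ((π i : ℕ) + 1) = i := by
  have := (π i).isLt
  rw [posOf, dif_pos (by omega)]
  simp

theorem exists_apply_eq {n : ℕ} (π : Equiv.Perm (Fin n)) {v : ℕ} (hv : v ∈ Finset.Icc 1 n) :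
    ∃ i : Fin n, v = (π i : ℕ) + 1 ∧ posOf π v = i := by
  rw [Finset.mem_Icc] at hv
  refine ⟨π.symm ⟨v - 1, by omega⟩, ?_, ?_⟩
  · simp only [Equiv.apply_symm_apply]; omega
  · rw [posOf, dif_pos hv]

theorem posOf_injOn {n : ℕ} (π : Equiv.Perm (Fin n)) : Set.InjOn (posOf π) (Finset.Icc 1 n) := by
  intro v hv w hw h
  obtain ⟨i, rfl, hi⟩ := exists_apply_eq π hv
  obtain ⟨j, rfl, hj⟩ := exists_apply_eq π hw
  rw [hi, hj] at h
  rw [Fin.ext h]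

/-- A strictly increasing map from `Fin n` to itself is the identity. -/
theorem idxOf_eq_of_increasing {ι : Type*} [DecidableEq ι] {n : ℕ} {l : List ι} (hl : l.length = n)
    {e : Fin n → ι} (he : ∀ i, e i ∈ l) (h : ∀ i j, i < j → l.idxOf (e i) < l.idxOf (e j))
    (i : Fin n) : l.idxOf (e i) = i := by
  let f : Fin n → Fin n := fun i => ⟨l.idxOf (e i), hl ▸ List.idxOf_lt_length_iff.2 (he i)⟩
  have hf : StrictMono f := fun i j hij => h i j hij
  have hs : Function.Surjective f := Finite.injective_iff_surjective.1 hf.injective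
  have : f = id := (hf.range_inj strictMono_id).1 (by rw [hs.range_eq]; simp)
  exact congrArg Fin.val (congrFun this i)

/-- A permutation is the label of a hierarchical floorplan of order `k` if and only if it can be
reduced to a point by contracting Baxter intervals with at most `k` elements. -/
theorem isHFOPerm_iff {n : ℕ} (hn : 1 ≤ n) (k : ℕ) (π : Equiv.Perm (Fin n)) :
    IsHFOPerm k π ↔ Dec k (posOf π) id (Finset.Icc 1 n) := by
  classical
  constructor
  · rintro ⟨B, R, hinj, hM, hF, tl, bl, htl, hbl, hlab⟩
    set s := Finset.univ.image R with hs
    have hsr : (s : Set Rect) = Set.range R := by simp [hs]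
    -- The rectangles become their own indices, the form in which `IsHFO.dec` applies.
    have htl' := (topLeftOrder_iff.1 htl).map (κ := Rect) (f := R) (R' := id) hinj.injOn
      fun _ _ => rfl
    have hbl' : BLO B s id (bl.map R) := BLO.map (topLeftOrder_iff.1 hbl) hinj.injOn fun _ _ => rfl
    have hD := hF.dec hsr htl' hbl'
    set T := tl.map R
    set L := bl.map R
    have key : ∀ P ∈ s, ∃ i : Fin n, L.idxOf P = i ∧ T.idxOf P = π i := by
      intro P hP
      have hPL : P ∈ L := (TLO.mem_iff hbl').2 hP
      have hlen : L.length = n := by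
        rw [← List.toFinset_card_of_nodup (TLO.nodup hbl'), TLO.toFinset hbl',
          Finset.card_image_of_injective _ hinj, Finset.card_univ, Fintype.card_fin]
      refine ⟨⟨L.idxOf P, hlen ▸ List.idxOf_lt_length_iff.2 hPL⟩, rfl, ?_⟩
      refine idxOf_of_getElem? htl'.nodup ?_
      rw [List.getElem?_map, ← hlab, ← List.getElem?_map]
      exact getElem?_of_idxOf hPL rfl
    have himg : s.image (fun P => T.idxOf P + 1) = Finset.Icc 1 n := by
      refine Finset.eq_of_subset_of_card_le ?_ ?_
      · intro v hv
        obtain ⟨P, hP, rfl⟩ := Finset.mem_image.1 hv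
        obtain ⟨i, -, h2⟩ := key P hP
        have := (π i).isLt
        rw [Finset.mem_Icc, h2]
        omega
      · rw [Finset.card_image_of_injOn, Finset.card_image_of_injective _ hinj]
        · simp
        · intro P hP Q hQ hPQ
          exact idxOf_injOn (fun i => htl'.mem_iff.2) hP hQ (Nat.succ_injective hPQ)
    rw [← himg]
    refine hD.image ?_ ?_ ?_
    · intro P hP Q hQ hPQ
      exact idxOf_injOn (fun i => htl'.mem_iff.2) hP hQ (Nat.succ_injective hPQ)
    · intro P hP Q hQ
      obtain ⟨i, h1, h2⟩ := key P hP
      obtain ⟨j, h3, h4⟩ := key Q hQ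
      rw [h1, h2, h3, h4, posOf_apply, posOf_apply]
    · intro P _ Q _
      simp
  · intro hD
    obtain ⟨B, R, hM, hF, tl, bl, htl, hbl, ru, rv⟩ := hD.exists_isHFO (posOf_injOn π)
      Function.injective_id.injOn
    -- Values are counted from `1`, the elements of `Fin n` from `0`; the reduction modulo `n` does
    -- nothing on `1, …, n`.
    let f : ℕ → Fin n := fun v => ⟨(v - 1) % n, Nat.mod_lt _ hn⟩
    have hf : ∀ v ∈ Finset.Icc 1 n, (f v : ℕ) + 1 = v := by
      intro v hv
      rw [Finset.mem_Icc] at hv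
      simp only [f]
      rw [Nat.mod_eq_of_lt (by omega)]
      omega
    have hfi : Set.InjOn f (Finset.Icc 1 n) := by
      intro v hv w hw h
      rw [← hf v hv, ← hf w hw, h]
    have himg : (Finset.Icc 1 n).image f = Finset.univ := by
      refine Finset.eq_univ_of_card _ ?_
      rw [Finset.card_image_of_injOn hfi]
      simp
    let R' : Fin n → Rect := fun r => R ((r : ℕ) + 1)
    have hR' : ∀ i ∈ Finset.Icc 1 n, R' (f i) = R i := fun i hi => by simp only [R', hf i hi]
    have htl' := htl.map hfi hR'
    have hbl' := hbl.map hfi hR'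
    have hrange : Set.range R' = R '' (Finset.Icc 1 n : Finset ℕ) := by
      ext P
      constructor
      · rintro ⟨r, rfl⟩
        exact ⟨(r : ℕ) + 1, by have := r.isLt; simp, rfl⟩
      · rintro ⟨v, hv, rfl⟩
        exact ⟨f v, hR' v hv⟩
    rw [himg] at htl' hbl'
    have hmem : ∀ i : Fin n, (π i : ℕ) + 1 ∈ Finset.Icc 1 n := by
      intro i
      have := (π i).isLt
      rw [Finset.mem_Icc]
      omega
    have hlen : ∀ l : List ℕ, l.Nodup → l.toFinset = Finset.Icc 1 n → l.length = n := by
      intro l h1 h2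
      rw [← List.toFinset_card_of_nodup h1, h2]
      simp
    refine ⟨B, R', ?_, ?_, ?_, tl.map f, bl.map f, topLeftOrder_iff.2 htl',
      topLeftOrder_iff.2 hbl', fun i => ?_⟩
    · intro r r' h
      have := r.isLt
      have := r'.isLt
      have := hM.injOn (by simp) (by simp) h
      exact Fin.ext (by omega)
    · rw [hrange]; exact hM.isMosaic
    · rw [hrange]; exact hF
    · have h1 : bl.idxOf ((π i : ℕ) + 1) = i := by
        refine idxOf_eq_of_increasing (e := fun i => (π i : ℕ) + 1)
          (hlen bl (TLO.nodup hbl) (TLO.toFinset hbl)) (fun i => (TLO.mem_iff hbl).2 (hmem i))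
          (fun i j hij => ?_) i
        rw [← ru _ (hmem i) _ (hmem j), posOf_apply, posOf_apply]
        exact hij
      have h2 : tl.idxOf ((π i : ℕ) + 1) = π i := by
        have hm : ∀ i : Fin n, (i : ℕ) + 1 ∈ Finset.Icc 1 n := fun i => by
          have := i.isLt
          rw [Finset.mem_Icc]
          omega
        refine idxOf_eq_of_increasing (e := fun i : Fin n => (i : ℕ) + 1)
          (hlen tl htl.nodup htl.toFinset) (fun i => htl.mem_iff.2 (hm i))
          (fun i j hij => ?_) (π i)
        rw [← rv _ (hm i) _ (hm j)]
        exact Nat.succ_lt_succ hij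
      rw [List.getElem?_map, List.getElem?_map,
        getElem?_of_idxOf ((TLO.mem_iff hbl).2 (hmem i)) h1,
        getElem?_of_idxOf (htl.mem_iff.2 (hmem i)) h2]

end HFO

namespace HFO

/-! ### Stacks of ranges -/

/-- The values in the stack entries `e` with `a ≤ e < m`. -/
def segUnion (lo hi : ℕ → ℕ) (a m : ℕ) : Finset ℕ :=
  (Finset.Ico a m).biUnion fun e => Finset.Icc (lo e) (hi e)

theorem mem_segUnion {lo hi : ℕ → ℕ} {a m x : ℕ} :
    x ∈ segUnion lo hi a m ↔ ∃ e, a ≤ e ∧ e < m ∧ lo e ≤ x ∧ x ≤ hi e := by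
  simp [segUnion, and_assoc]

/-- The union of the stack entries `e` with `a ≤ e < m` is a range. -/
def IsRange (lo hi : ℕ → ℕ) (a m : ℕ) : Prop :=
  ∃ mn mx, segUnion lo hi a m = Finset.Icc mn mx

theorem segUnion_congr {lo hi lo' hi' : ℕ → ℕ} {a m : ℕ}
    (h : ∀ e, e < m → lo e = lo' e ∧ hi e = hi' e) :
    segUnion lo hi a m = segUnion lo' hi' a m := by
  ext x
  simp only [mem_segUnion]
  constructor <;> rintro ⟨e, h1, h2, h3⟩ <;> refine ⟨e, h1, h2, ?_⟩
  · rwa [← (h e h2).1, ← (h e h2).2]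
  · rwa [(h e h2).1, (h e h2).2]

theorem IsRange.congr {lo hi lo' hi' : ℕ → ℕ} {a m : ℕ} (hr : IsRange lo hi a m)
    (h : ∀ e, e < m → lo e = lo' e ∧ hi e = hi' e) : IsRange lo' hi' a m := by
  obtain ⟨mn, mx, hr⟩ := hr
  exact ⟨mn, mx, by rw [← segUnion_congr h, hr]⟩

/-- No union of at least two and at most `K` consecutive entries among the lowest `m` stack entries
is a range. -/
def NoRange (K : ℕ) (lo hi : ℕ → ℕ) (m : ℕ) : Prop :=
  ∀ a m', a + 2 ≤ m' → m' ≤ m → m' ≤ a + K → ¬ IsRange lo hi a m'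

theorem NoRange.mono {K : ℕ} {lo hi lo' hi' : ℕ → ℕ} {m m' : ℕ} (h : NoRange K lo hi m)
    (hm : m' ≤ m) (h' : ∀ e, e < m' → lo e = lo' e ∧ hi e = hi' e) : NoRange K lo' hi' m' :=
  fun a b h1 h2 h3 hr => h a b h1 (h2.trans hm) h3
    (hr.congr fun e he => ⟨(h' e (by omega)).1.symm, (h' e (by omega)).2.symm⟩)

theorem NoRange.succ {K : ℕ} {lo hi : ℕ → ℕ} {m : ℕ} (h : NoRange K lo hi m)
    (h' : ∀ a, a + 2 ≤ m + 1 → m + 1 ≤ a + K → ¬ IsRange lo hi a (m + 1)) :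
    NoRange K lo hi (m + 1) := by
  intro a b h1 h2 h3
  rcases Nat.lt_or_ge m b with hb | hb
  · obtain rfl : b = m + 1 := by omega
    exact h' a h1 h3
  · exact h a b h1 hb h3

/-- The stack with entries `[lo e, hi e]`, `e < top`, describes the values at the positions less
than `i`, where `p x` is the position of the value `x`. -/
structure IsStack (n : ℕ) (p lo hi : ℕ → ℕ) (i top : ℕ) : Prop where
  bounds : ∀ e, e < top → 1 ≤ lo e ∧ lo e ≤ hi e ∧ hi e ≤ n
  read : ∀ e, e < top → ∀ x, lo e ≤ x → x ≤ hi e → p x < i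
  owned : ∀ x, 1 ≤ x → x ≤ n → p x < i → ∃ e, e < top ∧ lo e ≤ x ∧ x ≤ hi e
  mono : ∀ e e', e < e' → e' < top → ∀ x y, lo e ≤ x → x ≤ hi e → lo e' ≤ y → y ≤ hi e' → p x < p y

/-- The unread values, and one value for each entry of the stack. -/
def remaining (n : ℕ) (p lo : ℕ → ℕ) (i top : ℕ) : Finset ℕ :=
  {x ∈ Finset.Icc 1 n | i ≤ p x} ∪ (Finset.range top).image lo

theorem mem_remaining {n : ℕ} {p lo : ℕ → ℕ} {i top x : ℕ} :
    x ∈ remaining n p lo i top ↔ (1 ≤ x ∧ x ≤ n ∧ i ≤ p x) ∨ ∃ e, e < top ∧ lo e = x := by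
  simp [remaining, and_assoc]

/-- The representatives of the stack entries `e` with `a ≤ e < m`. -/
def segPoints (lo : ℕ → ℕ) (a m : ℕ) : Finset ℕ := (Finset.Ico a m).image lo

theorem mem_segPoints {lo : ℕ → ℕ} {a m x : ℕ} :
    x ∈ segPoints lo a m ↔ ∃ e, a ≤ e ∧ e < m ∧ lo e = x := by
  simp [segPoints, and_assoc]

theorem IsStack.zero (n : ℕ) (p lo hi : ℕ → ℕ) : IsStack n p lo hi 0 0 :=
  ⟨by simp, by simp, by simp, by simp⟩

theorem remaining_zero (n : ℕ) (p lo : ℕ → ℕ) : remaining n p lo 0 0 = Finset.Icc 1 n := by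
  ext x; simp [mem_remaining]

/-! ### Stack entries as points of a contracted pattern -/

namespace IsStack

variable {n : ℕ} {p lo hi : ℕ → ℕ} {i top : ℕ}

theorem eq_of_mem (h : IsStack n p lo hi i top) {e e' x : ℕ} (he : e < top) (he' : e' < top)
    (h1 : lo e ≤ x) (h2 : x ≤ hi e) (h3 : lo e' ≤ x) (h4 : x ≤ hi e') : e = e' := by
  rcases lt_trichotomy e e' with g | g | g
  · exact absurd (h.mono e e' g he' x x h1 h2 h3 h4) (lt_irrefl _)
  · exact g
  · exact absurd (h.mono e' e g he x x h3 h4 h1 h2) (lt_irrefl _)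

/-- Distinct entries lie on different sides of one another. -/
theorem hi_lt_lo (h : IsStack n p lo hi i top) {e e' : ℕ} (he : e < top) (he' : e' < top)
    (hl : lo e < lo e') : hi e < lo e' := by
  by_contra hc
  have := h.eq_of_mem he he' hl.le (not_lt.1 hc) le_rfl (h.bounds e' he').2.1
  subst this
  omega

theorem lo_inj (h : IsStack n p lo hi i top) {e e' : ℕ} (he : e < top) (he' : e' < top)
    (hl : lo e = lo e') : e = e' :=
  h.eq_of_mem he he' le_rfl (h.bounds e he).2.1 hl.ge (hl.trans_le (h.bounds e' he').2.1)

theorem pos_lo_lt_iff (h : IsStack n p lo hi i top) {e e' : ℕ} (he : e < top) (he' : e' < top) :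
    p (lo e) < p (lo e') ↔ e < e' := by
  have b := (h.bounds e he).2.1
  have b' := (h.bounds e' he').2.1
  constructor
  · intro hp
    by_contra hc
    rcases (not_lt.1 hc).eq_or_lt with g | g
    · subst g; omega
    · exact absurd (h.mono e' e g he _ _ le_rfl b' le_rfl b) hp.not_gt
  · exact fun g => h.mono e e' g he' _ _ le_rfl b le_rfl b'

theorem card_segPoints (h : IsStack n p lo hi i top) {a m : ℕ} (hm : m ≤ top) :
    (segPoints lo a m).card = m - a := by
  rw [segPoints, Finset.card_image_of_injOn, Nat.card_Ico]
  intro e he e' he' hl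
  simp only [Finset.coe_Ico, Set.mem_Ico] at he he'
  exact h.lo_inj (by omega) (by omega) hl

theorem segPoints_sub {a m : ℕ} (hm : m ≤ top) :
    segPoints lo a m ⊆ remaining n p lo i top := by
  intro x hx
  obtain ⟨e, -, h2, rfl⟩ := mem_segPoints.1 hx
  exact mem_remaining.2 (.inr ⟨e, by omega, rfl⟩)

theorem card_segUnion (h : IsStack n p lo hi i top) {a m : ℕ} (hm : m ≤ top) :
    (segUnion lo hi a m).card = ∑ e ∈ Finset.Ico a m, (hi e + 1 - lo e) := by
  rw [segUnion, Finset.card_biUnion]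
  · simp
  · intro e he e' he' hne
    simp only [Finset.coe_Ico, Set.mem_Ico] at he he'
    refine Finset.disjoint_left.2 fun x hx hx' => ?_
    rw [Finset.mem_Icc] at hx hx'
    exact hne (h.eq_of_mem (by omega) (by omega) hx.1 hx.2 hx'.1 hx'.2)

/-- Horizontally, the other entries are below or above in the stack and the unread values come
later. Vertically, another remaining value is not in the union of the entries, and since this is a
range, it lies on one side of it. -/
theorem isInterval (h : IsStack n p lo hi i top) {a m : ℕ} (ha : a < m) (hm : m ≤ top)
    (hr : IsRange lo hi a m) : IsInterval p id (remaining n p lo i top) (segPoints lo a m) := by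
  obtain ⟨mn, mx, hr⟩ := hr
  have hin : ∀ e, a ≤ e → e < m → mn ≤ lo e ∧ lo e ≤ mx := fun e h1 h2 => by
    rw [← Finset.mem_Icc, ← hr, mem_segUnion]
    exact ⟨e, h1, h2, le_rfl, (h.bounds e (by omega)).2.1⟩
  refine ⟨segPoints_sub hm, ⟨lo a, mem_segPoints.2 ⟨a, le_rfl, ha, rfl⟩⟩, ?_, ?_⟩
  · intro x hx hxI
    rcases mem_remaining.1 hx with ⟨-, -, h3⟩ | ⟨e, he, rfl⟩
    · refine .inr fun q hq => ?_
      obtain ⟨e, h1, h2, rfl⟩ := mem_segPoints.1 hq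
      exact (h.read e (by omega) _ le_rfl (h.bounds e (by omega)).2.1).trans_le h3
    · rcases Nat.lt_or_ge e a with g | g
      · refine .inl fun q hq => ?_
        obtain ⟨e', h1, h2, rfl⟩ := mem_segPoints.1 hq
        exact (h.pos_lo_lt_iff he (by omega)).2 (by omega)
      · have : m ≤ e := by
          by_contra hc
          exact hxI (mem_segPoints.2 ⟨e, g, by omega, rfl⟩)
        refine .inr fun q hq => ?_
        obtain ⟨e', h1, h2, rfl⟩ := mem_segPoints.1 hq
        exact (h.pos_lo_lt_iff (by omega) he).2 (by omega)
  · intro x hx hxI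
    have hxr : x ∉ Finset.Icc mn mx := by
      rw [← hr, mem_segUnion]
      rintro ⟨e, h1, h2, h3, h4⟩
      rcases mem_remaining.1 hx with ⟨-, -, g⟩ | ⟨e', he', rfl⟩
      · have := h.read e (by omega) x h3 h4
        omega
      · have := h.eq_of_mem (by omega) he' h3 h4 le_rfl (h.bounds e' he').2.1
        subst this
        exact hxI (mem_segPoints.2 ⟨e, h1, h2, rfl⟩)
    rw [Finset.mem_Icc] at hxr
    rcases Nat.lt_or_ge x mn with g | g
    · refine .inl fun q hq => ?_
      obtain ⟨e, h1, h2, rfl⟩ := mem_segPoints.1 hq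
      exact g.trans_le (hin e h1 h2).1
    · refine .inr fun q hq => ?_
      obtain ⟨e, h1, h2, rfl⟩ := mem_segPoints.1 hq
      have := (hin e h1 h2).2
      simp only [id]
      omega

/-- A value missing between the extremes of the union is unread or belongs to another entry. This
value, or the lower end of that entry, would be a remaining point that separates the
representatives. -/
theorem isRange (h : IsStack n p lo hi i top) {a m : ℕ} (ha : a < m) (hm : m ≤ top)
    (hI : IsInterval p id (remaining n p lo i top) (segPoints lo a m)) : IsRange lo hi a m := by
  obtain ⟨e₀, he₀, hmin⟩ := Finset.exists_min_image (Finset.Ico a m) lo ⟨a, by simp [ha]⟩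
  obtain ⟨e₁, he₁, hmax⟩ := Finset.exists_max_image (Finset.Ico a m) hi ⟨a, by simp [ha]⟩
  simp only [Finset.mem_Ico] at he₀ he₁ hmin hmax
  have b₀ := h.bounds e₀ (by omega)
  have b₁ := h.bounds e₁ (by omega)
  refine ⟨lo e₀, hi e₁, ?_⟩
  ext x
  rw [mem_segUnion, Finset.mem_Icc]
  constructor
  · rintro ⟨e, h1, h2, h3, h4⟩
    exact ⟨(hmin e ⟨h1, h2⟩).trans h3, h4.trans (hmax e ⟨h1, h2⟩)⟩
  · rintro ⟨h1, h2⟩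
    by_contra hx
    have hx' : ∀ e, a ≤ e → e < m → lo e ≤ x → hi e < x := fun e g1 g2 g3 => by
      by_contra hc
      exact hx ⟨e, g1, g2, g3, not_lt.1 hc⟩
    obtain ⟨r, hr, hrI, hrx, hr0⟩ : ∃ r ∈ remaining n p lo i top, r ∉ segPoints lo a m ∧
        lo e₀ < r ∧ r < lo e₁ := by
      have hx1 : x < lo e₁ := by
        by_contra hc
        have := hx' e₁ he₁.1 he₁.2 (not_lt.1 hc)
        omega
      have hx0 := hx' e₀ he₀.1 he₀.2 h1
      rcases Nat.lt_or_ge (p x) i with g | g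
      · obtain ⟨e, he, g1, g2⟩ := h.owned x (by omega) (by omega) g
        have hne : ¬ (a ≤ e ∧ e < m) := fun hc => hx ⟨e, hc.1, hc.2, g1, g2⟩
        refine ⟨lo e, mem_remaining.2 (.inr ⟨e, he, rfl⟩), ?_, ?_, by omega⟩
        · intro hc
          obtain ⟨e', h3, h4, h5⟩ := mem_segPoints.1 hc
          have := h.lo_inj (by omega) he h5
          subst this
          exact hne ⟨h3, h4⟩
        · by_contra hc
          have := h.eq_of_mem he (by omega : e₀ < top) (not_lt.1 hc) (by omega) le_rfl b₀.2.1
          subst this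
          exact hne he₀
      · refine ⟨x, mem_remaining.2 (.inl ⟨by omega, by omega, g⟩), ?_, by omega, hx1⟩
        intro hc
        obtain ⟨e, h3, h4, rfl⟩ := mem_segPoints.1 hc
        exact hx ⟨e, h3, h4, le_rfl, (h.bounds e (by omega)).2.1⟩
    have m₀ : lo e₀ ∈ segPoints lo a m := mem_segPoints.2 ⟨e₀, he₀.1, he₀.2, rfl⟩
    have m₁ : lo e₁ ∈ segPoints lo a m := mem_segPoints.2 ⟨e₁, he₁.1, he₁.2, rfl⟩
    rcases hI.apart_snd r hr hrI with g | g
    · exact absurd (g _ m₀) (by simp; omega)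
    · exact absurd (g _ m₁) (by simp; omega)

/-- An interval that consists of representatives of stack entries is contiguous. -/
theorem exists_segPoints (h : IsStack n p lo hi i top) {I : Finset ℕ}
    (hI : IsInterval p id (remaining n p lo i top) I) (hIs : I ⊆ segPoints lo 0 top) :
    ∃ a m, a < m ∧ m ≤ top ∧ I = segPoints lo a m := by
  have hne : ((Finset.range top).filter fun e => lo e ∈ I).Nonempty := by
    obtain ⟨x, hx⟩ := hI.nonempty
    obtain ⟨e, -, h2, rfl⟩ := mem_segPoints.1 (hIs hx)
    exact ⟨e, by simp [h2, hx]⟩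
  obtain ⟨a, ha, hmin⟩ := Finset.exists_min_image _ id hne
  obtain ⟨b, hb, hmax⟩ := Finset.exists_max_image _ id hne
  simp only [Finset.mem_filter, Finset.mem_range, id] at ha hb hmin hmax
  have hab := hmin b hb
  refine ⟨a, b + 1, by omega, by omega, ?_⟩
  ext x
  rw [mem_segPoints]
  constructor
  · intro hx
    obtain ⟨e, -, h2, rfl⟩ := mem_segPoints.1 (hIs hx)
    exact ⟨e, hmin e ⟨h2, hx⟩, Nat.lt_succ_of_le (hmax e ⟨h2, hx⟩), rfl⟩
  · rintro ⟨e, h1, h2, rfl⟩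
    by_contra hc
    rcases hI.apart_fst (lo e) (mem_remaining.2 (.inr ⟨e, by omega, rfl⟩)) hc with g | g
    · have := (h.pos_lo_lt_iff (by omega) (by omega)).1 (g _ ha.2)
      omega
    · have := (h.pos_lo_lt_iff (by omega) (by omega)).1 (g _ hb.2)
      omega

theorem push (h : IsStack n p lo hi i top) (hp : Set.InjOn p (Finset.Icc 1 n)) {x : ℕ}
    (hx : x ∈ Finset.Icc 1 n) (hpx : p x = i) :
    IsStack n p (Function.update lo top x) (Function.update hi top x) (i + 1) (top + 1) := by
  have hx' := Finset.mem_Icc.1 hx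
  refine ⟨fun e he => ?_, fun e he y h1 h2 => ?_, fun y h1 h2 h3 => ?_,
    fun e e' hee he' y z h1 h2 h3 h4 => ?_⟩
  · rcases Nat.lt_succ_iff_lt_or_eq.1 he with g | rfl
    · rw [Function.update_of_ne g.ne, Function.update_of_ne g.ne]
      exact h.bounds e g
    · simpa using hx'
  · rcases Nat.lt_succ_iff_lt_or_eq.1 he with g | rfl
    · rw [Function.update_of_ne g.ne] at h1 h2
      exact (h.read e g y h1 h2).trans (Nat.lt_succ_self i)
    · rw [Function.update_self] at h1 h2
      obtain rfl : y = x := by omega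
      omega
  · rcases Nat.lt_succ_iff_lt_or_eq.1 h3 with g | g
    · obtain ⟨e, he, g1, g2⟩ := h.owned y h1 h2 g
      refine ⟨e, by omega, ?_⟩
      rw [Function.update_of_ne he.ne, Function.update_of_ne he.ne]
      exact ⟨g1, g2⟩
    · have : y = x := hp (by simp; omega) hx (g.trans hpx.symm)
      subst this
      exact ⟨top, by omega, by simp⟩
  · have he : e < top := by omega
    rw [Function.update_of_ne he.ne] at h1 h2
    rcases Nat.lt_succ_iff_lt_or_eq.1 he' with g | rfl
    · rw [Function.update_of_ne g.ne] at h3 h4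
      exact h.mono e e' hee g y z h1 h2 h3 h4
    · rw [Function.update_self] at h3 h4
      obtain rfl : z = x := by omega
      rw [hpx]
      exact h.read e he y h1 h2

/-- The pushed value merely turns from an unread value into a representative, so the pattern does
not change. -/
theorem remaining_push (hp : Set.InjOn p (Finset.Icc 1 n)) {x : ℕ}
    (hx : x ∈ Finset.Icc 1 n) (hpx : p x = i) :
    remaining n p (Function.update lo top x) (i + 1) (top + 1) = remaining n p lo i top := by
  have hx' := Finset.mem_Icc.1 hx
  ext y
  rw [mem_remaining, mem_remaining]
  constructor
  · rintro (⟨h1, h2, h3⟩ | ⟨e, he, rfl⟩)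
    · exact .inl ⟨h1, h2, by omega⟩
    · rcases Nat.lt_succ_iff_lt_or_eq.1 he with g | rfl
      · exact .inr ⟨e, g, by rw [Function.update_of_ne g.ne]⟩
      · rw [Function.update_self]
        exact .inl ⟨hx'.1, hx'.2, hpx.ge⟩
  · rintro (⟨h1, h2, h3⟩ | ⟨e, he, rfl⟩)
    · rcases h3.eq_or_lt with g | g
      · have : y = x := hp (by simp; omega) hx (g.symm.trans hpx.symm)
        subst this
        exact .inr ⟨top, by omega, by simp⟩
      · exact .inl ⟨h1, h2, g⟩
    · exact .inr ⟨e, by omega, by rw [Function.update_of_ne he.ne]⟩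

/-- In a range of stack entries, the lower end of the union is one of the lower ends. -/
theorem exists_lo_eq {a mn mx : ℕ} (hmn : mn ≤ mx)
    (hr : segUnion lo hi a top = Finset.Icc mn mx) (h : IsStack n p lo hi i top) :
    ∃ e, a ≤ e ∧ e < top ∧ lo e = mn := by
  obtain ⟨e, h1, h2, h3, -⟩ := mem_segUnion.1 (hr ▸ Finset.left_mem_Icc.2 hmn)
  have : lo e ∈ segUnion lo hi a top := mem_segUnion.2 ⟨e, h1, h2, le_rfl, (h.bounds e h2).2.1⟩
  rw [hr, Finset.mem_Icc] at this
  exact ⟨e, h1, h2, by omega⟩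

theorem le_of_segUnion {a mn mx : ℕ} (ha : a < top)
    (hr : segUnion lo hi a top = Finset.Icc mn mx) (h : IsStack n p lo hi i top) : mn ≤ mx := by
  have : lo a ∈ segUnion lo hi a top :=
    mem_segUnion.2 ⟨a, le_rfl, ha, le_rfl, (h.bounds a ha).2.1⟩
  rw [hr, Finset.mem_Icc] at this
  omega

theorem merge (h : IsStack n p lo hi i top) {a mn mx : ℕ} (ha : a < top)
    (hr : segUnion lo hi a top = Finset.Icc mn mx) :
    IsStack n p (Function.update lo a mn) (Function.update hi a mx) i (a + 1) := by
  have hmn := h.le_of_segUnion ha hr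
  have hown : ∀ x, mn ≤ x → x ≤ mx → ∃ e, a ≤ e ∧ e < top ∧ lo e ≤ x ∧ x ≤ hi e :=
    fun x h1 h2 => mem_segUnion.1 (hr ▸ Finset.mem_Icc.2 ⟨h1, h2⟩)
  refine ⟨fun e he => ?_, fun e he y h1 h2 => ?_, fun y h1 h2 h3 => ?_,
    fun e e' hee he' y z h1 h2 h3 h4 => ?_⟩
  · rcases Nat.lt_succ_iff_lt_or_eq.1 he with g | rfl
    · rw [Function.update_of_ne g.ne, Function.update_of_ne g.ne]
      exact h.bounds e (by omega)
    · rw [Function.update_self, Function.update_self]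
      obtain ⟨e, h1, h2, h3, h4⟩ := hown mn le_rfl hmn
      obtain ⟨e', h1', h2', h3', h4'⟩ := hown mx hmn le_rfl
      obtain ⟨b1, b2, b3⟩ := h.bounds e h2
      obtain ⟨b1', b2', b3'⟩ := h.bounds e' h2'
      omega
  · rcases Nat.lt_succ_iff_lt_or_eq.1 he with g | rfl
    · rw [Function.update_of_ne g.ne] at h1 h2
      exact h.read e (by omega) y h1 h2
    · rw [Function.update_self] at h1 h2
      obtain ⟨e, -, g2, g3, g4⟩ := hown y h1 h2
      exact h.read e g2 y g3 g4
  · obtain ⟨e, he, g1, g2⟩ := h.owned y h1 h2 h3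
    rcases Nat.lt_or_ge e a with g | g
    · refine ⟨e, by omega, ?_⟩
      rw [Function.update_of_ne g.ne, Function.update_of_ne g.ne]
      exact ⟨g1, g2⟩
    · refine ⟨a, by omega, ?_⟩
      rw [Function.update_self, Function.update_self, ← Finset.mem_Icc, ← hr, mem_segUnion]
      exact ⟨e, g, he, g1, g2⟩
  · have he : e < a := by omega
    rw [Function.update_of_ne he.ne] at h1 h2
    rcases Nat.lt_succ_iff_lt_or_eq.1 he' with g | rfl
    · rw [Function.update_of_ne g.ne] at h3 h4
      exact h.mono e e' hee (by omega) y z h1 h2 h3 h4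
    · rw [Function.update_self] at h3 h4
      obtain ⟨f, g1, g2, g3, g4⟩ := hown z h3 h4
      exact h.mono e f (by omega) g2 y z h1 h2 g3 g4

/-- A merge is the contraction of the representatives onto the least of them, which is also the
lower end of the new entry. -/
theorem remaining_merge (h : IsStack n p lo hi i top) {a mn mx : ℕ} (ha : a < top)
    (hr : segUnion lo hi a top = Finset.Icc mn mx) :
    mn ∈ segPoints lo a top ∧ remaining n p (Function.update lo a mn) i (a + 1) =
      remaining n p lo i top \ (segPoints lo a top).erase mn := by
  obtain ⟨e₀, h1, h2, h3⟩ := h.exists_lo_eq (h.le_of_segUnion ha hr) hr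
  have hm : mn ∈ segPoints lo a top := mem_segPoints.2 ⟨e₀, h1, h2, h3⟩
  refine ⟨hm, ?_⟩
  ext y
  rw [mem_remaining, Finset.mem_sdiff, mem_remaining, Finset.mem_erase, mem_segPoints]
  constructor
  · rintro (⟨g1, g2, g3⟩ | ⟨e, he, rfl⟩)
    · refine ⟨.inl ⟨g1, g2, g3⟩, ?_⟩
      rintro ⟨-, e, -, f2, rfl⟩
      have := h.read e f2 _ le_rfl (h.bounds e f2).2.1
      omega
    · rcases Nat.lt_succ_iff_lt_or_eq.1 he with g | rfl
      · rw [Function.update_of_ne g.ne]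
        refine ⟨.inr ⟨e, by omega, rfl⟩, ?_⟩
        rintro ⟨-, e', f1, f2, f3⟩
        have := h.lo_inj f2 (by omega) f3
        omega
      · rw [Function.update_self]
        exact ⟨.inr ⟨e₀, h2, h3⟩, fun hc => hc.1 rfl⟩
  · rintro ⟨g | ⟨e, he, rfl⟩, hy⟩
    · exact .inl g
    · rcases Nat.lt_or_ge e a with g | g
      · exact .inr ⟨e, by omega, Function.update_of_ne g.ne _ _⟩
      · refine .inr ⟨a, by omega, ?_⟩
        rw [Function.update_self]
        by_contra hc
        exact hy ⟨fun hc' => hc hc'.symm, e, g, he, rfl⟩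

/-- The stack entries form a Baxter pattern if no quadruple violates the condition. -/
theorem baxter_segPoints (h : IsStack n p lo hi i top) {a₀ mn mx : ℕ}
    (hr : segUnion lo hi a₀ top = Finset.Icc mn mx) :
    Baxter p id (segPoints lo a₀ top) ↔ ∀ a b c d, a₀ ≤ a → a < b → b < c → c < d → d < top →
      ¬ ((hi a + 1 = lo d ∧ lo c < lo a ∧ lo d < lo b) ∨
        (hi d + 1 = lo a ∧ lo b < lo d ∧ lo a < lo c)) := by
  -- The entries together fill a range, so two of them that are not adjacent are separated in value
  -- by a third. Adjacency in the pattern is thus equality of `hi e + 1` and `lo f`.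
  have between : ∀ e f, a₀ ≤ e → e < top → a₀ ≤ f → f < top → lo e < lo f → hi e + 1 ≠ lo f →
      ∃ g ∈ segPoints lo a₀ top, lo e < g ∧ g < lo f := by
    intro e f he he' hf hf' hlt hne
    have h1 := h.hi_lt_lo he' hf' hlt
    have m1 : hi e ∈ Finset.Icc mn mx := hr ▸ mem_segUnion.2 ⟨e, he, he', (h.bounds e he').2.1, le_rfl⟩
    have m2 : lo f ∈ Finset.Icc mn mx := hr ▸ mem_segUnion.2 ⟨f, hf, hf', le_rfl, (h.bounds f hf').2.1⟩
    rw [Finset.mem_Icc] at m1 m2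
    obtain ⟨g, g1, g2, g3, g4⟩ := mem_segUnion.1
      (hr.symm ▸ Finset.mem_Icc.2 ⟨by omega, by omega⟩ : hi e + 1 ∈ segUnion lo hi a₀ top)
    refine ⟨lo g, mem_segPoints.2 ⟨g, g1, g2, rfl⟩, ?_, by omega⟩
    by_contra hc
    have := h.eq_of_mem he' g2 le_rfl (h.bounds e he').2.1 (not_lt.1 hc) (by have := (h.bounds e he').2.1; omega)
    subst this
    omega
  have adjacent : ∀ e f g, a₀ ≤ e → e < top → g ∈ segPoints lo a₀ top → hi e + 1 = lo f →
      lo e < g → g < lo f → False := by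
    intro e f g he he' hg h1 h2 h3
    obtain ⟨g, -, g2, rfl⟩ := mem_segPoints.1 hg
    have := h.hi_lt_lo he' g2 h2
    omega
  constructor
  · intro hB a b c d ha hab hbc hcd hd
    have mem : ∀ e, a₀ ≤ e → e < top → lo e ∈ segPoints lo a₀ top :=
      fun e h1 h2 => mem_segPoints.2 ⟨e, h1, h2, rfl⟩
    have hlt : ∀ e f, e < f → f < top → p (lo e) < p (lo f) :=
      fun e f h1 h2 => (h.pos_lo_lt_iff (by omega) h2).2 h1
    rintro (⟨h1, h2, h3⟩ | ⟨h1, h2, h3⟩)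
    · have hb := (h.bounds a (by omega)).2.1
      obtain ⟨e, he, h4, h5⟩ := hB.1 _ (mem a ha (by omega)) _ (mem b (by omega) (by omega)) _
        (mem c (by omega) (by omega)) _ (mem d (by omega) hd) (hlt a b hab (by omega))
        (hlt b c hbc (by omega)) (hlt c d hcd hd) h2 (by simp only [id]; omega) h3
      exact adjacent a d e ha (by omega) he h1 h4 h5
    · have hb := (h.bounds d (by omega)).2.1
      obtain ⟨e, he, h4, h5⟩ := hB.2 _ (mem d (by omega) hd) _ (mem c (by omega) (by omega)) _
        (mem b (by omega) (by omega)) _ (mem a ha (by omega)) (hlt c d hcd hd)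
        (hlt b c hbc (by omega)) (hlt a b hab (by omega)) h2 (by simp only [id]; omega) h3
      exact adjacent d a e (by omega) hd he h1 h4 h5
  · intro hQ
    constructor
    · intro x hx y hy z hz w hw hxy hyz hzw h1 h2 h3
      obtain ⟨a, ha, ha', rfl⟩ := mem_segPoints.1 hx
      obtain ⟨b, hb, hb', rfl⟩ := mem_segPoints.1 hy
      obtain ⟨c, hc, hc', rfl⟩ := mem_segPoints.1 hz
      obtain ⟨d, hd, hd', rfl⟩ := mem_segPoints.1 hw
      refine between a d ha ha' hd hd' h2 fun hne => ?_
      exact hQ a b c d ha ((h.pos_lo_lt_iff ha' hb').1 hxy) ((h.pos_lo_lt_iff hb' hc').1 hyz)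
        ((h.pos_lo_lt_iff hc' hd').1 hzw) hd' (.inl ⟨hne, h1, h3⟩)
    · intro x hx y hy z hz w hw hxy hyz hzw h1 h2 h3
      obtain ⟨a, ha, ha', rfl⟩ := mem_segPoints.1 hx
      obtain ⟨b, hb, hb', rfl⟩ := mem_segPoints.1 hy
      obtain ⟨c, hc, hc', rfl⟩ := mem_segPoints.1 hz
      obtain ⟨d, hd, hd', rfl⟩ := mem_segPoints.1 hw
      refine between a d ha ha' hd hd' h2 fun hne => ?_
      exact hQ d c b a hd ((h.pos_lo_lt_iff hd' hc').1 hzw) ((h.pos_lo_lt_iff hc' hb').1 hyz)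
        ((h.pos_lo_lt_iff hb' ha').1 hxy) ha' (.inr ⟨hne, h1, h3⟩)

/-- When everything has been read, the representatives of the stack entries are all that remains. -/
theorem remaining_eq (hi' : ∀ x, 1 ≤ x → x ≤ n → p x < i) :
    remaining n p lo i top = segPoints lo 0 top := by
  ext x
  rw [mem_remaining, mem_segPoints]
  constructor
  · rintro (⟨h1, h2, h3⟩ | ⟨e, he, rfl⟩)
    · have := hi' x h1 h2
      omega
    · exact ⟨e, by omega, he, rfl⟩
  · rintro ⟨e, -, he, rfl⟩
    exact .inr ⟨e, he, rfl⟩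

/-- A decomposable pattern with at least two points has a nontrivial interval of at most `k` points;
as only stack entries remain, it would be a segment of the stack and hence a range. -/
theorem not_dec_of_noRange (h : IsStack n p lo hi i top) (hi' : ∀ x, 1 ≤ x → x ≤ n → p x < i)
    {k : ℕ} (hN : NoRange k lo hi top) (ht : 2 ≤ top) : ¬ Dec k p id (remaining n p lo i top) := by
  intro hD
  have hS := remaining_eq (lo := lo) (top := top) hi'
  obtain ⟨I, hI, h2, hk⟩ := hD.exists_interval (by rw [hS, h.card_segPoints le_rfl]; omega)
  obtain ⟨a, m, ha, hm, rfl⟩ := h.exists_segPoints hI (hS ▸ hI.sub)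
  rw [h.card_segPoints hm] at h2 hk
  exact hN a m (by omega) hm (by omega) (h.isRange ha hm hI)

theorem top_le (h : IsStack n p lo hi i top) : top ≤ n := by
  have h1 := h.card_segPoints (a := 0) le_rfl
  have h2 : segPoints lo 0 top ⊆ Finset.Icc 1 n := by
    intro x hx
    obtain ⟨e, -, he, rfl⟩ := mem_segPoints.1 hx
    have := h.bounds e he
    rw [Finset.mem_Icc]
    omega
  have := Finset.card_le_card h2
  simp at this
  omega

/-- When everything has been read, the whole stack is the range from `1` to `n`, so two or more
entries would contradict `NoRange` with the bound `n`. -/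
theorem top_eq_one (h : IsStack n p lo hi i top) (hn : 1 ≤ n)
    (hi' : ∀ x, 1 ≤ x → x ≤ n → p x < i) (hN : NoRange n lo hi top) : top = 1 := by
  obtain ⟨e, he, -⟩ := h.owned 1 le_rfl hn (hi' 1 le_rfl hn)
  by_contra hc
  refine hN 0 top (by omega) le_rfl (by have := h.top_le; omega) ⟨1, n, ?_⟩
  ext x
  rw [mem_segUnion, Finset.mem_Icc]
  constructor
  · rintro ⟨e, -, he, h1, h2⟩
    have := h.bounds e he
    omega
  · rintro ⟨h1, h2⟩
    obtain ⟨e, he, g⟩ := h.owned x h1 h2 (hi' x h1 h2)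
    exact ⟨e, by omega, he, g⟩

/-- Merging a shortest range. -/
theorem dec_merge_iff (h : IsStack n p lo hi i top) {a mn mx k : ℕ} (ha : a + 2 ≤ top)
    (hr : segUnion lo hi a top = Finset.Icc mn mx) (hB : Baxter p id (segPoints lo a top))
    (hN : NoRange n lo hi (top - 1)) (hmin : ∀ b, a < b → b + 2 ≤ top → ¬ IsRange lo hi b top) :
    Dec k p id (remaining n p lo i top) ↔
      Dec k p id (remaining n p (Function.update lo a mn) i (a + 1)) ∧ top - a ≤ k := by
  obtain ⟨hm, hS⟩ := h.remaining_merge (by omega : a < top) hr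
  have hI := h.isInterval (by omega : a < top) le_rfl ⟨mn, mx, hr⟩
  have hcard := h.card_segPoints (a := a) le_rfl
  rw [hS]
  constructor
  · intro hD
    refine ⟨hD.contract hI hm, ?_⟩
    rw [← hcard]
    -- The merged entries form a minimal nontrivial interval: a smaller one would be a segment of
    -- the stack, and it would either end below the top, against `hN`, or be a shorter range at the
    -- top, against `hmin`.
    refine hD.card_le_of_minimal hI (by omega) fun J hJ hJI hJ2 => ?_
    obtain ⟨b, m, hb, hm', rfl⟩ := h.exists_segPoints hJ (hJI.trans fun x hx => by
      obtain ⟨e, -, h2, h3⟩ := mem_segPoints.1 hx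
      exact mem_segPoints.2 ⟨e, by omega, h2, h3⟩)
    rw [h.card_segPoints hm'] at hJ2
    have hrange := h.isRange hb hm' hJ
    have hmt : m = top := by
      by_contra hc
      exact hN b m (by omega) (by omega) (by have := h.top_le; omega) hrange
    subst hmt
    have hab : a ≤ b := by
      obtain ⟨e, h1, h2, h3⟩ := mem_segPoints.1 (hJI (mem_segPoints.2 ⟨b, le_rfl, hb, rfl⟩))
      have := h.lo_inj h2 hb h3
      omega
    rcases hab.eq_or_lt with g | g
    · rw [g]
    · exact absurd hrange (hmin b g (by omega))
  · rintro ⟨hD, hk⟩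
    exact .step _ _ mn hI hm (hcard ▸ hk) hB hD

end IsStack

end HFO

namespace HFO

/-! ### Reasoning about programs -/

theorem Expr.card_cells_le (σ : State) (e : Expr) : (e.cells σ).card ≤ e.cost := by
  induction e with
  | const m => simp [Expr.cells]
  | reg x => simp [Expr.cells]
  | get A e ih => exact (Finset.card_insert_le _ _).trans (Nat.succ_le_succ ih)
  | add e f ih ih' =>
    have := Finset.card_union_le (e.cells σ) (f.cells σ)
    simp only [Expr.cells, Expr.cost]
    omega
  | sub e f ih ih' =>
    have := Finset.card_union_le (e.cells σ) (f.cells σ)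
    simp only [Expr.cells, Expr.cost]
    omega

theorem Test.card_cells_le (σ : State) (b : Test) : (b.cells σ).card ≤ b.cost := by
  induction b with
  | lt e f | eq e f =>
    have := Finset.card_union_le (e.cells σ) (f.cells σ)
    have := e.card_cells_le σ
    have := f.card_cells_le σ
    simp only [Test.cells, Test.cost]
    omega
  | and s t ih ih' | or s t ih ih' =>
    have := Finset.card_union_le (s.cells σ) (t.cells σ)
    simp only [Test.cells, Test.cost]
    omega

/-- A run accesses at most as many cells as it has steps. -/
theorem Run.card_le {C : Cmd} {σ τ : State} {t : ℕ} {S : Finset (Arr × ℕ)} (h : Run C σ t S τ) :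
    S.card ≤ t := by
  induction h with
  | skip σ => simp
  | assign σ x e => exact (e.card_cells_le σ).trans (Nat.le_succ _)
  | store σ A e f =>
    have := Finset.card_insert_le (A, e.eval σ) (e.cells σ ∪ f.cells σ)
    have := Finset.card_union_le (e.cells σ) (f.cells σ)
    have := e.card_cells_le σ
    have := f.card_cells_le σ
    omega
  | seq σ ρ τ C D t u S T _ _ ih ih' =>
    have := Finset.card_union_le S T
    omega
  | ite_true σ τ b C D t S _ _ ih | ite_false σ τ b C D t S _ _ ih =>
    have := Finset.card_union_le (b.cells σ) S
    have := b.card_cells_le σ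
    omega
  | while_true σ ρ τ b C t u S T _ _ _ ih ih' =>
    have := Finset.card_union_le (b.cells σ ∪ S) T
    have := Finset.card_union_le (b.cells σ) S
    have := b.card_cells_le σ
    omega
  | while_false σ b C _ => exact (b.card_cells_le σ).trans (Nat.le_succ _)

/-- The program `C`, started in `σ`, halts after `t` steps in a state `τ` such that `Q t τ`. -/
def wp (C : Cmd) (σ : State) (Q : ℕ → State → Prop) : Prop := ∃ t S τ, Run C σ t S τ ∧ Q t τ

theorem wp.mono {C : Cmd} {σ : State} {Q Q' : ℕ → State → Prop} (h : wp C σ Q)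
    (hQ : ∀ t τ, Q t τ → Q' t τ) : wp C σ Q' := by
  obtain ⟨t, S, τ, h1, h2⟩ := h
  exact ⟨t, S, τ, h1, hQ t τ h2⟩

theorem wp_skip {σ : State} {Q : ℕ → State → Prop} : wp .skip σ Q ↔ Q 1 σ := by
  constructor
  · rintro ⟨t, S, τ, h, hQ⟩
    cases h
    exact hQ
  · exact fun h => ⟨_, _, _, .skip σ, h⟩

theorem wp_assign {σ : State} {x : Reg} {e : Expr} {Q : ℕ → State → Prop} :
    wp (.assign x e) σ Q ↔ Q (e.cost + 1) (σ.setReg x (e.eval σ)) := by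
  constructor
  · rintro ⟨t, S, τ, h, hQ⟩
    cases h
    exact hQ
  · exact fun h => ⟨_, _, _, .assign σ x e, h⟩

theorem wp_store {σ : State} {A : Arr} {e f : Expr} {Q : ℕ → State → Prop} :
    wp (.store A e f) σ Q ↔ Q (e.cost + f.cost + 1) (σ.setArr A (e.eval σ) (f.eval σ)) := by
  constructor
  · rintro ⟨t, S, τ, h, hQ⟩
    cases h
    exact hQ
  · exact fun h => ⟨_, _, _, .store σ A e f, h⟩

theorem wp_seq {σ : State} {C D : Cmd} {Q : ℕ → State → Prop} :
    wp (.seq C D) σ Q ↔ wp C σ fun t ρ => wp D ρ fun u τ => Q (t + u) τ := by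
  constructor
  · rintro ⟨t, S, τ, h, hQ⟩
    cases h with
    | seq _ ρ _ _ _ t u S T h1 h2 => exact ⟨t, S, ρ, h1, u, T, τ, h2, hQ⟩
  · rintro ⟨t, S, ρ, h1, u, T, τ, h2, hQ⟩
    exact ⟨_, _, _, .seq _ _ _ _ _ _ _ _ _ h1 h2, hQ⟩

theorem wp_ite {σ : State} {b : Test} {C D : Cmd} {Q : ℕ → State → Prop} :
    wp (.ite b C D) σ Q ↔ if b.eval σ = true then wp C σ fun t τ => Q (b.cost + 1 + t) τ
      else wp D σ fun t τ => Q (b.cost + 1 + t) τ := by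
  split_ifs with hb
  · constructor
    · rintro ⟨t, S, τ, h, hQ⟩
      cases h with
      | ite_true _ _ _ _ _ t S _ h => exact ⟨t, S, τ, h, hQ⟩
      | ite_false _ _ _ _ _ t S hb' h => simp [hb] at hb'
    · rintro ⟨t, S, τ, h, hQ⟩
      exact ⟨_, _, _, .ite_true _ _ _ _ _ _ _ hb h, hQ⟩
  · constructor
    · rintro ⟨t, S, τ, h, hQ⟩
      cases h with
      | ite_true _ _ _ _ _ t S hb' h => exact absurd hb' hb
      | ite_false _ _ _ _ _ t S _ h => exact ⟨t, S, τ, h, hQ⟩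
    · rintro ⟨t, S, τ, h, hQ⟩
      exact ⟨_, _, _, .ite_false _ _ _ _ _ _ _ (by simpa using hb) h, hQ⟩

/-- A loop with an invariant, and a potential that pays for the steps. -/
theorem wp_while {b : Test} {C : Cmd} (Inv : State → Prop) (Φ : State → ℕ)
    (hC : ∀ σ, Inv σ → b.eval σ = true →
      wp C σ fun t τ => Inv τ ∧ t + b.cost + 1 + Φ τ ≤ Φ σ) {σ : State} (hσ : Inv σ) :
    wp (.while b C) σ fun t τ => Inv τ ∧ b.eval τ = false ∧ t + Φ τ ≤ Φ σ + b.cost + 1 := by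
  suffices H : ∀ m σ, Φ σ = m → Inv σ →
      wp (.while b C) σ fun t τ => Inv τ ∧ b.eval τ = false ∧ t + Φ τ ≤ Φ σ + b.cost + 1 from
    H _ σ rfl hσ
  intro m
  induction m using Nat.strong_induction_on with
  | _ m ih =>
    rintro σ rfl hσ
    by_cases hb : b.eval σ = true
    · obtain ⟨t, S, ρ, h, hρ, ht⟩ := hC σ hσ hb
      obtain ⟨u, T, τ, h', hτ, hb', hu⟩ := ih (Φ ρ) (by omega) ρ rfl hρ
      exact ⟨_, _, _, .while_true _ _ _ _ _ _ _ _ _ hb h h', hτ, hb', by omega⟩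
    · exact ⟨_, _, _, .while_false σ b C (by simpa using hb), hσ, by simpa using hb, by omega⟩

theorem eval_lt {σ : State} {e f : Expr} :
    (Test.lt e f).eval σ = true ↔ e.eval σ < f.eval σ := decide_eq_true_iff

theorem eval_eq {σ : State} {e f : Expr} :
    (Test.eq e f).eval σ = true ↔ e.eval σ = f.eval σ := decide_eq_true_iff

theorem eval_and {σ : State} {s t : Test} :
    (Test.and s t).eval σ = true ↔ s.eval σ = true ∧ t.eval σ = true := Bool.and_eq_true_iff

theorem eval_or {σ : State} {s t : Test} :
    (Test.or s t).eval σ = true ↔ s.eval σ = true ∨ t.eval σ = true := Bool.or_eq_true_iff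

theorem setReg_reg (σ : State) (x y : Reg) (m : ℕ) :
    (σ.setReg x m).reg y = if y = x then m else σ.reg y := by
  simp [State.setReg, Function.update_apply]

theorem setReg_self (σ : State) (x : Reg) : σ.setReg x (σ.reg x) = σ := by
  simp [State.setReg]

theorem setReg_arr (σ : State) (x : Reg) (m : ℕ) : (σ.setReg x m).arr = σ.arr := rfl

theorem setArr_reg (σ : State) (A : Arr) (i m : ℕ) : (σ.setArr A i m).reg = σ.reg := rfl

theorem setArr_arr (σ : State) (A B : Arr) (i m : ℕ) :
    (σ.setArr A i m).arr B = if B = A then Function.update (σ.arr A) i m else σ.arr B := by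
  simp only [State.setArr, Function.update_apply]

theorem wp_ite_assign {σ : State} {b : Test} {x : Reg} {e : Expr} {Q : ℕ → State → Prop} :
    wp (.ite b (.assign x e) .skip) σ Q ↔
      Q (b.cost + 1 + if b.eval σ = true then e.cost + 1 else 1)
        (σ.setReg x (if b.eval σ = true then e.eval σ else σ.reg x)) := by
  rw [wp_ite]
  split_ifs
  · rw [wp_assign]
  · rw [wp_skip, setReg_self]

/-- Only the registers in `L` have changed. -/
def Frame (L : List Reg) (σ τ : State) : Prop := ∀ r, r ∉ L → τ.reg r = σ.reg r

theorem Frame.refl (L : List Reg) (σ : State) : Frame L σ σ := fun _ _ => rfl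

theorem Frame.trans {L L' : List Reg} {σ ρ τ : State} (h : Frame L σ ρ) (h' : Frame L' ρ τ)
    (hL : L' ⊆ L) : Frame L σ τ := fun r hr => (h' r fun hc => hr (hL hc)).trans (h r hr)

theorem Frame.setReg {L : List Reg} {σ ρ : State} (h : Frame L σ ρ) {x : Reg} (hx : x ∈ L) (m : ℕ) :
    Frame L σ (ρ.setReg x m) := by
  intro r hr
  rw [setReg_reg, if_neg (by rintro rfl; exact hr hx), h r hr]

/-- The register `ok` has been set to `0` if `P` fails. -/
def Checked (P : Prop) (σ τ : State) : Prop :=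
  (P ∧ τ.reg .ok = σ.reg .ok) ∨ (¬ P ∧ τ.reg .ok = 0)

/-- A loop that checks a property of all the numbers from `x` to `y`. -/
theorem wp_check {body : Cmd} {x y : Reg} {L : List Reg} {T : ℕ} {P : ℕ → Prop} {σ : State}
    {m N : ℕ} (hm : σ.reg x = m) (hN : σ.reg y = N)
    (hyL : y ∉ Reg.ok :: x :: L)
    (hbody : ∀ ρ : State, ρ.arr = σ.arr → Frame (.ok :: x :: L) σ ρ → m ≤ ρ.reg x →
      ρ.reg x < N → wp body ρ fun t τ => t ≤ T ∧ τ.arr = ρ.arr ∧ Frame (.ok :: x :: L) ρ τ ∧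
        τ.reg x = ρ.reg x + 1 ∧ Checked (P (ρ.reg x)) ρ τ) :
    wp (.while (.lt (.reg x) (.reg y)) body) σ fun t τ =>
      t ≤ (N - m) * (T + 4) + 4 ∧ τ.arr = σ.arr ∧ Frame (.ok :: x :: L) σ τ ∧
        Checked (∀ z, m ≤ z → z < N → P z) σ τ := by
  subst hm hN
  refine (wp_while
    (fun ρ => ρ.arr = σ.arr ∧ Frame (.ok :: x :: L) σ ρ ∧ σ.reg x ≤ ρ.reg x ∧
      Checked (∀ z, σ.reg x ≤ z → z < ρ.reg x → P z) σ ρ ∧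
      -- The second alternative covers a loop that starts beyond its bound and is never entered.
      (ρ.reg x ≤ σ.reg y ∨ ρ.reg x = σ.reg x))
    (fun ρ => (σ.reg y - ρ.reg x) * (T + 4)) ?_
    ⟨rfl, .refl _ _, le_rfl, .inl ⟨fun z h1 h2 => by omega, rfl⟩, .inr rfl⟩).mono ?_
  · rintro ρ ⟨h1, h2, h3, h4, h5⟩ hb
    have hy := h2 y hyL
    simp only [Test.eval, Expr.eval, decide_eq_true_eq, hy] at hb
    refine (hbody ρ h1 h2 h3 hb).mono ?_
    rintro t τ ⟨g1, g2, g3, g4, g5⟩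
    refine ⟨⟨g2.trans h1, h2.trans g3 (fun _ h => h), by omega, ?_, .inl (by omega)⟩, ?_⟩
    · rcases g5 with ⟨f1, f2⟩ | ⟨f1, f2⟩
      · rcases h4 with ⟨e1, e2⟩ | ⟨e1, e2⟩
        · refine .inl ⟨fun z hz hz' => ?_, by rw [f2, e2]⟩
          rw [g4] at hz'
          rcases Nat.lt_succ_iff_lt_or_eq.1 hz' with g | rfl
          · exact e1 z hz g
          · exact f1
        · exact .inr ⟨fun hc => e1 fun z hz hz' => hc z hz (by omega), by rw [f2, e2]⟩
      · exact .inr ⟨fun hc => f1 (hc _ h3 (by omega)), f2⟩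
    · simp only [Test.cost, Expr.cost]
      obtain ⟨m, hm⟩ : ∃ m, σ.reg y - ρ.reg x = m + 1 := ⟨σ.reg y - ρ.reg x - 1, by omega⟩
      have hm' : σ.reg y - τ.reg x = m := by omega
      rw [hm, hm', Nat.succ_mul]
      omega
  · rintro t τ ⟨⟨h1, h2, h3, h4, h5⟩, hb, ht⟩
    have hy := h2 y hyL
    simp only [Test.eval, Expr.eval, decide_eq_false_iff_not, hy, not_lt] at hb
    simp only [Test.cost, Expr.cost] at ht
    refine ⟨by omega, h1, h2, ?_⟩
    have : (∀ z, σ.reg x ≤ z → z < τ.reg x → P z) ↔ (∀ z, σ.reg x ≤ z → z < σ.reg y → P z) := by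
      rcases h5 with h5 | h5
      · rw [le_antisymm h5 hb]
      · constructor <;> intro _ z hz hz' <;> omega
    rwa [Checked, ← this]

/-! ### The programs for single tasks -/

/-- The registers `mn`, `mx`, `len` describe the stack entries `e` with `a ≤ e < m`. -/
structure Summary (lo hi : ℕ → ℕ) (a m mn mx len : ℕ) : Prop where
  mn_mem : mn ∈ segUnion lo hi a m
  mx_mem : mx ∈ segUnion lo hi a m
  sub : segUnion lo hi a m ⊆ Finset.Icc mn mx
  len : len = ∑ e ∈ Finset.Ico a m, (hi e + 1 - lo e)

theorem mem_segUnion_cons {lo hi : ℕ → ℕ} {a m x : ℕ} (ha : a < m) :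
    x ∈ segUnion lo hi a m ↔ (lo a ≤ x ∧ x ≤ hi a) ∨ x ∈ segUnion lo hi (a + 1) m := by
  rw [mem_segUnion, mem_segUnion]
  constructor
  · rintro ⟨e, h1, h2, h3⟩
    rcases h1.eq_or_lt with rfl | g
    · exact .inl h3
    · exact .inr ⟨e, g, h2, h3⟩
  · rintro (h | ⟨e, h1, h2, h3⟩)
    · exact ⟨a, le_rfl, ha, h⟩
    · exact ⟨e, by omega, h2, h3⟩

theorem Summary.single {lo hi : ℕ → ℕ} {a : ℕ} (h : lo a ≤ hi a) :
    Summary lo hi a (a + 1) (lo a) (hi a) (hi a + 1 - lo a) := by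
  refine ⟨mem_segUnion.2 ⟨a, le_rfl, by omega, le_rfl, h⟩,
    mem_segUnion.2 ⟨a, le_rfl, by omega, h, le_rfl⟩, fun x hx => ?_, by simp⟩
  obtain ⟨e, h1, h2, h3⟩ := mem_segUnion.1 hx
  obtain rfl : e = a := by omega
  exact Finset.mem_Icc.2 h3

theorem Summary.cons {lo hi : ℕ → ℕ} {a m mn mx len : ℕ} (hs : Summary lo hi (a + 1) m mn mx len)
    (ha : a < m) (h : lo a ≤ hi a) :
    Summary lo hi a m (min (lo a) mn) (max mx (hi a)) (len + (hi a + 1 - lo a)) := by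
  refine ⟨?_, ?_, fun x hx => ?_, ?_⟩
  · rw [mem_segUnion_cons ha]
    rcases min_choice (lo a) mn with g | g <;> rw [g]
    · exact .inl ⟨le_rfl, h⟩
    · exact .inr hs.mn_mem
  · rw [mem_segUnion_cons ha]
    rcases max_choice mx (hi a) with g | g <;> rw [g]
    · exact .inr hs.mx_mem
    · exact .inl ⟨h, le_rfl⟩
  · rw [Finset.mem_Icc]
    rcases (mem_segUnion_cons ha).1 hx with g | g
    · omega
    · have := Finset.mem_Icc.1 (hs.sub g)
      omega
  · rw [Finset.sum_eq_sum_Ico_succ_bot ha, hs.len, add_comm]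

theorem Summary.eq_of_isRange {lo hi : ℕ → ℕ} {a m mn mx len : ℕ}
    (hs : Summary lo hi a m mn mx len) (hr : IsRange lo hi a m) :
    segUnion lo hi a m = Finset.Icc mn mx := by
  obtain ⟨x, y, hr⟩ := hr
  have h1 := Finset.mem_Icc.1 (hr ▸ hs.mn_mem)
  have h2 := Finset.mem_Icc.1 (hr ▸ hs.mx_mem)
  refine Finset.Subset.antisymm hs.sub ?_
  rw [hr]
  exact Finset.Icc_subset_Icc h1.1 h2.2

/-- The entries are disjoint, so `len` is the size of their union. This union is contained in the
range from `mn` to `mx` and therefore equal to it exactly when the sizes agree. -/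
theorem Summary.eq_iff {n : ℕ} {p lo hi : ℕ → ℕ} {i top a m mn mx len : ℕ}
    (hs : Summary lo hi a m mn mx len) (h : IsStack n p lo hi i top) (hm : m ≤ top) :
    mx + 1 - mn = len ↔ segUnion lo hi a m = Finset.Icc mn mx := by
  rw [hs.len, ← h.card_segUnion hm, ← Nat.card_Icc]
  constructor
  · exact fun g => Finset.eq_of_subset_of_card_le hs.sub g.le
  · exact fun g => by rw [g]

/-- The search serves both algorithms: `M`, the bound on `j` expressed by `more`, is `min k top` in
one and `top` in the other. The summary is updated by one entry per round, so the time is linear in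
`M`. -/
theorem wp_findRange {more : Test} {σ : State} {n : ℕ} {p : ℕ → ℕ} {i M : ℕ}
    (h : IsStack n p (σ.arr .lo) (σ.arr .hi) i (σ.reg .top)) (ht : 1 ≤ σ.reg .top)
    (hM : M ≤ σ.reg .top)
    (hmore : ∀ ρ : State, ρ.reg .top = σ.reg .top → (more.eval ρ = true ↔ ρ.reg .j < M)) :
    wp (findRange more) σ fun t τ => t ≤ (more.cost + 60) * (M + 1) ∧ τ.arr = σ.arr ∧
      Frame [.j, .mn, .mx, .len, .found] σ τ ∧
      ((τ.reg .found = 1 ∧ 2 ≤ τ.reg .j ∧ τ.reg .j ≤ M ∧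
        segUnion (σ.arr .lo) (σ.arr .hi) (σ.reg .top - τ.reg .j) (σ.reg .top) =
          Finset.Icc (τ.reg .mn) (τ.reg .mx) ∧
        ∀ j, 2 ≤ j → j < τ.reg .j →
          ¬ IsRange (σ.arr .lo) (σ.arr .hi) (σ.reg .top - j) (σ.reg .top)) ∨
      (τ.reg .found = 0 ∧ ∀ j, 2 ≤ j → j ≤ M →
        ¬ IsRange (σ.arr .lo) (σ.arr .hi) (σ.reg .top - j) (σ.reg .top))) := by
  simp only [findRange, wp_seq, wp_assign, atDepth, Expr.eval, Expr.cost, setReg_reg, setReg_arr,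
    reduceCtorEq, if_true, if_false]
  set ρ₀ := ((((σ.setReg .j 1).setReg .mn (σ.arr .lo (σ.reg .top - 1))).setReg .mx
    (σ.arr .hi (σ.reg .top - 1))).setReg .len
      (σ.arr .hi (σ.reg .top - 1) + 1 - σ.arr .lo (σ.reg .top - 1))).setReg .found 0 with hρ₀
  have hf₀ : Frame [.j, .mn, .mx, .len, .found] σ ρ₀ := by
    intro r hr
    simp only [List.mem_cons, List.not_mem_nil, or_false, not_or] at hr
    simp [hρ₀, setReg_reg, hr]
  refine (wp_while
    (fun ρ => ρ.arr = σ.arr ∧ Frame [.j, .mn, .mx, .len, .found] σ ρ ∧ 1 ≤ ρ.reg .j ∧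
      ρ.reg .j ≤ σ.reg .top ∧
      Summary (σ.arr .lo) (σ.arr .hi) (σ.reg .top - ρ.reg .j) (σ.reg .top) (ρ.reg .mn) (ρ.reg .mx)
        (ρ.reg .len) ∧
      ((ρ.reg .found = 1 ∧ 2 ≤ ρ.reg .j ∧ ρ.reg .j ≤ M ∧
        segUnion (σ.arr .lo) (σ.arr .hi) (σ.reg .top - ρ.reg .j) (σ.reg .top) =
          Finset.Icc (ρ.reg .mn) (ρ.reg .mx) ∧
        ∀ j, 2 ≤ j → j < ρ.reg .j →
          ¬ IsRange (σ.arr .lo) (σ.arr .hi) (σ.reg .top - j) (σ.reg .top)) ∨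
      (ρ.reg .found = 0 ∧ ∀ j, 2 ≤ j → j ≤ ρ.reg .j →
        ¬ IsRange (σ.arr .lo) (σ.arr .hi) (σ.reg .top - j) (σ.reg .top))))
    (fun ρ => (more.cost + 60) * (M - ρ.reg .j)) ?_ (σ := ρ₀) ⟨rfl, hf₀, ?_, ?_, ?_, ?_⟩).mono ?_
  · rintro ρ ⟨h1, h2, h3, h4, h5, h6⟩ hb
    have htop := h2 .top (by decide)
    simp only [Test.eval, Expr.eval, Bool.and_eq_true] at hb
    obtain ⟨hb1, hb2⟩ := hb
    replace hb1 := of_decide_eq_true hb1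
    rw [hmore ρ htop] at hb2
    have h6' := (h6.resolve_left (by rintro ⟨g, -⟩; omega)).2
    have hlt : σ.reg .top - (ρ.reg .j + 1) < σ.reg .top := by omega
    have hbd := (h.bounds _ hlt).2.1
    have hadd : σ.reg .top - (ρ.reg .j + 1) + 1 = σ.reg .top - ρ.reg .j := by omega
    have hs' := Summary.cons (hadd ▸ h5) hlt hbd
    have hpot : (more.cost + 60) * (M - ρ.reg .j) =
        (more.cost + 60) * (M - (ρ.reg .j + 1)) + (more.cost + 60) := by
      rw [← Nat.mul_succ]; congr 1; omega
    set U := σ.reg .top - (ρ.reg .j + 1) with hU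
    have hframe : ∀ a b c d e, Frame [.j, .mn, .mx, .len, .found] σ
        (((((ρ.setReg .j a).setReg .mn b).setReg .mx c).setReg .len d).setReg .found e) :=
      fun a b c d e => ((((h2.setReg (by decide) a).setReg (by decide) b).setReg (by decide)
        c).setReg (by decide) d).setReg (by decide) e
    simp only [wp_seq, wp_assign, wp_ite_assign, Test.eval, Expr.eval, Expr.cost, Test.cost,
      setReg_reg, setReg_arr, reduceCtorEq, if_true, if_false, decide_eq_true_eq, htop, h1, ← hU,
      ← min_def_lt, ← max_def_lt]
    refine ⟨⟨trivial, hframe _ _ _ _ _, by omega, by omega, hs', ?_⟩, ?_⟩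
    · split_ifs with hc
      · refine .inl ⟨rfl, by omega, by omega, (hs'.eq_iff h le_rfl).1 hc, fun j g1 g2 => ?_⟩
        exact h6' j g1 (by omega)
      · refine .inr ⟨hb1, fun j g1 g2 => ?_⟩
        rcases Nat.lt_or_ge (ρ.reg .j) j with g | g
        · obtain rfl : j = ρ.reg .j + 1 := by omega
          exact fun hr => hc ((hs'.eq_iff h le_rfl).2 (hs'.eq_of_isRange hr))
        · exact h6' j g1 g
    · rw [hpot]
      split_ifs <;> omega
  · simp [hρ₀, setReg_reg]
  · simpa [hρ₀, setReg_reg] using ht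
  · have h1 : σ.reg .top - 1 + 1 = σ.reg .top := by omega
    have := Summary.single (h.bounds (σ.reg .top - 1) (by omega)).2.1
    rw [h1] at this
    simpa [hρ₀, setReg_reg] using this
  · refine .inr ⟨by simp [hρ₀, setReg_reg], fun j g1 g2 => ?_⟩
    simp [hρ₀, setReg_reg] at g2
    omega
  · rintro t τ ⟨⟨h1, h2, h3, h4, h5, h6⟩, hb, ht'⟩
    refine ⟨?_, h1, h2, ?_⟩
    · simp only [Test.cost, Expr.cost] at ht'
      have hj : ρ₀.reg .j = 1 := by simp [hρ₀, setReg_reg]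
      rw [hj] at ht'
      have : (more.cost + 60) * (M - 1) ≤ (more.cost + 60) * M := Nat.mul_le_mul_left _ (by omega)
      rw [Nat.mul_succ]
      omega
    · refine h6.imp_right ?_
      rintro ⟨h7, h8⟩
      refine ⟨h7, fun j g1 g2 => h8 j g1 ?_⟩
      have htop := h2 .top (by decide)
      simp only [Test.eval, Expr.eval, h7, decide_true, Bool.true_and] at hb
      by_contra hc
      have := (hmore τ htop).2 (by omega)
      rw [this] at hb
      exact absurd hb (by decide)

end HFO

/-! ### Merging, and the Baxter test for the top entries of the stack -/

namespace HFO

theorem wp_merge {σ : State} {Q : ℕ → State → Prop}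
    (h : ∀ τ : State, τ.arr .lo = Function.update (σ.arr .lo) (σ.reg .top - σ.reg .j) (σ.reg .mn) →
      τ.arr .hi = Function.update (σ.arr .hi) (σ.reg .top - σ.reg .j) (σ.reg .mx) →
      τ.arr .input = σ.arr .input → τ.reg .top = σ.reg .top - σ.reg .j + 1 →
      Frame [.top] σ τ → Q 14 τ) : wp merge σ Q := by
  simp only [merge, wp_seq, wp_assign, wp_store, Expr.eval, Expr.cost]
  refine h _ ?_ ?_ ?_ ?_ ?_
  · simp [setReg_reg, setReg_arr, setArr_arr, setArr_reg]
  · simp [setReg_reg, setReg_arr, setArr_arr, setArr_reg]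
  · simp [setReg_arr, setArr_arr]
  · simp [setReg_reg, setArr_reg]
  · intro r hr
    have : r ≠ .top := by simpa using hr
    simp [setReg_reg, setArr_reg, this]

/-- The condition tested by `badQuadruple`. -/
def Bad (lo hi : ℕ → ℕ) (a b c d : ℕ) : Prop :=
  (hi a + 1 = lo d ∧ lo c < lo a ∧ lo d < lo b) ∨ (hi d + 1 = lo a ∧ lo b < lo d ∧ lo a < lo c)

theorem badQuadruple_eval (σ : State) : badQuadruple.eval σ = true ↔
    Bad (σ.arr .lo) (σ.arr .hi) (σ.reg .a) (σ.reg .b) (σ.reg .c) (σ.reg .d) := by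
  simp only [badQuadruple, eval_or, eval_and, eval_eq, eval_lt, Expr.eval, Bad]

theorem Frame.of_setReg {L : List Reg} {σ τ : State} {x : Reg} {m : ℕ}
    (h : Frame L (σ.setReg x m) τ) (hx : x ∈ L) : Frame L σ τ :=
  ((Frame.refl L σ).setReg hx m).trans h fun _ h => h

/-- A step of a checking loop that consists of another checking loop. -/
theorem wp_check_step {body : Cmd} {x x' : Reg} {L : List Reg} {T W N m : ℕ} {P : ℕ → Prop}
    {ρ : State} (hx : Reg.top ∉ Reg.ok :: x' :: x :: L) (hx' : x' ∉ Reg.ok :: x :: L)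
    (hxo : x ≠ .ok) (hm : ρ.reg x' = m) (hN : ρ.reg .top = N) (hW : N ≤ m + 1 + W)
    (hbody : ∀ ρ' : State, ρ'.arr = ρ.arr → Frame (.ok :: x :: L) ρ ρ' → m + 1 ≤ ρ'.reg x →
      ρ'.reg x < N → wp body ρ' fun t τ => t ≤ T ∧ τ.arr = ρ'.arr ∧ Frame (.ok :: x :: L) ρ' τ ∧
        τ.reg x = ρ'.reg x + 1 ∧ Checked (P (ρ'.reg x)) ρ' τ) :
    wp (.seq (.assign x (.add (.reg x') (.const 1)))
        (.seq (.while (.lt (.reg x) (.reg .top)) body)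
          (.assign x' (.add (.reg x') (.const 1))))) ρ fun t τ =>
      t ≤ W * (T + 4) + 20 ∧ τ.arr = ρ.arr ∧ Frame (.ok :: x' :: x :: L) ρ τ ∧
        τ.reg x' = ρ.reg x' + 1 ∧ Checked (∀ z, m + 1 ≤ z → z < N → P z) ρ τ := by
  simp only [wp_seq, wp_assign, Expr.eval, Expr.cost]
  simp only [List.mem_cons, not_or] at hx hx'
  set σ := ρ.setReg x (ρ.reg x' + 1) with hσ
  have hσx : σ.reg x = m + 1 := by rw [hσ, setReg_reg, if_pos rfl, hm]
  have hσN : σ.reg .top = N := by rw [hσ, setReg_reg, if_neg hx.2.2.1, hN]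
  refine (wp_check (L := L) (T := T) (P := P) hσx hσN (by simp [hx]) fun ρ' h1 h2 h3 h4 =>
      hbody ρ' h1 (h2.of_setReg (by simp)) h3 h4).mono ?_
  rintro t τ ⟨h1, h2, h3, h4⟩
  have h3' := h3.of_setReg (by simp)
  have hmul : (N - (m + 1)) * (T + 4) ≤ W * (T + 4) := Nat.mul_le_mul_right _ (by omega)
  refine ⟨by omega, h2, ?_, ?_, ?_⟩
  · refine Frame.setReg (Frame.trans (.refl _ _) h3' ?_) (by simp) _
    intro r hr
    simp only [List.mem_cons] at hr ⊢
    tauto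
  · rw [setReg_reg, if_pos rfl, h3' x' (by simp [hx'])]
  · rcases h4 with ⟨g1, g2⟩ | ⟨g1, g2⟩
    · refine .inl ⟨g1, ?_⟩
      rw [setReg_reg, if_neg (Ne.symm hx'.1), g2, setReg_reg, if_neg hxo.symm]
    · refine .inr ⟨g1, ?_⟩
      rw [setReg_reg, if_neg (Ne.symm hx'.1), g2]

theorem wp_baxterTop (σ : State) {j top : ℕ} (hj' : σ.reg .j = j) (htop : σ.reg .top = top) :
    wp baxterTop σ fun t τ => t ≤ 1000 * (j + 1) ^ 4 ∧ τ.arr = σ.arr ∧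
      Frame [.ok, .a, .b, .c, .d] σ τ ∧
      ((∀ a, top - j ≤ a → a < top → ∀ b, a + 1 ≤ b → b < top → ∀ c, b + 1 ≤ c → c < top →
          ∀ d, c + 1 ≤ d → d < top → ¬ Bad (σ.arr .lo) (σ.arr .hi) a b c d) ∧ τ.reg .ok = 1 ∨
        ¬ (∀ a, top - j ≤ a → a < top → ∀ b, a + 1 ≤ b → b < top → ∀ c, b + 1 ≤ c → c < top →
          ∀ d, c + 1 ≤ d → d < top → ¬ Bad (σ.arr .lo) (σ.arr .hi) a b c d) ∧ τ.reg .ok = 0) := by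
  simp only [baxterTop, wp_seq, wp_assign, Expr.eval, Expr.cost]
  set σ₁ := (σ.setReg .ok 1).setReg .a ((σ.setReg .ok 1).reg .top - (σ.setReg .ok 1).reg .j) with h₁
  have e1 : σ₁.reg .a = top - j := by simp [h₁, setReg_reg, hj', htop]
  have e2 : σ₁.reg .top = top := by simp [h₁, setReg_reg, htop]
  have e3 : Frame [.ok, .a, .b, .c, .d] σ σ₁ :=
    ((Frame.refl _ σ).setReg (by decide) _).setReg (by decide) _
  -- The nested expression bounds, from the inside out, a round of the loop over `d`, and then the
  -- loops over `d`, `c` and `b`, each of which has at most `j` rounds.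
  refine (wp_check (L := [.b, .c, .d]) (T := j * (j * (j * (50 + 4) + 20 + 4) + 20 + 4) + 20)
    (P := fun a => ∀ b, a + 1 ≤ b → b < top → ∀ c, b + 1 ≤ c → c < top → ∀ d, c + 1 ≤ d → d < top →
      ¬ Bad (σ.arr .lo) (σ.arr .hi) a b c d) e1 e2 (by decide) ?_).mono ?_
  · intro ρ ra rf rx rlt
    have rt := (rf .top (by decide)).trans e2
    refine wp_check_step (by decide) (by decide) (by decide) rfl rt (by omega) ?_
    intro ρ' ra' rf' rx' rlt'
    have rt' := (rf' .top (by decide)).trans rt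
    have rA' := rf' .a (by decide)
    refine wp_check_step (by decide) (by decide) (by decide) rfl rt' (by omega) ?_
    intro μ ma mf mx mlt
    have mt := (mf .top (by decide)).trans rt'
    have mA := (mf .a (by decide)).trans rA'
    have mB := mf .b (by decide)
    refine wp_check_step (by decide) (by decide) (by decide) rfl mt (by omega) ?_
    intro ν na nf nx nlt
    have nA := (nf .a (by decide)).trans mA
    have nB := (nf .b (by decide)).trans mB
    have nC := nf .c (by decide)
    have hbad := badQuadruple_eval ν
    rw [na, ma, ra', ra, nA, nB, nC] at hbad
    change badQuadruple.eval ν = true ↔ Bad (σ.arr .lo) (σ.arr .hi) _ _ _ _ at hbad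
    rw [wp_seq, wp_ite_assign]
    simp only [wp_assign, Expr.eval, Expr.cost]
    have hcost : badQuadruple.cost = 39 := rfl
    refine ⟨?_, rfl, ?_, ?_, ?_⟩
    · rw [hcost]
      split_ifs <;> omega
    · exact ((Frame.refl _ ν).setReg (by decide) _).setReg (by decide) _
    · simp [setReg_reg]
    · by_cases hb : badQuadruple.eval ν = true
      · exact .inr ⟨not_not.2 (hbad.1 hb), by simp [setReg_reg, hb]⟩
      · exact .inl ⟨fun hc => hb (hbad.2 hc), by simp [setReg_reg, hb]⟩
  · rintro t τ ⟨h1, h2, h3, h4⟩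
    refine ⟨?_, h2, e3.trans h3 fun _ h => h, ?_⟩
    · have hmul : (top - (top - j)) * (j * (j * (j * (50 + 4) + 20 + 4) + 20 + 4) + 20 + 4) ≤
        j * (j * (j * (j * (50 + 4) + 20 + 4) + 20 + 4) + 20 + 4) :=
        Nat.mul_le_mul_right _ (by omega)
      have hpoly : j * (j * (j * (j * (50 + 4) + 20 + 4) + 20 + 4) + 20 + 4) + 20 ≤
          1000 * (j + 1) ^ 4 := by
        have h2 : 0 ≤ j ^ 2 := Nat.zero_le _
        have h3 : 0 ≤ j ^ 3 := Nat.zero_le _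
        have h4 : 0 ≤ j ^ 4 := Nat.zero_le _
        ring_nf
        linarith
      omega
    · have hok : σ₁.reg .ok = 1 := by simp [h₁, setReg_reg]
      rcases h4 with ⟨g1, g2⟩ | ⟨g1, g2⟩
      · exact .inl ⟨g1, by rw [g2, hok]⟩
      · exact .inr ⟨g1, g2⟩

end HFO

namespace HFO

/-! ### The main loops -/

theorem wp_pushNext {σ : State} {Q : ℕ → State → Prop}
    (h : ∀ τ : State, τ.arr .lo = Function.update (σ.arr .lo) (σ.reg .top) (σ.arr .input (σ.reg .i)) →
      τ.arr .hi = Function.update (σ.arr .hi) (σ.reg .top) (σ.arr .input (σ.reg .i)) →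
      τ.arr .input = σ.arr .input → τ.reg .top = σ.reg .top + 1 → τ.reg .i = σ.reg .i + 1 →
      Frame [.top, .i] σ τ → Q 16 τ) : wp pushNext σ Q := by
  simp only [pushNext, wp_seq, wp_assign, wp_store, Expr.eval, Expr.cost]
  refine h _ ?_ ?_ ?_ ?_ ?_ ?_
  · simp [setReg_arr, setArr_arr, setArr_reg]
  · simp [setReg_arr, setArr_arr, setArr_reg]
  · simp [setReg_arr, setArr_arr]
  · simp [setReg_reg, setArr_reg]
  · simp [setReg_reg, setArr_reg]
  · intro r hr
    simp only [List.mem_cons, List.not_mem_nil, or_false, not_or] at hr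
    simp [setReg_reg, setArr_reg, hr]

/-- The loop of `recognise` and of `findOrder`. -/
def mainLoop (step : Cmd) : Cmd :=
  .while (.reg .i ≺ .reg .n)
    (pushNext ;; .go ≔ .const 1 ;; .while (.reg .go ≐ .const 1) step)

/-- The invariant of the main loop: `E` relates the remaining points and the register `kmin`, and,
unless the outcome `F` is settled, the lowest `m` entries of the stack admit no merge. -/
structure LoopInv (n K : ℕ) (p inp : ℕ → ℕ) (F : Prop) (E : Finset ℕ → ℕ → Prop) (m : ℕ)
    (σ : State) : Prop where
  reg_n : σ.reg .n = n
  input : σ.arr .input = inp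
  stack : IsStack n p (σ.arr .lo) (σ.arr .hi) (σ.reg .i) (σ.reg .top)
  rel : E (remaining n p (σ.arr .lo) (σ.reg .i) (σ.reg .top)) (σ.reg .kmin)
  noRange : F ∨ NoRange K (σ.arr .lo) (σ.arr .hi) m

section MainLoop

variable {n K : ℕ} {p inp : ℕ → ℕ} {F : Prop} {E : Finset ℕ → ℕ → Prop}

theorem LoopInv.congr {m : ℕ} {σ τ : State} (h : LoopInv n K p inp F E m σ)
    (ha : τ.arr = σ.arr) {L : List Reg} (hf : Frame L σ τ)
    (hL : Reg.n ∉ L ∧ Reg.i ∉ L ∧ Reg.top ∉ L ∧ Reg.kmin ∉ L) : LoopInv n K p inp F E m τ := by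
  obtain ⟨h1, h2, h3, h4, h5⟩ := h
  refine ⟨?_, ?_, ?_, ?_, ?_⟩
  · rwa [hf _ hL.1]
  · rwa [ha]
  · rwa [ha, hf _ hL.2.1, hf _ hL.2.2.1]
  · rwa [ha, hf _ hL.2.1, hf _ hL.2.2.1, hf _ hL.2.2.2]
  · rwa [ha]

/-- Amortised analysis: a round of the inner loop ends the loop or shortens the stack. Each push
therefore pays `B` for the entry it creates and `B` for the last, unsuccessful round; the `40`
covers the fixed overhead. -/
theorem wp_mainLoop {step : Cmd} {B : ℕ} (hp : Set.InjOn p (Finset.Icc 1 n))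
    (hinp : ∀ i, i < n → inp i ∈ Finset.Icc 1 n ∧ p (inp i) = i)
    (hstep : ∀ ρ, LoopInv n K p inp F E (ρ.reg .top - 1) ρ → 1 ≤ ρ.reg .top →
      wp step ρ fun t τ => t + 4 ≤ B ∧ τ.reg .i = ρ.reg .i ∧
        ((τ.reg .go = 0 ∧ τ.reg .top = ρ.reg .top ∧ LoopInv n K p inp F E (τ.reg .top) τ) ∨
         (τ.reg .go = 1 ∧ 1 ≤ τ.reg .top ∧ τ.reg .top + 1 ≤ ρ.reg .top ∧
          LoopInv n K p inp F E (τ.reg .top - 1) τ)))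
    {σ : State} (hσ : LoopInv n K p inp F E (σ.reg .top) σ) (hi : σ.reg .i ≤ n) :
    wp (mainLoop step) σ fun t τ => LoopInv n K p inp F E (τ.reg .top) τ ∧ τ.reg .i = n ∧
      t ≤ (n - σ.reg .i) * (2 * B + 40) + B * σ.reg .top + 4 := by
  refine (wp_while (fun ρ => LoopInv n K p inp F E (ρ.reg .top) ρ ∧ ρ.reg .i ≤ n)
    (fun ρ => (n - ρ.reg .i) * (2 * B + 40) + B * ρ.reg .top) ?_ ⟨hσ, hi⟩).mono ?_
  · rintro ρ ⟨h, hle⟩ hlt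
    rw [eval_lt] at hlt
    simp only [Expr.eval, h.reg_n] at hlt
    obtain ⟨hx, hpx⟩ := hinp _ hlt
    rw [wp_seq]
    refine wp_pushNext fun μ m1 m2 m3 m4 m5 m6 => ?_
    rw [h.input] at m1 m2
    have hμ : LoopInv n K p inp F E (μ.reg .top - 1) μ := by
      refine ⟨(m6 _ (by decide)).trans h.reg_n, m3.trans h.input, ?_, ?_, ?_⟩
      · rw [m1, m2, m4, m5]
        exact h.stack.push hp hx hpx
      · rw [m1, m4, m5, m6 .kmin (by decide), IsStack.remaining_push hp hx hpx]
        exact h.rel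
      · refine h.noRange.imp_right fun hN => hN.mono (by omega) fun e he => ?_
        rw [m1, m2, Function.update_of_ne (by omega), Function.update_of_ne (by omega)]
        exact ⟨rfl, rfl⟩
    rw [wp_seq, wp_assign]
    have hμ' := hμ.congr (τ := μ.setReg .go 1) rfl
      ((Frame.refl [.go] μ).setReg (by decide) 1) (by decide)
    have hit : (μ.setReg .go 1).reg .top = μ.reg .top := by simp [setReg_reg]
    refine (wp_while
      (fun ν => ν.reg .i = ρ.reg .i + 1 ∧
        ((ν.reg .go = 0 ∧ LoopInv n K p inp F E (ν.reg .top) ν) ∨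
         (ν.reg .go = 1 ∧ 1 ≤ ν.reg .top ∧ LoopInv n K p inp F E (ν.reg .top - 1) ν)))
      -- A merging round is paid for by the decrease of `top`, the final round by the decrease of
      -- `go`.
      (fun ν => B * ν.reg .top + B * ν.reg .go) ?_ ⟨?_, .inr ⟨?_, ?_, ?_⟩⟩).mono ?_
    · rintro ν ⟨g1, g2⟩ hgo
      rw [eval_eq] at hgo
      simp only [Expr.eval] at hgo
      rcases g2 with ⟨g2, -⟩ | ⟨-, g2, g3⟩
      · omega
      refine (hstep ν g3 g2).mono ?_
      rintro t τ ⟨f1, f2, ⟨f3, f4, f5⟩ | ⟨f3, f4, f5, f6⟩⟩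
      · refine ⟨⟨f2.trans g1, .inl ⟨f3, f5⟩⟩, ?_⟩
        rw [f3, f4, hgo]
        simp only [Test.cost, Expr.cost]
        omega
      · refine ⟨⟨f2.trans g1, .inr ⟨f3, f4, f6⟩⟩, ?_⟩
        rw [f3, hgo]
        simp only [Test.cost, Expr.cost]
        have := Nat.mul_le_mul_left B f5
        rw [Nat.mul_succ] at this
        omega
    · simpa [setReg_reg] using m5
    · simp [setReg_reg, Expr.eval]
    · simp only [Expr.eval]
      omega
    · simp only [Expr.eval]
      exact hit ▸ hμ'
    · rintro t τ ⟨⟨g1, g2⟩, hgo, ht⟩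
      have hgo' : ¬ τ.reg .go = 1 := fun hc => by
        have := (eval_eq (σ := τ) (e := .reg .go) (f := .const 1)).2 hc
        rw [this] at hgo
        exact absurd hgo (by decide)
      obtain ⟨g2, g3⟩ := g2.resolve_right fun hc => hgo' hc.1
      refine ⟨⟨g3, by omega⟩, ?_⟩
      have hgo1 : (μ.setReg .go 1).reg .go = 1 := by simp [setReg_reg]
      simp only [Test.cost, Expr.cost, Expr.eval, hit, hgo1, g2, m4, mul_one, mul_zero] at ht ⊢
      have hB1 : B * (ρ.reg .top + 1) = B * ρ.reg .top + B := Nat.mul_succ _ _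
      have hpot : (n - ρ.reg .i) * (2 * B + 40) =
          (n - τ.reg .i) * (2 * B + 40) + (2 * B + 40) := by
        rw [← Nat.succ_mul]; congr 1; omega
      omega
  · rintro t τ ⟨⟨h1, h2⟩, hb, ht⟩
    have hi' : ¬ τ.reg .i < n := fun hc => by
      have := (eval_lt (σ := τ) (e := .reg .i) (f := .reg .n)).2 (by simpa [Expr.eval, h1.reg_n])
      rw [this] at hb
      exact absurd hb (by decide)
    simp only [Test.cost, Expr.cost] at ht
    exact ⟨h1, by omega, by omega⟩

theorem LoopInv.of_merge {ρ τ : State} {j mn mx : ℕ}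
    (h : LoopInv n K p inp F E (ρ.reg .top - 1) ρ) (hj : 2 ≤ j) (hjt : j ≤ ρ.reg .top)
    (hr : segUnion (ρ.arr .lo) (ρ.arr .hi) (ρ.reg .top - j) (ρ.reg .top) = Finset.Icc mn mx)
    (hlo : τ.arr .lo = Function.update (ρ.arr .lo) (ρ.reg .top - j) mn)
    (hhi : τ.arr .hi = Function.update (ρ.arr .hi) (ρ.reg .top - j) mx)
    (hinp : τ.arr .input = ρ.arr .input) (htop : τ.reg .top = ρ.reg .top - j + 1)
    (hn : τ.reg .n = ρ.reg .n) (hi : τ.reg .i = ρ.reg .i)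
    (hE : E (remaining n p (Function.update (ρ.arr .lo) (ρ.reg .top - j) mn) (ρ.reg .i)
      (ρ.reg .top - j + 1)) (τ.reg .kmin)) :
    LoopInv n K p inp F E (τ.reg .top - 1) τ := by
  refine ⟨hn.trans h.reg_n, hinp.trans h.input, ?_, ?_, ?_⟩
  · rw [hlo, hhi, htop, hi]
    exact h.stack.merge (by omega) hr
  · rwa [hlo, htop, hi]
  · refine h.noRange.imp_right fun hN => hN.mono (by omega) fun e he => ?_
    rw [hlo, hhi, Function.update_of_ne (by omega), Function.update_of_ne (by omega)]
    exact ⟨rfl, rfl⟩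

/-- Ranges that end below the top are excluded by the invariant, those that end at the top by the
failed search. -/
theorem LoopInv.of_not_found {ρ : State} {M : ℕ} (h : LoopInv n K p inp F E (ρ.reg .top - 1) ρ)
    (ht : 1 ≤ ρ.reg .top) (hM : min K (ρ.reg .top) ≤ M)
    (hr : ∀ j, 2 ≤ j → j ≤ M →
      ¬ IsRange (ρ.arr .lo) (ρ.arr .hi) (ρ.reg .top - j) (ρ.reg .top)) :
    LoopInv n K p inp F E (ρ.reg .top) ρ := by
  refine ⟨h.reg_n, h.input, h.stack, h.rel, h.noRange.imp_right fun hN => ?_⟩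
  have hs : ρ.reg .top - 1 + 1 = ρ.reg .top := by omega
  rw [← hs]
  refine hN.succ fun a h1 h2 => ?_
  rw [hs]
  have := hr (ρ.reg .top - a) (by omega) (by omega)
  rwa [show ρ.reg .top - (ρ.reg .top - a) = a by omega] at this

end MainLoop

/-- The body of the inner loop of `recognise`. -/
def recogniseStep (k : ℕ) : Cmd :=
  .go ≔ .const 0 ;;
  findRange (.and (.reg .j ≺ .const k) (.reg .j ≺ .reg .top)) ;;
  .ite (.reg .found ≐ .const 1)
    (baxterTop ;;
     .ite (.reg .ok ≐ .const 1) (merge ;; .go ≔ .const 1) .skip)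
    .skip

/-- A merge contracts a Baxter interval with at most `k` points, which by `Dec.contract` does not
affect decomposability. If the range found is not Baxter, the pattern has a non-Baxter interval and
cannot be decomposable; then `¬ D` is settled and the loop may stop although a range is left. -/
theorem wp_recogniseStep {n k : ℕ} {p inp : ℕ → ℕ} {D : Prop} (ρ : State)
    (h : LoopInv n k p inp (¬ D) (fun S _ => D ↔ Dec k p id S) (ρ.reg .top - 1) ρ)
    (ht : 1 ≤ ρ.reg .top) :
    wp (recogniseStep k) ρ fun t τ => t + 4 ≤ 2000 * (k + 1) ^ 4 ∧ τ.reg .i = ρ.reg .i ∧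
      ((τ.reg .go = 0 ∧ τ.reg .top = ρ.reg .top ∧
        LoopInv n k p inp (¬ D) (fun S _ => D ↔ Dec k p id S) (τ.reg .top) τ) ∨
       (τ.reg .go = 1 ∧ 1 ≤ τ.reg .top ∧ τ.reg .top + 1 ≤ ρ.reg .top ∧
        LoopInv n k p inp (¬ D) (fun S _ => D ↔ Dec k p id S) (τ.reg .top - 1) τ)) := by
  simp only [recogniseStep, wp_seq, wp_assign, Expr.eval, Expr.cost]
  set ρ₁ := ρ.setReg .go 0 with hρ₁
  have f₁ : Frame [.go] ρ ρ₁ := (Frame.refl [.go] ρ).setReg (by decide) 0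
  have h₁ := h.congr (τ := ρ₁) rfl f₁ (by decide)
  have t₁ : ρ₁.reg .top = ρ.reg .top := f₁ _ (by decide)
  have hgo : ρ₁.reg .go = 0 := by simp [hρ₁, setReg_reg]
  rw [← t₁] at h₁ ht ⊢
  rw [← show ρ₁.reg .i = ρ.reg .i from f₁ _ (by decide)]
  clear_value ρ₁
  refine (wp_findRange (M := min k (ρ₁.reg .top)) h₁.stack ht (min_le_right _ _) ?_).mono ?_
  · intro ν hν
    rw [eval_and, eval_lt, eval_lt]
    simp only [Expr.eval, hν, lt_min_iff]
  rintro s μ ⟨hs, ma, mf, hμ⟩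
  -- The loop test costs `7`, to which `wp_findRange` adds `60` per round.
  have hs' : s ≤ 67 * (k + 1) := by
    refine hs.trans (Nat.mul_le_mul le_rfl ?_)
    omega
  have hk4 : 67 * (k + 1) + 1000 * (k + 1) ^ 4 + 200 ≤ 2000 * (k + 1) ^ 4 := by
    have h2 : k ^ 2 + k ^ 3 + k ^ 4 ≥ 0 := Nat.zero_le _
    have h3 : 0 ≤ k ^ 2 := Nat.zero_le _
    have h4 : 0 ≤ k ^ 3 := Nat.zero_le _
    ring_nf
    linarith
  have hμL := h₁.congr ma mf (by decide)
  have mt : μ.reg .top = ρ₁.reg .top := mf _ (by decide)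
  have mi : μ.reg .i = ρ₁.reg .i := mf _ (by decide)
  have mgo : μ.reg .go = 0 := (mf _ (by decide)).trans hgo
  simp only [wp_ite, eval_eq, Expr.eval, Test.cost, Expr.cost]
  rw [← mt, ← ma] at hμ
  rw [← mt, ← mi]
  rw [← mt] at hμL ht
  rcases hμ with ⟨hf, hj2, hjM, hr, -⟩ | ⟨hf, hr⟩
  · rw [if_pos hf, wp_seq]
    refine (wp_baxterTop μ rfl rfl).mono ?_
    rintro s' ν ⟨hs'', na, nf, hν⟩
    have hjk : (μ.reg .j + 1) ^ 4 ≤ (k + 1) ^ 4 := Nat.pow_le_pow_left (by omega) 4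
    have hνL := hμL.congr na nf (by decide)
    have nt : ν.reg .top = μ.reg .top := nf _ (by decide)
    have ni : ν.reg .i = μ.reg .i := nf _ (by decide)
    have ngo : ν.reg .go = 0 := (nf _ (by decide)).trans mgo
    have hjt : μ.reg .j ≤ μ.reg .top := by omega
    have hB := hμL.stack.baxter_segPoints hr
    have hI := hμL.stack.isInterval (a := μ.reg .top - μ.reg .j) (by omega) le_rfl ⟨_, _, hr⟩
    simp only [wp_ite, eval_eq, Expr.eval, Test.cost, Expr.cost]
    rcases hν with ⟨hb, hok⟩ | ⟨hb, hok⟩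
    · have hB' := hB.2 fun a b c d g1 g2 g3 g4 g5 =>
        hb a g1 (by omega) b g2 (by omega) c g3 (by omega) d g4 g5
      rw [if_pos hok, wp_seq]
      have nj : ν.reg .j = μ.reg .j := nf _ (by decide)
      refine wp_merge fun τ a1 a2 a3 a4 a5 => ?_
      rw [na, nt, nj, nf .mn (by decide)] at a1
      rw [na, nt, nj, nf .mx (by decide)] at a2
      rw [nt, nj] at a4
      rw [na] at a3
      rw [wp_assign]
      have gf : Frame [.go] τ (τ.setReg .go 1) := (Frame.refl [.go] τ).setReg (by decide) 1
      have gt := gf .top (by decide)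
      obtain ⟨hm, hrem⟩ := hμL.stack.remaining_merge (by omega) hr
      have hL : LoopInv n k p inp (¬ D) (fun S _ => D ↔ Dec k p id S) (τ.reg .top - 1) τ := by
        refine hμL.of_merge hj2 hjt hr a1 a2 a3 a4 ((a5 _ (by decide)).trans (nf _ (by decide)))
          ((a5 _ (by decide)).trans ni) ?_
        rw [hrem]
        refine hμL.rel.trans ⟨fun hD => hD.contract hI hm, fun hD => .step _ _ _ hI hm ?_ hB' hD⟩
        rw [hμL.stack.card_segPoints le_rfl]
        omega
      refine ⟨?_, ?_, .inr ⟨by simp [setReg_reg, Expr.eval], ?_, ?_, ?_⟩⟩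
      · simp only [Expr.cost]
        omega
      · exact (gf _ (by decide)).trans ((a5 _ (by decide)).trans ni)
      · rw [Expr.eval, gt]
        omega
      · rw [Expr.eval, gt]
        omega
      · rw [Expr.eval, gt]
        exact hL.congr rfl gf (by decide)
    · rw [if_neg (by omega), wp_skip]
      refine ⟨by omega, ni, .inl ⟨ngo, nt, hνL.reg_n, hνL.input, hνL.stack, hνL.rel, .inl ?_⟩⟩
      intro hD
      refine hb fun a g1 g2 b g3 g4 c g5 g6 d g7 g8 => ?_
      exact hB.1 ((hμL.rel.1 hD).baxter.interval hI) a b c d g1 (by omega) (by omega) (by omega) g8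
  · rw [if_neg (by omega), wp_skip]
    exact ⟨by omega, rfl, .inl ⟨mgo, rfl, hμL.of_not_found ht le_rfl hr⟩⟩

end HFO

/-! ### The inner step of `findOrder` -/

namespace HFO

/-- The body of the inner loop of `findOrder`. -/
def findOrderStep : Cmd :=
  .go ≔ .const 0 ;;
  findRange (.reg .j ≺ .reg .top) ;;
  .ite (.reg .found ≐ .const 1)
    (.ite (.reg .kmin ≺ .reg .j) (.kmin ≔ .reg .j) .skip ;;
     merge ;;
     .go ≔ .const 1)
    .skip

/-- The relation between the remaining points and the register `kmin` in `findOrder`. -/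
def OrderRel (p : ℕ → ℕ) (D : ℕ → Prop) (S : Finset ℕ) (m : ℕ) : Prop :=
  Baxter p id S ∧ 1 ≤ m ∧ ∀ k, D k ↔ Dec k p id S ∧ m ≤ k

/-- Merging `j` entries contracts a minimal interval and adds exactly the condition `j ≤ k`
(`IsStack.dec_merge_iff`), so `kmin` becomes the maximum of its old value and `j`. No Baxter test is
needed, because contraction keeps the pattern Baxter. As the stack has at most `n` entries, the cost
is linear in `n`. -/
theorem wp_findOrderStep {n : ℕ} {p inp : ℕ → ℕ} {D : ℕ → Prop} (ρ : State)
    (h : LoopInv n n p inp False (OrderRel p D) (ρ.reg .top - 1) ρ) (ht : 1 ≤ ρ.reg .top) :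
    wp findOrderStep ρ fun t τ => t + 4 ≤ 200 * (n + 1) ∧ τ.reg .i = ρ.reg .i ∧
      ((τ.reg .go = 0 ∧ τ.reg .top = ρ.reg .top ∧
        LoopInv n n p inp False (OrderRel p D) (τ.reg .top) τ) ∨
       (τ.reg .go = 1 ∧ 1 ≤ τ.reg .top ∧ τ.reg .top + 1 ≤ ρ.reg .top ∧
        LoopInv n n p inp False (OrderRel p D) (τ.reg .top - 1) τ)) := by
  simp only [findOrderStep, wp_seq, wp_assign, Expr.eval, Expr.cost]
  set ρ₁ := ρ.setReg .go 0 with hρ₁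
  have f₁ : Frame [.go] ρ ρ₁ := (Frame.refl [.go] ρ).setReg (by decide) 0
  have h₁ := h.congr (τ := ρ₁) rfl f₁ (by decide)
  have t₁ : ρ₁.reg .top = ρ.reg .top := f₁ _ (by decide)
  have hgo : ρ₁.reg .go = 0 := by simp [hρ₁, setReg_reg]
  rw [← t₁] at h₁ ht ⊢
  rw [← show ρ₁.reg .i = ρ.reg .i from f₁ _ (by decide)]
  clear_value ρ₁
  refine (wp_findRange (M := ρ₁.reg .top) h₁.stack ht le_rfl ?_).mono ?_
  · intro ν hν
    rw [eval_lt]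
    simp only [Expr.eval, hν]
  rintro s μ ⟨hs, ma, mf, hμ⟩
  have hs' : s ≤ 63 * (n + 1) := by
    refine hs.trans (Nat.mul_le_mul le_rfl ?_)
    have := h₁.stack.top_le
    omega
  have hμL := h₁.congr ma mf (by decide)
  have mt : μ.reg .top = ρ₁.reg .top := mf _ (by decide)
  have mi : μ.reg .i = ρ₁.reg .i := mf _ (by decide)
  have mgo : μ.reg .go = 0 := (mf _ (by decide)).trans hgo
  simp only [wp_ite, eval_eq, Expr.eval, Test.cost, Expr.cost]
  rw [← mt, ← ma] at hμ
  rw [← mt, ← mi]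
  rw [← mt] at hμL ht
  rcases hμ with ⟨hf, hj2, hjt, hr, hmin⟩ | ⟨hf, hr⟩
  · rw [if_pos hf, wp_seq, wp_ite_assign, wp_seq]
    set ν := μ.setReg .kmin
      (if Test.eval μ (.reg .kmin ≺ .reg .j) = true then (Expr.reg .j).eval μ else μ.reg .kmin)
      with hν
    have nf : Frame [.kmin] μ ν := (Frame.refl [.kmin] μ).setReg (by decide) _
    have nk : ν.reg .kmin = max (μ.reg .kmin) (μ.reg .j) := by
      simp only [hν, setReg_reg, if_true, eval_lt, Expr.eval, max_def_lt]
    have na : ν.arr = μ.arr := rfl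
    have nt : ν.reg .top = μ.reg .top := nf _ (by decide)
    have nj : ν.reg .j = μ.reg .j := nf _ (by decide)
    clear_value ν
    refine wp_merge fun τ a1 a2 a3 a4 a5 => ?_
    rw [na, nt, nj, nf .mn (by decide)] at a1
    rw [na, nt, nj, nf .mx (by decide)] at a2
    rw [nt, nj] at a4
    rw [na] at a3
    have ti : τ.reg .i = μ.reg .i := (a5 _ (by decide)).trans (nf _ (by decide))
    rw [wp_assign]
    have gf : Frame [.go] τ (τ.setReg .go 1) := (Frame.refl [.go] τ).setReg (by decide) 1
    have gt := gf .top (by decide)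
    obtain ⟨hm, hrem⟩ := hμL.stack.remaining_merge (by omega) hr
    have hI := hμL.stack.isInterval (a := μ.reg .top - μ.reg .j) (by omega) le_rfl ⟨_, _, hr⟩
    have hL : LoopInv n n p inp False (OrderRel p D) (τ.reg .top - 1) τ := by
      refine hμL.of_merge hj2 hjt hr a1 a2 a3 a4 ((a5 _ (by decide)).trans (nf _ (by decide)))
        ti ?_
      obtain ⟨hB, h1, hD⟩ := hμL.rel
      rw [a5 .kmin (by decide), nk]
      refine ⟨by rw [hrem]; exact hB.contract hI hm, by omega, fun k => ?_⟩
      rw [hD k, hμL.stack.dec_merge_iff (by omega) hr (hB.interval hI)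
        (hμL.noRange.resolve_left id) fun b hb hbt => ?_,
        show μ.reg .top - (μ.reg .top - μ.reg .j) = μ.reg .j by omega, max_le_iff]
      · tauto
      · have := hmin (μ.reg .top - b) (by omega) (by omega)
        rwa [show μ.reg .top - (μ.reg .top - b) = b by omega] at this
    refine ⟨?_, (gf _ (by decide)).trans ti, .inr ⟨by simp [setReg_reg, Expr.eval], ?_, ?_, ?_⟩⟩
    · simp only [Test.cost, Expr.cost]
      split_ifs <;> omega
    · rw [Expr.eval, gt]
      omega
    · rw [Expr.eval, gt]
      omega
    · rw [Expr.eval, gt]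
      exact hL.congr rfl gf (by decide)
  · rw [if_neg (by omega), wp_skip]
    exact ⟨by omega, rfl, .inl ⟨mgo, rfl, hμL.of_not_found ht (min_le_right _ _) hr⟩⟩

/-! ### The Baxter test for the input -/

/-- A scan for an index with `A` before an index without `A`. -/
theorem wp_scan {test : Test} {y : Reg} {A : ℕ → Prop} {σ : State} {m N : ℕ}
    (hm : σ.reg .c = m) (hN : σ.reg .q = N ∧ y = .q ∨ σ.reg .p = N ∧ y = .p)
    (hseen : σ.reg .seen = 0)
    (htest : ∀ ρ : State, ρ.arr = σ.arr → Frame [.ok, .seen, .c] σ ρ →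
      (test.eval ρ = true ↔ A (ρ.reg .c))) :
    wp (.while (.reg .c ≺ .reg y)
      (.ite test (.seen ≔ .const 1) (.ite (.reg .seen ≐ .const 1) (.ok ≔ .const 0) .skip) ;;
       .c ≔ .reg .c ⊹ .const 1)) σ fun t τ =>
      t ≤ (N - m) * (test.cost + 30) + 4 ∧ τ.arr = σ.arr ∧ Frame [.ok, .seen, .c] σ τ ∧
        Checked (∀ b c, m ≤ b → b < c → c < N → A b → A c) σ τ := by
  have hy : ∀ ρ, Frame [.ok, .seen, .c] σ ρ → ρ.reg y = N := by
    intro ρ hρ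
    rcases hN with ⟨h, rfl⟩ | ⟨h, rfl⟩ <;> rw [hρ _ (by decide), h]
  -- The register `seen` records whether an earlier index has `A`, so one pass over the indices
  -- detects a forbidden pair.
  refine (wp_while (fun ρ => ρ.arr = σ.arr ∧ Frame [.ok, .seen, .c] σ ρ ∧ m ≤ ρ.reg .c ∧
      (ρ.reg .seen = 1 ↔ ∃ b, m ≤ b ∧ b < ρ.reg .c ∧ A b) ∧
      Checked (∀ b c, m ≤ b → b < c → c < ρ.reg .c → c < N → A b → A c) σ ρ)
    (fun ρ => (N - ρ.reg .c) * (test.cost + 30)) ?_ (σ := σ)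
    ⟨rfl, .refl _ _, hm.ge, ?_, .inl ⟨fun b c h1 h2 h3 => by omega, rfl⟩⟩).mono ?_
  · rintro ρ ⟨h1, h2, h3, h4, h5⟩ hlt
    rw [eval_lt] at hlt
    simp only [Expr.eval, hy ρ h2] at hlt
    have ht := htest ρ h1 h2
    have hpot : (N - ρ.reg .c) * (test.cost + 30) =
        (N - (ρ.reg .c + 1)) * (test.cost + 30) + (test.cost + 30) := by
      rw [← Nat.succ_mul]; congr 1; omega
    simp only [wp_seq, wp_ite, wp_assign, wp_skip, eval_eq, Expr.eval, Expr.cost, Test.cost,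
      setReg_reg, setReg_arr, reduceCtorEq, if_true, if_false]
    have hc : Reg.c ∈ [Reg.ok, .seen, .c] := by decide
    by_cases hA : A (ρ.reg .c)
    · rw [if_pos (ht.2 hA)]
      refine ⟨⟨h1, (h2.setReg (by decide) _).setReg hc _, by omega, ?_, ?_⟩, by omega⟩
      · exact ⟨fun _ => ⟨ρ.reg .c, h3, by omega, hA⟩, fun _ => trivial⟩
      · simp only [Checked, setReg_reg, reduceCtorEq, if_false] at h5 ⊢
        have : (∀ b c, m ≤ b → b < c → c < ρ.reg .c + 1 → c < N → A b → A c) ↔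
            ∀ b c, m ≤ b → b < c → c < ρ.reg .c → c < N → A b → A c := by
          constructor
          · exact fun g b c g1 g2 g3 => g b c g1 g2 (by omega)
          · intro g b c g1 g2 g3 g4 g5
            rcases Nat.lt_succ_iff_lt_or_eq.1 g3 with f | rfl
            · exact g b c g1 g2 f g4 g5
            · exact hA
        rwa [this]
    · have hsee : (∃ b, m ≤ b ∧ b < ρ.reg .c + 1 ∧ A b) ↔ ∃ b, m ≤ b ∧ b < ρ.reg .c ∧ A b := by
        constructor
        · rintro ⟨b, g1, g2, g3⟩
          rcases Nat.lt_succ_iff_lt_or_eq.1 g2 with f | rfl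
          · exact ⟨b, g1, f, g3⟩
          · exact absurd g3 hA
        · rintro ⟨b, g1, g2, g3⟩
          exact ⟨b, g1, by omega, g3⟩
      rw [if_neg (mt ht.1 hA)]
      by_cases hs : ρ.reg .seen = 1
      · rw [if_pos hs]
        refine ⟨⟨h1, (h2.setReg (by decide) _).setReg hc _, by omega, ?_, ?_⟩, by omega⟩
        · rw [hsee]
          exact h4
        · refine .inr ⟨fun g => ?_, by simp [setReg_reg]⟩
          obtain ⟨b, g1, g2, g3⟩ := h4.1 hs
          exact hA (g b _ g1 g2 (by omega) hlt g3)
      · rw [if_neg hs]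
        refine ⟨⟨h1, h2.setReg hc _, by omega, ?_, ?_⟩, by omega⟩
        · rw [hsee]
          exact h4
        · simp only [Checked, setReg_reg, reduceCtorEq, if_false] at h5 ⊢
          have : (∀ b c, m ≤ b → b < c → c < ρ.reg .c + 1 → c < N → A b → A c) ↔
              ∀ b c, m ≤ b → b < c → c < ρ.reg .c → c < N → A b → A c := by
            constructor
            · exact fun g b c g1 g2 g3 => g b c g1 g2 (by omega)
            · intro g b c g1 g2 g3 g4 g5
              rcases Nat.lt_succ_iff_lt_or_eq.1 g3 with f | rfl
              · exact g b c g1 g2 f g4 g5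
              · exact absurd (h4.2 ⟨b, g1, g2, g5⟩) hs
          rwa [this]
  · constructor
    · intro h; omega
    · rintro ⟨b, g1, g2, -⟩; omega
  · rintro t τ ⟨⟨h1, h2, h3, h4, h5⟩, hb, ht⟩
    have hle : N ≤ τ.reg .c := by
      by_contra hc
      have := (eval_lt (σ := τ) (e := .reg .c) (f := .reg y)).2
        (by simp only [Expr.eval, hy τ h2]; omega)
      rw [this] at hb
      exact absurd hb (by decide)
    simp only [Test.cost, Expr.cost, hm] at ht
    refine ⟨by omega, h1, h2, ?_⟩
    have : (∀ b c, m ≤ b → b < c → c < τ.reg .c → c < N → A b → A c) ↔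
        ∀ b c, m ≤ b → b < c → c < N → A b → A c :=
      ⟨fun g b c g1 g2 g3 => g b c g1 g2 (by omega) g3, fun g b c g1 g2 _ => g b c g1 g2⟩
    rwa [this] at h5

theorem Checked.trans_set {P : Prop} {σ ρ τ : State} (h : Checked P ρ τ)
    (hρ : ρ.reg .ok = σ.reg .ok) {x : Reg} (hx : x ≠ .ok) (m : ℕ) :
    Checked P σ (τ.setReg x m) := by
  rw [Checked, setReg_reg, if_neg hx.symm, ← hρ]
  exact h

/-- The values `v` and `v + 1` do not violate the Baxter condition. -/
def GoodPair (p inp : ℕ → ℕ) (v : ℕ) : Prop :=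
  (p v < p (v + 1) → ∀ b c, p v + 1 ≤ b → b < c → c < p (v + 1) → v < inp b → v < inp c) ∧
  (¬ p v < p (v + 1) → ∀ b c, p (v + 1) + 1 ≤ b → b < c → c < p v → inp b < v → inp c < v)

/-- All the values from `1` to `n` occur, so the adjacent values `2` and `3` of a forbidden pattern
are some `v` and `v + 1`. Strictly between their positions neither value occurs; hence an entry that
is not larger than `v` is smaller, and the two middle points of the pattern are a pair that
`GoodPair` excludes. Each `v` can be tested in linear time. -/
theorem baxter_iff_goodPair {n : ℕ} {p inp : ℕ → ℕ} (hp : Set.InjOn p (Finset.Icc 1 n))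
    (hpn : ∀ v ∈ Finset.Icc 1 n, p v < n)
    (hinp : ∀ i, i < n → inp i ∈ Finset.Icc 1 n ∧ p (inp i) = i) :
    Baxter p id (Finset.Icc 1 n) ↔ ∀ v, 1 ≤ v → v < n → GoodPair p inp v := by
  have hinv : ∀ v ∈ Finset.Icc 1 n, inp (p v) = v := fun v hv =>
    hp (hinp _ (hpn v hv)).1 hv (hinp _ (hpn v hv)).2
  have mem : ∀ v, 1 ≤ v → v ≤ n → v ∈ Finset.Icc 1 n := fun v h1 h2 => Finset.mem_Icc.2 ⟨h1, h2⟩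
  constructor
  · intro hB v hv hvn
    have m0 := mem v hv hvn.le
    have m1 := mem (v + 1) (by omega) hvn
    have l0 := hpn _ m0
    have l1 := hpn _ m1
    refine ⟨fun _ b c h1 h2 h3 h4 => ?_, fun _ b c h1 h2 h3 h4 => ?_⟩
    · by_contra hc
      obtain ⟨mb, pb⟩ := hinp b (by omega)
      obtain ⟨mc, pc⟩ := hinp c (by omega)
      have nb : inp b ≠ v + 1 := fun h => by rw [h] at pb; omega
      have nc : inp c ≠ v := fun h => by rw [h] at pc; omega
      obtain ⟨e, -, g1, g2⟩ := hB.1 v m0 _ mb _ mc _ m1 (by omega) (by omega) (by omega)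
        (by simp only [id]; omega) (by simp) (by simp only [id]; omega)
      simp only [id] at g1 g2
      omega
    · by_contra hc
      obtain ⟨mb, pb⟩ := hinp b (by omega)
      obtain ⟨mc, pc⟩ := hinp c (by omega)
      have nc : inp c ≠ v + 1 := fun h => by rw [h] at pc; omega
      have nc' : inp c ≠ v := fun h => by rw [h] at pc; omega
      obtain ⟨e, -, g1, g2⟩ := hB.2 v m0 _ mc _ mb _ m1
        (OrderDual.toDual_lt_toDual.2 (by omega)) (OrderDual.toDual_lt_toDual.2 (by omega))
        (OrderDual.toDual_lt_toDual.2 (by omega))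
        (by simp only [id]; omega) (by simp) (by simp only [id]; omega)
      simp only [id] at g1 g2
      omega
  · intro hG
    constructor
    · intro a ha b hb c hc d hd hab hbc hcd h1 h2 h3
      simp only [id] at h1 h2 h3
      by_contra hne
      have hA := Finset.mem_Icc.1 ha
      have hD := Finset.mem_Icc.1 hd
      have hda : d = a + 1 := by
        by_contra hc'
        exact hne ⟨a + 1, mem _ (by omega) (by omega), by simp, by simp only [id]; omega⟩
      subst hda
      have := (hG a hA.1 (by omega)).1 (by omega) (p b) (p c) hab hbc hcd
      rw [hinv b hb, hinv c hc] at this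
      omega
    · intro a ha b hb c hc d hd hab hbc hcd h1 h2 h3
      simp only [id] at h1 h2 h3
      replace hab : p b < p a := hab
      replace hbc : p c < p b := hbc
      replace hcd : p d < p c := hcd
      by_contra hne
      have hA := Finset.mem_Icc.1 ha
      have hD := Finset.mem_Icc.1 hd
      have hda : d = a + 1 := by
        by_contra hc'
        exact hne ⟨a + 1, mem _ (by omega) (by omega), by simp, by simp only [id]; omega⟩
      subst hda
      have := (hG a hA.1 (by omega)).2 (by omega) (p c) (p b) hcd hbc hab
      rw [hinv b hb, hinv c hc] at this
      omega

theorem wp_baxterInput {n : ℕ} {p inp : ℕ → ℕ} {σ : State} (hp : Set.InjOn p (Finset.Icc 1 n))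
    (hpn : ∀ v ∈ Finset.Icc 1 n, p v < n)
    (hinp : ∀ i, i < n → inp i ∈ Finset.Icc 1 n ∧ p (inp i) = i)
    (hn : σ.reg .n = n) (hσ : σ.arr .input = inp) :
    wp baxterInput σ fun t τ => t ≤ 200 * (n + 1) ^ 2 ∧ τ.reg .n = n ∧ τ.arr .input = inp ∧
      (Baxter p id (Finset.Icc 1 n) ∧ τ.reg .ok = 1 ∨
        ¬ Baxter p id (Finset.Icc 1 n) ∧ τ.reg .ok = 0) := by
  have hinv : ∀ v ∈ Finset.Icc 1 n, inp (p v) = v := fun v hv =>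
    hp (hinp _ (hpn v hv)).1 hv (hinp _ (hpn v hv)).2
  simp only [baxterInput, wp_seq, wp_assign, Expr.eval, Expr.cost]
  refine (wp_while (fun ρ => ρ.reg .n = n ∧ ρ.arr .input = inp ∧ ρ.reg .ok = 1 ∧ ρ.reg .i ≤ n ∧
      ∀ m, m < ρ.reg .i → ρ.arr .pos (inp m) = m) (fun ρ => (n - ρ.reg .i) * 20) ?_
      ⟨?_, ?_, ?_, ?_, ?_⟩).mono ?_
  · rintro ρ ⟨h1, h2, h3, h4, h5⟩ hlt
    rw [eval_lt] at hlt
    simp only [Expr.eval, h1] at hlt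
    simp only [wp_seq, wp_store, wp_assign, Expr.eval, Expr.cost, Test.cost, setReg_reg, setReg_arr,
      setArr_reg, setArr_arr, reduceCtorEq, if_true, if_false, h1, h2, h3]
    refine ⟨⟨trivial, trivial, trivial, hlt, fun m hm => ?_⟩, by omega⟩
    rcases Nat.lt_succ_iff_lt_or_eq.1 hm with g | rfl
    · rw [Function.update_of_ne, h5 m g]
      intro hc
      have := (hinp m (by omega)).2
      rw [hc, (hinp _ hlt).2] at this
      omega
    · rw [Function.update_self]
  · simpa [setReg_reg] using hn
  · exact hσ
  · simp [setReg_reg]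
  · simp [setReg_reg]
  · simp [setReg_reg]
  rintro t ρ ⟨⟨h1, h2, h3, h4, h5⟩, hb, ht⟩
  have hi : ρ.reg .i = n := by
    by_contra hc
    have := (eval_lt (σ := ρ) (e := .reg .i) (f := .reg .n)).2 (by simp only [Expr.eval]; omega)
    rw [this] at hb
    exact absurd hb (by decide)
  have hpos : ∀ v ∈ Finset.Icc 1 n, ρ.arr .pos v = p v := by
    intro v hv
    have := h5 (p v) (hi ▸ hpn v hv)
    rwa [hinv v hv] at this
  have ht' : t ≤ n * 20 + 4 := by
    simp only [Test.cost, Expr.cost, setReg_reg, if_true] at ht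
    omega
  have hv1 : (ρ.setReg .v 1).reg .v = 1 := by simp [setReg_reg]
  have hvn : (ρ.setReg .v 1).reg .n = n := by simp [setReg_reg, h1]
  have hvok : (ρ.setReg .v 1).reg .ok = 1 := by simp [setReg_reg, h3]
  refine (wp_check (L := [.p, .q, .seen, .c]) (T := n * 36 + 40) (P := GoodPair p inp) hv1 hvn
    (by decide) ?_).mono ?_
  · intro μ ma mf mv mn
    rw [setReg_arr] at ma
    have e1 := hpos (μ.reg .v) (by simp; omega)
    have e2 := hpos (μ.reg .v + 1) (by simp; omega)
    have l1 := hpn (μ.reg .v) (by simp; omega)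
    have l2 := hpn (μ.reg .v + 1) (by simp; omega)
    simp only [wp_seq, wp_ite, wp_assign, eval_lt, Expr.eval, Expr.cost, Test.cost,
      setReg_reg, setReg_arr, reduceCtorEq, if_true, if_false, ma, e1, e2]
    have hfin : ∀ (σ' τ : State) (P : Prop), σ'.arr = ρ.arr → Frame [.p, .q, .seen, .c] μ σ' →
        τ.arr = σ'.arr → Frame [.ok, .seen, .c] σ' τ → Checked P σ' τ →
        (P ↔ GoodPair p inp (μ.reg .v)) →
        τ.arr = ρ.arr ∧
        Frame [.ok, .v, .p, .q, .seen, .c] μ (τ.setReg .v (τ.reg .v + 1)) ∧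
        τ.reg .v + 1 = μ.reg .v + 1 ∧
        Checked (GoodPair p inp (μ.reg .v)) μ (τ.setReg .v (τ.reg .v + 1)) := by
      intro σ' τ P a1 f1 a2 f2 hch hP
      have fv : τ.reg .v = μ.reg .v := (f2 _ (by decide)).trans (f1 _ (by decide))
      refine ⟨a2.trans a1, ?_, by rw [fv], ?_⟩
      · exact (((Frame.refl _ μ).trans f1 (by decide)).trans f2 (by decide)).setReg (by decide) _
      · rw [← hP]
        exact Checked.trans_set hch (f1 _ (by decide)) (by decide) _
    have hframe : ∀ a b c d, Frame [.p, .q, .seen, .c] μ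
        ((((μ.setReg .p a).setReg .q b).setReg .seen c).setReg .c d) := fun a b c d =>
      ((((Frame.refl _ μ).setReg (by decide) a).setReg (by decide) b).setReg (by decide)
        c).setReg (by decide) d
    split_ifs with hlt
    · refine (wp_scan (A := fun c => μ.reg .v < inp c) (m := p (μ.reg .v) + 1)
        (N := p (μ.reg .v + 1)) (by simp [setReg_reg]) (.inl ⟨by simp [setReg_reg], rfl⟩)
        (by simp [setReg_reg]) fun ν na nf => ?_).mono ?_
      · have nv := (nf .v (by decide)).trans (hframe _ _ _ _ .v (by decide))
        simp only [setReg_arr] at na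
        rw [eval_lt]
        simp only [Expr.eval, nv, na, ma, h2]
      · rintro s τ ⟨g1, g2, g3, g4⟩
        refine ⟨?_, hfin _ _ _ (by exact ma) (hframe _ _ _ _) g2 g3 g4 ?_⟩
        · have := Nat.mul_le_mul_right 34
            (show p (μ.reg .v + 1) - (p (μ.reg .v) + 1) ≤ n by omega)
          simp only [Test.cost, Expr.cost] at g1
          omega
        · exact ⟨fun h => ⟨fun _ => h, fun hc => absurd hlt hc⟩, fun h => h.1 hlt⟩
    · refine (wp_scan (A := fun c => inp c < μ.reg .v) (m := p (μ.reg .v + 1) + 1)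
        (N := p (μ.reg .v)) (by simp [setReg_reg]) (.inr ⟨by simp [setReg_reg], rfl⟩)
        (by simp [setReg_reg]) fun ν na nf => ?_).mono ?_
      · have nv := (nf .v (by decide)).trans (hframe _ _ _ _ .v (by decide))
        simp only [setReg_arr] at na
        rw [eval_lt]
        simp only [Expr.eval, nv, na, ma, h2]
      · rintro s τ ⟨g1, g2, g3, g4⟩
        refine ⟨?_, hfin _ _ _ (by exact ma) (hframe _ _ _ _) g2 g3 g4 ?_⟩
        · have := Nat.mul_le_mul_right 34
            (show p (μ.reg .v) - (p (μ.reg .v + 1) + 1) ≤ n by omega)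
          simp only [Test.cost, Expr.cost] at g1
          omega
        · exact ⟨fun h => ⟨fun hc => absurd hc hlt, fun _ => h⟩, fun h => h.2 hlt⟩
  · rintro s τ ⟨g1, g2, g3, g4⟩
    refine ⟨?_, (g3 _ (by decide)).trans hvn, ?_, ?_⟩
    · have : (n - 1) * (n * 36 + 40 + 4) ≤ n * (n * 36 + 40 + 4) :=
        Nat.mul_le_mul_right _ (by omega)
      have hpoly : n * (n * 36 + 40 + 4) + n * 20 + 50 ≤ 200 * (n + 1) ^ 2 := by
        have : 0 ≤ n ^ 2 := Nat.zero_le _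
        ring_nf
        linarith
      omega
    · rw [g2, setReg_arr, h2]
    · rw [baxter_iff_goodPair hp hpn hinp]
      rcases g4 with ⟨f1, f2⟩ | ⟨f1, f2⟩
      · exact .inl ⟨f1, by rw [f2, hvok]⟩
      · exact .inr ⟨f1, f2⟩

end HFO

namespace HFO

/-! ### The two algorithms -/

theorem wp_verdict {σ : State} {Q : ℕ → State → Prop}
    (h : ∀ τ : State, τ.reg .kmin = σ.reg .kmin →
      (σ.reg .top = 1 → τ.reg .out = 1) → (σ.reg .top ≠ 1 → τ.reg .out = 0) → Q 6 τ) :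
    wp verdict σ Q := by
  simp only [verdict, wp_ite, eval_eq, wp_assign, Expr.eval, Expr.cost, Test.cost]
  split_ifs with ht
  · exact h _ (by simp [setReg_reg]) (fun _ => by simp [setReg_reg]) fun hc => absurd ht hc
  · exact h _ (by simp [setReg_reg]) (fun hc => absurd hc ht) fun _ => by simp [setReg_reg]

section Algorithms

variable {n : ℕ} {p inp : ℕ → ℕ}

theorem wp_recognise (hn : 1 ≤ n) (hp : Set.InjOn p (Finset.Icc 1 n))
    (hpn : ∀ v ∈ Finset.Icc 1 n, p v < n)
    (hinp : ∀ i, i < n → inp i ∈ Finset.Icc 1 n ∧ p (inp i) = i) (k : ℕ) {σ : State}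
    (hσn : σ.reg .n = n) (hσ : σ.arr .input = inp) :
    wp (recognise k) σ fun t τ => t ≤ 5000 * (k + 1) ^ 4 * n ∧
      (Dec k p id (Finset.Icc 1 n) → τ.reg .out = 1) ∧
      (¬ Dec k p id (Finset.Icc 1 n) → τ.reg .out = 0) := by
  change wp (.top ≔ .const 0 ;; .i ≔ .const 0 ;; mainLoop (recogniseStep k) ;; verdict) σ _
  simp only [wp_seq, wp_assign, Expr.eval, Expr.cost]
  set σ₁ := (σ.setReg .top 0).setReg .i 0 with hσ₁
  have et : σ₁.reg .top = 0 := by simp [hσ₁, setReg_reg]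
  have ei : σ₁.reg .i = 0 := by simp [hσ₁, setReg_reg]
  have hL : LoopInv n k p inp (¬ Dec k p id (Finset.Icc 1 n))
      (fun S _ => Dec k p id (Finset.Icc 1 n) ↔ Dec k p id S) (σ₁.reg .top) σ₁ := by
    refine ⟨by simpa [hσ₁, setReg_reg] using hσn, hσ, ?_, ?_, .inr ?_⟩
    · rw [et, ei]
      exact .zero _ _ _ _
    · rw [et, ei, remaining_zero]
    · rw [et]
      exact fun a b h1 h2 => by omega
  refine (wp_mainLoop hp hinp (fun ρ h ht => wp_recogniseStep ρ h ht) hL (by omega)).mono ?_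
  rintro t ρ ⟨h, hi, ht⟩
  refine wp_verdict fun τ _ h1 h0 => ⟨?_, ?_⟩
  · rw [et, ei] at ht
    have hk : 1 ≤ (k + 1) ^ 4 := Nat.one_le_pow _ _ (by omega)
    have e1 : (n - 0) * (2 * (2000 * (k + 1) ^ 4) + 40) = 4000 * ((k + 1) ^ 4 * n) + 40 * n := by
      rw [Nat.sub_zero]; ring
    have e2 : 5000 * (k + 1) ^ 4 * n = 5000 * ((k + 1) ^ 4 * n) := by ring
    have e3 : n ≤ (k + 1) ^ 4 * n := Nat.le_mul_of_pos_left _ hk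
    omega
  · have hread : ∀ x, 1 ≤ x → x ≤ n → p x < ρ.reg .i := fun x hx hx' =>
      hi ▸ hpn x (Finset.mem_Icc.2 ⟨hx, hx'⟩)
    have hpos : 1 ≤ ρ.reg .top := by
      obtain ⟨e, he, -⟩ := h.stack.owned 1 le_rfl hn (hread 1 le_rfl hn)
      omega
    -- With a single entry, the pattern has been reduced to a point. With more entries,
    -- decomposability would put the alternative `NoRange` of the invariant into force, which
    -- `not_dec_of_noRange` contradicts.
    have key : Dec k p id (Finset.Icc 1 n) ↔ ρ.reg .top = 1 := by
      constructor
      · intro hD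
        by_contra hc
        exact h.stack.not_dec_of_noRange hread (h.noRange.resolve_left fun g => g hD) (by omega)
          (h.rel.1 hD)
      · intro ht1
        rw [h.rel, IsStack.remaining_eq hread, ht1]
        have : segPoints (ρ.arr .lo) 0 1 = {ρ.arr .lo 0} := by simp [segPoints]
        rw [this]
        exact .single _
    exact ⟨fun hD => h1 (key.1 hD), fun hD => h0 (mt key.2 hD)⟩

theorem wp_findOrder (hn : 1 ≤ n) (hp : Set.InjOn p (Finset.Icc 1 n))
    (hpn : ∀ v ∈ Finset.Icc 1 n, p v < n)
    (hinp : ∀ i, i < n → inp i ∈ Finset.Icc 1 n ∧ p (inp i) = i) {σ : State}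
    (hσn : σ.reg .n = n) (hσ : σ.arr .input = inp) :
    wp findOrder σ fun t τ => t ≤ 4000 * n ^ 2 ∧
      ((∃ k, 1 ≤ k ∧ Dec k p id (Finset.Icc 1 n)) →
        τ.reg .out = 1 ∧ IsLeast {k | 1 ≤ k ∧ Dec k p id (Finset.Icc 1 n)} (τ.reg .kmin)) ∧
      ((¬ ∃ k, 1 ≤ k ∧ Dec k p id (Finset.Icc 1 n)) → τ.reg .out = 0) := by
  change wp (baxterInput ;; .ite (.reg .ok ≐ .const 0) (.out ≔ .const 0)
    (.kmin ≔ .const 1 ;; .top ≔ .const 0 ;; .i ≔ .const 0 ;; mainLoop findOrderStep ;; verdict)) σ _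
  rw [wp_seq]
  refine (wp_baxterInput hp hpn hinp hσn hσ).mono ?_
  rintro s σ' ⟨hs, hn', hinp', hB⟩
  have hsq : (n + 1) ^ 2 ≤ 4 * n ^ 2 := by nlinarith
  simp only [wp_ite, eval_eq, wp_seq, wp_assign, Expr.eval, Expr.cost, Test.cost]
  rcases hB with ⟨hB, hok⟩ | ⟨hB, hok⟩
  · rw [if_neg (by omega)]
    set σ₁ := ((σ'.setReg .kmin 1).setReg .top 0).setReg .i 0 with hσ₁
    have et : σ₁.reg .top = 0 := by simp [hσ₁, setReg_reg]
    have ei : σ₁.reg .i = 0 := by simp [hσ₁, setReg_reg]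
    have ek : σ₁.reg .kmin = 1 := by simp [hσ₁, setReg_reg]
    have hL : LoopInv n n p inp False
        (OrderRel p fun k => 1 ≤ k ∧ Dec k p id (Finset.Icc 1 n)) (σ₁.reg .top) σ₁ := by
      refine ⟨by simpa [hσ₁, setReg_reg] using hn', hinp', ?_, ?_, .inr ?_⟩
      · rw [et, ei]
        exact .zero _ _ _ _
      · rw [et, ei, remaining_zero, ek]
        -- The initial value `1` of `kmin` expresses the condition `1 ≤ k`.
        exact ⟨hB, le_rfl, fun k => and_comm⟩
      · rw [et]
        exact fun a b h1 h2 => by omega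
    refine (wp_mainLoop hp hinp (fun ρ h ht => wp_findOrderStep ρ h ht) hL (by omega)).mono ?_
    rintro t ρ ⟨h, hi, ht⟩
    refine wp_verdict fun τ hk h1 _ => ⟨?_, ?_⟩
    · rw [et, ei] at ht
      have e1 : (n - 0) * (2 * (200 * (n + 1)) + 40) = 400 * n ^ 2 + 440 * n := by
        rw [Nat.sub_zero]; ring
      have e2 : n ≤ n ^ 2 := Nat.le_self_pow (by norm_num) n
      omega
    · have hread : ∀ x, 1 ≤ x → x ≤ n → p x < ρ.reg .i := fun x hx hx' =>
        hi ▸ hpn x (Finset.mem_Icc.2 ⟨hx, hx'⟩)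
      -- Without a bound on the length of merges a Baxter input always ends with a single entry, so
      -- rejection can only come from the Baxter test. A point is decomposable for every `k`, and
      -- the invariant reduces to the condition that `kmin` is at most `k`.
      have ht1 := h.stack.top_eq_one hn hread (h.noRange.resolve_left id)
      obtain ⟨-, hk1, hD⟩ := h.rel
      have hsingle : segPoints (ρ.arr .lo) 0 1 = {ρ.arr .lo 0} := by simp [segPoints]
      have key : ∀ k, (1 ≤ k ∧ Dec k p id (Finset.Icc 1 n)) ↔ ρ.reg .kmin ≤ k := fun k => by
        refine (hD k).trans ?_
        rw [IsStack.remaining_eq hread, ht1, hsingle]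
        exact ⟨fun g => g.2, fun g => ⟨.single _, g⟩⟩
      rw [hk]
      exact ⟨fun _ => ⟨h1 ht1, (key _).2 le_rfl, fun k g => (key k).1 g⟩,
        fun g => absurd ⟨_, (key _).2 le_rfl⟩ g⟩
  · rw [if_pos hok]
    have e2 : n ≤ n ^ 2 := Nat.le_self_pow (by norm_num) n
    refine ⟨by omega, ?_, fun _ => by simp [setReg_reg]⟩
    rintro ⟨k, -, hD⟩
    exact absurd hD.baxter hB

end Algorithms

theorem posOf_lt {n : ℕ} (π : Equiv.Perm (Fin n)) : ∀ v ∈ Finset.Icc 1 n, posOf π v < n := by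
  intro v hv
  obtain ⟨i, -, hi⟩ := exists_apply_eq π hv
  rw [hi]
  exact i.isLt

theorem posOf_input {n : ℕ} (π : Equiv.Perm (Fin n)) : ∀ i, i < n →
    (inputState π).arr .input i ∈ Finset.Icc 1 n ∧ posOf π ((inputState π).arr .input i) = i := by
  intro i hi
  have : (inputState π).arr .input i = (π ⟨i, hi⟩ : ℕ) + 1 := by simp [inputState, hi]
  rw [this, posOf_apply, Finset.mem_Icc]
  have := (π ⟨i, hi⟩).isLt
  exact ⟨by omega, rfl⟩

end HFO

theorem mainTheorem4 :
    (∀ k : ℕ, 1 ≤ k → ∃ C : ℕ, ∀ (n : ℕ), 1 ≤ n → ∀ π : Equiv.Perm (Fin n),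
      ∃ (t : ℕ) (S : Finset (HFO.Arr × ℕ)) (τ : HFO.State),
        HFO.Run (HFO.recognise k) (HFO.inputState π) t S τ ∧
        t ≤ C * n ∧ S.card ≤ C * n ∧
        (HFO.IsHFOPerm k π → τ.reg .out = 1) ∧ (¬ HFO.IsHFOPerm k π → τ.reg .out = 0)) ∧
    (∃ C : ℝ, ∀ (n : ℕ), 1 ≤ n → ∀ π : Equiv.Perm (Fin n),
      ∃ (t : ℕ) (S : Finset (HFO.Arr × ℕ)) (τ : HFO.State),
        HFO.Run HFO.findOrder (HFO.inputState π) t S τ ∧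
        (2 ≤ n → (t : ℝ) ≤ C * ((n : ℝ) ^ 2 * Real.logb 2 n)) ∧
        ((∃ k : ℕ, 1 ≤ k ∧ HFO.IsHFOPerm k π) →
          τ.reg .out = 1 ∧ IsLeast {k : ℕ | 1 ≤ k ∧ HFO.IsHFOPerm k π} (τ.reg .kmin)) ∧
        ((¬ ∃ k : ℕ, 1 ≤ k ∧ HFO.IsHFOPerm k π) → τ.reg .out = 0)) := by
  constructor
  · intro k _
    refine ⟨5000 * (k + 1) ^ 4, fun n hn π => ?_⟩
    obtain ⟨t, S, τ, hR, ht, h1, h0⟩ := HFO.wp_recognise hn (HFO.posOf_injOn π) (HFO.posOf_lt π)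
      (HFO.posOf_input π) k (σ := HFO.inputState π) (by simp [HFO.inputState]) rfl
    rw [← HFO.isHFOPerm_iff hn] at h1 h0
    exact ⟨t, S, τ, hR, ht, hR.card_le.trans ht, h1, h0⟩
  · refine ⟨4000, fun n hn π => ?_⟩
    obtain ⟨t, S, τ, hR, ht, h1, h0⟩ := HFO.wp_findOrder hn (HFO.posOf_injOn π) (HFO.posOf_lt π)
      (HFO.posOf_input π) (σ := HFO.inputState π) (by simp [HFO.inputState]) rfl
    simp only [← HFO.isHFOPerm_iff hn] at h1 h0
    refine ⟨t, S, τ, hR, fun h2 => ?_, h1, h0⟩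
    -- The running time is in fact at most quadratic, and the logarithmic factor is at least `1` as
    -- soon as `n ≥ 2`.
    have hlog : 1 ≤ Real.logb 2 n := by
      rw [Real.le_logb_iff_rpow_le (by norm_num) (by positivity), Real.rpow_one]
      exact_mod_cast h2
    have ht' : (t : ℝ) ≤ 4000 * (n : ℝ) ^ 2 := by exact_mod_cast ht
    have := mul_le_mul_of_nonneg_left hlog (by positivity : (0 : ℝ) ≤ (n : ℝ) ^ 2)
    linarith
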